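/- **Setting.** Norms of vectors are Euclidean, norms of matrices are spectral, $\rho(\cdot)$ is the spectral radius, $X^\dagger$ the Moore–Penrose inverse, $\sigma_k(X)$ the $k$-th largest singular value. Let $n,m,p\ge 1$, let $Q\succeq 0$, $R\succ 0$, and let $\sigma_w,\sigma_z,\sigma_u,\lambda>0$. For a system $\Theta'=(A',B',C')\in\mathbb R^{n\times n}\times\mathbb R^{n\times p}\times\mathbb R^{m\times n}$ let $P(\Theta')$ and $\Sigma(\Theta')$ be the positive semidefinite solutions of $$P=A'^\top PA'+C'^\top QC'-A'^\top PB'(R+B'^\top PB')^{-1}B'^\top PA',$$ $$\Sigma=A'\Sigma A'^\top-A'\Sigma C'^\top(C'\Sigma C'^\top+\sigma_z^2I)^{-1}C'\Sigma A'^\top+\sigma_w^2I ,$$ put $K(\Theta')=(R+B'^\top PB')^{-1}B'^\top PA'$, $L(\Theta')=\Sigma C'^\top(C'\Sigma C'^\top+\sigma_z^2I)^{-1}$, and let $J(\Theta')$ be the optimal average expected cost $\lim_{N}\min_u\frac1N\mathbb E\sum_{t=1}^N(y_t^\top Qy_t+u_t^\top Ru_t)$ over controls $u_t$ that are functions of $y_0,\dots,y_t$.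 The true system $\Theta=(A,B,C)$ evolves as $x_{t+1}=Ax_t+Bu_t+w_t$, $y_t=Cx_t+z_t$ with independent $x_0\sim\mathcal N(0,\Sigma)$, $w_t\sim\mathcal N(0,\sigma_w^2I)$, $z_t\sim\mathcal N(0,\sigma_z^2I)$, where $\Sigma=\Sigma(\Theta)$, $L=L(\Theta)$. **Assumptions.** (1) $\rho(A)<1$ and $\sup_{\tau\ge0}\|A^\tau\|/\rho(A)^\tau<\infty$. (2) $\Theta\in\mathcal S$, where $\mathcal S$ is a bounded set of systems $\Theta'$ with $\rho(A')<1$ for which $(A',B')$ and $(A',A'L(\Theta'))$ are controllable and $(A',C')$ is observable. (3) For all $\Theta'\in\mathcal S$: $\|A'-B'K(\Theta')\|\le\rho<1$, $\|A'-A'L(\Theta')C'\|\le\upsilon<1$ (with $\upsilon>0$), $\|P(\Theta')\|\le D$, $\|K(\Theta')\|\le\Gamma$, $\|L(\Theta')\|\le\zeta$. **Estimation.** Let $H=d_1+d_2+1$ with $d_1,d_2\ge n$ and $|d_1-d_2|\le1$. With $F=AL$, $\bar A=A-FC$ let $\mathbf M=[CF,\,C\bar AF,\dots,C\bar A^{H-1}F,\,CB,\,C\bar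 AB,\dots,C\bar A^{H-1}B]$. With $\phi_r=[y_{r-1};\dots;y_{r-H};u_{r-1};\dots;u_{r-H}]$ let $\hat{\mathbf M}_t=\big(\sum_{r=H}^t y_r\phi_r^\top\big)\big(\lambda I+\sum_{r=H}^t\phi_r\phi_r^\top\big)^{-1}$. For a matrix $[F_1,\dots,F_H,G_1,\dots,G_H]$ let $\mathcal H$ be the two $d_1\times(d_2+1)$ block Hankel matrices with blocks $F_{i+j-1}$ and $G_{i+j-1}$ side by side, and let $\mathcal H^-$ (resp. $\mathcal H^+$) be $\mathcal H$ without the last (resp. first) block column of each half. The procedure SysId takes the truncation of $\mathcal H^-$ to its top $n$ singular values, with singular value decomposition $U\Lambda V^\top$, sets $\mathbf O=U\Lambda^{1/2}$, $\mathbf W=\Lambda^{1/2}V^\top$, and returns $\hat C$ (the first $m$ rows of $\mathbf O$), $\hat B$ (the first $p$ columns of the second half of $\mathbf W$), $\hat A=\mathbf O^\dagger\mathcal H^+\mathbf W^\dagger+\hat F\hat C$ with $\hat F$ the first $m$ columns of $\mathbf W$, and $\hat L$ (the first $m$ columns of $\hat A^\dagger\mathbf O^\dagger\mathcal H^-$).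 Let $(\hat A_t,\hat B_t,\hat C_t,\hat L_t)$ be its output on $\hat{\mathbf M}_t$, let $\mathcal H$ now be the matrix belonging to $\mathbf M$, and $$\beta_A(t)=c_1\tfrac{\sqrt{nH}(\|\mathcal H\|+\sigma_n(\mathcal H))}{\sigma_n^2(\mathcal H)}\|\hat{\mathbf M}_t-\mathbf M\|,\quad \beta_B(t)=\beta_C(t)=\sqrt{\tfrac{20nH}{\sigma_n(\mathcal H)}}\,\|\hat{\mathbf M}_t-\mathbf M\|,$$ $$\beta_L(t)=\tfrac{c_2\|\mathcal H\|}{\sqrt{\sigma_n(\mathcal H)}}\beta_A(t)+c_3\tfrac{\sqrt{nH}(\|\mathcal H\|+\sigma_n(\mathcal H))}{\sigma_n^{3/2}(\mathcal H)}\|\hat{\mathbf M}_t-\mathbf M\| .$$ For an orthogonal matrix $\mathbf T$ let $\mathcal B_t(\mathbf T)$ be the set of all $(A',B',C',L')$ with $\|\hat A_t-\mathbf T^\top A'\mathbf T\|\le\beta_A(t)$, $\|\hat B_t-\mathbf T^\top B'\|\le\beta_B(t)$, $\|\hat C_t-C'\mathbf T\|\le\beta_C(t)$, $\|\hat L_t-\mathbf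 T^\top L'\|\le\beta_L(t)$. Since data determine a system only up to a change of state coordinates $(A',B',C',L')\mapsto(G^{-1}A'G,G^{-1}B',C'G,G^{-1}L')$, the confidence set $\mathcal C_t$ consists of all $(A',B',C',L')$ that some such change of coordinates takes into $\mathcal B_t(\mathbf T)$ for some orthogonal $\mathbf T$. **The algorithm LqgOpt** (horizon $T$, warm-up length $T_w$). For $t<T_w$ the inputs $u_t\sim\mathcal N(0,\sigma_u^2I)$ are i.i.d. and independent of the noise. For $i=0,1,\dots$, from the data $y_0,\dots,y_{2^iT_w},u_0,\dots,u_{2^iT_w-1}$ the algorithm selects $\tilde\Theta_i=(\tilde A_i,\tilde B_i,\tilde C_i)\in\mathcal S$ with $(\tilde\Theta_i,L(\tilde\Theta_i))\in\mathcal C_{2^iT_w}$ and $J(\tilde\Theta_i)\le\inf J+1/T$, the infimum being over all $\Theta'\in\mathcal S$ with $(\Theta',L(\Theta'))\in\mathcal C_{2^iT_w}$ (an arbitrary element of $\mathcal S$ if there is no such $\Theta'$). For $2^iT_w\le t<2^{i+1}T_w$ it applies $u_t=-K(\tilde\Theta_i)\hat x_{t|t}$. Here, writing $\tilde\Theta_{(t)}=\tilde\Theta_i$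 for $2^iT_w\le t<2^{i+1}T_w$ and $\tilde\Theta_{(t)}=\tilde\Theta_0$ for $t<T_w$, with gain $\tilde L_{(t)}=L(\tilde\Theta_{(t)})$, the optimistic state estimates are $\hat x_{0|-1}=0$, $\hat x_{t|t}=\hat x_{t|t-1}+\tilde L_{(t)}(y_t-\tilde C_{(t)}\hat x_{t|t-1})$, $\hat x_{t+1|t}=\tilde A_{(t)}\hat x_{t|t}+\tilde B_{(t)}u_t$. **Lemma (Boundedness).** There is a constant $c_0>0$ such that for all $c_1,c_2,c_3\ge c_0$ there are constants $c_H,\mathsf K,c_X,c_Y>0$ and $k\in\mathbb N$ with the following property. Here $c_0$ depends only on $\Theta,Q,R,\sigma_w,\sigma_z,\sigma_u,\lambda,\rho,\upsilon,D,\Gamma,\zeta$ and the bound for $\mathcal S$, and the other constants depend on these data and $c_1,c_2,c_3$. Let $T\ge2$, $\delta\in(0,1)$, $H\ge\log(c_HT^2\sqrt m/\sqrt\lambda)/\log(1/\upsilon)$, and let the warm-up length satisfy $\mathsf K\,(H\log(T/\delta))^k\le T_w\le T$. Then with probability at least $1-3\delta$, for all $T_w\le t\le T$: 1. $(A,B,C,L)\in\mathcal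 C_t$; more precisely, whenever $(\bar A,\bar B,\bar C,\bar L)$ is an output of SysId on $\mathbf M$, it arises from $(A,B,C,L)$ by a change of state coordinates and lies in $\mathcal B_t(\mathbf T)$ for some orthogonal $\mathbf T$; 2. $\|\hat x_{t|t}\|\le\tilde{\mathcal X}:=c_X\sqrt{\log(T/\delta)}$; 3. $\|y_t\|\le\tilde{\mathcal Y}:=c_Y\sqrt{\log(T/\delta)}$. In particular $\tilde{\mathcal X},\tilde{\mathcal Y}=\mathcal O(\sqrt{\log T})$ for fixed $\delta$. -/

import Mathlib

open MeasureTheory ProbabilityTheory Filter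
open scoped Matrix Matrix.Norms.L2Operator ENNReal

noncomputable section

namespace LQG

/- All matrix norms below are spectral (`ℓ²` operator) norms, all vector norms are Euclidean. -/

/-- Euclidean space `ℝ^k`. -/
abbrev Vec (k : ℕ) := EuclideanSpace ℝ (Fin k)

/-- A linear system `Θ = (A, B, C)` with `n` states, `m` outputs and `p` inputs. -/
@[ext]
structure LinSys (n m p : ℕ) where
  A : Matrix (Fin n) (Fin n) ℝ
  B : Matrix (Fin n) (Fin p) ℝ
  C : Matrix (Fin m) (Fin n) ℝ

/-- The known data: cost matrices, noise levels, excitation level, regularization parameter. -/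
structure Setup (m p : ℕ) where
  Q : Matrix (Fin m) (Fin m) ℝ
  R : Matrix (Fin p) (Fin p) ℝ
  σw : ℝ
  σz : ℝ
  σu : ℝ
  lam : ℝ

structure Setup.Valid {m p : ℕ} (s : Setup m p) : Prop where
  Q_psd : s.Q.PosSemidef
  R_pd : s.R.PosDef
  σw_pos : 0 < s.σw
  σz_pos : 0 < s.σz
  σu_pos : 0 < s.σu
  lam_pos : 0 < s.lam

variable {n m p : ℕ}

/-! ### Linear systems: controllability, Riccati equations, gains -/

/-- The controllability matrix `[B, AB, …, A^{n-1}B]`. -/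
def ctrbMatrix {q : ℕ} (A : Matrix (Fin n) (Fin n) ℝ) (B : Matrix (Fin n) (Fin q) ℝ) :
    Matrix (Fin n) (Fin n × Fin q) ℝ :=
  Matrix.of fun i kj => (A ^ (kj.1 : ℕ) * B) i kj.2

def Controllable {q : ℕ} (A : Matrix (Fin n) (Fin n) ℝ) (B : Matrix (Fin n) (Fin q) ℝ) : Prop :=
  (ctrbMatrix A B).rank = n

/-- The observability matrix, with block rows `C, CA, …, CA^{n-1}`. -/
def obsvMatrix (A : Matrix (Fin n) (Fin n) ℝ) (C : Matrix (Fin m) (Fin n) ℝ) :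
    Matrix (Fin n × Fin m) (Fin n) ℝ :=
  Matrix.of fun ki j => (C * A ^ (ki.1 : ℕ)) ki.2 j

def Observable (A : Matrix (Fin n) (Fin n) ℝ) (C : Matrix (Fin m) (Fin n) ℝ) : Prop :=
  (obsvMatrix A C).rank = n

/-- Spectral radius of a real matrix (largest modulus of its complex eigenvalues). -/
def specRad (A : Matrix (Fin n) (Fin n) ℝ) : ℝ :=
  (spectralRadius ℂ (A.map (algebraMap ℝ ℂ))).toReal

/-- `P` is a positive semidefinite solution of the control Riccati equation of `Θ`. -/
def IsControlRiccati (s : Setup m p) (Θ : LinSys n m p) (P : Matrix (Fin n) (Fin n) ℝ) : Prop :=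
  P.PosSemidef ∧
    P = Θ.Aᵀ * P * Θ.A + Θ.Cᵀ * s.Q * Θ.C
      - Θ.Aᵀ * P * Θ.B * (s.R + Θ.Bᵀ * P * Θ.B)⁻¹ * Θ.Bᵀ * P * Θ.A

/-- `K` is the optimal feedback gain of `Θ`. -/
def IsOptimalGain (s : Setup m p) (Θ : LinSys n m p) (K : Matrix (Fin p) (Fin n) ℝ) : Prop :=
  ∃ P, IsControlRiccati s Θ P ∧ K = (s.R + Θ.Bᵀ * P * Θ.B)⁻¹ * Θ.Bᵀ * P * Θ.A

/-- `Sig` is a positive semidefinite solution of the filter Riccati equation of `Θ`. -/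
def IsFilterRiccati (s : Setup m p) (Θ : LinSys n m p) (Sig : Matrix (Fin n) (Fin n) ℝ) : Prop :=
  Sig.PosSemidef ∧
    Sig = Θ.A * Sig * Θ.Aᵀ
      - Θ.A * Sig * Θ.Cᵀ * (Θ.C * Sig * Θ.Cᵀ + s.σz ^ 2 • 1)⁻¹ * Θ.C * Sig * Θ.Aᵀ
      + s.σw ^ 2 • 1

/-- The Kalman gain attached to an error covariance `Sig`. -/
def kalmanGain (s : Setup m p) (Θ : LinSys n m p) (Sig : Matrix (Fin n) (Fin n) ℝ) :
    Matrix (Fin n) (Fin m) ℝ :=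
  Sig * Θ.Cᵀ * (Θ.C * Sig * Θ.Cᵀ + s.σz ^ 2 • 1)⁻¹

/-- `L` is the (steady-state) Kalman gain of `Θ`. -/
def IsKalmanGain (s : Setup m p) (Θ : LinSys n m p) (L : Matrix (Fin n) (Fin m) ℝ) : Prop :=
  ∃ Sig, IsFilterRiccati s Θ Sig ∧ L = kalmanGain s Θ Sig

/-! ### Standing assumptions -/

/-- The system is stable with finite `Φ(A) = sup_τ ‖A^τ‖ / ρ(A)^τ`. -/
def StableFinitePhi (Θ : LinSys n m p) : Prop :=
  specRad Θ.A < 1 ∧ ∃ Φ : ℝ, ∀ τ : ℕ, ‖Θ.A ^ τ‖ ≤ Φ * specRad Θ.A ^ τ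

/-- The numbers `ρ, υ, D, Γ, ζ` of the contractibility assumption, and a bound `b` for the set. -/
structure SetBounds where
  ρ : ℝ
  υ : ℝ
  D : ℝ
  Γ : ℝ
  ζ : ℝ
  b : ℝ

/-- The assumptions on the set `S` of candidate systems: stable, controllable, observable, with
`(A', F')` controllable for `F' = A' L(Θ')`, contractible with the given numbers, and bounded.
For stable `A'` both Riccati equations have exactly one positive semidefinite solution, so that
`P`, `K`, `L` range over one value for each system. -/
structure AdmissibleSet (s : Setup m p) (κ : SetBounds) (S : Set (LinSys n m p)) : Prop where
  stable : ∀ Θ ∈ S, specRad Θ.A < 1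
  ctrb : ∀ Θ ∈ S, Controllable Θ.A Θ.B
  obsv : ∀ Θ ∈ S, Observable Θ.A Θ.C
  ctrb_filter : ∀ Θ ∈ S, ∀ L, IsKalmanGain s Θ L → Controllable Θ.A (Θ.A * L)
  contract_control : ∀ Θ ∈ S, ∀ K, IsOptimalGain s Θ K → ‖Θ.A - Θ.B * K‖ ≤ κ.ρ
  contract_filter : ∀ Θ ∈ S, ∀ L, IsKalmanGain s Θ L → ‖Θ.A - Θ.A * L * Θ.C‖ ≤ κ.υ
  riccati_le : ∀ Θ ∈ S, ∀ P, IsControlRiccati s Θ P → ‖P‖ ≤ κ.D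
  control_le : ∀ Θ ∈ S, ∀ K, IsOptimalGain s Θ K → ‖K‖ ≤ κ.Γ
  filter_le : ∀ Θ ∈ S, ∀ L, IsKalmanGain s Θ L → ‖L‖ ≤ κ.ζ
  bounded : ∀ Θ ∈ S, ‖Θ.A‖ ≤ κ.b ∧ ‖Θ.B‖ ≤ κ.b ∧ ‖Θ.C‖ ≤ κ.b

/-! ### Noise, trajectories, optimal average cost -/

/-- `x0 ~ N(0, Sig)`, `w_t ~ N(0, σw² I)`, `z_t ~ N(0, σz² I)`, all independent. -/
structure SystemNoise {Ω : Type*} [MeasurableSpace Ω] (μ : Measure Ω) (s : Setup m p)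
    (Sig : Matrix (Fin n) (Fin n) ℝ) (x0 : Ω → Vec n) (w : ℕ → Ω → Vec n)
    (z : ℕ → Ω → Vec m) : Prop where
  meas_x0 : Measurable x0
  meas_w : ∀ t, Measurable (w t)
  meas_z : ∀ t, Measurable (z t)
  law_x0 : μ.map x0 = multivariateGaussian 0 Sig
  law_w : ∀ t, μ.map (w t) = multivariateGaussian 0 (s.σw ^ 2 • 1)
  law_z : ∀ t, μ.map (z t) = multivariateGaussian 0 (s.σz ^ 2 • 1)
  indep_w : iIndepFun w μ
  indep_z : iIndepFun z μ
  indep_w_z : IndepFun (fun ω t => w t ω) (fun ω t => z t ω) μ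
  indep_x0 : IndepFun x0 (fun ω => ((fun t => w t ω), (fun t => z t ω))) μ

/-- `x_{t+1} = A x_t + B u_t + w_t`, `y_t = C x_t + z_t`, started at `x0`. -/
structure IsTrajectory {Ω : Type*} (Θ : LinSys n m p) (x0 : Ω → Vec n) (w : ℕ → Ω → Vec n)
    (z : ℕ → Ω → Vec m) (x : ℕ → Ω → Vec n) (y : ℕ → Ω → Vec m) (u : ℕ → Ω → Vec p) : Prop where
  init : ∀ ω, x 0 ω = x0 ω
  state : ∀ t ω, x (t + 1) ω =
    Matrix.toEuclideanLin Θ.A (x t ω) + Matrix.toEuclideanLin Θ.B (u t ω) + w t ω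
  output : ∀ t ω, y t ω = Matrix.toEuclideanLin Θ.C (x t ω) + z t ω

/-- The stage cost `yᵀ Q y + uᵀ R u`. -/
def stageCost (s : Setup m p) (y : Vec m) (u : Vec p) : ℝ :=
  inner ℝ y (Matrix.toEuclideanLin s.Q y) + inner ℝ u (Matrix.toEuclideanLin s.R u)

/-- The σ-algebra generated by `y_0, …, y_t`. -/
@[reducible]
def obsHistory {Ω : Type*} (y : ℕ → Ω → Vec m) (t : ℕ) : MeasurableSpace Ω :=
  ⨆ r ∈ Finset.range (t + 1), MeasurableSpace.comap (y r) inferInstance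

/-- The minimal expected cost `min E[∑_{t=1}^N c_t]` over controls for which every `u_t` is a
measurable function of `y_0, …, y_t`; the system starts in its steady state. -/
def finiteHorizonCost (s : Setup m p) (Θ : LinSys n m p) (N : ℕ) : ℝ≥0∞ :=
  sInf {c | ∃ (Ω : Type) (_ : MeasurableSpace Ω) (μ : Measure Ω) (Sig : Matrix (Fin n) (Fin n) ℝ)
    (x0 : Ω → Vec n) (w : ℕ → Ω → Vec n) (z : ℕ → Ω → Vec m)
    (x : ℕ → Ω → Vec n) (y : ℕ → Ω → Vec m) (u : ℕ → Ω → Vec p),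
    IsProbabilityMeasure μ ∧ IsFilterRiccati s Θ Sig ∧ SystemNoise μ s Sig x0 w z ∧
    IsTrajectory Θ x0 w z x y u ∧ (∀ t, Measurable[obsHistory y t] (u t)) ∧
    c = ∫⁻ ω, ENNReal.ofReal (∑ t ∈ Finset.Icc 1 N, stageCost s (y t ω) (u t ω)) ∂μ}

/-- The optimal average expected cost `J(Θ)`. -/
def avgCost (s : Setup m p) (Θ : LinSys n m p) : ℝ≥0∞ :=
  limsup (fun N : ℕ => finiteHorizonCost s Θ N / (N : ℝ≥0∞)) atTop

/-! ### The truncated ARX model and its least-squares estimate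

The window length is `H = d₁ + d₂ + 1`. -/

/-- Index set of the regressor `φ_t`: `H` blocks for outputs, then `H` blocks for inputs. -/
abbrev BlockIdx (H m p : ℕ) := (Fin H × Fin m) ⊕ (Fin H × Fin p)

/-- `M = [CF, CĀF, …, CĀ^{H-1}F, CB, CĀB, …, CĀ^{H-1}B]` with `F = AL`, `Ā = A - FC`. -/
def arxMatrix (H : ℕ) (Θ : LinSys n m p) (L : Matrix (Fin n) (Fin m) ℝ) :
    Matrix (Fin m) (BlockIdx H m p) ℝ :=
  Matrix.of fun a c => Sum.elim
    (fun kb : Fin H × Fin m =>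
      (Θ.C * (Θ.A - Θ.A * L * Θ.C) ^ (kb.1 : ℕ) * (Θ.A * L)) a kb.2)
    (fun kb : Fin H × Fin p =>
      (Θ.C * (Θ.A - Θ.A * L * Θ.C) ^ (kb.1 : ℕ) * Θ.B) a kb.2) c

/-- `φ_t = [y_{t-1}; …; y_{t-H}; u_{t-1}; …; u_{t-H}]` (used for `t ≥ H`). -/
def regressor (H : ℕ) (y : ℕ → Vec m) (u : ℕ → Vec p) (t : ℕ) : BlockIdx H m p → ℝ :=
  Sum.elim (fun ka => y (t - 1 - ka.1) ka.2) (fun ka => u (t - 1 - ka.1) ka.2)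

/-- `V_t = λ I + ∑_{r=H}^t φ_r φ_rᵀ`. -/
def gramMatrix (H : ℕ) (lam : ℝ) (y : ℕ → Vec m) (u : ℕ → Vec p) (t : ℕ) :
    Matrix (BlockIdx H m p) (BlockIdx H m p) ℝ :=
  lam • 1 + ∑ r ∈ Finset.Icc H t, Matrix.vecMulVec (regressor H y u r) (regressor H y u r)

/-- The regularized least-squares estimate `M̂_t = (∑_{r=H}^t y_r φ_rᵀ) V_t⁻¹`. -/
def arxEstimate (H : ℕ) (lam : ℝ) (y : ℕ → Vec m) (u : ℕ → Vec p) (t : ℕ) :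
    Matrix (Fin m) (BlockIdx H m p) ℝ :=
  (∑ r ∈ Finset.Icc H t, Matrix.vecMulVec (fun a => y r a) (regressor H y u r)) *
    (gramMatrix H lam y u t)⁻¹

/-! ### The subspace identification procedure SysId -/

/-- The `d₁ × (d₂+1)` block Hankel matrices of the two halves of `M`, side by side. -/
def hankel (d₁ d₂ : ℕ) (M : Matrix (Fin m) (BlockIdx (d₁ + d₂ + 1) m p) ℝ) :
    Matrix (Fin d₁ × Fin m) (BlockIdx (d₂ + 1) m p) ℝ :=
  Matrix.of fun ia c => Sum.elim
    (fun jb : Fin (d₂ + 1) × Fin m =>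
      M ia.2 (Sum.inl (⟨ia.1 + jb.1, by omega⟩, jb.2)))
    (fun jb : Fin (d₂ + 1) × Fin p =>
      M ia.2 (Sum.inr (⟨ia.1 + jb.1, by omega⟩, jb.2))) c

/-- `ℋ⁻`: the last block column of each half is discarded. -/
def hankelMinus (d₁ d₂ : ℕ) (M : Matrix (Fin m) (BlockIdx (d₁ + d₂ + 1) m p) ℝ) :
    Matrix (Fin d₁ × Fin m) (BlockIdx d₂ m p) ℝ :=
  (hankel d₁ d₂ M).submatrix id
    (Sum.map (fun jb => (jb.1.castSucc, jb.2)) (fun jb => (jb.1.castSucc, jb.2)))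

/-- `ℋ⁺`: the first block column of each half is discarded. -/
def hankelPlus (d₁ d₂ : ℕ) (M : Matrix (Fin m) (BlockIdx (d₁ + d₂ + 1) m p) ℝ) :
    Matrix (Fin d₁ × Fin m) (BlockIdx d₂ m p) ℝ :=
  (hankel d₁ d₂ M).submatrix id
    (Sum.map (fun jb => (jb.1.succ, jb.2)) (fun jb => (jb.1.succ, jb.2)))

/-- `X = U diag(d) Vᵀ` is a singular value decomposition with `r` columns. -/
structure IsSVD {ι κ : Type*} [Fintype ι] [Fintype κ] {r : ℕ} (X : Matrix ι κ ℝ)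
    (U : Matrix ι (Fin r) ℝ) (d : Fin r → ℝ) (V : Matrix κ (Fin r) ℝ) : Prop where
  left : Uᵀ * U = 1
  right : Vᵀ * V = 1
  nonneg : ∀ j, 0 ≤ d j
  anti : Antitone d
  eq : X = U * Matrix.diagonal d * Vᵀ

/-- `N` arises from `X` by setting all but the top `r` singular values to zero. -/
def IsRankTruncation {ι κ : Type*} [Fintype ι] [Fintype κ] (r : ℕ) (X N : Matrix ι κ ℝ) : Prop :=
  ∃ (k : ℕ) (U : Matrix ι (Fin (r + k)) ℝ) (d : Fin (r + k) → ℝ) (V : Matrix κ (Fin (r + k)) ℝ),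
    IsSVD X U d V ∧
    N = U * Matrix.diagonal (fun j : Fin (r + k) => if (j : ℕ) < r then d j else 0) * Vᵀ

/-- `Y` is the Moore–Penrose inverse of `X`. -/
structure IsPInv {ι κ : Type*} [Fintype ι] [Fintype κ] (X : Matrix ι κ ℝ) (Y : Matrix κ ι ℝ) :
    Prop where
  left : X * Y * X = X
  right : Y * X * Y = Y
  symm_left : (X * Y)ᵀ = X * Y
  symm_right : (Y * X)ᵀ = Y * X

/-- `(Θ̂, L̂)` is an output of SysId on the input `M` (for some choice of the singular value
decompositions, which are not unique). -/
def IsSysIdOutput (d₁ d₂ : ℕ) (M : Matrix (Fin m) (BlockIdx (d₁ + d₂ + 1) m p) ℝ)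
    (Θh : LinSys n m p) (Lh : Matrix (Fin n) (Fin m) ℝ) : Prop :=
  ∃ (N : Matrix (Fin d₁ × Fin m) (BlockIdx d₂ m p) ℝ)
    (U : Matrix (Fin d₁ × Fin m) (Fin n) ℝ) (d : Fin n → ℝ)
    (V : Matrix (BlockIdx d₂ m p) (Fin n) ℝ)
    (O : Matrix (Fin d₁ × Fin m) (Fin n) ℝ) (Od : Matrix (Fin n) (Fin d₁ × Fin m) ℝ)
    (W : Matrix (Fin n) (BlockIdx d₂ m p) ℝ) (Wd : Matrix (BlockIdx d₂ m p) (Fin n) ℝ)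
    (F : Matrix (Fin n) (Fin m) ℝ) (Ad : Matrix (Fin n) (Fin n) ℝ),
    IsRankTruncation n (hankelMinus d₁ d₂ M) N ∧ IsSVD N U d V ∧
    O = U * Matrix.diagonal (fun j => √(d j)) ∧
    W = Matrix.diagonal (fun j => √(d j)) * Vᵀ ∧
    (∀ i : Fin d₁, (i : ℕ) = 0 → ∀ a k, Θh.C a k = O (i, a) k) ∧
    (∀ j : Fin d₂, (j : ℕ) = 0 → ∀ k b, Θh.B k b = W k (Sum.inr (j, b))) ∧
    (∀ j : Fin d₂, (j : ℕ) = 0 → ∀ k a, F k a = W k (Sum.inl (j, a))) ∧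
    IsPInv O Od ∧ IsPInv W Wd ∧
    Θh.A = Od * hankelPlus d₁ d₂ M * Wd + F * Θh.C ∧
    IsPInv Θh.A Ad ∧
    (∀ j : Fin d₂, (j : ℕ) = 0 →
      ∀ k a, Lh k a = (Ad * Od * hankelMinus d₁ d₂ M) k (Sum.inl (j, a)))

/-! ### Confidence sets -/

/-- The `k`-th largest singular value of `X`, for `k ≥ 1`. -/
def sigma {ι κ : Type*} [Fintype ι] [Fintype κ] [DecidableEq κ] (k : ℕ) (X : Matrix ι κ ℝ) : ℝ :=
  (Matrix.toEuclideanLin X).singularValues (k - 1)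

/-- The problem dependent constants in the confidence radii. -/
structure RadiusConst where
  c₁ : ℝ
  c₂ : ℝ
  c₃ : ℝ

/-- `β_A`, where `e` stands for `‖M̂_t - M‖` and `Hk` for the Hankel matrix of `M`. -/
def betaA {ι κ : Type*} [Fintype ι] [Fintype κ] [DecidableEq κ] (c : RadiusConst) (n H : ℕ)
    (Hk : Matrix ι κ ℝ) (e : ℝ) : ℝ :=
  c.c₁ * (√(n * H) * (‖Hk‖ + sigma n Hk) / sigma n Hk ^ 2) * e

/-- `β_B = β_C`. -/
def betaB {ι κ : Type*} [Fintype ι] [Fintype κ] [DecidableEq κ] (n H : ℕ)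
    (Hk : Matrix ι κ ℝ) (e : ℝ) : ℝ :=
  √(20 * n * H / sigma n Hk) * e

/-- `β_L`. -/
def betaL {ι κ : Type*} [Fintype ι] [Fintype κ] [DecidableEq κ] (c : RadiusConst) (n H : ℕ)
    (Hk : Matrix ι κ ℝ) (e : ℝ) : ℝ :=
  c.c₂ * ‖Hk‖ / √(sigma n Hk) * betaA c n H Hk e
    + c.c₃ * (√(n * H) * (‖Hk‖ + sigma n Hk) / sigma n Hk ^ (3 / 2 : ℝ)) * e

/-- Membership of `(A', B', C', L')` in the four balls around the estimate `(Θ̂, L̂)`, seen through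
the orthogonal matrix `O`; `e = ‖M̂ - M‖`. -/
def InBalls (c : RadiusConst) (d₁ d₂ : ℕ) (M Mh : Matrix (Fin m) (BlockIdx (d₁ + d₂ + 1) m p) ℝ)
    (Θh : LinSys n m p) (Lh : Matrix (Fin n) (Fin m) ℝ) (O : Matrix (Fin n) (Fin n) ℝ)
    (Θ' : LinSys n m p) (L' : Matrix (Fin n) (Fin m) ℝ) : Prop :=
  ‖Θh.A - Oᵀ * Θ'.A * O‖ ≤ betaA c n (d₁ + d₂ + 1) (hankel d₁ d₂ M) ‖Mh - M‖ ∧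
  ‖Θh.B - Oᵀ * Θ'.B‖ ≤ betaB n (d₁ + d₂ + 1) (hankel d₁ d₂ M) ‖Mh - M‖ ∧
  ‖Θh.C - Θ'.C * O‖ ≤ betaB n (d₁ + d₂ + 1) (hankel d₁ d₂ M) ‖Mh - M‖ ∧
  ‖Lh - Oᵀ * L'‖ ≤ betaL c n (d₁ + d₂ + 1) (hankel d₁ d₂ M) ‖Mh - M‖

/-- `(Θ₂, L₂)` arises from `(Θ₁, L₁)` by a change of state coordinates. -/
def Similar (Θ₁ : LinSys n m p) (L₁ : Matrix (Fin n) (Fin m) ℝ)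
    (Θ₂ : LinSys n m p) (L₂ : Matrix (Fin n) (Fin m) ℝ) : Prop :=
  ∃ G : Matrix (Fin n) (Fin n) ℝ, IsUnit G.det ∧ Θ₂.A = G⁻¹ * Θ₁.A * G ∧ Θ₂.B = G⁻¹ * Θ₁.B ∧
    Θ₂.C = Θ₁.C * G ∧ L₂ = G⁻¹ * L₁

/-- The confidence set. Data determine a system only up to a change of state coordinates, so a
system belongs to the set if, in suitable state coordinates, it lies in the four balls for some
orthogonal matrix `O`. -/
def confSet (c : RadiusConst) (d₁ d₂ : ℕ) (M Mh : Matrix (Fin m) (BlockIdx (d₁ + d₂ + 1) m p) ℝ)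
    (Θh : LinSys n m p) (Lh : Matrix (Fin n) (Fin m) ℝ) :
    Set (LinSys n m p × Matrix (Fin n) (Fin m) ℝ) :=
  {X | ∃ (Θ' : LinSys n m p) (L' : Matrix (Fin n) (Fin m) ℝ), Similar X.1 X.2 Θ' L' ∧
    ∃ O ∈ Matrix.orthogonalGroup (Fin n) ℝ, InBalls c d₁ d₂ M Mh Θh Lh O Θ' L'}

/-! ### Executions of LqgOpt -/

/-- The σ-algebra generated by `y_0, …, y_t, u_0, …, u_{t-1}`. -/
@[reducible]
def dataHistory {Ω : Type*} (y : ℕ → Ω → Vec m) (u : ℕ → Ω → Vec p) (t : ℕ) :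
    MeasurableSpace Ω :=
  obsHistory y t ⊔ ⨆ r ∈ Finset.range t, MeasurableSpace.comap (u r) inferInstance

/-- The index `i` with `2^i T_w ≤ t < 2^{i+1} T_w`, and `0` during the warm-up. -/
def epoch (Tw t : ℕ) : ℕ := Nat.log 2 (t / Tw)

/-- The processes occurring in an execution of LqgOpt. -/
structure Processes (n m p : ℕ) (Ω : Type*) where
  /-- initial state, process noise, measurement noise, warm-up excitation -/
  x0 : Ω → Vec n
  w : ℕ → Ω → Vec n
  z : ℕ → Ω → Vec m
  exc : ℕ → Ω → Vec p
  /-- state, output, input -/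
  x : ℕ → Ω → Vec n
  y : ℕ → Ω → Vec m
  u : ℕ → Ω → Vec p
  /-- SysId outputs at time `t` -/
  Θhat : ℕ → Ω → LinSys n m p
  Lhat : ℕ → Ω → Matrix (Fin n) (Fin m) ℝ
  /-- optimistic system and its gains in epoch `i` -/
  Θopt : ℕ → Ω → LinSys n m p
  Kopt : ℕ → Ω → Matrix (Fin p) (Fin n) ℝ
  Lopt : ℕ → Ω → Matrix (Fin n) (Fin m) ℝ
  /-- optimistic state estimates `x̂_{t|t-1}` and `x̂_{t|t}` -/
  xpred : ℕ → Ω → Vec n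
  xfilt : ℕ → Ω → Vec n

/-- The least-squares estimate at time `t`. -/
def Processes.Mhat {Ω : Type*} (X : Processes n m p Ω) (s : Setup m p) (H t : ℕ) (ω : Ω) :
    Matrix (Fin m) (BlockIdx H m p) ℝ :=
  arxEstimate H s.lam (fun r => X.y r ω) (fun r => X.u r ω) t

/-- The confidence set at time `t`, for the true system `(Θ, L)`. -/
def Processes.conf {Ω : Type*} (X : Processes n m p Ω) (s : Setup m p) (c : RadiusConst)
    (d₁ d₂ : ℕ) (Θ : LinSys n m p) (L : Matrix (Fin n) (Fin m) ℝ) (t : ℕ) (ω : Ω) :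
    Set (LinSys n m p × Matrix (Fin n) (Fin m) ℝ) :=
  confSet c d₁ d₂ (arxMatrix (d₁ + d₂ + 1) Θ L) (X.Mhat s (d₁ + d₂ + 1) t ω)
    (X.Θhat t ω) (X.Lhat t ω)

/-- The systems (with their Kalman gains) among which the optimistic one is searched. -/
def Processes.candidates {Ω : Type*} (X : Processes n m p Ω) (s : Setup m p) (c : RadiusConst)
    (d₁ d₂ : ℕ) (Θ : LinSys n m p) (L : Matrix (Fin n) (Fin m) ℝ) (S : Set (LinSys n m p))
    (t : ℕ) (ω : Ω) : Set (LinSys n m p × Matrix (Fin n) (Fin m) ℝ) :=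
  X.conf s c d₁ d₂ Θ L t ω ∩ {Y | Y.1 ∈ S ∧ IsKalmanGain s Y.1 Y.2}

/-- `X` is an execution of LqgOpt on the true system `Θ` (error covariance `Sig`, Kalman gain `L`)
with horizon `T`, warm-up length `Tw` and window `H = d₁ + d₂ + 1`. -/
structure IsLqgOptRun {Ω : Type*} [MeasurableSpace Ω] (μ : Measure Ω) (s : Setup m p)
    (c : RadiusConst) (S : Set (LinSys n m p)) (Θ : LinSys n m p)
    (Sig : Matrix (Fin n) (Fin n) ℝ) (L : Matrix (Fin n) (Fin m) ℝ) (T Tw d₁ d₂ : ℕ)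
    (X : Processes n m p Ω) : Prop where
  noise : SystemNoise μ s Sig X.x0 X.w X.z
  meas_exc : ∀ t, Measurable (X.exc t)
  law_exc : ∀ t, μ.map (X.exc t) = multivariateGaussian 0 (s.σu ^ 2 • 1)
  indep_exc : iIndepFun X.exc μ
  indep_exc_noise : IndepFun (fun ω t => X.exc t ω)
    (fun ω => (X.x0 ω, (fun t => X.w t ω), (fun t => X.z t ω))) μ
  trajectory : IsTrajectory Θ X.x0 X.w X.z X.x X.y X.u
  /- Gaussian excitation during the warm-up, then the optimistic controller. -/
  input : ∀ t ω, X.u t ω =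
    if t < Tw then X.exc t ω
    else -Matrix.toEuclideanLin (X.Kopt (epoch Tw t) ω) (X.xfilt t ω)
  sysId : ∀ t ω, Tw ≤ t →
    IsSysIdOutput d₁ d₂ (X.Mhat s (d₁ + d₂ + 1) t ω) (X.Θhat t ω) (X.Lhat t ω)
  /- The choice in epoch `i` uses only the data available at time `2^i Tw`. -/
  causal_A : ∀ i a b, Measurable[dataHistory X.y X.u (2 ^ i * Tw)] fun ω => (X.Θopt i ω).A a b
  causal_B : ∀ i a b, Measurable[dataHistory X.y X.u (2 ^ i * Tw)] fun ω => (X.Θopt i ω).B a b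
  causal_C : ∀ i a b, Measurable[dataHistory X.y X.u (2 ^ i * Tw)] fun ω => (X.Θopt i ω).C a b
  causal_K : ∀ i a b, Measurable[dataHistory X.y X.u (2 ^ i * Tw)] fun ω => X.Kopt i ω a b
  causal_L : ∀ i a b, Measurable[dataHistory X.y X.u (2 ^ i * Tw)] fun ω => X.Lopt i ω a b
  opt_mem : ∀ i ω, X.Θopt i ω ∈ S
  opt_gain : ∀ i ω, IsOptimalGain s (X.Θopt i ω) (X.Kopt i ω)
  opt_kalman : ∀ i ω, IsKalmanGain s (X.Θopt i ω) (X.Lopt i ω)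
  /- Optimism; if no candidate is left, the element of `S` is arbitrary. -/
  optimism : ∀ i ω, (X.candidates s c d₁ d₂ Θ L S (2 ^ i * Tw) ω).Nonempty →
    (X.Θopt i ω, X.Lopt i ω) ∈ X.candidates s c d₁ d₂ Θ L S (2 ^ i * Tw) ω ∧
    avgCost s (X.Θopt i ω) ≤
      (⨅ Y ∈ X.candidates s c d₁ d₂ Θ L S (2 ^ i * Tw) ω, avgCost s Y.1) + (T : ℝ≥0∞)⁻¹
  /- The Kalman filter of the optimistic system, started at `0`. -/
  pred_init : ∀ ω, X.xpred 0 ω = 0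
  pred : ∀ t ω, X.xpred (t + 1) ω =
    Matrix.toEuclideanLin (X.Θopt (epoch Tw t) ω).A (X.xfilt t ω)
      + Matrix.toEuclideanLin (X.Θopt (epoch Tw t) ω).B (X.u t ω)
  filt : ∀ t ω, X.xfilt t ω = X.xpred t ω + Matrix.toEuclideanLin (X.Lopt (epoch Tw t) ω)
    (X.y t ω - Matrix.toEuclideanLin (X.Θopt (epoch Tw t) ω).C (X.xpred t ω))

end LQG

end

/-! Put the true system in innovations form. The error of its steady-state Kalman predictor does not
involve the inputs, so subtracting it from the state leaves the optimal prediction ξ with ξ' = Aξ +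
Bu + Fe and y = Cξ + e. Because the initial covariance solves the filter Riccati equation, the
innovations e are independent Gaussian vectors (`IsLqgOptRun.whiteNoise`), and data and controller
are adapted to them.

Probability enters through one event, `GoodNoise`, whose complement has measure at most 3δ
(`IsLqgOptRun.measure_not_goodNoise_le`): noise of size O(√log(T/δ)), excitation of every regressor
direction during the warm-up, and a self-normalized martingale bound. Excitation and the martingale
bound are needed for random directions; they are proved on a finite grid of exp(O(H log(T/δ)))
directions by union bounds and transferred by rounding. The remaining argument is deterministic.

Estimation. The output is y = Mφ + e + CĀ^H ξ, the last term being negligible for the prescribed H.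
As long as the data stay bounded by a multiple of √log(T/δ), the excitation collected in the warm-up
makes √H‖M̂ − M‖ as small as desired, for T_w polynomial in H log(T/δ)
(`IsLqgOptRun.estimation_le`).

Identification. The Hankel matrix of M factors into an observability and a controllability block
with bounds uniform in H, and the singular value factors are balanced. An orthogonal Procrustes
argument compares the balanced factors of the true and the perturbed matrix, and SysId is a locally
Lipschitz function of them (`exists_sysId_radius`), which puts the truth into the confidence set.
Conversely each member of the set with bounded matrices is close to the truth after a change of
coordinates, whose size is controlled by observability and controllability (`exists_closeModel`).

Control. With an accurate model a weighted sum of predicted state and estimation error contracts at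
each step (`exists_lyapunov`). Estimation needs bounded data and boundedness needs accurate
estimates; induction over the epochs breaks the circle. Epochs double in length, and each is long
enough for the contraction to absorb the constant lost when the model and its coordinates change, so
the bound does not grow with the number of epochs (`exists_closedLoop_bound`). -/

noncomputable section

namespace LQG

set_option linter.unusedSectionVars false

/-! ### Spectral and Frobenius norms -/

section Frobenius

variable {ι κ : Type*} [Fintype ι] [Fintype κ]

/-- The square of the Frobenius norm. -/
def frobSq (X : Matrix ι κ ℝ) : ℝ := ∑ i, ∑ j, X i j ^ 2

theorem frobSq_eq_trace (X : Matrix ι κ ℝ) : frobSq X = (Xᵀ * X).trace := by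
  simp only [frobSq, Matrix.trace, Matrix.diag, Matrix.mul_apply, Matrix.transpose_apply]
  rw [Finset.sum_comm]
  simp [sq]

theorem frobSq_nonneg (X : Matrix ι κ ℝ) : 0 ≤ frobSq X :=
  Finset.sum_nonneg fun _ _ => Finset.sum_nonneg fun _ _ => sq_nonneg _

theorem frobSq_transpose (X : Matrix ι κ ℝ) : frobSq Xᵀ = frobSq X := by
  simp only [frobSq, Matrix.transpose_apply]
  exact Finset.sum_comm

end Frobenius

section Norms

variable {ι κ l : Type*} [Fintype ι] [Fintype κ] [Fintype l] [DecidableEq κ] [DecidableEq l]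

theorem norm_toEuclideanLin_le (A : Matrix ι κ ℝ) (x : EuclideanSpace ℝ κ) :
    ‖Matrix.toEuclideanLin A x‖ ≤ ‖A‖ * ‖x‖ :=
  Matrix.l2_opNorm_mulVec A x

theorem opNorm_le_of_forall (A : Matrix ι κ ℝ) {c : ℝ} (hc : 0 ≤ c)
    (h : ∀ x : EuclideanSpace ℝ κ, ‖Matrix.toEuclideanLin A x‖ ≤ c * ‖x‖) : ‖A‖ ≤ c := by
  rw [Matrix.l2_opNorm_def]
  exact ContinuousLinearMap.opNorm_le_bound _ hc h

theorem toEuclideanLin_mul_apply (A : Matrix ι κ ℝ) (B : Matrix κ l ℝ) (x : EuclideanSpace ℝ l) :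
    Matrix.toEuclideanLin (A * B) x = Matrix.toEuclideanLin A (Matrix.toEuclideanLin B x) := by
  ext i
  simp [Matrix.toLpLin_apply, Matrix.mulVec_mulVec]

theorem toEuclideanLin_one_apply (x : EuclideanSpace ℝ κ) :
    Matrix.toEuclideanLin (1 : Matrix κ κ ℝ) x = x := by
  simp

theorem norm_transpose [DecidableEq ι] (A : Matrix ι κ ℝ) : ‖Aᵀ‖ = ‖A‖ := by
  have := Matrix.l2_opNorm_conjTranspose A
  rwa [Matrix.conjTranspose_eq_transpose_of_trivial] at this

theorem inner_toEuclideanLin [DecidableEq ι] (A : Matrix ι κ ℝ) (x : EuclideanSpace ℝ κ)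
    (y : EuclideanSpace ℝ ι) :
    inner ℝ (Matrix.toEuclideanLin A x) y = inner ℝ x (Matrix.toEuclideanLin Aᵀ y) := by
  simp only [EuclideanSpace.inner_eq_star_dotProduct, star_trivial, Matrix.toLpLin_apply]
  rw [Matrix.dotProduct_mulVec, Matrix.mulVec_transpose]

theorem norm_sq_le_frobSq (X : Matrix ι κ ℝ) : ‖X‖ ^ 2 ≤ frobSq X := by
  have h : ‖X‖ ≤ √(frobSq X) := by
    refine opNorm_le_of_forall X (Real.sqrt_nonneg _) fun x => ?_
    refine le_of_sq_le_sq ?_ (by positivity)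
    rw [mul_pow, Real.sq_sqrt (frobSq_nonneg X), EuclideanSpace.norm_sq_eq,
      EuclideanSpace.norm_sq_eq, frobSq, Finset.sum_mul]
    refine Finset.sum_le_sum fun i _ => ?_
    simp only [Real.norm_eq_abs, sq_abs, Matrix.toLpLin_apply, Matrix.mulVec, dotProduct]
    exact Finset.sum_mul_sq_le_sq_mul_sq _ _ _
  calc ‖X‖ ^ 2 ≤ √(frobSq X) ^ 2 := by gcongr
    _ = frobSq X := Real.sq_sqrt (frobSq_nonneg X)

/-- The trace of XᵀX is the sum of its nonzero eigenvalues, as many as the rank, each at most ‖X‖².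
This is what lets the radii carry the factor n instead of the size of the Hankel matrix. -/
theorem frobSq_le_rank_mul (X : Matrix ι κ ℝ) : frobSq X ≤ X.rank * ‖X‖ ^ 2 := by
  have hH : (Xᵀ * X).IsHermitian := by
    rw [← Matrix.conjTranspose_eq_transpose_of_trivial]
    exact Matrix.isHermitian_conjTranspose_mul_self X
  have htr := hH.trace_eq_sum_eigenvalues
  have hrk := hH.rank_eq_card_non_zero_eigs
  rw [Matrix.rank_transpose_mul_self] at hrk
  rw [frobSq_eq_trace, htr, hrk, Fintype.card_subtype]
  have hle : ∀ i, hH.eigenvalues i ≤ ‖X‖ ^ 2 := by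
    intro i
    have hv := hH.mulVec_eigenvectorBasis i
    have h1 : ‖hH.eigenvectorBasis i‖ = 1 := hH.eigenvectorBasis.norm_eq_one i
    have h2 : Matrix.toEuclideanLin (Xᵀ * X) (hH.eigenvectorBasis i)
        = hH.eigenvalues i • hH.eigenvectorBasis i := by
      ext j
      simp [Matrix.toLpLin_apply, hv]
    have h3 := norm_toEuclideanLin_le (Xᵀ * X) (hH.eigenvectorBasis i)
    rw [h2, norm_smul, h1, mul_one, mul_one, Real.norm_eq_abs] at h3
    have h4 := Matrix.l2_opNorm_conjTranspose_mul_self X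
    rw [Matrix.conjTranspose_eq_transpose_of_trivial] at h4
    rw [h4] at h3
    nlinarith [le_abs_self (hH.eigenvalues i)]
  calc ((∑ i, (hH.eigenvalues i : ℝ)) : ℝ)
      = ∑ i with hH.eigenvalues i ≠ 0, hH.eigenvalues i := by
        rw [Finset.sum_filter_ne_zero]
    _ ≤ ∑ i with hH.eigenvalues i ≠ 0, ‖X‖ ^ 2 := Finset.sum_le_sum fun i _ => hle i
    _ = _ := by simp

theorem norm_submatrix_le {ι' κ' : Type*} [Fintype ι'] [Fintype κ'] [DecidableEq κ']
    (A : Matrix ι κ ℝ) {f : ι' → ι} {g : κ' → κ} (hf : f.Injective) (hg : g.Injective) :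
    ‖A.submatrix f g‖ ≤ ‖A‖ := by
  refine opNorm_le_of_forall _ (norm_nonneg _) fun x => ?_
  let x' : EuclideanSpace ℝ κ := WithLp.toLp 2 (Function.extend g x 0)
  have hx' : ‖x'‖ = ‖x‖ := by
    rw [EuclideanSpace.norm_eq, EuclideanSpace.norm_eq]
    congr 1
    classical
    rw [← Finset.sum_subset (Finset.subset_univ (Finset.univ.image g)),
      Finset.sum_image fun a _ b _ h => hg h]
    · simp [x', hg.extend_apply]
    · intro k _ hk
      have : ¬ ∃ a, g a = k := by simpa using hk
      simp [x', Function.extend_apply' _ _ _ this]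
  have hAx : ∀ i', Matrix.toEuclideanLin (A.submatrix f g) x i'
      = Matrix.toEuclideanLin A x' (f i') := by
    intro i'
    simp only [Matrix.toLpLin_apply, Matrix.mulVec, dotProduct, Matrix.submatrix_apply]
    classical
    rw [← Finset.sum_subset (Finset.subset_univ (Finset.univ.image g)),
      Finset.sum_image fun a _ b _ h => hg h]
    · simp [x', hg.extend_apply]
    · intro k _ hk
      have : ¬ ∃ a, g a = k := by simpa using hk
      simp [x', Function.extend_apply' _ _ _ this]
  calc ‖Matrix.toEuclideanLin (A.submatrix f g) x‖ ≤ ‖Matrix.toEuclideanLin A x'‖ := by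
        rw [EuclideanSpace.norm_eq, EuclideanSpace.norm_eq]
        refine Real.sqrt_le_sqrt ?_
        simp only [hAx]
        classical
        rw [← Finset.sum_image (s := Finset.univ) (g := f)
          (f := fun i => ‖Matrix.toEuclideanLin A x' i‖ ^ 2) fun a _ b _ h => hf h]
        exact Finset.sum_le_sum_of_subset_of_nonneg (Finset.subset_univ _)
          fun _ _ _ => sq_nonneg _
    _ ≤ ‖A‖ * ‖x'‖ := norm_toEuclideanLin_le _ _
    _ = ‖A‖ * ‖x‖ := by rw [hx']

theorem norm_toEuclideanLin_of_transpose_mul_self [DecidableEq ι] {U : Matrix ι κ ℝ}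
    (hU : Uᵀ * U = 1) (x : EuclideanSpace ℝ κ) : ‖Matrix.toEuclideanLin U x‖ = ‖x‖ := by
  have h : ‖Matrix.toEuclideanLin U x‖ ^ 2 = ‖x‖ ^ 2 := by
    rw [← real_inner_self_eq_norm_sq, inner_toEuclideanLin, ← toEuclideanLin_mul_apply, hU,
      toEuclideanLin_one_apply, real_inner_self_eq_norm_sq]
  exact (sq_eq_sq₀ (norm_nonneg _) (norm_nonneg _)).1 h

theorem norm_le_one_of_transpose_mul_self [DecidableEq ι] {U : Matrix ι κ ℝ}
    (hU : Uᵀ * U = 1) : ‖U‖ ≤ 1 :=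
  opNorm_le_of_forall _ zero_le_one fun x => by
    rw [norm_toEuclideanLin_of_transpose_mul_self hU, one_mul]

end Norms

/-! ### Orthogonal Procrustes problem for balanced factorizations -/

section Procrustes

variable {n : ℕ}

theorem transpose_mul_self_of_mem_orthogonal {T : Matrix (Fin n) (Fin n) ℝ}
    (hT : T ∈ Matrix.orthogonalGroup (Fin n) ℝ) : Tᵀ * T = 1 :=
  (Matrix.mem_orthogonalGroup_iff' (Fin n) ℝ).1 hT

theorem mul_transpose_self_of_mem_orthogonal {T : Matrix (Fin n) (Fin n) ℝ}
    (hT : T ∈ Matrix.orthogonalGroup (Fin n) ℝ) : T * Tᵀ = 1 :=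
  (Matrix.mem_orthogonalGroup_iff (Fin n) ℝ).1 hT

/-- Polar decomposition: T = Y⁻¹(YYᵀ)^{1/2} turns Y into (YYᵀ)^{1/2}. -/
theorem exists_polar_of_isUnit {Y : Matrix (Fin n) (Fin n) ℝ} (hY : IsUnit Y.det) :
    ∃ T ∈ Matrix.orthogonalGroup (Fin n) ℝ, (Y * T).PosSemidef := by
  open scoped MatrixOrder in
  have hpsd : (Y * Yᵀ).PosSemidef := by
    have := Matrix.posSemidef_self_mul_conjTranspose Y
    rwa [Matrix.conjTranspose_eq_transpose_of_trivial] at this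
  have hP : (CFC.sqrt (Y * Yᵀ)).PosSemidef := Matrix.nonneg_iff_posSemidef.1 (CFC.sqrt_nonneg _)
  have hPP : CFC.sqrt (Y * Yᵀ) * CFC.sqrt (Y * Yᵀ) = Y * Yᵀ :=
    CFC.sqrt_mul_sqrt_self _ hpsd.nonneg
  have hPt : (CFC.sqrt (Y * Yᵀ))ᵀ = CFC.sqrt (Y * Yᵀ) := by
    have := hP.isHermitian.eq
    rwa [Matrix.conjTranspose_eq_transpose_of_trivial] at this
  refine ⟨Y⁻¹ * CFC.sqrt (Y * Yᵀ), ?_, ?_⟩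
  · rw [Matrix.mem_orthogonalGroup_iff]
    have hYt : IsUnit (Yᵀ).det := by rwa [Matrix.det_transpose]
    rw [Matrix.transpose_mul, hPt, Matrix.transpose_nonsing_inv]
    calc Y⁻¹ * CFC.sqrt (Y * Yᵀ) * (CFC.sqrt (Y * Yᵀ) * Yᵀ⁻¹)
        = Y⁻¹ * (CFC.sqrt (Y * Yᵀ) * CFC.sqrt (Y * Yᵀ)) * Yᵀ⁻¹ := by simp only [Matrix.mul_assoc]
      _ = (Y⁻¹ * Y) * (Yᵀ * Yᵀ⁻¹) := by rw [hPP]; simp only [Matrix.mul_assoc]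
      _ = 1 := by rw [Matrix.nonsing_inv_mul _ hY, Matrix.mul_nonsing_inv _ hYt, one_mul]
  · rw [← Matrix.mul_assoc, Matrix.mul_nonsing_inv _ hY, one_mul]
    exact hP

theorem norm_le_one_of_mem_orthogonal {T : Matrix (Fin n) (Fin n) ℝ}
    (hT : T ∈ Matrix.orthogonalGroup (Fin n) ℝ) : ‖T‖ ≤ 1 :=
  norm_le_one_of_transpose_mul_self (transpose_mul_self_of_mem_orthogonal hT)

theorem isCompact_orthogonalGroup :
    IsCompact {T : Matrix (Fin n) (Fin n) ℝ | T ∈ Matrix.orthogonalGroup (Fin n) ℝ} := by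
  refine Metric.isCompact_of_isClosed_isBounded ?_ ?_
  · have : {T : Matrix (Fin n) (Fin n) ℝ | T ∈ Matrix.orthogonalGroup (Fin n) ℝ}
        = {T | T * Tᵀ = 1} := by
      ext T
      simp only [Set.mem_ofPred_eq, Matrix.mem_orthogonalGroup_iff]
    rw [this]
    exact isClosed_eq (by fun_prop) continuous_const
  · refine (Metric.isBounded_closedBall (x := (0 : Matrix (Fin n) (Fin n) ℝ)) (r := 1)).subset ?_
    intro T hT
    simpa using norm_le_one_of_mem_orthogonal hT

theorem isClosed_posSemidef : IsClosed {X : Matrix (Fin n) (Fin n) ℝ | X.PosSemidef} := by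
  have : {X : Matrix (Fin n) (Fin n) ℝ | X.PosSemidef}
      = {X | Xᵀ = X} ∩ ⋂ v : Fin n → ℝ, {X | 0 ≤ v ⬝ᵥ (X *ᵥ v)} := by
    ext X
    simp [Matrix.posSemidef_iff_dotProduct_mulVec, Matrix.IsHermitian,
      Matrix.conjTranspose_eq_transpose_of_trivial]
  rw [this]
  refine (isClosed_eq (by fun_prop) continuous_id).inter (isClosed_iInter fun v => ?_)
  exact isClosed_le continuous_const (by fun_prop)

theorem exists_polar (Y : Matrix (Fin n) (Fin n) ℝ) :
    ∃ T ∈ Matrix.orthogonalGroup (Fin n) ℝ, (Y * T).PosSemidef := by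
  -- perturb `Y` to an invertible matrix and pass to the limit
  have hfin : {x : ℝ | (Y + x • 1).det = 0}.Finite := by
    -- The singular perturbations are roots of the characteristic polynomial of −Y, hence finitely
    -- many.
    have hq : ∀ x : ℝ, (Y + x • 1).det = (-Y).charpoly.eval x := by
      intro x
      rw [Matrix.eval_charpoly]
      congr 1
      ext i j
      simp [Matrix.scalar_apply, Matrix.diagonal_apply, Matrix.one_apply, add_comm]
    have hroots := (-Y).charpoly.rootSet_finite ℝ
    refine hroots.subset fun x hx => ?_
    rw [Polynomial.mem_rootSet]
    refine ⟨(Matrix.charpoly_monic _).ne_zero, ?_⟩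
    simpa [hq] using hx
  have hev : ∀ᶠ x in nhdsWithin (0 : ℝ) {0}ᶜ, (Y + x • 1).det ≠ 0 := by
    have h1 : ({x : ℝ | (Y + x • 1).det = 0} \ {0})ᶜ ∈ nhds (0 : ℝ) :=
      (hfin.subset Set.sdiff_subset).isClosed.isOpen_compl.mem_nhds (by simp)
    filter_upwards [nhdsWithin_le_nhds h1, self_mem_nhdsWithin] with x hx hx0 h
    exact hx ⟨h, hx0⟩
  have hseq : ∃ x : ℕ → ℝ, Tendsto x atTop (nhds 0) ∧ ∀ k, (Y + x k • 1).det ≠ 0 := by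
    obtain ⟨x, hx, hx'⟩ := exists_seq_forall_of_frequently hev.frequently
    exact ⟨x, hx.mono_right nhdsWithin_le_nhds, hx'⟩
  obtain ⟨x, hx, hdet⟩ := hseq
  choose T hT hpos using fun k => exists_polar_of_isUnit (isUnit_iff_ne_zero.2 (hdet k))
  obtain ⟨T₀, hT₀, φ, hφ, hlim⟩ := isCompact_orthogonalGroup.tendsto_subseq hT
  refine ⟨T₀, hT₀, ?_⟩
  have hcont : Tendsto (fun k => (Y + x (φ k) • 1) * T (φ k)) atTop (nhds (Y * T₀)) := by
    have h1 : Tendsto (fun k => Y + x (φ k) • (1 : Matrix (Fin n) (Fin n) ℝ)) atTop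
        (nhds (Y + (0 : ℝ) • 1)) :=
      tendsto_const_nhds.add ((hx.comp hφ.tendsto_atTop).smul_const _)
    rw [zero_smul, add_zero] at h1
    exact h1.mul hlim
  exact isClosed_posSemidef.mem_of_tendsto hcont (Eventually.of_forall fun k => hpos (φ k))

theorem trace_mul_self_nonneg {X : Matrix (Fin n) (Fin n) ℝ} (hX : Xᵀ = X) :
    0 ≤ (X * X).trace := by
  have h := frobSq_nonneg X
  rwa [frobSq_eq_trace, hX] at h

/-- The trace of XY equals that of X^{1/2} Y X^{1/2}. -/
theorem trace_mul_nonneg {X Y : Matrix (Fin n) (Fin n) ℝ} (hX : X.PosSemidef)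
    (hY : Y.PosSemidef) : 0 ≤ (X * Y).trace := by
  open scoped MatrixOrder in
  have hP : (CFC.sqrt X).PosSemidef := Matrix.nonneg_iff_posSemidef.1 (CFC.sqrt_nonneg _)
  have hPP : CFC.sqrt X * CFC.sqrt X = X := CFC.sqrt_mul_sqrt_self _ hX.nonneg
  rw [← hPP, Matrix.mul_assoc, Matrix.trace_mul_comm]
  have := (hY.conjTranspose_mul_mul_same (CFC.sqrt X)).trace_nonneg
  rwa [hP.isHermitian.eq] at this

/-- A sum-of-squares certificate: right side minus left side is tr (Q + 7/5 (Y − P))² + 1/25 tr (Y −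
P)² + 6/5 tr YQ. -/
theorem trace_gram_ineq {P Q Y : Matrix (Fin n) (Fin n) ℝ} (hP : Pᵀ = P) (hQ : Q.PosSemidef)
    (hY : Y.PosSemidef) :
    4 / 5 * (P * Q).trace ≤ ((Q - P + (2 : ℝ) • Y) * (Q - P + (2 : ℝ) • Y)).trace + (P * P).trace
      - 2 * (Y * Y).trace := by
  have hQt : Qᵀ = Q := by simpa using hQ.isHermitian.eq
  have hYt : Yᵀ = Y := by simpa using hY.isHermitian.eq
  have h1 := trace_mul_self_nonneg (X := Q + (7 / 5 : ℝ) • (Y - P)) (by simp [hP, hQt, hYt])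
  have h2 := trace_mul_self_nonneg (X := Y - P) (by simp [hP, hYt])
  have h3 := trace_mul_nonneg hY hQ
  simp only [Matrix.mul_add, Matrix.add_mul, Matrix.mul_sub, Matrix.sub_mul, Matrix.smul_mul,
    Matrix.mul_smul, Matrix.trace_add, Matrix.trace_sub, Matrix.trace_smul, smul_eq_mul,
    smul_sub, Matrix.trace_mul_comm Y P, Matrix.trace_mul_comm Q P,
    Matrix.trace_mul_comm Q Y, smul_add, smul_smul] at *
  linarith

variable {ι κ : Type*} [Fintype ι] [Fintype κ]

/-- Procrustes bound for balanced factors, linear in the error of the product. The orthogonal T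
comes from the polar decomposition of ÔᵀO + ŴWᵀ, the Gram matrix of the stacked factors. The matrix
Q, whose trace is the left side, then depends only on the Gram matrices D, D̂ and on Y₁ + Y₂, and
`trace_gram_ineq` with P = 2D applies because Q − P + 2(Y₁ + Y₂) = 2D̂. This gives 8/5 τ tr Q ≤ 4‖ÔŴ
− OW‖², hence the constant 5/2. -/
theorem exists_orthogonal_frobSq_le {O Oh : Matrix ι (Fin n) ℝ} {W Wh : Matrix (Fin n) κ ℝ}
    {τ : ℝ} (hτ : 0 < τ) (hb : Oᵀ * O = W * Wᵀ) (hbh : Ohᵀ * Oh = Wh * Whᵀ)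
    (hlow : (Oᵀ * O - τ • 1).PosSemidef) :
    ∃ T ∈ Matrix.orthogonalGroup (Fin n) ℝ,
      frobSq (Oh - O * T) + frobSq (Wh - Tᵀ * W) ≤ 5 / 2 / τ * frobSq (Oh * Wh - O * W) := by
  obtain ⟨T, hT, hpos⟩ := exists_polar (Ohᵀ * O + Wh * Wᵀ)
  refine ⟨T, hT, ?_⟩
  have hTT := transpose_mul_self_of_mem_orthogonal hT
  have hTT' := mul_transpose_self_of_mem_orthogonal hT
  obtain ⟨Y₁, hY₁⟩ : ∃ Y₁, Y₁ = Ohᵀ * O * T := ⟨_, rfl⟩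
  obtain ⟨Y₂, hY₂⟩ : ∃ Y₂, Y₂ = Wh * Wᵀ * T := ⟨_, rfl⟩
  obtain ⟨D, hD⟩ : ∃ D, D = Tᵀ * (Oᵀ * O) * T := ⟨_, rfl⟩
  obtain ⟨Dh, hDh⟩ : ∃ Dh, Dh = Ohᵀ * Oh := ⟨_, rfl⟩
  have hY : (Y₁ + Y₂).PosSemidef := by rwa [hY₁, hY₂, ← Matrix.add_mul]
  have hYt : (Y₁ + Y₂)ᵀ = Y₁ + Y₂ := by simpa using hY.isHermitian.eq
  have e1 : (Oh - O * T)ᵀ * (Oh - O * T) = Dh - Y₁ - Y₁ᵀ + D := by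
    simp only [hY₁, hD, hDh, Matrix.transpose_sub, Matrix.transpose_mul, Matrix.mul_sub,
      Matrix.sub_mul, Matrix.mul_assoc, Matrix.transpose_transpose]
    abel
  have e2 : (Wh - Tᵀ * W) * (Wh - Tᵀ * W)ᵀ = Dh - Y₂ - Y₂ᵀ + D := by
    rw [hD, hDh, hb, hbh]
    simp only [hY₂, Matrix.transpose_sub, Matrix.transpose_mul, Matrix.mul_sub,
      Matrix.sub_mul, Matrix.mul_assoc, Matrix.transpose_transpose]
    abel
  obtain ⟨Q, hQ⟩ : ∃ Q, Q = (2 : ℝ) • Dh - (2 : ℝ) • (Y₁ + Y₂) + (2 : ℝ) • D := ⟨_, rfl⟩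
  have hQsum : Q = (Oh - O * T)ᵀ * (Oh - O * T) + (Wh - Tᵀ * W) * (Wh - Tᵀ * W)ᵀ := by
    rw [e1, e2, hQ]
    have : Y₁ᵀ + Y₂ᵀ = Y₁ + Y₂ := by rw [← Matrix.transpose_add, hYt]
    calc _ = (2 : ℝ) • Dh - ((Y₁ + Y₂) + (Y₁ + Y₂)) + (2 : ℝ) • D := by rw [two_smul ℝ (Y₁ + Y₂)]
      _ = (2 : ℝ) • Dh - ((Y₁ + Y₂) + (Y₁ᵀ + Y₂ᵀ)) + (2 : ℝ) • D := by rw [this]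
      _ = _ := by rw [two_smul, two_smul]; abel
  have hQpsd : Q.PosSemidef := by
    rw [hQsum]
    have h1 := Matrix.posSemidef_conjTranspose_mul_self (Oh - O * T)
    have h2 := Matrix.posSemidef_self_mul_conjTranspose (Wh - Tᵀ * W)
    rw [Matrix.conjTranspose_eq_transpose_of_trivial] at h1 h2
    exact h1.add h2
  have hQtr : Q.trace = frobSq (Oh - O * T) + frobSq (Wh - Tᵀ * W) := by
    rw [hQsum, Matrix.trace_add, frobSq_eq_trace, ← frobSq_transpose (Wh - Tᵀ * W),
      frobSq_eq_trace, Matrix.transpose_transpose]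
  have hDt : Dᵀ = D := by rw [hD]; simp [Matrix.mul_assoc]
  have key := trace_gram_ineq (P := (2 : ℝ) • D) (by simp [hDt]) hQpsd hY
  have hsub : Q - (2 : ℝ) • D + (2 : ℝ) • (Y₁ + Y₂) = (2 : ℝ) • Dh := by rw [hQ]; abel
  rw [hsub] at key
  have hlowD : τ * Q.trace ≤ (D * Q).trace := by
    have h1 : (D - τ • 1).PosSemidef := by
      have h := hlow.conjTranspose_mul_mul_same T
      rw [Matrix.conjTranspose_eq_transpose_of_trivial] at h
      have e : Tᵀ * (Oᵀ * O - τ • 1) * T = D - τ • 1 := by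
        rw [Matrix.mul_sub, Matrix.sub_mul, ← hD]
        simp [hTT]
      rwa [e] at h
    have h2 := trace_mul_nonneg h1 hQpsd
    simp only [Matrix.sub_mul, Matrix.trace_sub, Matrix.smul_mul, one_mul, Matrix.trace_smul,
      smul_eq_mul] at h2
    linarith
  have hN : frobSq (Oh * Wh - O * W)
      = (Dh * Dh).trace + (D * D).trace - 2 * (Y₁ * Y₂ᵀ).trace := by
    rw [frobSq_eq_trace]
    have a1 : ((Oh * Wh)ᵀ * (Oh * Wh)).trace = (Dh * Dh).trace := by
      nth_rewrite 2 [hDh]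
      rw [hbh, hDh, Matrix.transpose_mul, Matrix.mul_assoc, Matrix.trace_mul_comm]
      simp only [Matrix.mul_assoc]
    have a2 : ((O * W)ᵀ * (O * W)).trace = (D * D).trace := by
      have : D * D = Tᵀ * ((Oᵀ * O) * (W * Wᵀ)) * T := by
        rw [← hb, hD]
        calc _ = Tᵀ * (Oᵀ * O) * (T * Tᵀ) * (Oᵀ * O) * T := by simp only [Matrix.mul_assoc]
          _ = _ := by rw [hTT', mul_one]; simp only [Matrix.mul_assoc]
      rw [this, Matrix.trace_mul_comm (Tᵀ * _), ← Matrix.mul_assoc T, hTT', one_mul,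
        Matrix.transpose_mul, Matrix.mul_assoc, Matrix.trace_mul_comm]
      simp only [Matrix.mul_assoc]
    have a3 : ((Oh * Wh)ᵀ * (O * W)).trace = (Y₁ * Y₂ᵀ).trace := by
      have : Y₁ * Y₂ᵀ = Ohᵀ * O * (W * Whᵀ) := by
        rw [hY₁, hY₂, Matrix.transpose_mul, Matrix.transpose_mul, Matrix.transpose_transpose]
        calc _ = Ohᵀ * O * (T * Tᵀ) * (W * Whᵀ) := by simp only [Matrix.mul_assoc]
          _ = _ := by rw [hTT', mul_one]
      rw [this, Matrix.transpose_mul, Matrix.mul_assoc, Matrix.trace_mul_comm]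
      simp only [Matrix.mul_assoc]
    have a4 : ((O * W)ᵀ * (Oh * Wh)).trace = (Y₁ * Y₂ᵀ).trace := by
      rw [← a3, ← Matrix.trace_transpose, Matrix.transpose_mul, Matrix.transpose_transpose]
    rw [Matrix.transpose_sub, Matrix.sub_mul, Matrix.mul_sub, Matrix.mul_sub, Matrix.trace_sub,
      Matrix.trace_sub, Matrix.trace_sub, a1, a2, a3, a4]
    ring
  -- The defect is the squared Frobenius norm of Y₁ − Y₂; the symmetry of Y₁ + Y₂ is used here.
  have hYY : 4 * (Y₁ * Y₂ᵀ).trace ≤ ((Y₁ + Y₂) * (Y₁ + Y₂)).trace := by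
    have h1 := frobSq_nonneg (Y₁ - Y₂)ᵀ
    rw [frobSq_eq_trace, Matrix.transpose_transpose] at h1
    have h2 : ((Y₁ + Y₂) * (Y₁ + Y₂)).trace = ((Y₁ + Y₂) * (Y₁ + Y₂)ᵀ).trace := by rw [hYt]
    have h3 : (Y₂ * Y₁ᵀ).trace = (Y₁ * Y₂ᵀ).trace := by
      rw [← Matrix.trace_transpose, Matrix.transpose_mul, Matrix.transpose_transpose]
    rw [h2]
    simp only [Matrix.transpose_add, Matrix.transpose_sub, Matrix.mul_add, Matrix.add_mul,
      Matrix.mul_sub, Matrix.sub_mul, Matrix.trace_add, Matrix.trace_sub, h3] at h1 ⊢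
    linarith
  simp only [Matrix.smul_mul, Matrix.mul_smul, Matrix.trace_smul, smul_eq_mul] at key
  have hfin : 8 / 5 * τ * Q.trace ≤ 4 * frobSq (Oh * Wh - O * W) := by
    rw [hN]; nlinarith
  rw [← hQtr, div_div, div_mul_eq_mul_div, le_div_iff₀ (by positivity)]
  nlinarith

end Procrustes

/-! ### Rank truncation and singular values -/

section Truncation

variable {ι κ : Type*} [Fintype ι] [Fintype κ] [DecidableEq ι] [DecidableEq κ]

theorem exists_ne_zero_map_eq_zero {E G : Type*} [AddCommGroup E] [Module ℝ E] [AddCommGroup G]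
    [Module ℝ G] [FiniteDimensional ℝ E] (g : E →ₗ[ℝ] G)
    (h : Module.finrank ℝ (LinearMap.range g) < Module.finrank ℝ E) : ∃ x, x ≠ 0 ∧ g x = 0 := by
  by_contra hcon
  push Not at hcon
  have hker : LinearMap.ker g = ⊥ := by
    rw [LinearMap.ker_eq_bot']
    intro x hx
    by_contra hx0
    exact hcon x hx0 hx
  have := LinearMap.finrank_range_of_inj (LinearMap.ker_eq_bot.1 hker)
  omega

theorem toEuclideanLin_diagonal_apply {n : ℕ} (d : Fin n → ℝ) (x : Vec n) (i : Fin n) :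
    Matrix.toEuclideanLin (Matrix.diagonal d) x i = d i * x i := by
  simp [Matrix.toLpLin_apply, Matrix.mulVec_diagonal]

/-- Eckart–Young in the spectral norm. The truncation error is at most the first discarded singular
value, and a unit vector in the span of the leading r + 1 right singular vectors that X kills shows
that no matrix of rank r does better. On exact data it forces the truncation to change nothing. -/
theorem norm_sub_rankTruncation_le {r : ℕ} {Xh Nh X : Matrix ι κ ℝ}
    (h : IsRankTruncation r Xh Nh) (hX : X.rank ≤ r) : ‖Xh - Nh‖ ≤ ‖Xh - X‖ := by
  obtain ⟨k, U, d, V, hs, rfl⟩ := h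
  have hsub : Xh - U * Matrix.diagonal (fun j : Fin (r + k) => if (j : ℕ) < r then d j else 0) * Vᵀ
      = U * Matrix.diagonal (fun j : Fin (r + k) => if (j : ℕ) < r then 0 else d j) * Vᵀ := by
    nth_rewrite 1 [hs.eq]
    rw [← Matrix.sub_mul, ← Matrix.mul_sub, Matrix.diagonal_sub]
    congr 3
    ext j
    split_ifs <;> simp
  rw [hsub]
  -- For k = 0 there is no discarded singular value.
  rcases Nat.eq_zero_or_pos k with hk | hk
  · subst hk
    have : (fun j : Fin (r + 0) => if (j : ℕ) < r then 0 else d j) = 0 := by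
      ext j
      simp [show (j : ℕ) < r from j.2]
    rw [this]
    simp
  have hj : r < r + k := by omega
  have hU : ‖U‖ ≤ 1 := norm_le_one_of_transpose_mul_self hs.left
  have hV : ‖Vᵀ‖ ≤ 1 := by
    rw [norm_transpose]
    exact norm_le_one_of_transpose_mul_self hs.right
  have hd : ‖Matrix.diagonal (fun j : Fin (r + k) => if (j : ℕ) < r then 0 else d j)‖
      ≤ d ⟨r, hj⟩ := by
    rw [Matrix.l2_opNorm_diagonal, pi_norm_le_iff_of_nonneg (hs.nonneg _)]
    intro j
    by_cases hjr : (j : ℕ) < r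
    · simp [hjr, hs.nonneg]
    · simp only [hjr, if_false, Real.norm_eq_abs, abs_of_nonneg (hs.nonneg j)]
      exact hs.anti (Fin.mk_le_of_le_val (by omega))
  have h1 : ‖U * Matrix.diagonal (fun j : Fin (r + k) => if (j : ℕ) < r then 0 else d j) * Vᵀ‖
      ≤ d ⟨r, hj⟩ := by
    have h0 := hs.nonneg ⟨r, hj⟩
    calc _ ≤ ‖U‖ * ‖Matrix.diagonal (fun j : Fin (r + k) => if (j : ℕ) < r then 0 else d j)‖
          * ‖Vᵀ‖ := (Matrix.l2_opNorm_mul _ _).trans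
            (mul_le_mul_of_nonneg_right (Matrix.l2_opNorm_mul _ _) (norm_nonneg _))
      _ ≤ 1 * d ⟨r, hj⟩ * 1 := by gcongr
      _ = _ := by ring
  refine h1.trans ?_
  -- a vector in the span of the first `r + 1` right singular vectors that `X` kills
  let E : Matrix (Fin (r + k)) (Fin (r + 1)) ℝ :=
    (1 : Matrix (Fin (r + k)) (Fin (r + k)) ℝ).submatrix id (Fin.castLE (by omega))
  have hinj : Function.Injective (Fin.castLE (show r + 1 ≤ r + k by omega)) :=
    Fin.castLE_injective _
  have hEE : Eᵀ * E = 1 := by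
    ext a b
    simp [E, Matrix.mul_apply, Matrix.one_apply, hinj.eq_iff]
  have hrk : Module.finrank ℝ (LinearMap.range (Matrix.toEuclideanLin (X * (V * E))))
      < Module.finrank ℝ (Vec (r + 1)) := by
    have h2 : (X * (V * E)).rank ≤ r := (Matrix.rank_mul_le_left _ _).trans hX
    rw [Matrix.rank_eq_finrank_range_toLin (X * (V * E)) (EuclideanSpace.basisFun ι ℝ).toBasis
      (EuclideanSpace.basisFun (Fin (r + 1)) ℝ).toBasis] at h2
    rw [Matrix.toEuclideanLin_eq_toLin_orthonormal]
    simp only [finrank_euclideanSpace, Fintype.card_fin]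
    omega
  obtain ⟨c, hc0, hc⟩ := exists_ne_zero_map_eq_zero _ hrk
  rw [toEuclideanLin_mul_apply] at hc
  set x := Matrix.toEuclideanLin (V * E) c with hx
  have hxn : ‖x‖ = ‖c‖ := by
    refine norm_toEuclideanLin_of_transpose_mul_self ?_ c
    rw [Matrix.transpose_mul, Matrix.mul_assoc, ← Matrix.mul_assoc Vᵀ, hs.right,
      Matrix.one_mul, hEE]
  set b := Matrix.toEuclideanLin E c with hb
  have hbn : ‖b‖ = ‖c‖ := norm_toEuclideanLin_of_transpose_mul_self hEE c
  have hb0 : ∀ j : Fin (r + k), r < (j : ℕ) → b j = 0 := by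
    intro j hj'
    simp only [hb, E, Matrix.toLpLin_apply, Matrix.mulVec, dotProduct]
    refine Finset.sum_eq_zero fun a _ => ?_
    have : j ≠ Fin.castLE (show r + 1 ≤ r + k by omega) a := by
      intro he
      have : (j : ℕ) = a := by rw [he]; rfl
      have := a.2
      omega
    simp [this]
  have hXhx : Matrix.toEuclideanLin Xh x
      = Matrix.toEuclideanLin U (Matrix.toEuclideanLin (Matrix.diagonal d) b) := by
    rw [hx, hb, ← toEuclideanLin_mul_apply, ← toEuclideanLin_mul_apply,
      ← toEuclideanLin_mul_apply, hs.eq]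
    congr 2
    simp only [Matrix.mul_assoc]
    rw [← Matrix.mul_assoc Vᵀ, hs.right, Matrix.one_mul]
  have hlow : d ⟨r, hj⟩ * ‖c‖ ≤ ‖Matrix.toEuclideanLin Xh x‖ := by
    rw [hXhx, norm_toEuclideanLin_of_transpose_mul_self hs.left, ← hbn]
    refine le_of_sq_le_sq ?_ (norm_nonneg _)
    rw [mul_pow, EuclideanSpace.norm_sq_eq, EuclideanSpace.norm_sq_eq, Finset.mul_sum]
    refine Finset.sum_le_sum fun j _ => ?_
    rw [toEuclideanLin_diagonal_apply, norm_mul, mul_pow]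
    by_cases hjr : r < (j : ℕ)
    · simp [hb0 j hjr]
    · have h3 : d ⟨r, hj⟩ ≤ d j := hs.anti (Fin.le_def.2 (by simpa using hjr))
      have := hs.nonneg ⟨r, hj⟩
      rw [Real.norm_eq_abs (d j), sq_abs]
      gcongr
  have hup : ‖Matrix.toEuclideanLin Xh x‖ ≤ ‖Xh - X‖ * ‖c‖ := by
    have := norm_toEuclideanLin_le (Xh - X) x
    rwa [map_sub, LinearMap.sub_apply, hc, sub_zero, hxn] at this
  have hcpos : 0 < ‖c‖ := norm_pos_iff.2 hc0
  exact le_of_mul_le_mul_right (hlow.trans hup) hcpos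

end Truncation

section SingularValues

variable {E F G : Type*} [NormedAddCommGroup E] [InnerProductSpace ℝ E] [FiniteDimensional ℝ E]
  [NormedAddCommGroup F] [InnerProductSpace ℝ F] [FiniteDimensional ℝ F]
  [AddCommGroup G] [Module ℝ G]

/-- Upper half of the Courant–Fischer principle: the kernel of g has codimension at most i, so it
meets the span of the leading i + 1 right singular vectors. Singular values are numbered from 0
here, while `sigma` numbers them from 1. -/
theorem singularValues_le_of_map_eq_zero (f : E →ₗ[ℝ] F) (g : E →ₗ[ℝ] G) {i : ℕ} {c : ℝ}
    (hc : 0 ≤ c) (hg : Module.finrank ℝ (LinearMap.range g) ≤ i)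
    (h : ∀ x, g x = 0 → ‖f x‖ ≤ c * ‖x‖) : f.singularValues i ≤ c := by
  by_cases hi : Module.finrank ℝ E ≤ i
  · rw [LinearMap.singularValues_of_finrank_le f hi]
    exact hc
  push Not at hi
  have hsq := f.sq_singularValues_of_lt rfl hi
  set hsym := f.isSymmetric_adjoint_comp_self
  let b := hsym.eigenvectorBasis rfl
  let e : (Fin (i + 1) → ℝ) →ₗ[ℝ] E :=
    Fintype.linearCombination ℝ (fun j : Fin (i + 1) => b (Fin.castLE (by omega) j))
  have he : ∀ a, e a = ∑ j, a j • b (Fin.castLE (by omega) j) := fun a => by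
    simp [e, Fintype.linearCombination_apply]
  have hrk : Module.finrank ℝ (LinearMap.range (g ∘ₗ e)) < Module.finrank ℝ (Fin (i + 1) → ℝ) := by
    have h1 : LinearMap.range (g ∘ₗ e) ≤ LinearMap.range g := LinearMap.range_comp_le_range e g
    have := Submodule.finrank_mono h1
    simp only [Module.finrank_fintype_fun_eq_card, Fintype.card_fin]
    omega
  obtain ⟨a, ha0, ha⟩ := exists_ne_zero_map_eq_zero _ hrk
  have hinj : Function.Injective (Fin.castLE (show i + 1 ≤ Module.finrank ℝ E by omega)) :=
    Fin.castLE_injective _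
  have horth : Orthonormal ℝ (fun j : Fin (i + 1) => b (Fin.castLE (by omega) j)) :=
    b.orthonormal.comp _ hinj
  have hn : ‖e a‖ ^ 2 = ∑ j, a j ^ 2 := by
    rw [← real_inner_self_eq_norm_sq, he, horth.inner_sum]
    simp [sq]
  have hfn : f.singularValues i ^ 2 * ∑ j, a j ^ 2 ≤ ‖f (e a)‖ ^ 2 := by
    have h1 : ‖f (e a)‖ ^ 2 = inner ℝ (e a) ((f.adjoint ∘ₗ f) (e a)) := by
      rw [LinearMap.comp_apply, LinearMap.adjoint_inner_right, real_inner_self_eq_norm_sq]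
    have h2 : (f.adjoint ∘ₗ f) (e a)
        = ∑ j, (hsym.eigenvalues rfl (Fin.castLE (by omega) j) * a j) •
            b (Fin.castLE (by omega) j) := by
      rw [he, map_sum]
      refine Finset.sum_congr rfl fun j _ => ?_
      rw [map_smul, hsym.apply_eigenvectorBasis rfl]
      simp [b, smul_smul, mul_comm]
    rw [h1, h2, he, horth.inner_sum, hsq, Finset.mul_sum]
    refine Finset.sum_le_sum fun j _ => ?_
    have h3 : hsym.eigenvalues rfl ⟨i, hi⟩ ≤ hsym.eigenvalues rfl (Fin.castLE (by omega) j) :=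
      hsym.eigenvalues_antitone rfl (Fin.le_def.2 (by simpa using Nat.lt_succ_iff.1 j.2))
    simp only [conj_trivial]
    nlinarith [sq_nonneg (a j)]
  have hpos : 0 < ∑ j, a j ^ 2 := by
    obtain ⟨j, hj⟩ := Function.ne_iff.1 ha0
    exact Finset.sum_pos' (fun _ _ => sq_nonneg _)
      ⟨j, Finset.mem_univ _, by have : a j ≠ 0 := hj; positivity⟩
  have hup := h (e a) ha
  have hup2 : ‖f (e a)‖ ^ 2 ≤ c ^ 2 * ∑ j, a j ^ 2 := by
    rw [← hn, ← mul_pow]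
    gcongr
  exact le_of_sq_le_sq (le_of_mul_le_mul_right (hfn.trans hup2) hpos) hc

theorem sigma_le_of_map_eq_zero {ι κ : Type*} [Fintype ι] [Fintype κ] [DecidableEq κ]
    (X : Matrix ι κ ℝ) (g : EuclideanSpace ℝ κ →ₗ[ℝ] G) {k : ℕ} {c : ℝ}
    (hc : 0 ≤ c) (hg : Module.finrank ℝ (LinearMap.range g) < k)
    (h : ∀ x, g x = 0 → ‖Matrix.toEuclideanLin X x‖ ≤ c * ‖x‖) : sigma k X ≤ c :=
  singularValues_le_of_map_eq_zero _ g hc (by omega) h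

theorem sigma_le_norm {ι κ : Type*} [Fintype ι] [Fintype κ] [DecidableEq κ]
    (X : Matrix ι κ ℝ) {k : ℕ} (hk : 0 < k) : sigma k X ≤ ‖X‖ :=
  sigma_le_of_map_eq_zero X (0 : EuclideanSpace ℝ κ →ₗ[ℝ] ℝ) (norm_nonneg _)
    (by rw [LinearMap.range_zero]; simpa using hk) fun x _ => norm_toEuclideanLin_le X x

end SingularValues

/-! ### Quadratic forms of symmetric matrices -/

section Quadratic

variable {n : ℕ}

theorem inner_toEuclideanLin_eq_sum {D : Matrix (Fin n) (Fin n) ℝ} (hD : D.IsHermitian)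
    (v : Vec n) : inner ℝ v (Matrix.toEuclideanLin D v)
      = ∑ i, hD.eigenvalues i * inner ℝ (hD.eigenvectorBasis i) v ^ 2 := by
  rw [← hD.eigenvectorBasis.sum_inner_mul_inner]
  refine Finset.sum_congr rfl fun i _ => ?_
  have h2 : Matrix.toEuclideanLin D (hD.eigenvectorBasis i)
      = hD.eigenvalues i • hD.eigenvectorBasis i := by
    ext j
    simp [Matrix.toLpLin_apply, hD.mulVec_eigenvectorBasis]
  have h3 : inner ℝ (hD.eigenvectorBasis i) (Matrix.toEuclideanLin D v)
      = hD.eigenvalues i * inner ℝ (hD.eigenvectorBasis i) v := by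
    have h4 := inner_toEuclideanLin D (hD.eigenvectorBasis i) v
    have h5 : Dᵀ = D := by simpa using hD.eq
    rw [h5, h2, real_inner_smul_left] at h4
    exact h4.symm
  rw [h3, real_inner_comm]
  ring

theorem sum_inner_eigenvectorBasis_sq {D : Matrix (Fin n) (Fin n) ℝ} (hD : D.IsHermitian)
    (v : Vec n) : ∑ i, inner ℝ (hD.eigenvectorBasis i) v ^ 2 = ‖v‖ ^ 2 := by
  have h := hD.eigenvectorBasis.sum_sq_norm_inner_right v
  simpa using h

/-- Bounds for the eigenvalues bound the quadratic form, and the lower bound is attained. -/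
theorem quadratic_bounds_of_eigen {D : Matrix (Fin n) (Fin n) ℝ} (hD : Dᵀ = D) (hn : 0 < n)
    {lo hi : ℝ} (h : ∀ (τ : ℝ) (q : Vec n), ‖q‖ = 1 → Matrix.toEuclideanLin D q = τ • q →
      lo ≤ τ ∧ τ ≤ hi) :
    (∀ v : Vec n, lo * ‖v‖ ^ 2 ≤ inner ℝ v (Matrix.toEuclideanLin D v)) ∧
    (∀ v : Vec n, inner ℝ v (Matrix.toEuclideanLin D v) ≤ hi * ‖v‖ ^ 2) ∧
    ∃ (τ : ℝ) (q : Vec n), ‖q‖ = 1 ∧ Matrix.toEuclideanLin D q = τ • q ∧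
      ∀ v : Vec n, τ * ‖v‖ ^ 2 ≤ inner ℝ v (Matrix.toEuclideanLin D v) := by
  have hH : D.IsHermitian := by
    rw [Matrix.IsHermitian, Matrix.conjTranspose_eq_transpose_of_trivial, hD]
  have heig : ∀ i, Matrix.toEuclideanLin D (hH.eigenvectorBasis i)
      = hH.eigenvalues i • hH.eigenvectorBasis i := by
    intro i
    ext j
    simp [Matrix.toLpLin_apply, hH.mulVec_eigenvectorBasis]
  have hb : ∀ i, lo ≤ hH.eigenvalues i ∧ hH.eigenvalues i ≤ hi := fun i =>
    h _ _ (hH.eigenvectorBasis.norm_eq_one i) (heig i)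
  have hlow : ∀ c : ℝ, (∀ i, c ≤ hH.eigenvalues i) →
      ∀ v : Vec n, c * ‖v‖ ^ 2 ≤ inner ℝ v (Matrix.toEuclideanLin D v) := by
    intro c hc v
    rw [inner_toEuclideanLin_eq_sum hH, ← sum_inner_eigenvectorBasis_sq hH, Finset.mul_sum]
    exact Finset.sum_le_sum fun i _ => mul_le_mul_of_nonneg_right (hc i) (sq_nonneg _)
  refine ⟨hlow lo fun i => (hb i).1, fun v => ?_, ?_⟩
  · rw [inner_toEuclideanLin_eq_sum hH, ← sum_inner_eigenvectorBasis_sq hH, Finset.mul_sum]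
    exact Finset.sum_le_sum fun i _ => mul_le_mul_of_nonneg_right (hb i).2 (sq_nonneg _)
  · have : Nonempty (Fin n) := ⟨⟨0, hn⟩⟩
    obtain ⟨i, hi'⟩ := Finite.exists_min hH.eigenvalues
    exact ⟨_, _, hH.eigenvectorBasis.norm_eq_one i, heig i, hlow _ hi'⟩

theorem posSemidef_of_inner_nonneg {D : Matrix (Fin n) (Fin n) ℝ} (hD : Dᵀ = D)
    (h : ∀ v : Vec n, 0 ≤ inner ℝ v (Matrix.toEuclideanLin D v)) : D.PosSemidef := by
  refine Matrix.PosSemidef.of_dotProduct_mulVec_nonneg ?_ fun v => ?_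
  · rw [Matrix.IsHermitian, Matrix.conjTranspose_eq_transpose_of_trivial, hD]
  · have := h (WithLp.toLp 2 v)
    simpa [EuclideanSpace.inner_eq_star_dotProduct, Matrix.toLpLin_apply, dotProduct_comm] using this

theorem norm_sq_toEuclideanLin {ι : Type*} [Fintype ι] [DecidableEq ι] (X : Matrix ι (Fin n) ℝ)
    (v : Vec n) :
    ‖Matrix.toEuclideanLin X v‖ ^ 2 = inner ℝ v (Matrix.toEuclideanLin (Xᵀ * X) v) := by
  rw [← real_inner_self_eq_norm_sq, inner_toEuclideanLin, toEuclideanLin_mul_apply]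

theorem isUnit_det_of_injective {X : Matrix (Fin n) (Fin n) ℝ}
    (h : ∀ v : Vec n, Matrix.toEuclideanLin X v = 0 → v = 0) : IsUnit X.det := by
  rw [isUnit_iff_ne_zero]
  intro h0
  obtain ⟨v, hv, hXv⟩ := Matrix.exists_mulVec_eq_zero_iff.2 h0
  refine hv ?_
  have := h (WithLp.toLp 2 v) (by ext i; simp [Matrix.toLpLin_apply, hXv])
  simpa using this

theorem isUnit_det_transpose_mul_self {ι : Type*} [Fintype ι] [DecidableEq ι]
    {X : Matrix ι (Fin n) ℝ} {c : ℝ} (hc : 0 < c)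
    (h : ∀ v : Vec n, c * ‖v‖ ≤ ‖Matrix.toEuclideanLin X v‖) : IsUnit (Xᵀ * X).det := by
  refine isUnit_det_of_injective fun v hv => ?_
  have h1 := norm_sq_toEuclideanLin X v
  rw [hv, inner_zero_right, sq_eq_zero_iff] at h1
  have h2 := h v
  rw [h1] at h2
  have h3 : ‖v‖ ≤ 0 := by
    by_contra hcon
    push Not at hcon
    have := mul_pos hc hcon
    linarith
  exact norm_le_zero_iff.1 h3

end Quadratic

/-! ### Balancing coordinates of a factorization -/

section Balancing

variable {n : ℕ} {ι κ : Type*} [Fintype ι] [Fintype κ] [DecidableEq ι] [DecidableEq κ]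

/-- `G` makes the two factors of `O * W` balanced. -/
structure IsBalancing (O : Matrix ι (Fin n) ℝ) (W : Matrix (Fin n) κ ℝ)
    (G : Matrix (Fin n) (Fin n) ℝ) : Prop where
  unit : IsUnit G.det
  balanced : (O * G)ᵀ * (O * G) = (G⁻¹ * W) * (G⁻¹ * W)ᵀ

/-- Two-sided bounds for the two factors. -/
structure FactorBounds (x₀ x₁ y₀ y₁ : ℝ) (O : Matrix ι (Fin n) ℝ) (W : Matrix (Fin n) κ ℝ) :
    Prop where
  left_ge : ∀ v : Vec n, x₀ * ‖v‖ ≤ ‖Matrix.toEuclideanLin O v‖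
  left_le : ∀ v : Vec n, ‖Matrix.toEuclideanLin O v‖ ≤ x₁ * ‖v‖
  right_ge : ∀ v : Vec n, y₀ * ‖v‖ ≤ ‖Matrix.toEuclideanLin Wᵀ v‖
  right_le : ∀ v : Vec n, ‖Matrix.toEuclideanLin Wᵀ v‖ ≤ y₁ * ‖v‖

variable {x₀ x₁ y₀ y₁ : ℝ} {O : Matrix ι (Fin n) ℝ} {W : Matrix (Fin n) κ ℝ}

theorem FactorBounds.isUnit_left (h : FactorBounds x₀ x₁ y₀ y₁ O W) (hx : 0 < x₀) :
    IsUnit (Oᵀ * O).det :=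
  isUnit_det_transpose_mul_self hx h.left_ge

theorem FactorBounds.isUnit_right (h : FactorBounds x₀ x₁ y₀ y₁ O W) (hy : 0 < y₀) :
    IsUnit (W * Wᵀ).det := by
  simpa using isUnit_det_transpose_mul_self hy h.right_ge

/-- Two factorizations through `ℝ^n` of the same matrix differ by a change of coordinates. -/
theorem exists_coordinates_of_mul_eq (hX : IsUnit (Oᵀ * O).det) (hY : IsUnit (W * Wᵀ).det)
    {O' : Matrix ι (Fin n) ℝ} {W' : Matrix (Fin n) κ ℝ} (h : O' * W' = O * W) :
    ∃ G : Matrix (Fin n) (Fin n) ℝ, IsUnit G.det ∧ O' = O * G ∧ W' = G⁻¹ * W := by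
  set G := (Oᵀ * O)⁻¹ * (Oᵀ * O') with hG
  set G' := W' * Wᵀ * (W * Wᵀ)⁻¹ with hG'
  have h1 : O' * G' = O := by
    rw [hG', ← Matrix.mul_assoc, ← Matrix.mul_assoc, h, Matrix.mul_assoc O, Matrix.mul_assoc O,
      Matrix.mul_nonsing_inv _ hY, Matrix.mul_one]
  have h2 : G * W' = W := by
    rw [hG, Matrix.mul_assoc, Matrix.mul_assoc, h, ← Matrix.mul_assoc Oᵀ, ← Matrix.mul_assoc,
      Matrix.nonsing_inv_mul _ hX, Matrix.one_mul]
  have h3 : G * G' = 1 := by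
    rw [hG, Matrix.mul_assoc, Matrix.mul_assoc, h1, Matrix.nonsing_inv_mul _ hX]
  have h4 : G' * G = 1 := mul_eq_one_comm.1 h3
  have hinv : G⁻¹ = G' := Matrix.inv_eq_right_inv h3
  refine ⟨G, Matrix.isUnit_det_of_right_inverse h3, ?_, ?_⟩
  · rw [← h1, Matrix.mul_assoc, h4, Matrix.mul_one]
  · rw [hinv, ← h2, ← Matrix.mul_assoc, h4, Matrix.one_mul]

/-- With R² = OᵀO and S⁴ = R WWᵀ R the choice G = R⁻¹S turns both Gram matrices into S². -/
theorem exists_isBalancing (hX : IsUnit (Oᵀ * O).det) (hY : IsUnit (W * Wᵀ).det) :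
    ∃ G : Matrix (Fin n) (Fin n) ℝ, IsBalancing O W G := by
  open scoped MatrixOrder in
  -- symmetric square roots of positive definite matrices
  have hroot : ∀ X : Matrix (Fin n) (Fin n) ℝ, X.PosSemidef → IsUnit X.det →
      ∃ S : Matrix (Fin n) (Fin n) ℝ, S.PosSemidef ∧ Sᵀ = S ∧ IsUnit S.det ∧ S * S = X := by
    intro X hX hdet
    have hP : (CFC.sqrt X).PosSemidef := Matrix.nonneg_iff_posSemidef.1 (CFC.sqrt_nonneg _)
    have hPP : CFC.sqrt X * CFC.sqrt X = X := CFC.sqrt_mul_sqrt_self _ hX.nonneg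
    refine ⟨CFC.sqrt X, hP, by simpa using hP.isHermitian.eq, ?_, hPP⟩
    rw [← hPP, Matrix.det_mul] at hdet
    exact isUnit_of_mul_isUnit_left hdet
  have hXp : (Oᵀ * O).PosSemidef := by
    simpa using Matrix.posSemidef_conjTranspose_mul_self O
  have hYp : (W * Wᵀ).PosSemidef := by
    simpa using Matrix.posSemidef_self_mul_conjTranspose W
  obtain ⟨R, hRp, hRt, hRu, hRR⟩ := hroot _ hXp hX
  have hMp : (R * (W * Wᵀ) * R).PosSemidef := by
    have := hYp.mul_mul_conjTranspose_same R
    rwa [Matrix.conjTranspose_eq_transpose_of_trivial, hRt] at this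
  obtain ⟨Q, hQp, hQt, hQu, hQQ⟩ := hroot _ hMp (by
    rw [Matrix.det_mul, Matrix.det_mul]
    exact (hRu.mul hY).mul hRu)
  obtain ⟨S, hSp, hSt, hSu, hSS⟩ := hroot _ hQp hQu
  have hRiu : IsUnit (R⁻¹).det := by
    rw [Matrix.det_nonsing_inv]; exact hRu.ringInverse
  refine ⟨R⁻¹ * S, by rw [Matrix.det_mul]; exact hRiu.mul hSu, ?_⟩
  have hinv : (R⁻¹ * S)⁻¹ = S⁻¹ * R := by
    rw [Matrix.mul_inv_rev, Matrix.nonsing_inv_nonsing_inv _ hRu]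
  have e1 : (O * (R⁻¹ * S))ᵀ * (O * (R⁻¹ * S)) = Q := by
    calc (O * (R⁻¹ * S))ᵀ * (O * (R⁻¹ * S)) = S * R⁻¹ * (Oᵀ * O) * R⁻¹ * S := by
          simp only [Matrix.transpose_mul, Matrix.transpose_nonsing_inv, hRt, hSt,
            Matrix.mul_assoc]
      _ = S * ((R⁻¹ * R) * (R * R⁻¹)) * S := by rw [← hRR]; simp only [Matrix.mul_assoc]
      _ = Q := by
          rw [Matrix.nonsing_inv_mul _ hRu, Matrix.mul_nonsing_inv _ hRu, Matrix.mul_one,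
            Matrix.mul_one, hSS]
  have e2 : ((R⁻¹ * S)⁻¹ * W) * ((R⁻¹ * S)⁻¹ * W)ᵀ = Q := by
    calc ((R⁻¹ * S)⁻¹ * W) * ((R⁻¹ * S)⁻¹ * W)ᵀ = S⁻¹ * (R * (W * Wᵀ) * R) * S⁻¹ := by
          rw [hinv]
          simp only [Matrix.transpose_mul, Matrix.transpose_nonsing_inv, hRt, hSt,
            Matrix.mul_assoc]
      _ = (S⁻¹ * S) * S * S * (S * S⁻¹) := by
          rw [← hQQ, ← hSS]; simp only [Matrix.mul_assoc]
      _ = Q := by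
          rw [Matrix.nonsing_inv_mul _ hSu, Matrix.mul_nonsing_inv _ hSu, Matrix.mul_one,
            Matrix.one_mul, hSS]
  rw [e1, e2]

/-- Put a = Gq and b = G⁻ᵀq. Then ⟨a, b⟩ = 1 and ‖Oa‖² = ‖Wᵀb‖² = τ, so 1 ≤ ‖a‖‖b‖ gives the lower
bound. For the upper one, OᵀOa = τb gives √τ‖b‖ ≤ x₁, and √τ ≤ y₁‖b‖. The size of G never enters. -/
theorem IsBalancing.eigen_bounds (h : FactorBounds x₀ x₁ y₀ y₁ O W) (hx : 0 < x₀) (hy : 0 < y₀)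
    {G : Matrix (Fin n) (Fin n) ℝ} (hG : IsBalancing O W G) {τ : ℝ} {q : Vec n} (hq : ‖q‖ = 1)
    (hτ : Matrix.toEuclideanLin ((O * G)ᵀ * (O * G)) q = τ • q) :
    x₀ * y₀ ≤ τ ∧ τ ≤ x₁ * y₁ := by
  set a := Matrix.toEuclideanLin G q with ha
  set b := Matrix.toEuclideanLin (G⁻¹)ᵀ q with hb
  have hab : inner ℝ a b = (1 : ℝ) := by
    rw [ha, hb, inner_toEuclideanLin, ← toEuclideanLin_mul_apply, ← Matrix.transpose_mul,
      Matrix.nonsing_inv_mul _ hG.unit, Matrix.transpose_one, toEuclideanLin_one_apply,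
      real_inner_self_eq_norm_sq, hq, one_pow]
  have hqq : inner ℝ q (τ • q) = τ := by
    rw [real_inner_smul_right, real_inner_self_eq_norm_sq, hq]; ring
  have hOa : ‖Matrix.toEuclideanLin O a‖ ^ 2 = τ := by
    rw [ha, ← toEuclideanLin_mul_apply, norm_sq_toEuclideanLin, hτ, hqq]
  have hWb : ‖Matrix.toEuclideanLin Wᵀ b‖ ^ 2 = τ := by
    rw [hb, ← toEuclideanLin_mul_apply, ← Matrix.transpose_mul, norm_sq_toEuclideanLin,
      Matrix.transpose_transpose, ← hG.balanced, hτ, hqq]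
  have hτ0 : 0 ≤ τ := hOa ▸ sq_nonneg _
  have hsx : ‖Matrix.toEuclideanLin O a‖ = √τ := by
    rw [← hOa, Real.sqrt_sq (norm_nonneg _)]
  have hsy : ‖Matrix.toEuclideanLin Wᵀ b‖ = √τ := by
    rw [← hWb, Real.sqrt_sq (norm_nonneg _)]
  have h1 : x₀ * ‖a‖ ≤ √τ := hsx ▸ h.left_ge a
  have h2 : y₀ * ‖b‖ ≤ √τ := hsy ▸ h.right_ge b
  have h3 : √τ * √τ = τ := Real.mul_self_sqrt hτ0
  have h4 : (1 : ℝ) ≤ ‖a‖ * ‖b‖ := hab ▸ real_inner_le_norm a b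
  have hlow : x₀ * y₀ ≤ τ := by
    have := mul_le_mul h1 h2 (by positivity) (Real.sqrt_nonneg _)
    nlinarith [mul_pos hx hy]
  refine ⟨hlow, ?_⟩
  have hτpos : 0 < τ := lt_of_lt_of_le (mul_pos hx hy) hlow
  have h5 : τ * ‖b‖ ≤ x₁ * √τ := by
    have e : Matrix.toEuclideanLin Oᵀ (Matrix.toEuclideanLin O a) = τ • b := by
      have e1 := congrArg (Matrix.toEuclideanLin (G⁻¹)ᵀ) hτ
      rw [map_smul, ← hb, ← toEuclideanLin_mul_apply] at e1
      rw [← e1, ha, ← toEuclideanLin_mul_apply, ← toEuclideanLin_mul_apply,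
        Matrix.transpose_mul O G, Matrix.mul_assoc Gᵀ, ← Matrix.mul_assoc (G⁻¹)ᵀ,
        ← Matrix.transpose_mul, Matrix.mul_nonsing_inv _ hG.unit, Matrix.transpose_one,
        Matrix.one_mul, Matrix.mul_assoc]
    have e2 : ‖O‖ ≤ x₁ := by
      refine opNorm_le_of_forall _ ?_ h.left_le
      have := h.left_le q
      rw [hq, mul_one] at this
      exact (norm_nonneg _).trans this
    calc τ * ‖b‖ = ‖τ • b‖ := by rw [norm_smul, Real.norm_of_nonneg hτ0]
      _ ≤ ‖Oᵀ‖ * ‖Matrix.toEuclideanLin O a‖ := e ▸ norm_toEuclideanLin_le _ _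
      _ ≤ x₁ * √τ := by
          rw [norm_transpose, hsx]
          exact mul_le_mul_of_nonneg_right e2 (Real.sqrt_nonneg _)
  have h6 : √τ ≤ y₁ * ‖b‖ := hsy ▸ h.right_le b
  have hs : 0 < √τ := Real.sqrt_pos.2 hτpos
  have hb0 : 0 < ‖b‖ := by
    by_contra hcon
    have : ‖b‖ = 0 := le_antisymm (not_lt.1 hcon) (norm_nonneg _)
    rw [this, mul_zero] at h6
    linarith
  have hx1 : 0 ≤ x₁ := by
    by_contra hcon
    push Not at hcon
    nlinarith [mul_pos hτpos hb0, mul_pos hs (neg_pos.2 hcon)]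
  have h7 : √τ * ‖b‖ ≤ x₁ := by
    have : √τ * (√τ * ‖b‖) ≤ √τ * x₁ := by rw [← mul_assoc, h3]; linarith
    exact le_of_mul_le_mul_left this hs
  have hy1 : 0 ≤ y₁ := by
    by_contra hcon
    push Not at hcon
    nlinarith [mul_pos hb0 (neg_pos.2 hcon)]
  calc τ = √τ * √τ := h3.symm
    _ ≤ √τ * (y₁ * ‖b‖) := by gcongr
    _ = y₁ * (√τ * ‖b‖) := by ring
    _ ≤ y₁ * x₁ := by gcongr
    _ = x₁ * y₁ := mul_comm _ _

/-- Every balancing change of coordinates inherits bounds from the factor bounds alone. The smallest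
eigenvalue is returned with an eigenvector because `sigma_hankel_le` needs the direction in which it
is attained. -/
theorem IsBalancing.bounds (h : FactorBounds x₀ x₁ y₀ y₁ O W) (hx : 0 < x₀) (hy : 0 < y₀)
    (hn : 0 < n) {G : Matrix (Fin n) (Fin n) ℝ} (hG : IsBalancing O W G) :
    ‖O * G‖ ≤ √(x₁ * y₁) ∧ ‖G⁻¹ * W‖ ≤ √(x₁ * y₁) ∧ ‖G‖ ≤ √(x₁ * y₁) / x₀ ∧
    ‖G⁻¹‖ ≤ √(x₁ * y₁) / y₀ ∧
    ∃ (τ : ℝ) (q : Vec n), x₀ * y₀ ≤ τ ∧ τ ≤ x₁ * y₁ ∧ ‖q‖ = 1 ∧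
      Matrix.toEuclideanLin ((O * G)ᵀ * (O * G)) q = τ • q ∧
      ((O * G)ᵀ * (O * G) - τ • 1).PosSemidef := by
  set D := (O * G)ᵀ * (O * G) with hD
  have hDt : Dᵀ = D := by rw [hD, Matrix.transpose_mul, Matrix.transpose_transpose]
  obtain ⟨hlow, hup, τ, q, hq, hτ, hmin⟩ := quadratic_bounds_of_eigen hDt hn
    (lo := x₀ * y₀) (hi := x₁ * y₁) fun τ q hq hτ => hG.eigen_bounds h hx hy hq hτ
  have hτb := hG.eigen_bounds h hx hy hq hτ
  have hxy : 0 ≤ x₁ * y₁ := (mul_pos hx hy).le.trans (hτb.1.trans hτb.2)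
  have hOv : ∀ v : Vec n, ‖Matrix.toEuclideanLin (O * G) v‖ ≤ √(x₁ * y₁) * ‖v‖ := by
    intro v
    refine le_of_sq_le_sq ?_ (by positivity)
    rw [mul_pow, Real.sq_sqrt hxy, norm_sq_toEuclideanLin]
    exact hup v
  have hWv : ∀ v : Vec n, ‖Matrix.toEuclideanLin (G⁻¹ * W)ᵀ v‖ ≤ √(x₁ * y₁) * ‖v‖ := by
    intro v
    refine le_of_sq_le_sq ?_ (by positivity)
    rw [mul_pow, Real.sq_sqrt hxy, norm_sq_toEuclideanLin, Matrix.transpose_transpose,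
      ← hG.balanced]
    exact hup v
  refine ⟨opNorm_le_of_forall _ (Real.sqrt_nonneg _) hOv, ?_, ?_, ?_, τ, q, hτb.1, hτb.2, hq, hτ, ?_⟩
  · rw [← norm_transpose]
    exact opNorm_le_of_forall _ (Real.sqrt_nonneg _) hWv
  · refine opNorm_le_of_forall _ (by positivity) fun v => ?_
    have h1 := h.left_ge (Matrix.toEuclideanLin G v)
    rw [← toEuclideanLin_mul_apply] at h1
    rw [div_mul_eq_mul_div, le_div_iff₀ hx, mul_comm]
    exact h1.trans (hOv v)
  · rw [← norm_transpose]
    refine opNorm_le_of_forall _ (by positivity) fun v => ?_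
    have h1 := h.right_ge (Matrix.toEuclideanLin (G⁻¹)ᵀ v)
    rw [← toEuclideanLin_mul_apply, ← Matrix.transpose_mul] at h1
    rw [div_mul_eq_mul_div, le_div_iff₀ hy, mul_comm]
    exact h1.trans (hWv v)
  · refine posSemidef_of_inner_nonneg (by simp [hDt]) fun v => ?_
    have h1 := hmin v
    have h2 : Matrix.toEuclideanLin (D - τ • 1) v = Matrix.toEuclideanLin D v - τ • v := by
      rw [map_sub, map_smul, LinearMap.sub_apply, LinearMap.smul_apply, toEuclideanLin_one_apply]
    rw [h2, inner_sub_right, real_inner_smul_right, real_inner_self_eq_norm_sq]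
    linarith

end Balancing

variable {n m p : ℕ}

/-! ### Hankel matrices as products of observability and controllability blocks -/

section Blocks

/-- `Ā = A - F C`. -/
def filterMat (Θ : LinSys n m p) (L : Matrix (Fin n) (Fin m) ℝ) : Matrix (Fin n) (Fin n) ℝ :=
  Θ.A - Θ.A * L * Θ.C

/-- Block rows `C, CĀ, …, CĀ^{d-1}`. -/
def obsBlock (d : ℕ) (Θ : LinSys n m p) (L : Matrix (Fin n) (Fin m) ℝ) :
    Matrix (Fin d × Fin m) (Fin n) ℝ :=
  Matrix.of fun ia k => (Θ.C * filterMat Θ L ^ (ia.1 : ℕ)) ia.2 k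

/-- Block columns `F, ĀF, …, Ā^{d-1}F, B, ĀB, …, Ā^{d-1}B`. -/
def ctrBlock (d : ℕ) (Θ : LinSys n m p) (L : Matrix (Fin n) (Fin m) ℝ) :
    Matrix (Fin n) (BlockIdx d m p) ℝ :=
  Matrix.of fun k c => Sum.elim
    (fun jb : Fin d × Fin m => (filterMat Θ L ^ (jb.1 : ℕ) * (Θ.A * L)) k jb.2)
    (fun jb : Fin d × Fin p => (filterMat Θ L ^ (jb.1 : ℕ) * Θ.B) k jb.2) c

variable (Θ : LinSys n m p) (L : Matrix (Fin n) (Fin m) ℝ)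

theorem obsBlock_mul_apply {l : Type*} (d : ℕ) (X : Matrix (Fin n) l ℝ) (i : Fin d) (a : Fin m)
    (j : l) : (obsBlock d Θ L * X) (i, a) j = (Θ.C * filterMat Θ L ^ (i : ℕ) * X) a j := by
  simp [Matrix.mul_apply, obsBlock]

theorem mul_ctrBlock_apply_inl {l : Type*} (d : ℕ) (X : Matrix l (Fin n) ℝ) (i : l) (j : Fin d)
    (b : Fin m) : (X * ctrBlock d Θ L) i (Sum.inl (j, b))
      = (X * (filterMat Θ L ^ (j : ℕ) * (Θ.A * L))) i b := by
  rw [Matrix.mul_apply, Matrix.mul_apply]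
  rfl

theorem mul_ctrBlock_apply_inr {l : Type*} (d : ℕ) (X : Matrix l (Fin n) ℝ) (i : l) (j : Fin d)
    (b : Fin p) : (X * ctrBlock d Θ L) i (Sum.inr (j, b))
      = (X * (filterMat Θ L ^ (j : ℕ) * Θ.B)) i b := by
  rw [Matrix.mul_apply, Matrix.mul_apply]
  rfl

theorem obsBlock_mul_mul_ctrBlock_inl (d d' : ℕ) (X : Matrix (Fin n) (Fin n) ℝ) (i : Fin d)
    (a : Fin m) (j : Fin d') (b : Fin m) :
    (obsBlock d Θ L * X * ctrBlock d' Θ L) (i, a) (Sum.inl (j, b))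
      = (Θ.C * filterMat Θ L ^ (i : ℕ) * X * (filterMat Θ L ^ (j : ℕ) * (Θ.A * L))) a b := by
  rw [mul_ctrBlock_apply_inl, Matrix.mul_assoc, obsBlock_mul_apply, ← Matrix.mul_assoc]

theorem obsBlock_mul_mul_ctrBlock_inr (d d' : ℕ) (X : Matrix (Fin n) (Fin n) ℝ) (i : Fin d)
    (a : Fin m) (j : Fin d') (b : Fin p) :
    (obsBlock d Θ L * X * ctrBlock d' Θ L) (i, a) (Sum.inr (j, b))
      = (Θ.C * filterMat Θ L ^ (i : ℕ) * X * (filterMat Θ L ^ (j : ℕ) * Θ.B)) a b := by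
  rw [mul_ctrBlock_apply_inr, Matrix.mul_assoc, obsBlock_mul_apply, ← Matrix.mul_assoc]

/-- Block (i, j) is CĀ^{i+j}F or CĀ^{i+j}B, and the power splits between row and column. -/
theorem hankel_arxMatrix (d₁ d₂ : ℕ) :
    hankel d₁ d₂ (arxMatrix (d₁ + d₂ + 1) Θ L) = obsBlock d₁ Θ L * ctrBlock (d₂ + 1) Θ L := by
  rw [← Matrix.mul_one (obsBlock d₁ Θ L)]
  ext ⟨i, a⟩ (⟨j, b⟩ | ⟨j, b⟩)
  · rw [obsBlock_mul_mul_ctrBlock_inl]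
    simp only [hankel, arxMatrix, Matrix.of_apply, Sum.elim_inl, pow_add, Matrix.mul_assoc,
      Matrix.one_mul, filterMat]
  · rw [obsBlock_mul_mul_ctrBlock_inr]
    simp only [hankel, arxMatrix, Matrix.of_apply, Sum.elim_inr, pow_add, Matrix.mul_assoc,
      Matrix.one_mul, filterMat]

theorem hankelMinus_arxMatrix (d₁ d₂ : ℕ) :
    hankelMinus d₁ d₂ (arxMatrix (d₁ + d₂ + 1) Θ L) = obsBlock d₁ Θ L * ctrBlock d₂ Θ L := by
  rw [← Matrix.mul_one (obsBlock d₁ Θ L)]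
  ext ⟨i, a⟩ (⟨j, b⟩ | ⟨j, b⟩)
  · rw [obsBlock_mul_mul_ctrBlock_inl]
    simp only [hankelMinus, Matrix.submatrix_apply, Sum.map_inl, id, hankel, arxMatrix,
      Matrix.of_apply, Sum.elim_inl, pow_add, Matrix.mul_assoc, Matrix.one_mul, filterMat,
      Fin.val_castSucc]
  · rw [obsBlock_mul_mul_ctrBlock_inr]
    simp only [hankelMinus, Matrix.submatrix_apply, Sum.map_inr, id, hankel, arxMatrix,
      Matrix.of_apply, Sum.elim_inr, pow_add, Matrix.mul_assoc, Matrix.one_mul, filterMat,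
      Fin.val_castSucc]

theorem hankelPlus_arxMatrix (d₁ d₂ : ℕ) :
    hankelPlus d₁ d₂ (arxMatrix (d₁ + d₂ + 1) Θ L)
      = obsBlock d₁ Θ L * filterMat Θ L * ctrBlock d₂ Θ L := by
  ext ⟨i, a⟩ (⟨j, b⟩ | ⟨j, b⟩)
  · rw [obsBlock_mul_mul_ctrBlock_inl]
    simp only [hankelPlus, Matrix.submatrix_apply, Sum.map_inl, id, hankel, arxMatrix,
      Matrix.of_apply, Sum.elim_inl, pow_add, pow_succ', Matrix.mul_assoc, filterMat,
      Fin.val_succ]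
  · rw [obsBlock_mul_mul_ctrBlock_inr]
    simp only [hankelPlus, Matrix.submatrix_apply, Sum.map_inr, id, hankel, arxMatrix,
      Matrix.of_apply, Sum.elim_inr, pow_add, pow_succ', Matrix.mul_assoc, filterMat,
      Fin.val_succ]

theorem norm_sq_obsBlock (d : ℕ) (v : Vec n) :
    ‖Matrix.toEuclideanLin (obsBlock d Θ L) v‖ ^ 2
      = ∑ i : Fin d, ‖Matrix.toEuclideanLin (Θ.C * filterMat Θ L ^ (i : ℕ)) v‖ ^ 2 := by
  simp only [EuclideanSpace.norm_sq_eq, Fintype.sum_prod_type]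
  rfl

theorem norm_sq_ctrBlock_transpose (d : ℕ) (v : Vec n) :
    ‖Matrix.toEuclideanLin (ctrBlock d Θ L)ᵀ v‖ ^ 2
      = ∑ j : Fin d, (‖Matrix.toEuclideanLin (filterMat Θ L ^ (j : ℕ) * (Θ.A * L))ᵀ v‖ ^ 2
        + ‖Matrix.toEuclideanLin (filterMat Θ L ^ (j : ℕ) * Θ.B)ᵀ v‖ ^ 2) := by
  simp only [EuclideanSpace.norm_sq_eq, Fintype.sum_sum_type, Fintype.sum_prod_type,
    Finset.sum_add_distrib]
  rfl

/-- Each of the d₁ block rows is a submatrix of M, and the squares of their norms add up. -/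
theorem norm_hankel_le (d₁ d₂ : ℕ) (M : Matrix (Fin m) (BlockIdx (d₁ + d₂ + 1) m p) ℝ) :
    ‖hankel d₁ d₂ M‖ ≤ √d₁ * ‖M‖ := by
  refine opNorm_le_of_forall _ (by positivity) fun x => ?_
  refine le_of_sq_le_sq ?_ (by positivity)
  let g : Fin d₁ → BlockIdx (d₂ + 1) m p → BlockIdx (d₁ + d₂ + 1) m p := fun i =>
    Sum.map (fun jb => (⟨i + jb.1, by omega⟩, jb.2)) (fun jb => (⟨i + jb.1, by omega⟩, jb.2))
  have hg : ∀ i, Function.Injective (g i) := by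
    intro i
    refine Function.Injective.sumMap ?_ ?_ <;>
    · rintro ⟨j, b⟩ ⟨j', b'⟩ h
      simp only [Prod.mk.injEq, Fin.mk.injEq] at h
      ext1
      · exact Fin.ext (by simpa using h.1)
      · exact h.2
  have h1 : ∀ i, ‖Matrix.toEuclideanLin (M.submatrix id (g i)) x‖ ^ 2 ≤ (‖M‖ * ‖x‖) ^ 2 := by
    intro i
    have h2 := norm_submatrix_le M (f := id) Function.injective_id (hg i)
    have h3 := norm_toEuclideanLin_le (M.submatrix id (g i)) x
    have h4 : ‖Matrix.toEuclideanLin (M.submatrix id (g i)) x‖ ≤ ‖M‖ * ‖x‖ :=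
      h3.trans (mul_le_mul_of_nonneg_right h2 (norm_nonneg _))
    gcongr
  have h5 : ‖Matrix.toEuclideanLin (hankel d₁ d₂ M) x‖ ^ 2
      = ∑ i, ‖Matrix.toEuclideanLin (M.submatrix id (g i)) x‖ ^ 2 := by
    simp only [EuclideanSpace.norm_sq_eq, Fintype.sum_prod_type]
    refine Finset.sum_congr rfl fun i _ => Finset.sum_congr rfl fun a _ => ?_
    congr 2
    simp only [Matrix.toLpLin_apply, Matrix.mulVec, dotProduct]
    refine Finset.sum_congr rfl fun c _ => ?_
    rcases c with c | c <;> rfl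
  rw [h5]
  refine (Finset.sum_le_sum fun i _ => h1 i).trans ?_
  rw [Finset.sum_const, Finset.card_univ, Fintype.card_fin, nsmul_eq_mul, mul_assoc, mul_pow (√d₁),
    Real.sq_sqrt (Nat.cast_nonneg _)]

theorem hankelMinus_sub (d₁ d₂ : ℕ) (M M' : Matrix (Fin m) (BlockIdx (d₁ + d₂ + 1) m p) ℝ) :
    hankelMinus d₁ d₂ M - hankelMinus d₁ d₂ M' = hankelMinus d₁ d₂ (M - M') := by
  ext ⟨i, a⟩ (c | c) <;> rfl

theorem hankelPlus_sub (d₁ d₂ : ℕ) (M M' : Matrix (Fin m) (BlockIdx (d₁ + d₂ + 1) m p) ℝ) :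
    hankelPlus d₁ d₂ M - hankelPlus d₁ d₂ M' = hankelPlus d₁ d₂ (M - M') := by
  ext ⟨i, a⟩ (c | c) <;> rfl

theorem norm_hankelMinus_sub_le (d₁ d₂ : ℕ)
    (M M' : Matrix (Fin m) (BlockIdx (d₁ + d₂ + 1) m p) ℝ) :
    ‖hankelMinus d₁ d₂ M - hankelMinus d₁ d₂ M'‖ ≤ √d₁ * ‖M - M'‖ := by
  rw [hankelMinus_sub]
  refine (norm_submatrix_le _ Function.injective_id ?_).trans (norm_hankel_le d₁ d₂ _)
  refine Function.Injective.sumMap ?_ ?_ <;>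
  · rintro ⟨j, b⟩ ⟨j', b'⟩ h
    simpa using h

theorem norm_hankelPlus_sub_le (d₁ d₂ : ℕ)
    (M M' : Matrix (Fin m) (BlockIdx (d₁ + d₂ + 1) m p) ℝ) :
    ‖hankelPlus d₁ d₂ M - hankelPlus d₁ d₂ M'‖ ≤ √d₁ * ‖M - M'‖ := by
  rw [hankelPlus_sub]
  refine (norm_submatrix_le _ Function.injective_id ?_).trans (norm_hankel_le d₁ d₂ _)
  refine Function.Injective.sumMap ?_ ?_ <;>
  · rintro ⟨j, b⟩ ⟨j', b'⟩ h
    simpa using h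

end Blocks

/-! ### Moore–Penrose inverses and balanced factors from singular value decompositions -/

section PInv

variable {ι κ : Type*} [Fintype ι] [Fintype κ] [DecidableEq ι] [DecidableEq κ]

theorem IsPInv.transpose {X : Matrix ι κ ℝ} {Y : Matrix κ ι ℝ} (h : IsPInv X Y) :
    IsPInv Xᵀ Yᵀ where
  left := by rw [← Matrix.transpose_mul, ← Matrix.transpose_mul, ← Matrix.mul_assoc, h.left]
  right := by rw [← Matrix.transpose_mul, ← Matrix.transpose_mul, ← Matrix.mul_assoc, h.right]
  symm_left := by rw [← Matrix.transpose_mul, h.symm_right, h.symm_right]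
  symm_right := by rw [← Matrix.transpose_mul, h.symm_left, h.symm_left]

/-- An X that is bounded below is injective, so its pseudo-inverse is a left inverse. As XY is an
orthogonal projection, c‖Yv‖ ≤ ‖XYv‖ ≤ ‖v‖. -/
theorem IsPInv.mul_eq_one_of_lower_bound {X : Matrix ι (Fin n) ℝ} {Y : Matrix (Fin n) ι ℝ}
    (h : IsPInv X Y) {c : ℝ} (hc : 0 < c)
    (hX : ∀ v : Vec n, c * ‖v‖ ≤ ‖Matrix.toEuclideanLin X v‖) : Y * X = 1 ∧ ‖Y‖ ≤ c⁻¹ := by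
  have hu := isUnit_det_transpose_mul_self hc hX
  have h1 : Y * X = 1 := by
    have h2 : (Xᵀ * X) * (Y * X) = (Xᵀ * X) * 1 := by
      calc (Xᵀ * X) * (Y * X) = Xᵀ * (X * Y * X) := by simp only [Matrix.mul_assoc]
        _ = _ := by rw [h.left, Matrix.mul_one]
    calc Y * X = (Xᵀ * X)⁻¹ * ((Xᵀ * X) * (Y * X)) := by
          rw [← Matrix.mul_assoc, Matrix.nonsing_inv_mul _ hu, Matrix.one_mul]
      _ = 1 := by rw [h2, Matrix.mul_one, Matrix.nonsing_inv_mul _ hu]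
  refine ⟨h1, opNorm_le_of_forall _ (by positivity) fun v => ?_⟩
  have h3 : ‖Matrix.toEuclideanLin (X * Y) v‖ ≤ ‖v‖ := by
    have h4 : ‖Matrix.toEuclideanLin (X * Y) v‖ ^ 2
        = inner ℝ v (Matrix.toEuclideanLin (X * Y) v) := by
      rw [← real_inner_self_eq_norm_sq, inner_toEuclideanLin, h.symm_left,
        ← toEuclideanLin_mul_apply, ← Matrix.mul_assoc, h.left]
    have h5 := real_inner_le_norm v (Matrix.toEuclideanLin (X * Y) v)
    rw [← h4, sq] at h5
    by_contra hcon
    push Not at hcon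
    nlinarith [norm_nonneg v]
  have h6 := hX (Matrix.toEuclideanLin Y v)
  rw [← toEuclideanLin_mul_apply] at h6
  rw [inv_mul_eq_div, le_div_iff₀ hc, mul_comm]
  exact h6.trans h3

theorem IsSVD.balanced {X : Matrix ι κ ℝ} {U : Matrix ι (Fin n) ℝ} {d : Fin n → ℝ}
    {V : Matrix κ (Fin n) ℝ} (h : IsSVD X U d V) :
    (U * Matrix.diagonal fun j => √(d j)) * ((Matrix.diagonal fun j => √(d j)) * Vᵀ) = X ∧
    (U * Matrix.diagonal fun j => √(d j))ᵀ * (U * Matrix.diagonal fun j => √(d j))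
      = ((Matrix.diagonal fun j => √(d j)) * Vᵀ) * ((Matrix.diagonal fun j => √(d j)) * Vᵀ)ᵀ := by
  have hd : (Matrix.diagonal fun j => √(d j)) * (Matrix.diagonal fun j => √(d j))
      = Matrix.diagonal d := by
    rw [Matrix.diagonal_mul_diagonal]
    congr 1
    ext j
    exact Real.mul_self_sqrt (h.nonneg j)
  constructor
  · rw [Matrix.mul_assoc, ← Matrix.mul_assoc (Matrix.diagonal _) (Matrix.diagonal _), hd,
      ← Matrix.mul_assoc, ← h.eq]
  · rw [Matrix.transpose_mul, Matrix.transpose_mul, Matrix.diagonal_transpose,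
      Matrix.transpose_transpose, Matrix.mul_assoc, ← Matrix.mul_assoc Uᵀ, h.left, Matrix.one_mul,
      Matrix.mul_assoc, ← Matrix.mul_assoc Vᵀ, h.right, Matrix.one_mul]

end PInv

/-! ### SysId on exact data -/

section Exact

variable {Θ : LinSys n m p} {L : Matrix (Fin n) (Fin m) ℝ} {d₁ d₂ : ℕ}

theorem norm_mul_le_mul {ι κ l : Type*} [Fintype ι] [Fintype κ] [Fintype l] [DecidableEq κ]
    [DecidableEq l] (A : Matrix ι κ ℝ) (B : Matrix κ l ℝ) {a b : ℝ} (hA : ‖A‖ ≤ a) (hB : ‖B‖ ≤ b) :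
    ‖A * B‖ ≤ a * b :=
  (Matrix.l2_opNorm_mul A B).trans
    (mul_le_mul hA hB (norm_nonneg _) ((norm_nonneg _).trans hA))

/-- The system in the coordinates given by `G`. -/
def LinSys.conj (Θ : LinSys n m p) (G : Matrix (Fin n) (Fin n) ℝ) : LinSys n m p :=
  ⟨G⁻¹ * Θ.A * G, G⁻¹ * Θ.B, Θ.C * G⟩

theorem similar_conj {G : Matrix (Fin n) (Fin n) ℝ} (hG : IsUnit G.det) :
    Similar Θ L (Θ.conj G) (G⁻¹ * L) :=
  ⟨G, hG, rfl, rfl, rfl, rfl⟩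

theorem obsBlock_mul_zero_row {l : Type*} (X : Matrix (Fin n) l ℝ) {i : Fin d₁} (hi : (i : ℕ) = 0)
    (a : Fin m) (k : l) : (obsBlock d₁ Θ L * X) (i, a) k = (Θ.C * X) a k := by
  rw [obsBlock_mul_apply, hi, pow_zero, Matrix.mul_one]

theorem mul_ctrBlock_zero_inl {l : Type*} (X : Matrix l (Fin n) ℝ) {j : Fin d₂} (hj : (j : ℕ) = 0)
    (k : l) (b : Fin m) :
    (X * ctrBlock d₂ Θ L) k (Sum.inl (j, b)) = (X * (Θ.A * L)) k b := by
  rw [mul_ctrBlock_apply_inl, hj, pow_zero, Matrix.one_mul]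

theorem mul_ctrBlock_zero_inr {l : Type*} (X : Matrix l (Fin n) ℝ) {j : Fin d₂} (hj : (j : ℕ) = 0)
    (k : l) (b : Fin p) :
    (X * ctrBlock d₂ Θ L) k (Sum.inr (j, b)) = (X * Θ.B) k b := by
  rw [mul_ctrBlock_apply_inr, hj, pow_zero, Matrix.one_mul]

/-- The shift of the Hankel matrix recovers Ā rather than A; adding FC back, in arbitrary
coordinates, restores A. -/
theorem mul_filterMat_mul_add (X Y : Matrix (Fin n) (Fin n) ℝ) :
    X * filterMat Θ L * Y + X * (Θ.A * L) * (Θ.C * Y) = X * Θ.A * Y := by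
  simp only [filterMat, Matrix.mul_sub, Matrix.sub_mul, Matrix.mul_assoc]
  abel

/-- On exact data the truncation is the identity, since the Hankel matrix has rank at most n. The
factors from the singular value decomposition are balanced and differ from the observability and
controllability blocks by some G, and every formula of SysId is covariant under G. Invertibility of
A is what recovers L from F = AL. -/
theorem exists_isBalancing_of_isSysIdOutput {x₀ x₁ y₀ y₁ : ℝ} (hx : 0 < x₀) (hy : 0 < y₀)
    (hfb : FactorBounds x₀ x₁ y₀ y₁ (obsBlock d₁ Θ L) (ctrBlock d₂ Θ L)) (hd₁ : 0 < d₁)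
    (hd₂ : 0 < d₂) (hA : IsUnit Θ.A.det) {Θbar : LinSys n m p} {Lbar : Matrix (Fin n) (Fin m) ℝ}
    (h : IsSysIdOutput d₁ d₂ (arxMatrix (d₁ + d₂ + 1) Θ L) Θbar Lbar) :
    ∃ G, IsBalancing (obsBlock d₁ Θ L) (ctrBlock d₂ Θ L) G ∧ Θbar = Θ.conj G ∧
      Lbar = G⁻¹ * L := by
  obtain ⟨N, U, d, V, O, Od, W, Wd, F, Ad, htr, hsvd, hO, hW, hC, hB, hF, hOd, hWd, hAh, hAd, hLh⟩
    := h
  have hXu := hfb.isUnit_left hx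
  have hYu := hfb.isUnit_right hy
  have hrank : (hankelMinus d₁ d₂ (arxMatrix (d₁ + d₂ + 1) Θ L)).rank ≤ n := by
    rw [hankelMinus_arxMatrix]
    exact (Matrix.rank_mul_le_left _ _).trans ((Matrix.rank_le_card_width _).trans_eq (Fintype.card_fin n))
  have hN : N = hankelMinus d₁ d₂ (arxMatrix (d₁ + d₂ + 1) Θ L) := by
    have h1 := norm_sub_rankTruncation_le htr hrank
    rw [sub_self, norm_zero, norm_le_zero_iff, sub_eq_zero] at h1
    exact h1.symm
  obtain ⟨hOW, hbal⟩ := hsvd.balanced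
  rw [← hO, ← hW] at hOW hbal
  obtain ⟨G, hGu, hOG, hWG⟩ := exists_coordinates_of_mul_eq hXu hYu
    (hOW.trans (hN.trans (hankelMinus_arxMatrix Θ L d₁ d₂)))
  have hG : IsBalancing (obsBlock d₁ Θ L) (ctrBlock d₂ Θ L) G := by
    refine ⟨hGu, ?_⟩
    rw [← hOG, ← hWG]
    exact hbal
  -- lower bounds for the factors in the new coordinates
  have hGi : IsUnit (G⁻¹).det := by rw [Matrix.det_nonsing_inv]; exact hGu.ringInverse
  have hOu : IsUnit (Oᵀ * O).det := by
    rw [hOG, Matrix.transpose_mul, Matrix.mul_assoc, ← Matrix.mul_assoc _ _ G, Matrix.det_mul,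
      Matrix.det_mul, Matrix.det_transpose]
    exact hGu.mul (hXu.mul hGu)
  have hOd1 : Od * O = 1 := by
    have h2 : (Oᵀ * O) * (Od * O) = (Oᵀ * O) * 1 := by
      calc (Oᵀ * O) * (Od * O) = Oᵀ * (O * Od * O) := by simp only [Matrix.mul_assoc]
        _ = _ := by rw [hOd.left, Matrix.mul_one]
    calc Od * O = (Oᵀ * O)⁻¹ * ((Oᵀ * O) * (Od * O)) := by
          rw [← Matrix.mul_assoc, Matrix.nonsing_inv_mul _ hOu, Matrix.one_mul]
      _ = 1 := by rw [h2, Matrix.mul_one, Matrix.nonsing_inv_mul _ hOu]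
  have hWu : IsUnit (W * Wᵀ).det := by rw [← hbal]; exact hOu
  have hWd1 : W * Wd = 1 := by
    have h2 : (W * Wd) * (W * Wᵀ) = 1 * (W * Wᵀ) := by
      calc (W * Wd) * (W * Wᵀ) = (W * Wd * W) * Wᵀ := by simp only [Matrix.mul_assoc]
        _ = _ := by rw [hWd.left, Matrix.one_mul]
    calc W * Wd = (W * Wd) * (W * Wᵀ) * (W * Wᵀ)⁻¹ := by
          rw [Matrix.mul_assoc, Matrix.mul_nonsing_inv _ hWu, Matrix.mul_one]
      _ = 1 := by rw [h2, Matrix.one_mul, Matrix.mul_nonsing_inv _ hWu]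
  have hO0 : Od * obsBlock d₁ Θ L = G⁻¹ := by
    calc Od * obsBlock d₁ Θ L = Od * (obsBlock d₁ Θ L * G) * G⁻¹ := by
          rw [Matrix.mul_assoc, Matrix.mul_assoc, Matrix.mul_nonsing_inv _ hGu, Matrix.mul_one]
      _ = G⁻¹ := by rw [← hOG, hOd1, Matrix.one_mul]
  have hW0 : ctrBlock d₂ Θ L * Wd = G := by
    calc ctrBlock d₂ Θ L * Wd = G * (G⁻¹ * ctrBlock d₂ Θ L * Wd) := by
          rw [← Matrix.mul_assoc, ← Matrix.mul_assoc, Matrix.mul_nonsing_inv _ hGu, Matrix.one_mul]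
      _ = G := by rw [← hWG, hWd1, Matrix.mul_one]
  have hCG : Θbar.C = Θ.C * G := by
    ext a k
    rw [hC ⟨0, hd₁⟩ rfl, hOG, obsBlock_mul_zero_row _ rfl]
  have hFG : F = G⁻¹ * (Θ.A * L) := by
    ext k a
    rw [hF ⟨0, hd₂⟩ rfl, hWG, mul_ctrBlock_zero_inl _ rfl]
  have hBG : Θbar.B = G⁻¹ * Θ.B := by
    ext k a
    rw [hB ⟨0, hd₂⟩ rfl, hWG, mul_ctrBlock_zero_inr _ rfl]
  have hAG : Θbar.A = G⁻¹ * Θ.A * G := by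
    rw [hAh, hankelPlus_arxMatrix, ← Matrix.mul_assoc, ← Matrix.mul_assoc, hO0, Matrix.mul_assoc,
      hW0, hFG, hCG, mul_filterMat_mul_add]
  have hAbu : IsUnit Θbar.A.det := by
    rw [hAG, Matrix.det_mul, Matrix.det_mul]
    exact (hGi.mul hA).mul hGu
  have hAd1 : Ad * Θbar.A = 1 := by
    have h1 : Θbar.A * (Ad * Θbar.A) = Θbar.A * 1 := by
      rw [← Matrix.mul_assoc, hAd.left, Matrix.mul_one]
    calc Ad * Θbar.A = Θbar.A⁻¹ * (Θbar.A * (Ad * Θbar.A)) := by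
          rw [← Matrix.mul_assoc, Matrix.nonsing_inv_mul _ hAbu, Matrix.one_mul]
      _ = 1 := by rw [h1, Matrix.mul_one, Matrix.nonsing_inv_mul _ hAbu]
  refine ⟨G, hG, LinSys.ext hAG hBG hCG, ?_⟩
  ext k a
  rw [hLh ⟨0, hd₂⟩ rfl, hankelMinus_arxMatrix, ← Matrix.mul_assoc, Matrix.mul_assoc Ad, hO0,
    mul_ctrBlock_zero_inl _ rfl]
  have hL : G⁻¹ * (Θ.A * L) = Θbar.A * (G⁻¹ * L) := by
    rw [hAG]
    calc G⁻¹ * (Θ.A * L) = G⁻¹ * Θ.A * (G * G⁻¹) * L := by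
          rw [Matrix.mul_nonsing_inv _ hGu, Matrix.mul_one, Matrix.mul_assoc]
      _ = _ := by simp only [Matrix.mul_assoc]
  rw [Matrix.mul_assoc, hL, ← Matrix.mul_assoc, hAd1, Matrix.one_mul]

/-- Projecting away from q loses a dimension, so the projected map is an admissible test map in the
min-max principle for the n-th singular value. -/
theorem finrank_range_deflate_lt {q : Vec n} (hq : ‖q‖ = 1) {E : Type*} [AddCommGroup E]
    [Module ℝ E] (f : E →ₗ[ℝ] Vec n) (g : E →ₗ[ℝ] Vec n)
    (hg : ∀ x, g x = f x - (inner ℝ q (f x) : ℝ) • q) :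
    Module.finrank ℝ (LinearMap.range g) < n := by
  let P : Vec n →ₗ[ℝ] Vec n := LinearMap.id - (innerₛₗ ℝ q).smulRight q
  have hP : ∀ v, P v = v - (inner ℝ q v : ℝ) • q := fun v => rfl
  have hle : LinearMap.range g ≤ LinearMap.range P := by
    rintro _ ⟨x, rfl⟩
    exact ⟨f x, by rw [hP, hg]⟩
  have hker : 0 < Module.finrank ℝ (LinearMap.ker P) := by
    have hmem : q ∈ LinearMap.ker P := by
      rw [LinearMap.mem_ker, hP, real_inner_self_eq_norm_sq, hq]
      simp
    have hq0 : q ≠ 0 := by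
      intro h0
      rw [h0, norm_zero] at hq
      exact zero_ne_one hq
    have : Nontrivial (LinearMap.ker P) :=
      ⟨⟨q, hmem⟩, 0, fun h => hq0 (by simpa using congrArg Subtype.val h)⟩
    exact Module.finrank_pos
  have h1 := LinearMap.finrank_range_add_finrank_ker P
  rw [finrank_euclideanSpace, Fintype.card_fin] at h1
  have h2 := Submodule.finrank_mono hle
  omega

/-- If the tail of the controllability block is small, the `n`-th singular value of the full
Hankel matrix is at most twice the smallest eigenvalue of the balanced Gramian. -/
theorem sigma_hankel_le {G : Matrix (Fin n) (Fin n) ℝ}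
    (hG : IsBalancing (obsBlock d₁ Θ L) (ctrBlock d₂ Θ L) G) {τ : ℝ} {q : Vec n} (hτ : 0 ≤ τ)
    (hq : ‖q‖ = 1)
    (heig : Matrix.toEuclideanLin ((obsBlock d₁ Θ L * G)ᵀ * (obsBlock d₁ Θ L * G)) q = τ • q)
    (htail : ‖G⁻¹ * (filterMat Θ L ^ d₂ * (Θ.A * L))‖ ^ 2
      + ‖G⁻¹ * (filterMat Θ L ^ d₂ * Θ.B)‖ ^ 2 ≤ 3 * τ) :
    sigma n (hankel d₁ d₂ (arxMatrix (d₁ + d₂ + 1) Θ L)) ≤ 2 * τ := by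
  rw [hankel_arxMatrix]
  set O := obsBlock d₁ Θ L * G with hO
  set W := G⁻¹ * ctrBlock (d₂ + 1) Θ L with hW
  have hprod : obsBlock d₁ Θ L * ctrBlock (d₂ + 1) Θ L = O * W := by
    rw [hO, hW, Matrix.mul_assoc, ← Matrix.mul_assoc G, Matrix.mul_nonsing_inv _ hG.unit,
      Matrix.one_mul]
  let f : EuclideanSpace ℝ (BlockIdx (d₂ + 1) m p) →ₗ[ℝ] Vec n := Matrix.toEuclideanLin W
  let g : EuclideanSpace ℝ (BlockIdx (d₂ + 1) m p) →ₗ[ℝ] Vec n :=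
    f - ((innerₛₗ ℝ q) ∘ₗ f).smulRight q
  have hg : ∀ x, g x = f x - (inner ℝ q (f x) : ℝ) • q := fun x => rfl
  refine sigma_le_of_map_eq_zero _ g (by positivity) (finrank_range_deflate_lt hq f g hg) ?_
  intro x hx
  -- On the kernel of g the vector Wx is a multiple of q, so ‖OWx‖ = √τ |⟨Wᵀq, x⟩|.
  have hfx : Matrix.toEuclideanLin W x = (inner ℝ q (f x) : ℝ) • q := by
    have := hg x
    rw [hx] at this
    exact (sub_eq_zero.1 this.symm)
  have hOq : ‖Matrix.toEuclideanLin O q‖ = √τ := by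
    have h1 : ‖Matrix.toEuclideanLin O q‖ ^ 2 = τ := by
      rw [norm_sq_toEuclideanLin, heig, real_inner_smul_right, real_inner_self_eq_norm_sq, hq]
      ring
    rw [← h1, Real.sqrt_sq (norm_nonneg _)]
  -- Balancing refers to d₂ block columns, which contribute τ; the additional block column of the
  -- full Hankel matrix contributes at most 3τ.
  have hWq : ‖Matrix.toEuclideanLin Wᵀ q‖ ^ 2 ≤ 4 * τ := by
    have e1 : Matrix.toEuclideanLin Wᵀ q
        = Matrix.toEuclideanLin (ctrBlock (d₂ + 1) Θ L)ᵀ (Matrix.toEuclideanLin (G⁻¹)ᵀ q) := by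
      rw [hW, Matrix.transpose_mul, toEuclideanLin_mul_apply]
    have e2 : ‖Matrix.toEuclideanLin (ctrBlock d₂ Θ L)ᵀ (Matrix.toEuclideanLin (G⁻¹)ᵀ q)‖ ^ 2
        = τ := by
      rw [← toEuclideanLin_mul_apply, ← Matrix.transpose_mul, norm_sq_toEuclideanLin,
        Matrix.transpose_transpose, ← hG.balanced, heig, real_inner_smul_right,
        real_inner_self_eq_norm_sq, hq]
      ring
    have e3 : ∀ {k : ℕ} (Y : Matrix (Fin n) (Fin k) ℝ),
        ‖Matrix.toEuclideanLin Yᵀ (Matrix.toEuclideanLin (G⁻¹)ᵀ q)‖ ^ 2 ≤ ‖G⁻¹ * Y‖ ^ 2 := by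
      intro k Y
      rw [← toEuclideanLin_mul_apply, ← Matrix.transpose_mul]
      have := norm_toEuclideanLin_le (G⁻¹ * Y)ᵀ q
      rw [hq, mul_one, norm_transpose] at this
      gcongr
    rw [e1, norm_sq_ctrBlock_transpose, Fin.sum_univ_castSucc]
    simp only [Fin.val_castSucc, Fin.val_last]
    rw [norm_sq_ctrBlock_transpose] at e2
    have e4 := e3 (filterMat Θ L ^ d₂ * (Θ.A * L))
    have e5 := e3 (filterMat Θ L ^ d₂ * Θ.B)
    linarith
  have hWq' : ‖Matrix.toEuclideanLin Wᵀ q‖ ≤ 2 * √τ := by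
    refine le_of_sq_le_sq ?_ (by positivity)
    rw [mul_pow, Real.sq_sqrt hτ]
    linarith
  rw [hprod, toEuclideanLin_mul_apply, hfx, map_smul, norm_smul, hOq]
  have h2 : inner ℝ q (f x) = inner ℝ (Matrix.toEuclideanLin Wᵀ q) x := by
    rw [inner_toEuclideanLin, Matrix.transpose_transpose]
  rw [h2]
  calc ‖(inner ℝ (Matrix.toEuclideanLin Wᵀ q) x : ℝ)‖ * √τ
      ≤ ‖Matrix.toEuclideanLin Wᵀ q‖ * ‖x‖ * √τ :=
        mul_le_mul_of_nonneg_right (norm_inner_le_norm _ _) (Real.sqrt_nonneg _)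
    _ ≤ 2 * √τ * ‖x‖ * √τ := by gcongr
    _ = 2 * (√τ * √τ) * ‖x‖ := by ring
    _ = 2 * τ * ‖x‖ := by rw [Real.mul_self_sqrt hτ]

end Exact

/-! ### Perturbation of SysId -/

section Perturbation

theorem inner_nonneg_of_posSemidef {D : Matrix (Fin n) (Fin n) ℝ} (hD : D.PosSemidef) (v : Vec n) :
    0 ≤ inner ℝ v (Matrix.toEuclideanLin D v) := by
  have h := hD.dotProduct_mulVec_nonneg v.ofLp
  rw [EuclideanSpace.inner_eq_star_dotProduct, star_trivial, Matrix.toLpLin_apply, dotProduct_comm]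
  simpa using h

theorem lower_bound_of_posSemidef {ι : Type*} [Fintype ι] [DecidableEq ι] {O : Matrix ι (Fin n) ℝ}
    {τ : ℝ} (hτ : 0 < τ) (hlow : (Oᵀ * O - τ • 1).PosSemidef) (v : Vec n) :
    √τ * ‖v‖ ≤ ‖Matrix.toEuclideanLin O v‖ := by
  refine le_of_sq_le_sq ?_ (norm_nonneg _)
  rw [mul_pow, Real.sq_sqrt hτ.le, norm_sq_toEuclideanLin]
  have h2 := inner_nonneg_of_posSemidef hlow v
  have h3 : Matrix.toEuclideanLin (Oᵀ * O - τ • 1) v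
      = Matrix.toEuclideanLin (Oᵀ * O) v - τ • v := by
    rw [map_sub, map_smul, LinearMap.sub_apply, LinearMap.smul_apply, toEuclideanLin_one_apply]
  rw [h3, inner_sub_right, real_inner_smul_right, real_inner_self_eq_norm_sq] at h2
  linarith

variable {ι κ : Type*} [Fintype ι] [Fintype κ] [DecidableEq ι] [DecidableEq κ]

/-- Truncation at most doubles the error, and a difference of two products through ℝⁿ has rank at
most 2n. With the Procrustes constant, 5/2 · 2n · 2² = 20n. -/
theorem exists_orthogonal_factor_close {O Oh : Matrix ι (Fin n) ℝ} {W Wh : Matrix (Fin n) κ ℝ}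
    {Hm N : Matrix ι κ ℝ} {τ η : ℝ} (hτ : 0 < τ) (hbal : Oᵀ * O = W * Wᵀ)
    (hlow : (Oᵀ * O - τ • 1).PosSemidef) (hm : ‖Hm - O * W‖ ≤ η) (htr : IsRankTruncation n Hm N)
    (hN : Oh * Wh = N) (hbalh : Ohᵀ * Oh = Wh * Whᵀ) :
    ∃ T ∈ Matrix.orthogonalGroup (Fin n) ℝ,
      ‖Oh - O * T‖ ^ 2 ≤ 20 * n * η ^ 2 / τ ∧ ‖Wh - Tᵀ * W‖ ^ 2 ≤ 20 * n * η ^ 2 / τ := by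
  obtain ⟨T, hT, hfrob⟩ := exists_orthogonal_frobSq_le hτ hbal hbalh hlow
  have hη : 0 ≤ η := (norm_nonneg _).trans hm
  have hrk : (O * W).rank ≤ n :=
    (Matrix.rank_mul_le_left _ _).trans ((Matrix.rank_le_card_width _).trans_eq (Fintype.card_fin n))
  have hN2 : ‖Oh * Wh - O * W‖ ≤ 2 * η := by
    have h1 := norm_sub_rankTruncation_le htr hrk
    have h2 : Oh * Wh - O * W = -(Hm - N) + (Hm - O * W) := by rw [hN]; abel
    rw [h2]
    refine (norm_add_le _ _).trans ?_
    rw [norm_neg]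
    linarith
  have hfr : frobSq (Oh * Wh - O * W) ≤ 2 * n * (2 * η) ^ 2 := by
    refine (frobSq_le_rank_mul _).trans ?_
    have h1 : ((Oh * Wh - O * W).rank : ℝ) ≤ 2 * n := by
      have : (Oh * Wh - O * W).rank ≤ 2 * n := by
        have h2 : Oh * Wh - O * W = Matrix.fromCols Oh (-O) * Matrix.fromRows Wh W := by
          rw [Matrix.fromCols_mul_fromRows, Matrix.neg_mul, sub_eq_add_neg]
        rw [h2]
        refine (Matrix.rank_mul_le_left _ _).trans ((Matrix.rank_le_card_width _).trans_eq ?_)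
        simp [two_mul]
      exact_mod_cast this
    gcongr
  have hsum : frobSq (Oh - O * T) + frobSq (Wh - Tᵀ * W) ≤ 20 * n * η ^ 2 / τ := by
    refine hfrob.trans ?_
    calc 5 / 2 / τ * frobSq (Oh * Wh - O * W) ≤ 5 / 2 / τ * (2 * n * (2 * η) ^ 2) := by gcongr
      _ = _ := by ring
  exact ⟨T, hT, (norm_sq_le_frobSq _).trans (by linarith [frobSq_nonneg (Wh - Tᵀ * W)]),
    (norm_sq_le_frobSq _).trans (by linarith [frobSq_nonneg (Oh - O * T)])⟩

/-- Half of the lower bound r survives a perturbation of size at most r/2. -/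
theorem IsPInv.bounds_of_close {O Oh : Matrix ι (Fin n) ℝ} {Ohd : Matrix (Fin n) ι ℝ}
    {T : Matrix (Fin n) (Fin n) ℝ} {r δ : ℝ} (hOd : IsPInv Oh Ohd) (hr : 0 < r)
    (hO : ∀ v : Vec n, r * ‖v‖ ≤ ‖Matrix.toEuclideanLin O v‖)
    (hT : T ∈ Matrix.orthogonalGroup (Fin n) ℝ) (hδ : ‖Oh - O * T‖ ≤ δ) (hδr : 2 * δ ≤ r) :
    Ohd * Oh = 1 ∧ ‖Ohd‖ ≤ 2 / r := by
  have hlow : ∀ v : Vec n, r / 2 * ‖v‖ ≤ ‖Matrix.toEuclideanLin Oh v‖ := by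
    intro v
    have h1 := hO (Matrix.toEuclideanLin T v)
    rw [norm_toEuclideanLin_of_transpose_mul_self (transpose_mul_self_of_mem_orthogonal hT),
      ← toEuclideanLin_mul_apply] at h1
    have h2 := norm_toEuclideanLin_le (Oh - O * T) v
    rw [map_sub, LinearMap.sub_apply] at h2
    have h3 : ‖Oh - O * T‖ * ‖v‖ ≤ r / 2 * ‖v‖ :=
      mul_le_mul_of_nonneg_right (by linarith) (norm_nonneg _)
    have h4 := norm_sub_norm_le (Matrix.toEuclideanLin (O * T) v) (Matrix.toEuclideanLin Oh v)
    rw [norm_sub_rev] at h4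
    linarith
  have := hOd.mul_eq_one_of_lower_bound (half_pos hr) hlow
  rwa [inv_div] at this

/-- Write Ô†OT = 1 − E₁ and TᵀWŴ† = 1 − E₂ with ‖Eᵢ‖ ≤ kδ and expand (1 − E₁)TᵀĀT(1 − E₂). The
quadratic term is absorbed by kδ ≤ 1, whence the factor 3. -/
theorem norm_shift_estimate_le {O Oh : Matrix ι (Fin n) ℝ} {W Wh : Matrix (Fin n) κ ℝ}
    {Ab T : Matrix (Fin n) (Fin n) ℝ} {Hp : Matrix ι κ ℝ} {Ohd : Matrix (Fin n) ι ℝ}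
    {Whd : Matrix κ (Fin n) ℝ} {η δ a k : ℝ} (hp : ‖Hp - O * Ab * W‖ ≤ η)
    (hT : T ∈ Matrix.orthogonalGroup (Fin n) ℝ) (hOd : Ohd * Oh = 1) (hWd : Wh * Whd = 1)
    (hOdn : ‖Ohd‖ ≤ k) (hWdn : ‖Whd‖ ≤ k) (hΔO : ‖Oh - O * T‖ ≤ δ) (hΔW : ‖Wh - Tᵀ * W‖ ≤ δ)
    (hkδ : k * δ ≤ 1) (ha : ‖Ab‖ ≤ a) :
    ‖Ohd * Hp * Whd - Tᵀ * Ab * T‖ ≤ k ^ 2 * η + 3 * k * δ * a := by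
  have hTT' := mul_transpose_self_of_mem_orthogonal hT
  have hTn := norm_le_one_of_mem_orthogonal hT
  have hTn' : ‖Tᵀ‖ ≤ 1 := by rw [norm_transpose]; exact hTn
  have ha0 : 0 ≤ a := (norm_nonneg _).trans ha
  have hk0 : 0 ≤ k := (norm_nonneg _).trans hOdn
  have hδ0 : 0 ≤ δ := (norm_nonneg _).trans hΔO
  have hOdO : Ohd * (O * T) = 1 - Ohd * (Oh - O * T) := by
    rw [Matrix.mul_sub, hOd]; abel
  have hWWd : (Tᵀ * W) * Whd = 1 - (Wh - Tᵀ * W) * Whd := by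
    rw [Matrix.sub_mul, hWd]; abel
  have hEO : ‖Ohd * (Oh - O * T)‖ ≤ k * δ := norm_mul_le_mul _ _ hOdn hΔO
  have hEW : ‖(Wh - Tᵀ * W) * Whd‖ ≤ k * δ :=
    (norm_mul_le_mul _ _ hΔW hWdn).trans (mul_comm _ _).le
  have hAt : ‖Tᵀ * Ab * T‖ ≤ a := by
    have := norm_mul_le_mul _ _ (norm_mul_le_mul _ _ hTn' ha) hTn
    rwa [one_mul, mul_one] at this
  have t1 : ‖Ohd * (Hp - O * Ab * W) * Whd‖ ≤ k * η * k :=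
    norm_mul_le_mul _ _ (norm_mul_le_mul _ _ hOdn hp) hWdn
  have e1 : Ohd * (O * Ab * W) * Whd = Ohd * (O * T) * (Tᵀ * Ab * T) * ((Tᵀ * W) * Whd) := by
    calc Ohd * (O * Ab * W) * Whd = Ohd * (O * (1 : Matrix (Fin n) (Fin n) ℝ) * Ab *
          (1 : Matrix (Fin n) (Fin n) ℝ) * W) * Whd := by
          rw [Matrix.mul_one, Matrix.mul_one]
      _ = Ohd * (O * (T * Tᵀ) * Ab * (T * Tᵀ) * W) * Whd := by rw [hTT']
      _ = _ := by simp only [Matrix.mul_assoc]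
  have e2 : Ohd * Hp * Whd = Ohd * (Hp - O * Ab * W) * Whd + Ohd * (O * Ab * W) * Whd := by
    rw [Matrix.mul_sub, Matrix.sub_mul, sub_add_cancel]
  rw [e2, e1, hOdO, hWWd]
  generalize Ohd * (Oh - O * T) = E₁ at *
  generalize (Wh - Tᵀ * W) * Whd = E₂ at *
  generalize Ohd * (Hp - O * Ab * W) * Whd = E₃ at *
  generalize Tᵀ * Ab * T = At at *
  have t2 : ‖E₁ * At‖ ≤ k * δ * a := norm_mul_le_mul _ _ hEO hAt
  have t3 : ‖At * E₂‖ ≤ a * (k * δ) := norm_mul_le_mul _ _ hAt hEW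
  have t4 : ‖E₁ * At * E₂‖ ≤ k * δ * a * (k * δ) := norm_mul_le_mul _ _ t2 hEW
  have t5 : k * δ * a * (k * δ) ≤ k * δ * a * 1 := by gcongr
  have hsplit : E₃ + (1 - E₁) * At * (1 - E₂) - At = E₃ - E₁ * At - At * E₂ + E₁ * At * E₂ := by
    noncomm_ring
  rw [hsplit]
  refine (norm_add_le _ _).trans ?_
  have t6 := norm_sub_le (E₃ - E₁ * At) (At * E₂)
  have t7 := norm_sub_le E₃ (E₁ * At)
  have t8 : k * η * k = k ^ 2 * η := by ring
  have t9 : a * (k * δ) = k * δ * a := by ring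
  rw [t8] at t1
  rw [t9] at t3
  linarith

theorem norm_left_estimate_le {O Oh : Matrix ι (Fin n) ℝ} {W : Matrix (Fin n) κ ℝ}
    {T : Matrix (Fin n) (Fin n) ℝ} {Hm : Matrix ι κ ℝ} {Ohd : Matrix (Fin n) ι ℝ} {η δ s k : ℝ}
    (hm : ‖Hm - O * W‖ ≤ η) (hT : T ∈ Matrix.orthogonalGroup (Fin n) ℝ) (hOd : Ohd * Oh = 1)
    (hOdn : ‖Ohd‖ ≤ k) (hΔO : ‖Oh - O * T‖ ≤ δ) (hs : ‖W‖ ≤ s) :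
    ‖Ohd * Hm - Tᵀ * W‖ ≤ k * η + k * δ * s := by
  have hTT' := mul_transpose_self_of_mem_orthogonal hT
  have hTn' : ‖Tᵀ‖ ≤ 1 := by rw [norm_transpose]; exact norm_le_one_of_mem_orthogonal hT
  have hOdO : Ohd * (O * T) = 1 - Ohd * (Oh - O * T) := by
    rw [Matrix.mul_sub, hOd]; abel
  have hsplit : Ohd * Hm - Tᵀ * W = Ohd * (Hm - O * W) - Ohd * (Oh - O * T) * (Tᵀ * W) := by
    have e1 : Ohd * (O * W) = Ohd * (O * T) * (Tᵀ * W) := by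
      calc Ohd * (O * W) = Ohd * (O * (1 : Matrix (Fin n) (Fin n) ℝ) * W) := by rw [Matrix.mul_one]
        _ = Ohd * (O * (T * Tᵀ) * W) := by rw [hTT']
        _ = _ := by simp only [Matrix.mul_assoc]
    rw [Matrix.mul_sub Ohd Hm, e1, hOdO, Matrix.sub_mul, Matrix.one_mul]
    abel
  rw [hsplit]
  refine (norm_sub_le _ _).trans (add_le_add (norm_mul_le_mul _ _ hOdn hm) ?_)
  have hWt : ‖Tᵀ * W‖ ≤ s := by
    have := norm_mul_le_mul _ _ hTn' hs
    rwa [one_mul] at this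
  exact norm_mul_le_mul _ _ (norm_mul_le_mul _ _ hOdn hΔO) hWt

theorem norm_first_rows_le {d₁ : ℕ} (hd₁ : 0 < d₁) (X : Matrix (Fin d₁ × Fin m) (Fin n) ℝ)
    (Y : Matrix (Fin m) (Fin n) ℝ) (h : ∀ a k, Y a k = X (⟨0, hd₁⟩, a) k) : ‖Y‖ ≤ ‖X‖ := by
  have : Y = X.submatrix (fun a => (⟨0, hd₁⟩, a)) id := by
    ext a k
    exact h a k
  rw [this]
  exact norm_submatrix_le _ (fun a b hab => (Prod.mk.inj hab).2) Function.injective_id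

theorem norm_first_cols_inl_le {d₂ : ℕ} (hd₂ : 0 < d₂) (X : Matrix (Fin n) (BlockIdx d₂ m p) ℝ)
    (Y : Matrix (Fin n) (Fin m) ℝ) (h : ∀ k a, Y k a = X k (Sum.inl (⟨0, hd₂⟩, a))) :
    ‖Y‖ ≤ ‖X‖ := by
  have : Y = X.submatrix id (fun a => Sum.inl (⟨0, hd₂⟩, a)) := by
    ext k a
    exact h k a
  rw [this]
  exact norm_submatrix_le _ Function.injective_id fun a b hab => by simpa using hab

theorem norm_first_cols_inr_le {d₂ : ℕ} (hd₂ : 0 < d₂) (X : Matrix (Fin n) (BlockIdx d₂ m p) ℝ)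
    (Y : Matrix (Fin n) (Fin p) ℝ) (h : ∀ k a, Y k a = X k (Sum.inr (⟨0, hd₂⟩, a))) :
    ‖Y‖ ≤ ‖X‖ := by
  have : Y = X.submatrix id (fun a => Sum.inr (⟨0, hd₂⟩, a)) := by
    ext k a
    exact h k a
  rw [this]
  exact norm_submatrix_le _ Function.injective_id fun a b hab => by simpa using hab

/-- Since (‖Hk‖ + σ)/σ² ≥ 1/σ ≥ 1/s, a large enough c₁ lets the radius dominate any given Lipschitz
bound. -/
theorem mul_le_betaA {c : RadiusConst}
    {H : ℕ} {Hk : Matrix ι κ ℝ} {e s q : ℝ} (hn : 0 < n) (he : 0 ≤ e) (hσ : 0 < sigma n Hk)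
    (hσs : sigma n Hk ≤ s) (hq : 0 ≤ q) (hc : q * s ≤ c.c₁) : q * (√H * e) ≤ betaA c n H Hk e := by
  have hs : 0 < s := hσ.trans_le hσs
  have hc0 : 0 ≤ c.c₁ := (mul_nonneg hq hs.le).trans hc
  have h1 : √H ≤ √(n * H) := by
    refine Real.sqrt_le_sqrt ?_
    have : (1 : ℝ) ≤ n := by exact_mod_cast hn
    nlinarith [(Nat.cast_nonneg H : (0 : ℝ) ≤ H)]
  have h2 : s⁻¹ ≤ (‖Hk‖ + sigma n Hk) / sigma n Hk ^ 2 := by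
    rw [le_div_iff₀ (by positivity)]
    have : s⁻¹ * sigma n Hk ^ 2 ≤ (sigma n Hk)⁻¹ * sigma n Hk ^ 2 := by gcongr
    refine this.trans ?_
    rw [sq, inv_mul_cancel_left₀ hσ.ne']
    linarith [norm_nonneg Hk]
  calc q * (√H * e) = (q * s) * (√H * s⁻¹) * e := by field_simp
    _ ≤ c.c₁ * (√(n * H) * ((‖Hk‖ + sigma n Hk) / sigma n Hk ^ 2)) * e := by gcongr
    _ = betaA c n H Hk e := by rw [betaA, mul_div_assoc]

/-- The c₃ summand dominates by itself, as (‖Hk‖ + σ)/σ^{3/2} ≥ 1/√s; the other summand is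
nonnegative. -/
theorem mul_le_betaL {c : RadiusConst}
    {H : ℕ} {Hk : Matrix ι κ ℝ} {e s q : ℝ} (hn : 0 < n) (he : 0 ≤ e) (hσ : 0 < sigma n Hk)
    (hσs : sigma n Hk ≤ s) (hq : 0 ≤ q) (hc₁ : 0 ≤ c.c₁) (hc₂ : 0 ≤ c.c₂) (hc : q * √s ≤ c.c₃) :
    q * (√H * e) ≤ betaL c n H Hk e := by
  have hs : 0 < s := hσ.trans_le hσs
  have hc0 : 0 ≤ c.c₃ := (mul_nonneg hq (Real.sqrt_nonneg s)).trans hc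
  have h0 : 0 ≤ c.c₂ * ‖Hk‖ / √(sigma n Hk) * betaA c n H Hk e := by
    rw [betaA]
    positivity
  have h1 : √H ≤ √(n * H) := by
    refine Real.sqrt_le_sqrt ?_
    have : (1 : ℝ) ≤ n := by exact_mod_cast hn
    nlinarith [(Nat.cast_nonneg H : (0 : ℝ) ≤ H)]
  have hpow : sigma n Hk ^ (3 / 2 : ℝ) = sigma n Hk * √(sigma n Hk) := by
    rw [show (3 / 2 : ℝ) = 1 + 1 / 2 by norm_num, Real.rpow_add hσ, Real.rpow_one,
      ← Real.sqrt_eq_rpow]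
  have h2 : (√s)⁻¹ ≤ (‖Hk‖ + sigma n Hk) / sigma n Hk ^ (3 / 2 : ℝ) := by
    have hsq : 0 < √(sigma n Hk) := Real.sqrt_pos.2 hσ
    rw [hpow, le_div_iff₀ (by positivity)]
    have : (√s)⁻¹ * (sigma n Hk * √(sigma n Hk))
        ≤ (√(sigma n Hk))⁻¹ * (sigma n Hk * √(sigma n Hk)) := by gcongr
    refine this.trans ?_
    have : (√(sigma n Hk))⁻¹ * (sigma n Hk * √(sigma n Hk)) = sigma n Hk := by field_simp
    rw [this]
    linarith [norm_nonneg Hk]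
  have hss : 0 < √s := Real.sqrt_pos.2 hs
  have h3 : q * (√H * e)
      ≤ c.c₃ * (√(n * H) * (‖Hk‖ + sigma n Hk) / sigma n Hk ^ (3 / 2 : ℝ)) * e := by
    calc q * (√H * e) = (q * √s) * (√H * (√s)⁻¹) * e := by field_simp
      _ ≤ c.c₃ * (√(n * H) * ((‖Hk‖ + sigma n Hk) / sigma n Hk ^ (3 / 2 : ℝ))) * e := by gcongr
      _ = _ := by rw [mul_div_assoc]
  rw [betaL]
  linarith

/-- This radius has the explicit constant 20 and nothing to enlarge, so the factor 2 lost in σ ≤ 2τ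
must have been saved beforehand; it comes from d₁ being at most H/2. -/
theorem le_betaB {H : ℕ} {Hk : Matrix ι κ ℝ} {e τ r : ℝ} (he : 0 ≤ e) (hσ : 0 < sigma n Hk)
    (hστ : sigma n Hk ≤ 2 * τ) (h : r ^ 2 ≤ 10 * n * H * e ^ 2 / τ) :
    r ≤ betaB n H Hk e := by
  have hτ : 0 < τ := by linarith
  rw [betaB]
  refine le_of_sq_le_sq ?_ (by positivity)
  rw [mul_pow, Real.sq_sqrt (by positivity)]
  refine h.trans ?_
  calc 10 * n * H * e ^ 2 / τ = 20 * n * H * e ^ 2 / (2 * τ) := by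
        rw [div_eq_div_iff hτ.ne' (by positivity)]; ring
    _ ≤ 20 * n * H * e ^ 2 / sigma n Hk := by gcongr
    _ = _ := by ring

end Perturbation

/-! ### Lower bounds for singular values. -/

section SingularValuesLower

/-- The other half of Courant–Fischer: the range of g has dimension greater than i, so it contains a
nonzero vector orthogonal to the leading i right singular vectors. -/
theorem le_singularValues_of_injective {E F G : Type*} [NormedAddCommGroup E]
    [InnerProductSpace ℝ E] [FiniteDimensional ℝ E] [NormedAddCommGroup F] [InnerProductSpace ℝ F]
    [FiniteDimensional ℝ F] [AddCommGroup G] [Module ℝ G] [FiniteDimensional ℝ G]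
    (f : E →ₗ[ℝ] F) (g : G →ₗ[ℝ] E) (hg : Function.Injective g) {i : ℕ} {c : ℝ} (hc : 0 ≤ c)
    (hi : i < Module.finrank ℝ G) (h : ∀ v, c * ‖g v‖ ≤ ‖f (g v)‖) : c ≤ f.singularValues i := by
  have hiE : i < Module.finrank ℝ E := hi.trans_le (LinearMap.finrank_le_finrank_of_injective hg)
  have hsq := f.sq_singularValues_of_lt rfl hiE
  set hsym := f.isSymmetric_adjoint_comp_self
  let b := hsym.eigenvectorBasis rfl
  let e : G →ₗ[ℝ] (Fin i → ℝ) := LinearMap.pi fun j =>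
    (innerₛₗ ℝ (b (Fin.castLE hiE.le j))) ∘ₗ g
  have hrk : Module.finrank ℝ (LinearMap.range e) < Module.finrank ℝ G := by
    have h1 := Submodule.finrank_le (LinearMap.range e)
    simp only [Module.finrank_fintype_fun_eq_card, Fintype.card_fin] at h1
    omega
  obtain ⟨v, hv0, hv⟩ := exists_ne_zero_map_eq_zero _ hrk
  have hcoord : ∀ j : Fin (Module.finrank ℝ E), (j : ℕ) < i → inner ℝ (b j) (g v) = (0 : ℝ) := by
    intro j hj
    have := congrFun hv ⟨j, hj⟩
    simpa [e] using this
  have hx0 : 0 < ‖g v‖ := norm_pos_iff.2 fun h0 => hv0 (hg (by rw [h0, map_zero]))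
  have hfn : ‖f (g v)‖ ^ 2 ≤ f.singularValues i ^ 2 * ‖g v‖ ^ 2 := by
    have h1 : ‖f (g v)‖ ^ 2 = inner ℝ (g v) ((f.adjoint ∘ₗ f) (g v)) := by
      rw [LinearMap.comp_apply, LinearMap.adjoint_inner_right, real_inner_self_eq_norm_sq]
    have h2 : ∀ j, inner ℝ (b j) ((f.adjoint ∘ₗ f) (g v))
        = hsym.eigenvalues rfl j * inner ℝ (b j) (g v) := by
      intro j
      rw [← hsym, hsym.apply_eigenvectorBasis rfl, real_inner_smul_left]
      simp [b]
    have h3 : ∑ j, inner ℝ (b j) (g v) ^ 2 = ‖g v‖ ^ 2 := by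
      simpa using b.sum_sq_norm_inner_right (g v)
    rw [h1, ← b.sum_inner_mul_inner, hsq, ← h3, Finset.mul_sum]
    refine Finset.sum_le_sum fun j _ => ?_
    rw [h2, real_inner_comm]
    by_cases hj : (j : ℕ) < i
    · rw [hcoord j hj]
      simp
    · have h4 : hsym.eigenvalues rfl j ≤ hsym.eigenvalues rfl ⟨i, hiE⟩ :=
        hsym.eigenvalues_antitone rfl (Fin.le_def.2 (by simpa using hj))
      nlinarith [sq_nonneg (inner ℝ (b j) (g v))]
  have h5 : c ^ 2 * ‖g v‖ ^ 2 ≤ f.singularValues i ^ 2 * ‖g v‖ ^ 2 := by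
    refine le_trans ?_ hfn
    rw [← mul_pow]
    have := h v
    gcongr
  exact le_of_sq_le_sq (le_of_mul_le_mul_right h5 (by positivity)) (f.singularValues_nonneg i)

/-- The test space is the range of Wᵀ, of dimension n. There ‖WWᵀv‖ ≥ y₀‖Wᵀv‖, by Cauchy–Schwarz
applied to ‖Wᵀv‖² = ⟨v, WWᵀv⟩. -/
theorem FactorBounds.le_sigma {ι κ : Type*} [Fintype ι] [Fintype κ] [DecidableEq ι]
    [DecidableEq κ] {x₀ x₁ y₀ y₁ : ℝ} {O : Matrix ι (Fin n) ℝ} {W : Matrix (Fin n) κ ℝ}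
    (h : FactorBounds x₀ x₁ y₀ y₁ O W) (hx : 0 < x₀) (hy : 0 < y₀) (hn : 0 < n) :
    x₀ * y₀ ≤ sigma n (O * W) := by
  refine le_singularValues_of_injective _ (Matrix.toEuclideanLin Wᵀ) ?_ (by positivity) ?_ ?_
  · rw [← LinearMap.ker_eq_bot, LinearMap.ker_eq_bot']
    intro v hv
    have h1 := h.right_ge v
    rw [hv, norm_zero] at h1
    have : ‖v‖ ≤ 0 := by
      by_contra hcon
      push Not at hcon
      have := mul_pos hy hcon
      linarith
    exact norm_le_zero_iff.1 this
  · rw [finrank_euclideanSpace, Fintype.card_fin]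
    omega
  · intro v
    rw [toEuclideanLin_mul_apply]
    refine le_trans ?_ (h.left_ge _)
    rw [mul_assoc]
    refine mul_le_mul_of_nonneg_left ?_ hx.le
    rcases eq_or_lt_of_le (norm_nonneg v) with hv | hv
    · have : v = 0 := norm_eq_zero.1 hv.symm
      simp [this]
    · have h1 : ‖Matrix.toEuclideanLin Wᵀ v‖ ^ 2
          ≤ ‖v‖ * ‖Matrix.toEuclideanLin W (Matrix.toEuclideanLin Wᵀ v)‖ := by
        rw [norm_sq_toEuclideanLin, Matrix.transpose_transpose, toEuclideanLin_mul_apply]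
        exact real_inner_le_norm _ _
      have h2 := h.right_ge v
      have h3 := norm_nonneg (Matrix.toEuclideanLin Wᵀ v)
      have h4 : ‖v‖ * (y₀ * ‖Matrix.toEuclideanLin Wᵀ v‖)
          ≤ ‖v‖ * ‖Matrix.toEuclideanLin W (Matrix.toEuclideanLin Wᵀ v)‖ := by nlinarith
      exact le_of_mul_le_mul_left h4 hv

end SingularValuesLower

/-! ### Lipschitz bound for SysId near the true system. -/

section Radius

variable {Θ : LinSys n m p} {L : Matrix (Fin n) (Fin m) ℝ}

/-- The gain is recovered as A⁻¹F, so its error combines the error of F with that of A times the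
gain. -/
theorem norm_filter_gain_estimate_le {A Ah Ad : Matrix (Fin n) (Fin n) ℝ}
    {Lt q : Matrix (Fin n) (Fin m) ℝ} {a η r l : ℝ} (hAd : Ad * Ah = 1) (ha : ‖Ad‖ ≤ a)
    (hA : ‖Ah - A‖ ≤ η) (hq : ‖q - A * Lt‖ ≤ r) (hL : ‖Lt‖ ≤ l) :
    ‖Ad * q - Lt‖ ≤ a * (r + η * l) := by
  have h1 : Ad * q - Lt = Ad * ((q - A * Lt) - (Ah - A) * Lt) := by
    have : (q - A * Lt) - (Ah - A) * Lt = q - Ah * Lt := by rw [Matrix.sub_mul]; abel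
    rw [this, Matrix.mul_sub, ← Matrix.mul_assoc, hAd, Matrix.one_mul]
  rw [h1]
  refine norm_mul_le_mul _ _ ha ((norm_sub_le _ _).trans (add_le_add hq ?_))
  exact norm_mul_le_mul _ _ hA hL

theorem lower_bound_of_close {A Ah Ai : Matrix (Fin n) (Fin n) ℝ} {a : ℝ} (ha : 0 < a)
    (hAi : Ai * A = 1) (hAin : ‖Ai‖ ≤ a) (h : ‖Ah - A‖ ≤ 1 / (2 * a)) (v : Vec n) :
    1 / (2 * a) * ‖v‖ ≤ ‖Matrix.toEuclideanLin Ah v‖ := by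
  have h1 : ‖v‖ ≤ a * ‖Matrix.toEuclideanLin A v‖ := by
    calc ‖v‖ = ‖Matrix.toEuclideanLin (Ai * A) v‖ := by rw [hAi, toEuclideanLin_one_apply]
      _ ≤ ‖Ai‖ * ‖Matrix.toEuclideanLin A v‖ := by
          rw [toEuclideanLin_mul_apply]; exact norm_toEuclideanLin_le _ _
      _ ≤ _ := by gcongr
  have h2 := norm_toEuclideanLin_le (Ah - A) v
  rw [map_sub, LinearMap.sub_apply] at h2
  have h3 := norm_sub_norm_le (Matrix.toEuclideanLin A v) (Matrix.toEuclideanLin Ah v)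
  rw [norm_sub_rev] at h3
  have h4 : ‖Ah - A‖ * ‖v‖ ≤ 1 / (2 * a) * ‖v‖ := by gcongr
  have h5 : 1 / a * ‖v‖ ≤ ‖Matrix.toEuclideanLin A v‖ := by
    rw [div_mul_eq_mul_div, one_mul, div_le_iff₀ ha, mul_comm]
    exact h1
  have h6 : 1 / a * ‖v‖ = 1 / (2 * a) * ‖v‖ + 1 / (2 * a) * ‖v‖ := by field_simp; ring
  linarith

set_option maxHeartbeats 4000000 in
/-- SysId applied to a slightly perturbed input returns a slightly perturbed system, up to an
orthogonal change of coordinates. -/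
theorem exists_sysId_radius (hn : 0 < n) {x₀ x₁ y₀ y₁ : ℝ} (hx : 0 < x₀) (hy : 0 < y₀)
    (hx₁ : 0 ≤ x₁) (hy₁ : 0 ≤ y₁) (hA : IsUnit Θ.A.det) (hfm : ‖filterMat Θ L‖ ≤ 1) :
    ∃ c₀ ε₀ : ℝ, 0 < c₀ ∧ 0 < ε₀ ∧ ∀ d₁ d₂ : ℕ, 0 < d₁ → 0 < d₂ → 2 * d₁ ≤ d₁ + d₂ + 1 →
      FactorBounds x₀ x₁ y₀ y₁ (obsBlock d₁ Θ L) (ctrBlock d₂ Θ L) →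
      (√(x₁ * y₁) / y₀ * ‖filterMat Θ L ^ d₂ * (Θ.A * L)‖) ^ 2
        + (√(x₁ * y₁) / y₀ * ‖filterMat Θ L ^ d₂ * Θ.B‖) ^ 2 ≤ 3 * (x₀ * y₀) →
      ∀ (Mh : Matrix (Fin m) (BlockIdx (d₁ + d₂ + 1) m p) ℝ) (Θh : LinSys n m p)
        (Lh : Matrix (Fin n) (Fin m) ℝ), IsSysIdOutput d₁ d₂ Mh Θh Lh →
      √(d₁ + d₂ + 1 : ℕ) * ‖Mh - arxMatrix (d₁ + d₂ + 1) Θ L‖ ≤ ε₀ →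
      0 < sigma n (hankel d₁ d₂ (arxMatrix (d₁ + d₂ + 1) Θ L)) →
      ∀ G, IsBalancing (obsBlock d₁ Θ L) (ctrBlock d₂ Θ L) G →
      ∃ T ∈ Matrix.orthogonalGroup (Fin n) ℝ, ∀ c : RadiusConst, c₀ ≤ c.c₁ → c₀ ≤ c.c₂ →
        c₀ ≤ c.c₃ →
        InBalls c d₁ d₂ (arxMatrix (d₁ + d₂ + 1) Θ L) Mh Θh Lh T (Θ.conj G) (G⁻¹ * L) := by
  -- Here s bounds the two balanced factors, g and g' bound G and G⁻¹, and τ₀ bounds the smallest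
  -- Gramian eigenvalue from below. With η = √H‖M̂ − M‖, k bounds the pseudo-inverses, bη the factor
  -- errors, a₁ the matrix Ā and a₂ the inverse of A in balanced coordinates, and cA, cL are the
  -- Lipschitz constants for the state matrix and the filter gain.
  set s := √(x₁ * y₁) with hs
  set g := s / x₀ with hg
  set g' := s / y₀ with hg'
  set τ₀ := x₀ * y₀ with hτ₀
  have hτ₀pos : 0 < τ₀ := mul_pos hx hy
  set k := 2 / √τ₀ with hk
  set b := √(20 * n / τ₀) with hb
  set a₁ := g' * g with ha₁
  set a₂ := g' * ‖Θ.A⁻¹‖ * g + 1 with ha₂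
  set cA := k ^ 2 + 3 * k * b * a₁ + b * (2 * s + 1) with hcA
  set cL := 2 * a₂ * (k + k * b * s + cA * (g' * ‖L‖)) with hcL
  have hs0 : 0 ≤ s := Real.sqrt_nonneg _
  have hg0 : 0 ≤ g := by positivity
  have hg'0 : 0 ≤ g' := by positivity
  have hk0 : 0 < k := by positivity
  have hb0 : 0 ≤ b := Real.sqrt_nonneg _
  have ha₁0 : 0 ≤ a₁ := by positivity
  have ha₂0 : 0 < a₂ := by positivity
  have hcA0 : 0 < cA := by positivity
  have hcL0 : 0 ≤ cL := by positivity
  set s₂ := 2 * (x₁ * y₁) + 1 with hs₂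
  have hs₂0 : 0 < s₂ := by positivity
  -- The last three terms of the minimum ensure that the factor error is at most 1, that it is at
  -- most half of √τ₀ so the pseudo-inverses stay bounded, and that the estimated state matrix stays
  -- invertible.
  refine ⟨cA * s₂ + cL * √s₂ + 1,
    min (min 1 (1 / (b + 1))) (min (√τ₀ / (2 * (b + 1))) (1 / (2 * a₂ * cA))),
    by positivity, by positivity, ?_⟩
  intro d₁ d₂ hd₁ hd₂ hdd hfb htail Mh Θh Lh hout hclose hσ G hG
  set M := arxMatrix (d₁ + d₂ + 1) Θ L with hM
  obtain ⟨hOn, hWn, hGn, hGin, τ, q, hτlo, hτhi, hq, heig, hpsd⟩ := hG.bounds hfb hx hy hn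
  have hτpos : 0 < τ := hτ₀pos.trans_le hτlo
  obtain ⟨N, U, d, V, Oh, Od, Wh, Wd, F, Ad, htr, hsvd, hO, hW, hC, hB, hF, hOd, hWd, hAh, hAd,
    hLh⟩ := hout
  set O := obsBlock d₁ Θ L * G with hOdef
  set W := G⁻¹ * ctrBlock d₂ Θ L with hWdef
  set e := ‖Mh - M‖ with he
  have he0 : 0 ≤ e := norm_nonneg _
  set H : ℝ := ((d₁ + d₂ + 1 : ℕ) : ℝ) with hH
  set η := √H * e with hη
  have hη0 : 0 ≤ η := by positivity
  have hη1 : η ≤ 1 / (b + 1) := hclose.trans ((min_le_left _ _).trans (min_le_right _ _))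
  have hη2 : η ≤ √τ₀ / (2 * (b + 1)) := hclose.trans ((min_le_right _ _).trans (min_le_left _ _))
  have hη3 : η ≤ 1 / (2 * a₂ * cA) := hclose.trans ((min_le_right _ _).trans (min_le_right _ _))
  -- the Hankel matrices are close
  set η' := √(d₁ : ℝ) * e with hη'
  -- Keeping d₁ ≤ H/2 instead of d₁ ≤ H saves the factor 2 needed for the radii of B and C.
  have hη'2 : η' ^ 2 ≤ H * e ^ 2 / 2 := by
    rw [hη', mul_pow, Real.sq_sqrt (Nat.cast_nonneg _)]
    have h2 : (2 : ℝ) * d₁ ≤ H := by rw [hH]; exact_mod_cast hdd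
    have h3 := mul_le_mul_of_nonneg_right h2 (sq_nonneg e)
    linarith only [h3]
  have hη'η : η' ≤ η := by
    rw [hη', hη]
    have : (d₁ : ℝ) ≤ H := by rw [hH]; exact_mod_cast (by omega : d₁ ≤ d₁ + d₂ + 1)
    gcongr
  have hη'0 : 0 ≤ η' := by positivity
  have hOW : O * W = hankelMinus d₁ d₂ M := by
    rw [hM, hankelMinus_arxMatrix, hOdef, hWdef, Matrix.mul_assoc, ← Matrix.mul_assoc G,
      Matrix.mul_nonsing_inv _ hG.unit, Matrix.one_mul]
  set Ab := G⁻¹ * filterMat Θ L * G with hAb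
  have hOAW : O * Ab * W = hankelPlus d₁ d₂ M := by
    rw [hM, hankelPlus_arxMatrix, hOdef, hWdef, hAb]
    calc obsBlock d₁ Θ L * G * (G⁻¹ * filterMat Θ L * G) * (G⁻¹ * ctrBlock d₂ Θ L)
        = obsBlock d₁ Θ L * (G * G⁻¹) * filterMat Θ L * (G * G⁻¹) * ctrBlock d₂ Θ L := by
          simp only [Matrix.mul_assoc]
      _ = _ := by rw [Matrix.mul_nonsing_inv _ hG.unit, Matrix.mul_one, Matrix.mul_one]
  have hm : ‖hankelMinus d₁ d₂ Mh - O * W‖ ≤ η' := by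
    rw [hOW]; exact norm_hankelMinus_sub_le d₁ d₂ Mh M
  have hp : ‖hankelPlus d₁ d₂ Mh - O * Ab * W‖ ≤ η' := by
    rw [hOAW]; exact norm_hankelPlus_sub_le d₁ d₂ Mh M
  obtain ⟨hOWh, hbalh⟩ := hsvd.balanced
  rw [← hO, ← hW] at hOWh hbalh
  obtain ⟨T, hT, hΔO, hΔW⟩ := exists_orthogonal_factor_close hτpos hG.balanced hpsd hm htr
    hOWh hbalh
  have hbound : 20 * n * η' ^ 2 / τ ≤ 10 * n * H * e ^ 2 / τ := by
    refine div_le_div_of_nonneg_right ?_ hτpos.le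
    have h3 := mul_le_mul_of_nonneg_left hη'2 (by positivity : (0 : ℝ) ≤ 20 * n)
    linarith only [h3]
  set δ := b * η with hδ
  have hδ0 : 0 ≤ δ := by positivity
  have hδsq : 20 * n * η' ^ 2 / τ ≤ δ ^ 2 := by
    rw [hδ, mul_pow b η, hb, Real.sq_sqrt (by positivity)]
    calc 20 * n * η' ^ 2 / τ ≤ 20 * n * η ^ 2 / τ₀ := by gcongr
      _ = _ := by ring
  have hΔO' : ‖Oh - O * T‖ ≤ δ := le_of_sq_le_sq (hΔO.trans hδsq) hδ0
  have hΔW' : ‖Wh - Tᵀ * W‖ ≤ δ := le_of_sq_le_sq (hΔW.trans hδsq) hδ0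
  have hb1 : 0 < b + 1 := by positivity
  have hδτ : 2 * δ ≤ √τ₀ := by
    rw [le_div_iff₀ (by positivity)] at hη2
    rw [hδ]; linarith only [hη2, hη0]
  have hδ1 : δ ≤ 1 := by
    rw [le_div_iff₀ hb1] at hη1
    rw [hδ]; linarith only [hη1, hη0]
  have hsτ : 0 < √τ₀ := Real.sqrt_pos.2 hτ₀pos
  have hOlow : ∀ v : Vec n, √τ₀ * ‖v‖ ≤ ‖Matrix.toEuclideanLin O v‖ := fun v =>
    (mul_le_mul_of_nonneg_right (Real.sqrt_le_sqrt hτlo) (norm_nonneg _)).trans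
      (lower_bound_of_posSemidef hτpos hpsd v)
  have hWlow : ∀ v : Vec n, √τ₀ * ‖v‖ ≤ ‖Matrix.toEuclideanLin Wᵀ v‖ := fun v => by
    have h1 : ‖Matrix.toEuclideanLin Wᵀ v‖ ^ 2 = ‖Matrix.toEuclideanLin O v‖ ^ 2 := by
      rw [norm_sq_toEuclideanLin, norm_sq_toEuclideanLin, Matrix.transpose_transpose,
        ← hG.balanced]
    rw [(sq_eq_sq₀ (norm_nonneg _) (norm_nonneg _)).1 h1]
    exact hOlow v
  obtain ⟨hOd1, hOdn⟩ := hOd.bounds_of_close hsτ hOlow hT hΔO' hδτ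
  have hΔW'' : ‖Whᵀ - Wᵀ * T‖ ≤ δ := by
    have : Whᵀ - Wᵀ * T = (Wh - Tᵀ * W)ᵀ := by
      rw [Matrix.transpose_sub, Matrix.transpose_mul Tᵀ W, Matrix.transpose_transpose]
    rw [this, norm_transpose]
    exact hΔW'
  obtain ⟨hWd1, hWdn⟩ := hWd.transpose.bounds_of_close hsτ hWlow hT hΔW'' hδτ
  rw [norm_transpose] at hWdn
  replace hWd1 : Wh * Wd = 1 := by simpa using congrArg Matrix.transpose hWd1
  have hkδ : k * δ ≤ 1 := by
    rw [hk, div_mul_eq_mul_div, div_le_one hsτ]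
    exact hδτ
  have hAbn : ‖Ab‖ ≤ a₁ := by
    have := norm_mul_le_mul _ _ (norm_mul_le_mul _ _ hGin hfm) hGn
    rwa [mul_one] at this
  have hshift := norm_shift_estimate_le hp hT hOd1 hWd1 hOdn hWdn hΔO' hΔW' hkδ hAbn
  have hleft := norm_left_estimate_le hm hT hOd1 hOdn hΔO' hWn
  have hTT := transpose_mul_self_of_mem_orthogonal hT
  have hTT' := mul_transpose_self_of_mem_orthogonal hT
  have hTn := norm_le_one_of_mem_orthogonal hT
  have hTn' : ‖Tᵀ‖ ≤ 1 := by rw [norm_transpose]; exact hTn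
  -- output matrix
  have hCd : ‖Θh.C - Θ.C * G * T‖ ≤ ‖Oh - O * T‖ := by
    refine norm_first_rows_le hd₁ _ _ fun a j => ?_
    rw [Matrix.sub_apply, Matrix.sub_apply, hC ⟨0, hd₁⟩ rfl, hOdef, Matrix.mul_assoc,
      Matrix.mul_assoc, obsBlock_mul_zero_row _ rfl]
  have hBd : ‖Θh.B - Tᵀ * (G⁻¹ * Θ.B)‖ ≤ ‖Wh - Tᵀ * W‖ := by
    refine norm_first_cols_inr_le hd₂ _ _ fun a j => ?_
    rw [Matrix.sub_apply, Matrix.sub_apply, hB ⟨0, hd₂⟩ rfl, hWdef, ← Matrix.mul_assoc,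
      ← Matrix.mul_assoc, mul_ctrBlock_zero_inr _ rfl]
  have hFd : ‖F - Tᵀ * (G⁻¹ * (Θ.A * L))‖ ≤ ‖Wh - Tᵀ * W‖ := by
    refine norm_first_cols_inl_le hd₂ _ _ fun a j => ?_
    rw [Matrix.sub_apply, Matrix.sub_apply, hF ⟨0, hd₂⟩ rfl, hWdef, ← Matrix.mul_assoc,
      ← Matrix.mul_assoc Tᵀ G⁻¹ (ctrBlock d₂ Θ L), mul_ctrBlock_zero_inl _ rfl]
  have hFn : ‖G⁻¹ * (Θ.A * L)‖ ≤ s := by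
    refine (norm_first_cols_inl_le hd₂ W _ fun a j => ?_).trans hWn
    rw [hWdef, mul_ctrBlock_zero_inl _ rfl]
  have hCn : ‖Θ.C * G‖ ≤ s := by
    refine (norm_first_rows_le hd₁ O _ fun a j => ?_).trans hOn
    rw [hOdef, obsBlock_mul_zero_row _ rfl]
  -- state matrix
  have hAd1 : ‖Θh.A - Tᵀ * (Θ.conj G).A * T‖ ≤ cA * η := by
    have e1 : Tᵀ * (Θ.conj G).A * T
        = Tᵀ * Ab * T + Tᵀ * (G⁻¹ * (Θ.A * L)) * (Θ.C * G * T) := by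
      have h1 := mul_filterMat_mul_add (Θ := Θ) (L := L) (Tᵀ * G⁻¹) (G * T)
      simp only [LinSys.conj, hAb]
      simp only [Matrix.mul_assoc] at h1 ⊢
      exact h1.symm
    have e2 : Θh.A - Tᵀ * (Θ.conj G).A * T
        = (Od * hankelPlus d₁ d₂ Mh * Wd - Tᵀ * Ab * T)
          + ((F - Tᵀ * (G⁻¹ * (Θ.A * L))) * Θh.C
            + Tᵀ * (G⁻¹ * (Θ.A * L)) * (Θh.C - Θ.C * G * T)) := by
      rw [hAh, e1, Matrix.sub_mul, Matrix.mul_sub]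
      abel
    have hChn : ‖Θh.C‖ ≤ s + 1 := by
      have h1 : Θh.C = (Θh.C - Θ.C * G * T) + Θ.C * G * T := by abel
      rw [h1]
      refine (norm_add_le _ _).trans ?_
      have h2 := norm_mul_le_mul _ _ hCn hTn
      rw [mul_one] at h2
      linarith [hCd.trans hΔO']
    have t1 := norm_mul_le_mul _ _ (hFd.trans hΔW') hChn
    have t2 := norm_mul_le_mul _ _ (norm_mul_le_mul _ _ hTn' hFn) (hCd.trans hΔO')
    rw [e2]
    refine (norm_add_le _ _).trans ?_
    have t3 := norm_add_le ((F - Tᵀ * (G⁻¹ * (Θ.A * L))) * Θh.C)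
      (Tᵀ * (G⁻¹ * (Θ.A * L)) * (Θh.C - Θ.C * G * T))
    have t4 : k ^ 2 * η' ≤ k ^ 2 * η := by gcongr
    have t5 : cA * η = k ^ 2 * η + 3 * k * δ * a₁ + (δ * (s + 1) + 1 * s * δ) := by
      rw [hcA, hδ]; ring
    linarith
  -- filter gain
  have hLd : ‖Lh - Tᵀ * (G⁻¹ * L)‖ ≤ cL * η := by
    have hAinv : Tᵀ * (G⁻¹ * Θ.A⁻¹ * G) * T * (Tᵀ * (Θ.conj G).A * T) = 1 := by
      simp only [LinSys.conj]
      calc Tᵀ * (G⁻¹ * Θ.A⁻¹ * G) * T * (Tᵀ * (G⁻¹ * Θ.A * G) * T)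
          = Tᵀ * (G⁻¹ * Θ.A⁻¹ * G) * (T * Tᵀ) * (G⁻¹ * Θ.A * G) * T := by
            simp only [Matrix.mul_assoc]
        _ = Tᵀ * (G⁻¹ * Θ.A⁻¹ * (G * G⁻¹) * Θ.A * G) * T := by
            rw [hTT', Matrix.mul_one]; simp only [Matrix.mul_assoc]
        _ = Tᵀ * (G⁻¹ * (Θ.A⁻¹ * Θ.A) * G) * T := by
            rw [Matrix.mul_nonsing_inv _ hG.unit, Matrix.mul_one]; simp only [Matrix.mul_assoc]
        _ = 1 := by
            rw [Matrix.nonsing_inv_mul _ hA, Matrix.mul_one, Matrix.nonsing_inv_mul _ hG.unit,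
              Matrix.mul_one, hTT]
    have hAinvn : ‖Tᵀ * (G⁻¹ * Θ.A⁻¹ * G) * T‖ ≤ a₂ := by
      have h1 := norm_mul_le_mul _ _ (norm_mul_le_mul _ _ hTn'
        (norm_mul_le_mul _ _ (norm_mul_le_mul _ _ hGin (le_refl ‖Θ.A⁻¹‖)) hGn)) hTn
      rw [one_mul, mul_one] at h1
      linarith
    have hclA : ‖Θh.A - Tᵀ * (Θ.conj G).A * T‖ ≤ 1 / (2 * a₂) := by
      refine hAd1.trans ?_
      rw [le_div_iff₀ (by positivity)] at hη3
      rw [le_div_iff₀ (by positivity)]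
      linarith only [hη3]
    obtain ⟨hAd2, hAdn⟩ := hAd.mul_eq_one_of_lower_bound (c := 1 / (2 * a₂)) (by positivity)
      (lower_bound_of_close ha₂0 hAinv hAinvn hclA)
    rw [one_div, inv_inv] at hAdn
    -- Q is the first block column of Ô†ℋ̂⁻ and estimates F; the estimated gain is Â†Q.
    let Q : Matrix (Fin n) (Fin m) ℝ := Matrix.of fun i a =>
      (Od * hankelMinus d₁ d₂ Mh) i (Sum.inl (⟨0, hd₂⟩, a))
    have hLQ : Lh = Ad * Q := by
      ext i a
      rw [hLh ⟨0, hd₂⟩ rfl, Matrix.mul_assoc, Matrix.mul_apply, Matrix.mul_apply]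
      rfl
    have hFA : Tᵀ * (G⁻¹ * (Θ.A * L)) = Tᵀ * (Θ.conj G).A * T * (Tᵀ * (G⁻¹ * L)) := by
      simp only [LinSys.conj]
      calc Tᵀ * (G⁻¹ * (Θ.A * L)) = Tᵀ * (G⁻¹ * Θ.A * (G * G⁻¹) * L) := by
            rw [Matrix.mul_nonsing_inv _ hG.unit, Matrix.mul_one, Matrix.mul_assoc G⁻¹]
        _ = Tᵀ * (G⁻¹ * Θ.A * G) * (T * Tᵀ) * (G⁻¹ * L) := by
            rw [hTT', Matrix.mul_one]; simp only [Matrix.mul_assoc]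
        _ = _ := by simp only [Matrix.mul_assoc]
    have hQ : ‖Q - Tᵀ * (Θ.conj G).A * T * (Tᵀ * (G⁻¹ * L))‖ ≤ k * η' + k * δ * s := by
      rw [← hFA]
      refine (norm_first_cols_inl_le hd₂ (Od * hankelMinus d₁ d₂ Mh - Tᵀ * W) _
        fun i a => ?_).trans hleft
      rw [Matrix.sub_apply, Matrix.sub_apply, hWdef, ← Matrix.mul_assoc Tᵀ G⁻¹ (ctrBlock d₂ Θ L),
        mul_ctrBlock_zero_inl _ rfl, Matrix.mul_assoc Tᵀ]
      rfl
    have hLn : ‖Tᵀ * (G⁻¹ * L)‖ ≤ g' * ‖L‖ := by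
      have := norm_mul_le_mul _ _ hTn' (norm_mul_le_mul _ _ hGin (le_refl ‖L‖))
      rwa [one_mul] at this
    have hfin := norm_filter_gain_estimate_le hAd2 hAdn hAd1 hQ hLn
    rw [hLQ]
    refine hfin.trans ?_
    have t4 : k * η' ≤ k * η := by gcongr
    calc 2 * a₂ * (k * η' + k * δ * s + cA * η * (g' * ‖L‖))
        ≤ 2 * a₂ * (k * η + k * δ * s + cA * η * (g' * ‖L‖)) := by gcongr
      _ = cL * η := by rw [hcL, hδ]; ring
  -- comparison with the radii
  have hστ : sigma n (hankel d₁ d₂ M) ≤ 2 * τ := by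
    refine sigma_hankel_le hG hτpos.le hq heig (le_trans ?_ (htail.trans (by linarith)))
    have t1 := norm_mul_le_mul _ _ hGin (le_refl ‖filterMat Θ L ^ d₂ * (Θ.A * L)‖)
    have t2 := norm_mul_le_mul _ _ hGin (le_refl ‖filterMat Θ L ^ d₂ * Θ.B‖)
    gcongr
  have hσs : sigma n (hankel d₁ d₂ M) ≤ s₂ := by linarith
  refine ⟨T, hT, fun c hc₁ hc₂ hc₃ => ⟨?_, ?_, ?_, ?_⟩⟩
  · refine hAd1.trans (mul_le_betaA hn he0 hσ hσs hcA0.le (le_trans ?_ hc₁))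
    have : 0 ≤ cL * √s₂ := by positivity
    linarith
  · exact le_betaB he0 hσ hστ
      ((pow_le_pow_left₀ (norm_nonneg _) hBd 2).trans (hΔW.trans hbound))
  · exact le_betaB he0 hσ hστ
      ((pow_le_pow_left₀ (norm_nonneg _) hCd 2).trans (hΔO.trans hbound))
  · have h0 : 0 ≤ cA * s₂ + cL * √s₂ + 1 := by positivity
    refine hLd.trans (mul_le_betaL hn he0 hσ hσs hcL0 (h0.trans hc₁) (h0.trans hc₂)
      (le_trans ?_ hc₃))
    have : 0 ≤ cA * s₂ := by positivity
    linarith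

end Radius

/-! ### Observability and controllability as window-independent factor bounds. -/

section RankConditions

theorem eq_zero_of_rank_eq {ι : Type*} [Fintype ι] {X : Matrix ι (Fin n) ℝ} (h : X.rank = n)
    {v : Fin n → ℝ} (hv : X.mulVec v = 0) : v = 0 := by
  have h1 := LinearMap.finrank_range_add_finrank_ker X.mulVecLin
  rw [Module.finrank_fintype_fun_eq_card, Fintype.card_fin] at h1
  rw [Matrix.rank] at h
  have h2 : Module.finrank ℝ (LinearMap.ker X.mulVecLin) = 0 := by omega
  have h3 := Submodule.finrank_eq_zero.1 h2
  have : v ∈ LinearMap.ker X.mulVecLin := by simpa using hv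
  rwa [h3, Submodule.mem_bot] at this

theorem Observable.eq_zero {A : Matrix (Fin n) (Fin n) ℝ} {C : Matrix (Fin m) (Fin n) ℝ}
    (h : Observable A C) {v : Vec n}
    (hv : ∀ i < n, Matrix.toEuclideanLin (C * A ^ i) v = 0) : v = 0 := by
  have h1 := eq_zero_of_rank_eq h (v := v.ofLp) <| by
    ext ⟨k, i⟩
    have := congrArg (fun x : Vec m => x i) (hv k k.2)
    exact this
  ext i
  simpa using congrFun h1 i

theorem Controllable.eq_zero {q : ℕ} {A : Matrix (Fin n) (Fin n) ℝ} {B : Matrix (Fin n) (Fin q) ℝ}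
    (h : Controllable A B) {v : Vec n}
    (hv : ∀ i < n, Matrix.toEuclideanLin (A ^ i * B)ᵀ v = 0) : v = 0 := by
  have h' : (ctrbMatrix A B)ᵀ.rank = n := by rw [Matrix.rank_transpose]; exact h
  have h1 := eq_zero_of_rank_eq h' (v := v.ofLp) <| by
    ext ⟨k, i⟩
    have := congrArg (fun x : Vec q => x i) (hv k k.2)
    exact this
  ext i
  simpa using congrFun h1 i

/-- Every block AⁱAL begins with a factor A, so a vector killed by Aᵀ is orthogonal to all reachable
directions. -/
theorem Controllable.isUnit_det {A : Matrix (Fin n) (Fin n) ℝ} {L : Matrix (Fin n) (Fin m) ℝ}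
    (h : Controllable A (A * L)) : IsUnit A.det := by
  suffices hT : IsUnit Aᵀ.det by rwa [Matrix.det_transpose] at hT
  refine isUnit_det_of_injective fun v hv => h.eq_zero fun i _ => ?_
  have : (A ^ i * (A * L))ᵀ = Lᵀ * (Aᵀ ^ i * Aᵀ) := by
    rw [← pow_succ, ← Matrix.transpose_pow, ← Matrix.transpose_mul, pow_succ, Matrix.mul_assoc]
  rw [this, toEuclideanLin_mul_apply, toEuclideanLin_mul_apply, hv, map_zero, map_zero]

/-- Output injection is invisible along trajectories with zero output. This carries observability
from (A, C) to (Ā, C) and, transposed, controllability to Ā. -/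
theorem pow_apply_eq_of_annihilates {q : ℕ} {A Ab : Matrix (Fin n) (Fin n) ℝ}
    {X : Matrix (Fin q) (Fin n) ℝ} {Y : Matrix (Fin n) (Fin q) ℝ} (h : Ab = A - Y * X) {v : Vec n}
    {N : ℕ} (h0 : ∀ i < N, Matrix.toEuclideanLin (X * Ab ^ i) v = 0) :
    ∀ i ≤ N, Matrix.toEuclideanLin (Ab ^ i) v = Matrix.toEuclideanLin (A ^ i) v := by
  intro i
  induction i with
  | zero => intro _; simp
  | succ i ih =>
    intro hi
    have h1 := h0 i (by omega)
    have h2 : Ab ^ (i + 1) = A * Ab ^ i - Y * (X * Ab ^ i) := by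
      rw [pow_succ', ← Matrix.mul_assoc Y X, ← Matrix.sub_mul, ← h]
    rw [h2, map_sub, LinearMap.sub_apply, toEuclideanLin_mul_apply, toEuclideanLin_mul_apply Y, h1,
      map_zero, sub_zero, ih (by omega), pow_succ', toEuclideanLin_mul_apply]

theorem exists_lower_bound {ι : Type*} [Fintype ι] (X : Matrix ι (Fin n) ℝ)
    (h : ∀ v : Vec n, Matrix.toEuclideanLin X v = 0 → v = 0) :
    ∃ c : ℝ, 0 < c ∧ ∀ v : Vec n, c * ‖v‖ ≤ ‖Matrix.toEuclideanLin X v‖ := by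
  obtain ⟨K, hK, hanti⟩ := LinearMap.exists_antilipschitzWith (Matrix.toEuclideanLin X)
    (LinearMap.ker_eq_bot'.2 h)
  refine ⟨(K : ℝ)⁻¹, by positivity, fun v => ?_⟩
  have h1 := hanti.le_mul_dist v 0
  rw [dist_zero_right, map_zero, dist_zero_right] at h1
  rw [inv_mul_le_iff₀ (by exact_mod_cast hK)]
  exact h1

theorem obsBlock_eq_zero {Θ : LinSys n m p} (L : Matrix (Fin n) (Fin m) ℝ)
    (h : Observable Θ.A Θ.C) {v : Vec n}
    (hv : Matrix.toEuclideanLin (obsBlock n Θ L) v = 0) : v = 0 := by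
  have h1 : ∀ i < n, Matrix.toEuclideanLin (Θ.C * filterMat Θ L ^ i) v = 0 := by
    intro i hi
    have h2 := norm_sq_obsBlock Θ L n v
    rw [hv, norm_zero, zero_pow two_ne_zero, eq_comm,
      Finset.sum_eq_zero_iff_of_nonneg fun _ _ => sq_nonneg _] at h2
    have h3 := h2 ⟨i, hi⟩ (Finset.mem_univ _)
    simpa using h3
  refine h.eq_zero fun i hi => ?_
  have h2 := pow_apply_eq_of_annihilates (A := Θ.A) (Y := Θ.A * L) rfl h1 i hi.le
  rw [toEuclideanLin_mul_apply, ← h2, ← toEuclideanLin_mul_apply]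
  exact h1 i hi

/-- Vanishing on the blocks ĀⁱF allows Āᵀ to be replaced by Aᵀ on v; the blocks ĀⁱB then become AⁱB.
-/
theorem ctrBlock_transpose_eq_zero {Θ : LinSys n m p} (L : Matrix (Fin n) (Fin m) ℝ)
    (h : Controllable Θ.A Θ.B) {v : Vec n}
    (hv : Matrix.toEuclideanLin (ctrBlock n Θ L)ᵀ v = 0) : v = 0 := by
  have h1 : ∀ i < n, Matrix.toEuclideanLin (filterMat Θ L ^ i * (Θ.A * L))ᵀ v = 0 ∧
      Matrix.toEuclideanLin (filterMat Θ L ^ i * Θ.B)ᵀ v = 0 := by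
    intro i hi
    have h2 := norm_sq_ctrBlock_transpose Θ L n v
    rw [hv, norm_zero, zero_pow two_ne_zero, eq_comm,
      Finset.sum_eq_zero_iff_of_nonneg fun _ _ => by positivity] at h2
    have h3 := h2 ⟨i, hi⟩ (Finset.mem_univ _)
    rw [add_eq_zero_iff_of_nonneg (sq_nonneg _) (sq_nonneg _)] at h3
    exact ⟨by simpa using h3.1, by simpa using h3.2⟩
  refine h.eq_zero fun i hi => ?_
  have h2 := pow_apply_eq_of_annihilates (A := Θ.Aᵀ) (Ab := (filterMat Θ L)ᵀ) (X := (Θ.A * L)ᵀ)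
    (Y := Θ.Cᵀ) (v := v) (N := n)
    (by rw [filterMat, Matrix.transpose_sub, ← Matrix.transpose_mul])
    (fun i hi => by
      rw [← Matrix.transpose_pow, ← Matrix.transpose_mul]; exact (h1 i hi).1) i hi.le
  rw [Matrix.transpose_mul, toEuclideanLin_mul_apply, Matrix.transpose_pow, ← h2,
    ← Matrix.transpose_pow, ← toEuclideanLin_mul_apply, ← Matrix.transpose_mul, (h1 i hi).2]

theorem sum_geometric_sq_le {a : ℕ → ℝ} {c r : ℝ} (hr0 : 0 ≤ r) (hr1 : r < 1)
    (h : ∀ i, a i ≤ (c * r ^ i) ^ 2) (d : ℕ) : ∑ i ∈ Finset.range d, a i ≤ c ^ 2 / (1 - r) := by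
  have h1 : ∀ i ∈ Finset.range d, a i ≤ c ^ 2 * r ^ i := by
    intro i _
    refine (h i).trans ?_
    rw [mul_pow]
    refine mul_le_mul_of_nonneg_left ?_ (sq_nonneg c)
    rw [← pow_mul, mul_comm, pow_mul, pow_two]
    exact pow_le_pow_left₀ (by positivity) (by nlinarith) _
  refine (Finset.sum_le_sum h1).trans ?_
  rw [← Finset.mul_sum, div_eq_mul_inv]
  refine mul_le_mul_of_nonneg_left ?_ (sq_nonneg c)
  rw [← tsum_geometric_of_lt_one hr0 hr1]
  exact (summable_geometric_of_lt_one hr0 hr1).sum_le_tsum _ fun _ _ => by positivity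

theorem norm_pow_le_pow {A : Matrix (Fin n) (Fin n) ℝ} {r : ℝ} (hr : ‖A‖ ≤ r) (i : ℕ) :
    ‖A ^ i‖ ≤ r ^ i := by
  have hr0 : 0 ≤ r := (norm_nonneg _).trans hr
  induction i with
  | zero =>
    rw [pow_zero, pow_zero]
    exact norm_le_one_of_mem_orthogonal (one_mem _)
  | succ i ih => rw [pow_succ, pow_succ]; exact norm_mul_le_mul _ _ ih hr

/-- The factors of the Hankel matrix satisfy two-sided bounds that do not depend on the window. -/
theorem exists_factorBounds {Θ : LinSys n m p} {L : Matrix (Fin n) (Fin m) ℝ} {r : ℝ}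
    (hr : ‖filterMat Θ L‖ ≤ r) (hr1 : r < 1) (ho : Observable Θ.A Θ.C)
    (hc : Controllable Θ.A Θ.B) :
    ∃ x₀ x₁ y₀ y₁ : ℝ, 0 < x₀ ∧ 0 ≤ x₁ ∧ 0 < y₀ ∧ 0 ≤ y₁ ∧ ∀ d₁ d₂ : ℕ, n ≤ d₁ → n ≤ d₂ →
      FactorBounds x₀ x₁ y₀ y₁ (obsBlock d₁ Θ L) (ctrBlock d₂ Θ L) := by
  have hr0 : 0 ≤ r := (norm_nonneg _).trans hr
  -- Lower bounds come from the first n blocks, since further blocks only add squares; upper bounds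
  -- come from the geometric decay of the powers of Ā.
  obtain ⟨x₀, hx₀, hx⟩ := exists_lower_bound (obsBlock n Θ L) fun v => obsBlock_eq_zero L ho
  obtain ⟨y₀, hy₀, hy⟩ := exists_lower_bound (ctrBlock n Θ L)ᵀ
    fun v => ctrBlock_transpose_eq_zero L hc
  have hpow : ∀ i, ‖filterMat Θ L ^ i‖ ≤ r ^ i := norm_pow_le_pow hr
  have hr' : 0 < 1 - r := by linarith
  refine ⟨x₀, √(‖Θ.C‖ ^ 2 / (1 - r)), y₀,
    √(‖Θ.A * L‖ ^ 2 / (1 - r) + ‖Θ.B‖ ^ 2 / (1 - r)), hx₀, Real.sqrt_nonneg _, hy₀,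
    Real.sqrt_nonneg _, fun d₁ d₂ hd₁ hd₂ => ⟨fun v => ?_, fun v => ?_, fun v => ?_, fun v => ?_⟩⟩
  · refine (hx v).trans (le_of_sq_le_sq ?_ (norm_nonneg _))
    rw [norm_sq_obsBlock, norm_sq_obsBlock,
      Fin.sum_univ_eq_sum_range fun i => ‖Matrix.toEuclideanLin (Θ.C * filterMat Θ L ^ i) v‖ ^ 2,
      Fin.sum_univ_eq_sum_range fun i => ‖Matrix.toEuclideanLin (Θ.C * filterMat Θ L ^ i) v‖ ^ 2]
    exact Finset.sum_le_sum_of_subset_of_nonneg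
      (Finset.range_subset_range.2 hd₁) fun _ _ _ => sq_nonneg _
  · refine le_of_sq_le_sq ?_ (by positivity)
    rw [norm_sq_obsBlock, mul_pow, Real.sq_sqrt (by positivity),
      Fin.sum_univ_eq_sum_range fun i => ‖Matrix.toEuclideanLin (Θ.C * filterMat Θ L ^ i) v‖ ^ 2]
    refine (sum_geometric_sq_le (c := ‖Θ.C‖ * ‖v‖) hr0 hr1 (fun i => ?_) d₁).trans_eq (by ring)
    refine pow_le_pow_left₀ (norm_nonneg _) ((norm_toEuclideanLin_le _ _).trans ?_) 2
    have := norm_mul_le_mul _ _ (le_refl ‖Θ.C‖) (hpow i)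
    calc _ ≤ ‖Θ.C‖ * r ^ i * ‖v‖ := by gcongr
      _ = _ := by ring
  · refine (hy v).trans (le_of_sq_le_sq ?_ (norm_nonneg _))
    rw [norm_sq_ctrBlock_transpose, norm_sq_ctrBlock_transpose,
      Fin.sum_univ_eq_sum_range fun j =>
        (‖Matrix.toEuclideanLin (filterMat Θ L ^ j * (Θ.A * L))ᵀ v‖ ^ 2
        + ‖Matrix.toEuclideanLin (filterMat Θ L ^ j * Θ.B)ᵀ v‖ ^ 2),
      Fin.sum_univ_eq_sum_range fun j =>
        (‖Matrix.toEuclideanLin (filterMat Θ L ^ j * (Θ.A * L))ᵀ v‖ ^ 2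
        + ‖Matrix.toEuclideanLin (filterMat Θ L ^ j * Θ.B)ᵀ v‖ ^ 2)]
    exact Finset.sum_le_sum_of_subset_of_nonneg
      (Finset.range_subset_range.2 hd₂) fun _ _ _ => by positivity
  · refine le_of_sq_le_sq ?_ (by positivity)
    rw [norm_sq_ctrBlock_transpose, mul_pow, Real.sq_sqrt (by positivity),
      Fin.sum_univ_eq_sum_range fun j =>
        (‖Matrix.toEuclideanLin (filterMat Θ L ^ j * (Θ.A * L))ᵀ v‖ ^ 2
        + ‖Matrix.toEuclideanLin (filterMat Θ L ^ j * Θ.B)ᵀ v‖ ^ 2), Finset.sum_add_distrib,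
      add_mul]
    have key : ∀ {q : ℕ} (X : Matrix (Fin n) (Fin q) ℝ) (i : ℕ),
        ‖Matrix.toEuclideanLin (filterMat Θ L ^ i * X)ᵀ v‖ ^ 2 ≤ (‖X‖ * ‖v‖ * r ^ i) ^ 2 := by
      intro q X i
      refine pow_le_pow_left₀ (norm_nonneg _) ((norm_toEuclideanLin_le _ _).trans ?_) 2
      rw [norm_transpose]
      have := norm_mul_le_mul _ _ (hpow i) (le_refl ‖X‖)
      calc _ ≤ r ^ i * ‖X‖ * ‖v‖ := by gcongr
        _ = _ := by ring
    refine add_le_add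
      ((sum_geometric_sq_le (c := ‖Θ.A * L‖ * ‖v‖) hr0 hr1 (key _) d₂).trans_eq (by ring))
      ((sum_geometric_sq_le (c := ‖Θ.B‖ * ‖v‖) hr0 hr1 (key _) d₂).trans_eq (by ring))

end RankConditions

/-! ### Lower bounds for intertwiners. -/

section Similarity

/-- If an intertwined pair is close to an observable one, the intertwiner is bounded below. -/
theorem exists_intertwiner_lower_bound {q : ℕ} {A : Matrix (Fin n) (Fin n) ℝ}
    {C : Matrix (Fin q) (Fin n) ℝ}
    (h : ∀ v : Vec n, (∀ i < n, Matrix.toEuclideanLin (C * A ^ i) v = 0) → v = 0) (b : ℝ) :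
    ∃ ε₀ c : ℝ, 0 < ε₀ ∧ 0 < c ∧ ∀ (A' At S : Matrix (Fin n) (Fin n) ℝ)
      (C' Ct : Matrix (Fin q) (Fin n) ℝ), ‖A' - A‖ ≤ ε₀ → ‖C' - C‖ ≤ ε₀ → S * A' = At * S →
      C' = Ct * S → ‖At‖ ≤ b → ‖Ct‖ ≤ b →
      ∀ v : Vec n, ‖v‖ ≤ c * ‖Matrix.toEuclideanLin S v‖ := by
  let f : Matrix (Fin n) (Fin n) ℝ × Matrix (Fin q) (Fin n) ℝ → ℝ := fun X =>
    ∑ i ∈ Finset.range n, ‖X.2 * X.1 ^ i - C * A ^ i‖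
  let X : Matrix (Fin n × Fin q) (Fin n) ℝ := Matrix.of fun ia k => (C * A ^ (ia.1 : ℕ)) ia.2 k
  have hXsq : ∀ v : Vec n, ‖Matrix.toEuclideanLin X v‖ ^ 2
      = ∑ i : Fin n, ‖Matrix.toEuclideanLin (C * A ^ (i : ℕ)) v‖ ^ 2 := by
    intro v
    simp only [EuclideanSpace.norm_sq_eq, Fintype.sum_prod_type]
    rfl
  obtain ⟨o, ho, hlow⟩ := exists_lower_bound X fun v hv => h v fun i hi => by
    have h2 := hXsq v
    rw [hv, norm_zero, zero_pow two_ne_zero, eq_comm,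
      Finset.sum_eq_zero_iff_of_nonneg fun _ _ => sq_nonneg _] at h2
    simpa using h2 ⟨i, hi⟩ (Finset.mem_univ _)
  have hlow' : ∀ v : Vec n, o * ‖v‖
      ≤ ∑ i ∈ Finset.range n, ‖Matrix.toEuclideanLin (C * A ^ i) v‖ := by
    intro v
    refine (hlow v).trans (le_of_sq_le_sq ?_ (Finset.sum_nonneg fun _ _ => norm_nonneg _))
    rw [hXsq, Fin.sum_univ_eq_sum_range fun i => ‖Matrix.toEuclideanLin (C * A ^ i) v‖ ^ 2]
    exact Finset.sum_sq_le_sq_sum_of_nonneg fun _ _ => norm_nonneg _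
  have hcont : Continuous f := by fun_prop
  have hf0 : f (A, C) = 0 := by simp [f]
  obtain ⟨ε, hε, hball⟩ := Metric.continuous_iff.1 hcont (A, C) (o / 2) (by positivity)
  refine ⟨ε / 2, (2 / o) * (∑ i ∈ Finset.range n, |b| * |b| ^ i) + 1, by positivity, by positivity,
    fun A' At S C' Ct hA hC hS hCS hAt hCt v => ?_⟩
  have h1 : f (A', C') < o / 2 := by
    have := hball (A', C') (by
      rw [Prod.dist_eq, dist_eq_norm, dist_eq_norm]
      exact max_lt (by linarith) (by linarith))
    rw [hf0, Real.dist_eq, sub_zero] at this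
    exact (le_abs_self _).trans_lt this
  -- Consequently C'A'ⁱ = CtAtⁱS. If Sv were small then so would be all outputs of v, against the
  -- observability of the nearby pair (A, C).
  have hpow : ∀ i, S * A' ^ i = At ^ i * S := by
    intro i
    induction i with
    | zero => simp
    | succ i ih => rw [pow_succ, ← Matrix.mul_assoc, ih, Matrix.mul_assoc, hS, pow_succ,
        Matrix.mul_assoc]
  have h2 : ∀ i ∈ Finset.range n, ‖Matrix.toEuclideanLin (C * A ^ i) v‖
      ≤ |b| * |b| ^ i * ‖Matrix.toEuclideanLin S v‖ + ‖C' * A' ^ i - C * A ^ i‖ * ‖v‖ := by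
    intro i _
    have e1 : C * A ^ i = (Ct * At ^ i) * S - (C' * A' ^ i - C * A ^ i) := by
      rw [hCS, Matrix.mul_assoc Ct S, hpow, ← Matrix.mul_assoc]
      abel
    nth_rw 1 [e1]
    rw [map_sub, LinearMap.sub_apply]
    refine (norm_sub_le _ _).trans (add_le_add ?_ (norm_toEuclideanLin_le _ _))
    rw [toEuclideanLin_mul_apply]
    refine (norm_toEuclideanLin_le _ _).trans (mul_le_mul_of_nonneg_right ?_ (norm_nonneg _))
    exact norm_mul_le_mul _ _ (hCt.trans (le_abs_self b))
      (norm_pow_le_pow (hAt.trans (le_abs_self b)) i)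
  have h3 := (hlow' v).trans (Finset.sum_le_sum h2)
  rw [Finset.sum_add_distrib, ← Finset.sum_mul, ← Finset.sum_mul] at h3
  have h4 : (∑ i ∈ Finset.range n, ‖C' * A' ^ i - C * A ^ i‖) * ‖v‖ ≤ o / 2 * ‖v‖ :=
    mul_le_mul_of_nonneg_right h1.le (norm_nonneg _)
  have h5 : ‖v‖ ≤ 2 / o * ((∑ i ∈ Finset.range n, |b| * |b| ^ i)
      * ‖Matrix.toEuclideanLin S v‖) := by
    rw [div_mul_eq_mul_div, le_div_iff₀ ho]
    linarith
  have h6 := norm_nonneg (Matrix.toEuclideanLin S v)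
  calc _ ≤ _ := h5
    _ ≤ _ := by rw [add_mul, one_mul, mul_assoc]; linarith

theorem norm_inv_le_of_lower_bound {S : Matrix (Fin n) (Fin n) ℝ} {c : ℝ} (hc : 0 ≤ c)
    (hS : IsUnit S.det) (h : ∀ v : Vec n, ‖v‖ ≤ c * ‖Matrix.toEuclideanLin S v‖) :
    ‖S⁻¹‖ ≤ c := by
  refine opNorm_le_of_forall _ hc fun v => ?_
  have := h (Matrix.toEuclideanLin S⁻¹ v)
  rwa [← toEuclideanLin_mul_apply, Matrix.mul_nonsing_inv _ hS, toEuclideanLin_one_apply] at this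

end Similarity

/-! ### Upper bounds for the radii. -/

section RadiusUpperBounds

variable {ι κ : Type*} [Fintype ι] [Fintype κ] [DecidableEq ι] [DecidableEq κ]

theorem betaA_le {c : RadiusConst} {H : ℕ} {Hk : Matrix ι κ ℝ} {e x X : ℝ} (hc : 0 ≤ c.c₁)
    (he : 0 ≤ e) (hx : 0 < x) (hσ : x ≤ sigma n Hk) (hX : ‖Hk‖ ≤ X) (hσX : sigma n Hk ≤ X) :
    betaA c n H Hk e ≤ c.c₁ * (√n * (X + X) / x ^ 2) * (√H * e) := by
  have h0 : 0 ≤ X := (norm_nonneg _).trans hX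
  have hσ0 : 0 < sigma n Hk := hx.trans_le hσ
  rw [betaA, Real.sqrt_mul (Nat.cast_nonneg n)]
  calc c.c₁ * (√n * √H * (‖Hk‖ + sigma n Hk) / sigma n Hk ^ 2) * e
      ≤ c.c₁ * (√n * √H * (X + X) / x ^ 2) * e := by gcongr
    _ = _ := by ring

theorem betaB_le {H : ℕ} {Hk : Matrix ι κ ℝ} {e x : ℝ} (he : 0 ≤ e) (hx : 0 < x)
    (hσ : x ≤ sigma n Hk) : betaB n H Hk e ≤ √(20 * n / x) * (√H * e) := by
  rw [betaB, ← mul_assoc, ← Real.sqrt_mul (by positivity)]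
  refine mul_le_mul_of_nonneg_right (Real.sqrt_le_sqrt ?_) he
  calc 20 * n * H / sigma n Hk ≤ 20 * n * H / x := by gcongr
    _ = _ := by ring

end RadiusUpperBounds

/-! ### Members of the confidence set are close to the truth up to coordinates. -/

section CloseModel

/-- After the change of coordinates `S`, with inverse `S'`, the system `Θt` is `ε`-close to `Θ`. -/
structure CloseModel (g ε : ℝ) (Θ Θt : LinSys n m p) (S S' : Matrix (Fin n) (Fin n) ℝ) : Prop where
  mul_inv : S * S' = 1
  inv_mul : S' * S = 1
  norm_le : ‖S‖ ≤ g
  norm_inv_le : ‖S'‖ ≤ g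
  state : ‖S' * Θt.A * S - Θ.A‖ ≤ ε
  input : ‖S' * Θt.B - Θ.B‖ ≤ ε
  output : ‖Θt.C * S - Θ.C‖ ≤ ε

/-- Two systems that are close to a common one after bounded changes of coordinates are close
to each other, in coordinates whose size is controlled by observability and controllability. -/
theorem exists_closeModel {Θ : LinSys n m p} (ho : Observable Θ.A Θ.C)
    (hc : Controllable Θ.A Θ.B) {γ : ℝ} (hγ : 0 < γ) (b : ℝ) :
    ∃ g : ℝ, ∀ ε : ℝ, 0 < ε → ∃ η : ℝ, 0 < η ∧ ∀ (Θt Θh : LinSys n m p)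
      (G T G' T' : Matrix (Fin n) (Fin n) ℝ), IsUnit G.det → IsUnit G'.det → ‖G‖ ≤ γ → ‖G⁻¹‖ ≤ γ →
      T ∈ Matrix.orthogonalGroup (Fin n) ℝ → T' ∈ Matrix.orthogonalGroup (Fin n) ℝ →
      ‖Θt.A‖ ≤ b → ‖Θt.B‖ ≤ b → ‖Θt.C‖ ≤ b →
      ‖Θh.A - Tᵀ * (Θ.conj G).A * T‖ ≤ η → ‖Θh.B - Tᵀ * (Θ.conj G).B‖ ≤ η →
      ‖Θh.C - (Θ.conj G).C * T‖ ≤ η →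
      ‖Θh.A - T'ᵀ * (Θt.conj G').A * T'‖ ≤ η → ‖Θh.B - T'ᵀ * (Θt.conj G').B‖ ≤ η →
      ‖Θh.C - (Θt.conj G').C * T'‖ ≤ η → ∃ S S', CloseModel g ε Θ Θt S S' := by
  obtain ⟨ε₁, c₁, hε₁, hc₁, h₁⟩ := exists_intertwiner_lower_bound (A := Θ.A) (C := Θ.C)
    (fun v hv => ho.eq_zero hv) b
  obtain ⟨ε₂, c₂, hε₂, hc₂, h₂⟩ := exists_intertwiner_lower_bound (A := Θ.Aᵀ) (C := Θ.Bᵀ)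
    (fun v hv => hc.eq_zero fun i hi => by
      have := hv i hi
      rwa [← Matrix.transpose_pow, ← Matrix.transpose_mul] at this) b
  -- The bound on the coordinates is fixed before ε, because the accuracy demanded later depends on
  -- it.
  refine ⟨max c₁ c₂, fun ε hε => ?_⟩
  set ε' := min ε (min ε₁ ε₂) with hε'
  have hε'0 : 0 < ε' := by positivity
  set γ' := γ * γ + γ with hγ'
  have hγ'0 : 0 < γ' := by positivity
  refine ⟨ε' / (2 * γ'), by positivity, ?_⟩
  intro Θt Θh G T G' T' hG hG' hGn hGin hT hT' hAb hBb hCb hA hB hC hA' hB' hC'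
  have hTT := transpose_mul_self_of_mem_orthogonal hT
  have hTT' := mul_transpose_self_of_mem_orthogonal hT
  have hUU := transpose_mul_self_of_mem_orthogonal hT'
  have hUU' := mul_transpose_self_of_mem_orthogonal hT'
  have hTn := norm_le_one_of_mem_orthogonal hT
  have hTn' : ‖Tᵀ‖ ≤ 1 := by rw [norm_transpose]; exact hTn
  -- the two changes of coordinates and their inverses
  obtain ⟨G₂, hG₂⟩ : ∃ X, X = G * T := ⟨_, rfl⟩
  obtain ⟨J₂, hJ₂⟩ : ∃ X, X = Tᵀ * G⁻¹ := ⟨_, rfl⟩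
  obtain ⟨G₁, hG₁⟩ : ∃ X, X = G' * T' := ⟨_, rfl⟩
  obtain ⟨J₁, hJ₁⟩ : ∃ X, X = T'ᵀ * G'⁻¹ := ⟨_, rfl⟩
  have hGJ : ∀ {X U : Matrix (Fin n) (Fin n) ℝ}, IsUnit X.det → U * Uᵀ = 1 →
      X * U * (Uᵀ * X⁻¹) = 1 := by
    intro X U hX hU
    rw [Matrix.mul_assoc, ← Matrix.mul_assoc U, hU, Matrix.one_mul, Matrix.mul_nonsing_inv _ hX]
  have hGJ₂ : G₂ * J₂ = 1 := by rw [hG₂, hJ₂, hGJ hG hTT']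
  have hGJ₁ : G₁ * J₁ = 1 := by rw [hG₁, hJ₁, hGJ hG' hUU']
  have hJG₂ : J₂ * G₂ = 1 := mul_eq_one_comm.1 hGJ₂
  have hJG₁ : J₁ * G₁ = 1 := mul_eq_one_comm.1 hGJ₁
  have hG₂n : ‖G₂‖ ≤ γ := by
    have := norm_mul_le_mul _ _ hGn hTn
    rwa [mul_one, ← hG₂] at this
  have hJ₂n : ‖J₂‖ ≤ γ := by
    have := norm_mul_le_mul _ _ hTn' hGin
    rwa [one_mul, ← hJ₂] at this
  have e1 : Tᵀ * (Θ.conj G).A * T = J₂ * Θ.A * G₂ := by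
    rw [hJ₂, hG₂, LinSys.conj]; simp only [Matrix.mul_assoc]
  have e2 : T'ᵀ * (Θt.conj G').A * T' = J₁ * Θt.A * G₁ := by
    rw [hJ₁, hG₁, LinSys.conj]; simp only [Matrix.mul_assoc]
  have e3 : Tᵀ * (Θ.conj G).B = J₂ * Θ.B := by rw [hJ₂, LinSys.conj]; simp only [Matrix.mul_assoc]
  have e4 : T'ᵀ * (Θt.conj G').B = J₁ * Θt.B := by
    rw [hJ₁, LinSys.conj]; simp only [Matrix.mul_assoc]
  have e5 : (Θ.conj G).C * T = Θ.C * G₂ := by rw [hG₂, LinSys.conj]; simp only [Matrix.mul_assoc]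
  have e6 : (Θt.conj G').C * T' = Θt.C * G₁ := by
    rw [hG₁, LinSys.conj]; simp only [Matrix.mul_assoc]
  rw [e1] at hA
  rw [e2] at hA'
  rw [e3] at hB
  rw [e4] at hB'
  rw [e5] at hC
  rw [e6] at hC'
  have hη : ε' / (2 * γ') + ε' / (2 * γ') = ε' / γ' := by field_simp; ring
  have dA : ‖J₁ * Θt.A * G₁ - J₂ * Θ.A * G₂‖ ≤ ε' / γ' := by
    have h := norm_sub_le (Θh.A - J₂ * Θ.A * G₂) (Θh.A - J₁ * Θt.A * G₁)
    rw [sub_sub_sub_cancel_left] at h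
    linarith
  have dB : ‖J₁ * Θt.B - J₂ * Θ.B‖ ≤ ε' / γ' := by
    have h := norm_sub_le (Θh.B - J₂ * Θ.B) (Θh.B - J₁ * Θt.B)
    rw [sub_sub_sub_cancel_left] at h
    linarith
  have dC : ‖Θt.C * G₁ - Θ.C * G₂‖ ≤ ε' / γ' := by
    have h := norm_sub_le (Θh.C - Θ.C * G₂) (Θh.C - Θt.C * G₁)
    rw [sub_sub_sub_cancel_left] at h
    linarith
  -- the intertwiner
  obtain ⟨S, hS⟩ : ∃ X, X = G₁ * J₂ := ⟨_, rfl⟩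
  obtain ⟨S', hS'⟩ : ∃ X, X = G₂ * J₁ := ⟨_, rfl⟩
  have hSS' : S * S' = 1 := by
    rw [hS, hS', Matrix.mul_assoc, ← Matrix.mul_assoc J₂, hJG₂, Matrix.one_mul, hGJ₁]
  have hS'S : S' * S = 1 := mul_eq_one_comm.1 hSS'
  have fA : S' * Θt.A * S - Θ.A = G₂ * (J₁ * Θt.A * G₁ - J₂ * Θ.A * G₂) * J₂ := by
    rw [hS, hS', Matrix.mul_sub, Matrix.sub_mul]
    congr 1
    · simp only [Matrix.mul_assoc]
    · calc Θ.A = (G₂ * J₂) * Θ.A * (G₂ * J₂) := by rw [hGJ₂, Matrix.one_mul, Matrix.mul_one]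
        _ = _ := by simp only [Matrix.mul_assoc]
  have fB : S' * Θt.B - Θ.B = G₂ * (J₁ * Θt.B - J₂ * Θ.B) := by
    rw [hS', Matrix.mul_sub]
    congr 1
    · simp only [Matrix.mul_assoc]
    · rw [← Matrix.mul_assoc, hGJ₂, Matrix.one_mul]
  have fC : Θt.C * S - Θ.C = (Θt.C * G₁ - Θ.C * G₂) * J₂ := by
    rw [hS, Matrix.sub_mul]
    congr 1
    · simp only [Matrix.mul_assoc]
    · rw [Matrix.mul_assoc, hGJ₂, Matrix.mul_one]
  have hle : ∀ k : ℝ, k ≤ γ' → k * (ε' / γ') ≤ ε' := by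
    intro k hk
    calc k * (ε' / γ') ≤ γ' * (ε' / γ') := by gcongr
      _ = ε' := by field_simp
  have gA : ‖S' * Θt.A * S - Θ.A‖ ≤ ε' := by
    rw [fA]
    refine (norm_mul_le_mul _ _ (norm_mul_le_mul _ _ hG₂n dA) hJ₂n).trans ?_
    refine le_trans (le_of_eq ?_) (hle (γ * γ) (by linarith))
    ring
  have gB : ‖S' * Θt.B - Θ.B‖ ≤ ε' := by
    rw [fB]
    exact (norm_mul_le_mul _ _ hG₂n dB).trans (hle γ (by nlinarith))
  have gC : ‖Θt.C * S - Θ.C‖ ≤ ε' := by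
    rw [fC]
    refine (norm_mul_le_mul _ _ dC hJ₂n).trans ?_
    rw [mul_comm]
    exact hle γ (by nlinarith)
  have l1 : ε' ≤ ε := min_le_left _ _
  have l2 : ε' ≤ ε₁ := (min_le_right _ _).trans (min_le_left _ _)
  have l3 : ε' ≤ ε₂ := (min_le_right _ _).trans (min_le_right _ _)
  -- The change of coordinates G' of the candidate is arbitrary, so S has no a priori bound.
  -- Observability bounds S from below, hence its inverse S' from above; controllability bounds S'ᵀ
  -- from below, hence S from above.
  have low1 := h₁ (S' * Θt.A * S) Θt.A S (Θt.C * S) Θt.C (gA.trans l2) (gC.trans l2)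
    (by rw [Matrix.mul_assoc, ← Matrix.mul_assoc, hSS', Matrix.one_mul]) rfl hAb hCb
  have low2 := h₂ (S' * Θt.A * S)ᵀ Θt.Aᵀ S'ᵀ (S' * Θt.B)ᵀ Θt.Bᵀ
    (by rw [← Matrix.transpose_sub, norm_transpose]; exact gA.trans l3)
    (by rw [← Matrix.transpose_sub, norm_transpose]; exact gB.trans l3)
    (by rw [← Matrix.transpose_mul, ← Matrix.transpose_mul, Matrix.mul_assoc, hSS',
          Matrix.mul_one])
    (by rw [← Matrix.transpose_mul])
    (by rw [norm_transpose]; exact hAb) (by rw [norm_transpose]; exact hBb)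
  have hSu : IsUnit S.det := Matrix.isUnit_det_of_right_inverse hSS'
  have hS'u : IsUnit S'ᵀ.det := by
    rw [Matrix.det_transpose]
    exact Matrix.isUnit_det_of_right_inverse hS'S
  have n1 := norm_inv_le_of_lower_bound hc₁.le hSu low1
  rw [Matrix.inv_eq_right_inv hSS'] at n1
  have n2 := norm_inv_le_of_lower_bound hc₂.le hS'u low2
  rw [← Matrix.transpose_nonsing_inv, norm_transpose, Matrix.inv_eq_right_inv hS'S] at n2
  exact ⟨S, S', hSS', hS'S, n2.trans (le_max_right _ _), n1.trans (le_max_left _ _),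
    gA.trans l1, gB.trans l1, gC.trans l1⟩

end CloseModel

/-! ### One-step contraction of the closed loop. -/

section ClosedLoop

theorem norm_apply_le {ι κ : Type*} [Fintype ι] [Fintype κ] [DecidableEq κ] {A : Matrix ι κ ℝ}
    {v : EuclideanSpace ℝ κ} {a b : ℝ} (hA : ‖A‖ ≤ a) (hv : ‖v‖ ≤ b) :
    ‖Matrix.toEuclideanLin A v‖ ≤ a * b :=
  (norm_toEuclideanLin_le _ _).trans
    (mul_le_mul hA hv (norm_nonneg _) ((norm_nonneg _).trans hA))

/-- Bounds for a model with its two gains. -/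
structure ModelBounds (g ρ υ : ℝ) (Θt : LinSys n m p) (K : Matrix (Fin p) (Fin n) ℝ)
    (L : Matrix (Fin n) (Fin m) ℝ) : Prop where
  state : ‖Θt.A‖ ≤ g
  input : ‖Θt.B‖ ≤ g
  output : ‖Θt.C‖ ≤ g
  control : ‖K‖ ≤ g
  filter : ‖L‖ ≤ g
  closed : ‖Θt.A - Θt.B * K‖ ≤ ρ
  error : ‖Θt.A - Θt.A * L * Θt.C‖ ≤ υ

/-- The scalar core of `exists_lyapunov`: a, d, e, f are the norms of prediction, estimation error,
innovation and filtered state, while x and D are the next values of a and d. The coupling g²d is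
paid by half of the decay of Md, since g² = M(1 − υ)/2, and the model error by half of the remaining
margin 1 − r₀. -/
theorem lyapunov_arith {g ρ υ M ε r₀ a d e f x D : ℝ} (hg : 1 ≤ g) (ha0 : 0 ≤ a) (hd0 : 0 ≤ d)
    (he0 : 0 ≤ e) (hε0 : 0 ≤ ε) (hε1 : ε ≤ 1) (hM1 : 1 ≤ M) (hMg : g ^ 2 = M * (1 - υ) / 2)
    (hρr : ρ ≤ r₀) (hυr : (1 + υ) / 2 ≤ r₀) (hρ0 : 0 ≤ ρ) (hρ1 : ρ ≤ 1) (hr₀ : r₀ ≤ 1)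
    (hεk : (g ^ 2 + 5 * M * g ^ 4) * ε ≤ (1 - r₀) / 2)
    (hf : f ≤ a + g * (g * d + ε * (g * (a + d)) + e)) (hx : x ≤ ρ * f)
    (hD : D ≤ υ * d + g * ε * (g * (a + d)) + g * g * (ε * (g * (a + d))) + g * ε * (g * f)
      + (g * g * e + g * g * e)) :
    x + M * D ≤ (1 + r₀) / 2 * (a + M * d) + (g + 3 * M * g ^ 3) * e := by
  have hg0 : 0 < g := by linarith
  have hM0 : 0 < M := by linarith
  have had : 0 ≤ a + d := by positivity
  have hg2 : 1 ≤ g ^ 2 := one_le_pow₀ hg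
  have hp32 : g ^ 2 ≤ g ^ 3 := pow_le_pow_right₀ hg (by norm_num)
  have hp43 : g ^ 3 ≤ g ^ 4 := pow_le_pow_right₀ hg (by norm_num)
  have q1 : x ≤ ρ * a + g ^ 2 * d + g ^ 2 * ε * (a + d) + g * e := by
    have h1 : ρ * f ≤ ρ * (a + g * (g * d + ε * (g * (a + d)) + e)) := by gcongr
    have h2 : ρ * (g * (g * d + ε * (g * (a + d)) + e))
        ≤ 1 * (g * (g * d + ε * (g * (a + d)) + e)) := by gcongr
    linarith only [hx, h1, h2]
  have q2 : D ≤ υ * d + 5 * g ^ 4 * ε * (a + d) + 3 * g ^ 3 * e := by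
    have h1 : f ≤ 2 * g ^ 2 * (a + d) + g * e := by
      have t1 : g * (ε * (g * (a + d))) ≤ g * (1 * (g * (a + d))) := by gcongr
      have t2 : a ≤ g ^ 2 * a := le_mul_of_one_le_left ha0 hg2
      linarith only [hf, t1, t2]
    have h2 : g * ε * (g * f) ≤ g * ε * (g * (2 * g ^ 2 * (a + d) + g * e)) := by gcongr
    have h3 : g ^ 3 * ε * e ≤ g ^ 3 * 1 * e := by gcongr
    have h4 : g ^ 2 * (ε * (a + d)) ≤ g ^ 4 * (ε * (a + d)) :=
      mul_le_mul_of_nonneg_right (hp32.trans hp43) (by positivity)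
    have h5 : g ^ 3 * (ε * (a + d)) ≤ g ^ 4 * (ε * (a + d)) :=
      mul_le_mul_of_nonneg_right hp43 (by positivity)
    have h6 : g ^ 2 * e ≤ g ^ 3 * e := by gcongr
    have h7 : 0 ≤ g ^ 4 * (ε * (a + d)) := by positivity
    linarith only [hD, h2, h3, h4, h5, h6, h7]
  have q3 : M * D ≤ M * (υ * d + 5 * g ^ 4 * ε * (a + d) + 3 * g ^ 3 * e) := by gcongr
  have q4 : g ^ 2 * d + M * (υ * d) = M * ((1 + υ) / 2 * d) := by rw [hMg]; ring
  have q5 : ρ * a ≤ r₀ * a := by gcongr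
  have q6 : M * ((1 + υ) / 2 * d) ≤ M * (r₀ * d) := by gcongr
  have q7 : a + d ≤ a + M * d := by nlinarith only [hM1, hd0]
  have q8 : (g ^ 2 + 5 * M * g ^ 4) * ε * (a + d) ≤ (1 - r₀) / 2 * (a + M * d) :=
    mul_le_mul hεk q7 had (by linarith)
  linarith only [q1, q3, q4, q5, q6, q8]

/-- For an exact model the loop is block triangular: the error Sξ − x̂ evolves by Ã − ÃL̃C̃ on its
own and drives the prediction, which evolves by Ã − B̃K̃. Weighting the error by a large M makes the
sum contract, and small model errors keep this. All constants depend on the bounds only, hence serve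
every epoch. -/
theorem exists_lyapunov {Θ : LinSys n m p} {F : Matrix (Fin n) (Fin m) ℝ} {g ρ υ : ℝ}
    (hg : 1 ≤ g) (hF : ‖F‖ ≤ g) (hρ0 : 0 ≤ ρ) (hρ : ρ < 1) (hυ0 : 0 ≤ υ) (hυ : υ < 1) :
    ∃ M ε r c : ℝ, 1 ≤ M ∧ 0 < ε ∧ 0 ≤ r ∧ r < 1 ∧ 0 ≤ c ∧
      ∀ (Θt : LinSys n m p) (K : Matrix (Fin p) (Fin n) ℝ) (Lt : Matrix (Fin n) (Fin m) ℝ)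
        (S S' : Matrix (Fin n) (Fin n) ℝ), ModelBounds g ρ υ Θt K Lt → CloseModel g ε Θ Θt S S' →
      ∀ (xi xp xf xi' xp' : Vec n) (u : Vec p) (e : Vec m),
        xf = xp + Matrix.toEuclideanLin Lt
          (Matrix.toEuclideanLin Θ.C xi + e - Matrix.toEuclideanLin Θt.C xp) →
        u = -Matrix.toEuclideanLin K xf →
        xi' = Matrix.toEuclideanLin Θ.A xi + Matrix.toEuclideanLin Θ.B u
          + Matrix.toEuclideanLin F e →
        xp' = Matrix.toEuclideanLin Θt.A xf + Matrix.toEuclideanLin Θt.B u →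
        ‖xp'‖ + M * ‖Matrix.toEuclideanLin S xi' - xp'‖
          ≤ r * (‖xp‖ + M * ‖Matrix.toEuclideanLin S xi - xp‖) + c * ‖e‖ := by
  have hg0 : 0 < g := by linarith
  set M := 2 * g ^ 2 / (1 - υ) with hM
  have hυ' : 0 < 1 - υ := by linarith
  have hg2 : 1 ≤ g ^ 2 := one_le_pow₀ hg
  have hM1 : 1 ≤ M := by
    rw [hM, le_div_iff₀ hυ']
    linarith
  have hM0 : 0 < M := by linarith
  have hMg : g ^ 2 = M * (1 - υ) / 2 := by rw [hM]; field_simp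
  set r₀ := max ρ ((1 + υ) / 2) with hr₀
  have hr₀1 : r₀ < 1 := max_lt hρ (by linarith)
  have hr₀0 : 0 ≤ r₀ := hρ0.trans (le_max_left _ _)
  set k := g ^ 2 + 5 * M * g ^ 4 with hk
  have hk0 : 0 < k := by positivity
  set ε := min 1 ((1 - r₀) / (2 * k)) with hε
  have hε0 : 0 < ε := lt_min one_pos (div_pos (by linarith) (by positivity))
  have hε1 : ε ≤ 1 := min_le_left _ _
  have hεk : k * ε ≤ (1 - r₀) / 2 := by
    calc k * ε ≤ k * ((1 - r₀) / (2 * k)) := by gcongr; exact min_le_right _ _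
      _ = _ := by field_simp
  refine ⟨M, ε, (1 + r₀) / 2, g + 3 * M * g ^ 3, hM1, hε0, by linarith, by linarith,
    by positivity, ?_⟩
  intro Θt K Lt S S' hb hcl xi xp xf xi' xp' u e hxf hu hxi' hxp'
  set D := Matrix.toEuclideanLin S xi - xp with hD
  set a := ‖xp‖ with ha
  set d := ‖D‖ with hd
  have ha0 : 0 ≤ a := norm_nonneg _
  have hd0 : 0 ≤ d := norm_nonneg _
  have he0 : 0 ≤ ‖e‖ := norm_nonneg _
  -- the true state in terms of the prediction
  have hxi : ‖xi‖ ≤ g * (a + d) := by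
    have h1 : xi = Matrix.toEuclideanLin S' (xp + D) := by
      rw [hD, add_sub_cancel, ← toEuclideanLin_mul_apply, hcl.inv_mul, toEuclideanLin_one_apply]
    rw [h1]
    exact norm_apply_le hcl.norm_inv_le (norm_add_le _ _)
  have hout : ‖Matrix.toEuclideanLin (Θ.C - Θt.C * S) xi‖ ≤ ε * (g * (a + d)) :=
    norm_apply_le (by rw [norm_sub_rev]; exact hcl.output) hxi
  have hxf' : xf = xp + Matrix.toEuclideanLin Lt (Matrix.toEuclideanLin Θt.C D
      + Matrix.toEuclideanLin (Θ.C - Θt.C * S) xi + e) := by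
    rw [hxf, hD]
    simp only [map_sub, map_add, LinearMap.sub_apply, toEuclideanLin_mul_apply]
    abel
  have hinn : ‖Matrix.toEuclideanLin Lt (Matrix.toEuclideanLin Θt.C D
      + Matrix.toEuclideanLin (Θ.C - Θt.C * S) xi + e)‖ ≤ g * (g * d + ε * (g * (a + d)) + ‖e‖) :=
    norm_apply_le hb.filter ((norm_add₃_le).trans
      (add_le_add (add_le_add (norm_apply_le hb.output le_rfl) hout) le_rfl))
  have hxfn : ‖xf‖ ≤ a + g * (g * d + ε * (g * (a + d)) + ‖e‖) := by
    rw [hxf']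
    exact (norm_add_le _ _).trans (add_le_add le_rfl hinn)
  have hun : ‖u‖ ≤ g * ‖xf‖ := by
    rw [hu, norm_neg]
    exact norm_apply_le hb.control le_rfl
  have hxpn : ‖xp'‖ ≤ ρ * ‖xf‖ := by
    have : xp' = Matrix.toEuclideanLin (Θt.A - Θt.B * K) xf := by
      rw [hxp', hu, map_sub Matrix.toEuclideanLin, LinearMap.sub_apply, toEuclideanLin_mul_apply,
        map_neg, sub_eq_add_neg]
    rw [this]
    exact norm_apply_le hb.closed le_rfl
  -- the estimation error
  have hSA : S * Θ.A - Θt.A * S = -(S * (S' * Θt.A * S - Θ.A)) := by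
    rw [Matrix.mul_sub, Matrix.mul_assoc S', ← Matrix.mul_assoc S S', hcl.mul_inv, Matrix.one_mul]
    abel
  have hSB : S * Θ.B - Θt.B = -(S * (S' * Θt.B - Θ.B)) := by
    rw [Matrix.mul_sub, ← Matrix.mul_assoc S S', hcl.mul_inv, Matrix.one_mul]
    abel
  have hDeq : Matrix.toEuclideanLin S xi' - xp'
      = Matrix.toEuclideanLin (Θt.A - Θt.A * Lt * Θt.C) D
        + Matrix.toEuclideanLin (S * Θ.A - Θt.A * S) xi
        - Matrix.toEuclideanLin (Θt.A * Lt) (Matrix.toEuclideanLin (Θ.C - Θt.C * S) xi)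
        + Matrix.toEuclideanLin (S * Θ.B - Θt.B) u
        + (Matrix.toEuclideanLin (S * F) e - Matrix.toEuclideanLin (Θt.A * Lt) e) := by
    rw [hxi', hxp', hxf, hD]
    simp only [map_sub, map_add, LinearMap.sub_apply, toEuclideanLin_mul_apply]
    abel
  have hDn : ‖Matrix.toEuclideanLin S xi' - xp'‖ ≤ υ * d + g * ε * (g * (a + d))
      + g * g * (ε * (g * (a + d))) + g * ε * (g * ‖xf‖) + (g * g * ‖e‖ + g * g * ‖e‖) := by
    rw [hDeq]
    refine (norm_add_le _ _).trans (add_le_add ((norm_add_le _ _).trans (add_le_add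
      ((norm_sub_le _ _).trans (add_le_add ((norm_add_le _ _).trans (add_le_add ?_ ?_)) ?_)) ?_))
      ((norm_sub_le _ _).trans (add_le_add ?_ ?_)))
    · exact norm_apply_le hb.error le_rfl
    · refine norm_apply_le ?_ hxi
      rw [hSA, norm_neg]
      exact norm_mul_le_mul _ _ hcl.norm_le hcl.state
    · exact norm_apply_le (norm_mul_le_mul _ _ hb.state hb.filter) hout
    · refine norm_apply_le ?_ hun
      rw [hSB, norm_neg]
      exact norm_mul_le_mul _ _ hcl.norm_le hcl.input
    · exact norm_apply_le (norm_mul_le_mul _ _ hcl.norm_le hF) le_rfl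
    · exact norm_apply_le (norm_mul_le_mul _ _ hb.state hb.filter) le_rfl
  exact lyapunov_arith hg ha0 hd0 he0 hε0.le hε1 hM1 hMg (le_max_left _ _) (le_max_right _ _) hρ0
    hρ.le hr₀1.le hεk hxfn hxpn hDn

end ClosedLoop

/-! ### Boundedness over the warm-up and all epochs. -/

section Epochs

theorem epoch_eq {Tw t i : ℕ} (hTw : 0 < Tw) (h1 : 2 ^ i * Tw ≤ t) (h2 : t < 2 ^ (i + 1) * Tw) :
    epoch Tw t = i := by
  have h3 : 2 ^ i ≤ t / Tw := (Nat.le_div_iff_mul_le hTw).2 h1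
  have h4 : t / Tw < 2 ^ (i + 1) := (Nat.div_lt_iff_lt_mul hTw).2 h2
  exact Nat.log_eq_of_pow_le_of_lt_pow h3 h4

theorem epoch_of_lt {Tw t : ℕ} (h : t < Tw) : epoch Tw t = 0 := by
  rw [epoch, Nat.div_eq_of_lt h, Nat.log_zero_right]

theorem epoch_spec {Tw t : ℕ} (hTw : 0 < Tw) (h : Tw ≤ t) :
    2 ^ epoch Tw t * Tw ≤ t ∧ t < 2 ^ (epoch Tw t + 1) * Tw := by
  have h0 : t / Tw ≠ 0 := by
    have := (Nat.le_div_iff_mul_le hTw).2 (by rwa [one_mul] : 1 * Tw ≤ t)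
    omega
  exact ⟨(Nat.le_div_iff_mul_le hTw).1 (Nat.pow_log_le_self 2 h0),
    (Nat.div_lt_iff_lt_mul hTw).1 (Nat.lt_pow_succ_log_self (by norm_num) _)⟩

/-- The closed loop in innovations form: `xi` is the optimal prediction of the true state, `xp` and
`xf` are the predicted and filtered states of the models used by the controller. -/
structure ClosedLoop (Θ : LinSys n m p) (F : Matrix (Fin n) (Fin m) ℝ) (Tw : ℕ)
    (Θt : ℕ → LinSys n m p) (K : ℕ → Matrix (Fin p) (Fin n) ℝ) (Lt : ℕ → Matrix (Fin n) (Fin m) ℝ)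
    (e : ℕ → Vec m) (xi xp xf : ℕ → Vec n) (u : ℕ → Vec p) : Prop where
  xi_zero : xi 0 = 0
  xi_succ : ∀ t, xi (t + 1) = Matrix.toEuclideanLin Θ.A (xi t) + Matrix.toEuclideanLin Θ.B (u t)
    + Matrix.toEuclideanLin F (e t)
  xp_zero : xp 0 = 0
  xp_succ : ∀ t, xp (t + 1) = Matrix.toEuclideanLin (Θt (epoch Tw t)).A (xf t)
    + Matrix.toEuclideanLin (Θt (epoch Tw t)).B (u t)
  filt : ∀ t, xf t = xp t + Matrix.toEuclideanLin (Lt (epoch Tw t))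
    (Matrix.toEuclideanLin Θ.C (xi t) + e t - Matrix.toEuclideanLin (Θt (epoch Tw t)).C (xp t))
  input : ∀ t, Tw ≤ t → u t = -Matrix.toEuclideanLin (K (epoch Tw t)) (xf t)

variable {Θ : LinSys n m p} {F : Matrix (Fin n) (Fin m) ℝ} {Tw : ℕ}
    {Θt : ℕ → LinSys n m p} {K : ℕ → Matrix (Fin p) (Fin n) ℝ} {Lt : ℕ → Matrix (Fin n) (Fin m) ℝ}
    {e : ℕ → Vec m} {xi xp xf : ℕ → Vec n} {u : ℕ → Vec p}

theorem StableFinitePhi.exists_pow_bound (h : StableFinitePhi Θ) :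
    ∃ Φ q : ℝ, 0 ≤ Φ ∧ 0 ≤ q ∧ q < 1 ∧ ∀ τ, ‖Θ.A ^ τ‖ ≤ Φ * q ^ τ := by
  obtain ⟨h1, Φ, hΦ⟩ := h
  have h0 : 0 ≤ specRad Θ.A := ENNReal.toReal_nonneg
  refine ⟨|Φ|, specRad Θ.A, abs_nonneg _, h0, h1, fun τ => (hΦ τ).trans ?_⟩
  gcongr
  exact le_abs_self Φ

/-- The matrix A is stable but need not contract in norm, so the induction controls all A^τ ξ_t at
once; the bound D is the fixed point of D = qD + 2gb. -/
theorem ClosedLoop.xi_warmup_le (h : ClosedLoop Θ F Tw Θt K Lt e xi xp xf u) {Φ q g b : ℝ}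
    (hΦ : 0 ≤ Φ) (hq0 : 0 ≤ q) (hq : q < 1) (hA : ∀ τ, ‖Θ.A ^ τ‖ ≤ Φ * q ^ τ) (hB : ‖Θ.B‖ ≤ g)
    (hF : ‖F‖ ≤ g) (hb : 0 ≤ b) {N : ℕ} (he : ∀ t < N, ‖e t‖ ≤ b) (hu : ∀ t < N, ‖u t‖ ≤ b) :
    ∀ t ≤ N, ‖xi t‖ ≤ Φ * (2 * g * b / (1 - q)) := by
  have hq' : 0 < 1 - q := by linarith
  have hg : 0 ≤ g := (norm_nonneg _).trans hB
  set D := 2 * g * b / (1 - q) with hD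
  have hD0 : 0 ≤ D := by positivity
  have hDq : q * D + 2 * g * b = D := by rw [hD]; field_simp; ring
  have key : ∀ t ≤ N, ∀ τ, ‖Matrix.toEuclideanLin (Θ.A ^ τ) (xi t)‖ ≤ Φ * q ^ τ * D := by
    intro t
    induction t with
    | zero => intro _ τ; rw [h.xi_zero, map_zero, norm_zero]; positivity
    | succ t ih =>
      intro ht τ
      have e1 : Matrix.toEuclideanLin (Θ.A ^ τ) (xi (t + 1))
          = Matrix.toEuclideanLin (Θ.A ^ (τ + 1)) (xi t)
            + Matrix.toEuclideanLin (Θ.A ^ τ)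
              (Matrix.toEuclideanLin Θ.B (u t) + Matrix.toEuclideanLin F (e t)) := by
        rw [h.xi_succ, pow_succ, toEuclideanLin_mul_apply, ← map_add, ← add_assoc]
      rw [e1]
      have t1 := ih (by omega) (τ + 1)
      have t2 : ‖Matrix.toEuclideanLin Θ.B (u t) + Matrix.toEuclideanLin F (e t)‖
          ≤ g * b + g * b := (norm_add_le _ _).trans (add_le_add
            (norm_apply_le hB (hu t (by omega))) (norm_apply_le hF (he t (by omega))))
      have t3 := norm_apply_le (hA τ) t2
      refine (norm_add_le _ _).trans ((add_le_add t1 t3).trans_eq ?_)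
      nth_rw 2 [← hDq]
      ring
  intro t ht
  have := key t ht 0
  rwa [pow_zero, toEuclideanLin_one_apply, pow_zero, mul_one] at this

/-- With inputs and outputs bounded from outside, the contraction of the model's own filter
suffices, however inaccurate the model. -/
theorem ClosedLoop.xp_warmup_le (h : ClosedLoop Θ F Tw Θt K Lt e xi xp xf u) {g ρ υ b c : ℝ}
    (hυ : υ < 1) (hb : ∀ i, ModelBounds g ρ υ (Θt i) (K i) (Lt i)) (hC : ‖Θ.C‖ ≤ g)
    (hc : 0 ≤ c) (hb0 : 0 ≤ b) {N : ℕ} (he : ∀ t < N, ‖e t‖ ≤ b) (hu : ∀ t < N, ‖u t‖ ≤ b)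
    (hxi : ∀ t ≤ N, ‖xi t‖ ≤ c) :
    ∀ t ≤ N, ‖xp t‖ ≤ (g * g * (g * c + b) + g * b) / (1 - υ) := by
  have hυ' : 0 < 1 - υ := by linarith
  have hυ0 : 0 ≤ υ := (norm_nonneg _).trans (hb 0).error
  have hg : 0 ≤ g := (norm_nonneg _).trans hC
  set D := (g * g * (g * c + b) + g * b) / (1 - υ) with hD
  have hD0 : 0 ≤ D := by positivity
  have hDq : υ * D + g * g * (g * c + b) + g * b = D := by rw [hD]; field_simp; ring
  intro t
  induction t with
  | zero => intro _; rw [h.xp_zero, norm_zero]; exact hD0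
  | succ t ih =>
    intro ht
    have hbt := hb (epoch Tw t)
    have e1 : xp (t + 1) = Matrix.toEuclideanLin ((Θt (epoch Tw t)).A
          - (Θt (epoch Tw t)).A * Lt (epoch Tw t) * (Θt (epoch Tw t)).C) (xp t)
        + Matrix.toEuclideanLin ((Θt (epoch Tw t)).A * Lt (epoch Tw t))
          (Matrix.toEuclideanLin Θ.C (xi t) + e t)
        + Matrix.toEuclideanLin (Θt (epoch Tw t)).B (u t) := by
      rw [h.xp_succ, h.filt]
      simp only [map_sub, map_add, LinearMap.sub_apply, toEuclideanLin_mul_apply]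
      abel
    rw [e1, ← hDq]
    refine norm_add₃_le.trans (add_le_add (add_le_add ?_ ?_) ?_)
    · exact norm_apply_le hbt.error (ih (by omega))
    · refine norm_apply_le (norm_mul_le_mul _ _ hbt.state hbt.filter)
        ((norm_add_le _ _).trans (add_le_add ?_ (he t (by omega))))
      exact norm_apply_le hC (hxi t (by omega))
    · exact norm_apply_le hbt.input (hu t (by omega))

/-- Boundedness of the closed loop, provided that the model used in each epoch is accurate as soon
as the data before the epoch are bounded. -/
theorem exists_closedLoop_bound (hΘ : StableFinitePhi Θ) {g ρ υ : ℝ}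
    (hg : 1 ≤ g) (hF : ‖F‖ ≤ g) (hB : ‖Θ.B‖ ≤ g) (hC : ‖Θ.C‖ ≤ g) (hρ0 : 0 ≤ ρ) (hρ : ρ < 1)
    (hυ0 : 0 ≤ υ) (hυ : υ < 1) :
    ∃ (ε β : ℝ) (N : ℕ), 0 < ε ∧ 1 ≤ β ∧ ∀ (Tw T : ℕ) (Θt : ℕ → LinSys n m p)
      (K : ℕ → Matrix (Fin p) (Fin n) ℝ) (Lt : ℕ → Matrix (Fin n) (Fin m) ℝ) (e : ℕ → Vec m)
      (xi xp xf : ℕ → Vec n) (u : ℕ → Vec p) (b : ℝ), N ≤ Tw → 0 < Tw → Tw ≤ T →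
      ClosedLoop Θ F Tw Θt K Lt e xi xp xf u →
      (∀ i, ModelBounds g ρ υ (Θt i) (K i) (Lt i)) → (∀ t ≤ T, ‖e t‖ ≤ b) →
      (∀ t < Tw, ‖u t‖ ≤ b) →
      (∀ i, 2 ^ i * Tw ≤ T → (∀ t ≤ 2 ^ i * Tw, ‖xi t‖ + ‖xp t‖ ≤ β * b) →
        ∃ S S', CloseModel g ε Θ (Θt i) S S') →
      ∀ t ≤ T, ‖xi t‖ + ‖xp t‖ ≤ β * b := by
  obtain ⟨Φ, q, hΦ, hq0, hq, hA⟩ := hΘ.exists_pow_bound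
  obtain ⟨M, ε, r, c, hM, hε, hr0, hr, hc, hstep⟩ :=
    exists_lyapunov (Θ := Θ) hg hF hρ0 hρ hυ0 hυ
  have hr' : 0 < 1 - r := by linarith
  have hq' : 0 < 1 - q := by linarith
  have hυ' : 0 < 1 - υ := by linarith
  have hg0 : 0 < g := by linarith
  have hM0 : 0 < M := by linarith
  obtain ⟨c₁, hc₁⟩ : ∃ x, x = Φ * (2 * g * 1 / (1 - q)) := ⟨_, rfl⟩
  obtain ⟨c₂, hc₂⟩ : ∃ x, x = (g * g * (g * c₁ + 1) + g * 1) / (1 - υ) := ⟨_, rfl⟩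
  have hc₁0 : 0 ≤ c₁ := by rw [hc₁]; positivity
  have hc₂0 : 0 ≤ c₂ := by rw [hc₂]; positivity
  obtain ⟨C₁, hC₁⟩ : ∃ x, x = 1 + M + M * g := ⟨_, rfl⟩
  obtain ⟨C₂, hC₂⟩ : ∃ x, x = 1 + g := ⟨_, rfl⟩
  have hC₁0 : 0 < C₁ := by rw [hC₁]; positivity
  have hC₂0 : 0 < C₂ := by rw [hC₂]; positivity
  obtain ⟨C₃, hC₃⟩ : ∃ x, x = C₂ * (c / (1 - r)) := ⟨_, rfl⟩
  have hC₃0 : 0 ≤ C₃ := by rw [hC₃]; positivity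
  -- B covers the warm-up and satisfies B/2 + C₃ ≤ B, so the bound at epoch starts reproduces
  -- itself.
  obtain ⟨B, hBdef⟩ : ∃ x, x = c₁ + c₂ + 2 * C₃ := ⟨_, rfl⟩
  have hB0 : 0 ≤ B := by rw [hBdef]; positivity
  -- C₁ and C₂ are the losses in passing to and from the weighted norm of an epoch; N steps of
  -- contraction outweigh them.
  obtain ⟨N, hN⟩ : ∃ N : ℕ, ∀ k ≥ N, C₁ * C₂ * r ^ k ≤ 1 / 2 := by
    have h1 : Tendsto (fun k => C₁ * C₂ * r ^ k) atTop (nhds (C₁ * C₂ * 0)) :=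
      (tendsto_pow_atTop_nhds_zero_of_lt_one hr0 hr).const_mul _
    rw [mul_zero] at h1
    exact eventually_atTop.1 (h1.eventually_le_const (by norm_num))
  refine ⟨ε, C₁ * C₂ * B + C₃ + B + 1, N, hε, ?_, ?_⟩
  · have : 0 ≤ C₁ * C₂ * B := by positivity
    linarith
  obtain ⟨β, hβ⟩ : ∃ x, x = C₁ * C₂ * B + C₃ + B + 1 := ⟨_, rfl⟩
  rw [← hβ]
  intro Tw T Θt K Lt e xi xp xf u b hNTw hTw hTwT h hb he hu hgood
  have hCCB : 0 ≤ C₁ * C₂ * B := by positivity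
  have hb0 : 0 ≤ b := (norm_nonneg _).trans (he 0 (Nat.zero_le _))
  -- warm-up
  have hw1 : ∀ t ≤ Tw, ‖xi t‖ ≤ c₁ * b := fun t ht =>
    (h.xi_warmup_le hΦ hq0 hq hA hB hF hb0 (fun t ht => he t (by omega)) hu t ht).trans_eq
      (by rw [hc₁]; ring)
  have hw2 : ∀ t ≤ Tw, ‖xp t‖ ≤ c₂ * b := fun t ht =>
    (h.xp_warmup_le hυ hb hC (by positivity) hb0 (fun t ht => he t (by omega)) hu hw1 t ht).trans_eq
      (by rw [hc₂]; ring)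
  have hw : ∀ t ≤ Tw, ‖xi t‖ + ‖xp t‖ ≤ B * b := by
    intro t ht
    have := hw1 t ht
    have := hw2 t ht
    have h3 : 0 ≤ C₃ * b := by positivity
    rw [hBdef]
    linarith
  have hBβ : B * b ≤ β * b := by
    refine mul_le_mul_of_nonneg_right ?_ hb0
    linarith
  -- one epoch
  have hepoch : ∀ i, 2 ^ i * Tw ≤ T → (∀ t ≤ 2 ^ i * Tw, ‖xi t‖ + ‖xp t‖ ≤ β * b) →
      ‖xi (2 ^ i * Tw)‖ + ‖xp (2 ^ i * Tw)‖ ≤ B * b → ∀ k, k ≤ 2 ^ i * Tw → 2 ^ i * Tw + k ≤ T →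
      ‖xi (2 ^ i * Tw + k)‖ + ‖xp (2 ^ i * Tw + k)‖ ≤ C₁ * C₂ * r ^ k * (B * b) + C₃ * b := by
    intro i hiT hall hst k hk hkT
    obtain ⟨S, S', hcl⟩ := hgood i hiT hall
    have hV : ∀ k, k ≤ 2 ^ i * Tw → 2 ^ i * Tw + k ≤ T →
        ‖xp (2 ^ i * Tw + k)‖
          + M * ‖Matrix.toEuclideanLin S (xi (2 ^ i * Tw + k)) - xp (2 ^ i * Tw + k)‖
        ≤ r ^ k * (C₁ * (B * b)) + c * b / (1 - r) := by
      intro k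
      induction k with
      | zero =>
        intro _ _
        have t1 : ‖Matrix.toEuclideanLin S (xi (2 ^ i * Tw)) - xp (2 ^ i * Tw)‖
            ≤ g * ‖xi (2 ^ i * Tw)‖ + ‖xp (2 ^ i * Tw)‖ :=
          (norm_sub_le _ _).trans (add_le_add (norm_apply_le hcl.norm_le le_rfl) le_rfl)
        have t2 := mul_le_mul_of_nonneg_left t1 hM0.le
        have t3 := mul_le_mul_of_nonneg_left hst hC₁0.le
        have t4 : 0 ≤ c * b / (1 - r) := by positivity
        have t5 : 0 ≤ M * ‖xi (2 ^ i * Tw)‖ := by positivity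
        have t6 : 0 ≤ M * (g * ‖xp (2 ^ i * Tw)‖) := by positivity
        have t7 := norm_nonneg (xi (2 ^ i * Tw))
        rw [hC₁] at t3 ⊢
        rw [pow_zero, one_mul, add_zero]
        linarith
      | succ k ih =>
        intro hk hkT
        have hep : epoch Tw (2 ^ i * Tw + k) = i := epoch_eq hTw (by omega) (by
          rw [pow_succ, mul_assoc, mul_comm 2, ← mul_assoc]
          omega)
        have h1 := h.xp_succ (2 ^ i * Tw + k)
        have h2 := h.filt (2 ^ i * Tw + k)
        have h3 := h.input (2 ^ i * Tw + k) (by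
          have : Tw ≤ 2 ^ i * Tw := Nat.le_mul_of_pos_left _ (by positivity)
          omega)
        rw [hep] at h1 h2 h3
        have h4 := hstep (Θt i) (K i) (Lt i) S S' (hb i) hcl _ _ _ _ _ _ _ h2 h3
          (h.xi_succ (2 ^ i * Tw + k)) h1
        rw [← add_assoc]
        refine h4.trans ?_
        have h5 := mul_le_mul_of_nonneg_left (ih (by omega) (by omega)) hr0
        have h6 := mul_le_mul_of_nonneg_left (he (2 ^ i * Tw + k) (by omega)) hc
        have h7 : r * (c * b / (1 - r)) + c * b = c * b / (1 - r) := by field_simp; ring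
        calc _ ≤ r * (r ^ k * (C₁ * (B * b)) + c * b / (1 - r)) + c * b := add_le_add h5 h6
          _ = r ^ (k + 1) * (C₁ * (B * b)) + (r * (c * b / (1 - r)) + c * b) := by ring
          _ = _ := by rw [h7]
    have hVk := hV k hk hkT
    set x := xp (2 ^ i * Tw + k)
    set y := xi (2 ^ i * Tw + k)
    have hy : ‖y‖ ≤ g * (‖x‖ + ‖Matrix.toEuclideanLin S y - x‖) := by
      have h1 : y = Matrix.toEuclideanLin S' (x + (Matrix.toEuclideanLin S y - x)) := by
        rw [add_sub_cancel, ← toEuclideanLin_mul_apply, hcl.inv_mul, toEuclideanLin_one_apply]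
      nth_rw 1 [h1]
      exact norm_apply_le hcl.norm_inv_le (norm_add_le _ _)
    have hn0 := norm_nonneg (Matrix.toEuclideanLin S y - x)
    have hle : ‖y‖ + ‖x‖ ≤ C₂ * (‖x‖ + M * ‖Matrix.toEuclideanLin S y - x‖) := by
      have t1 : ‖Matrix.toEuclideanLin S y - x‖ ≤ M * ‖Matrix.toEuclideanLin S y - x‖ :=
        le_mul_of_one_le_left hn0 hM
      have t2 := mul_le_mul_of_nonneg_left t1 hg0.le
      have t3 := norm_nonneg x
      rw [hC₂]
      linarith
    refine hle.trans ((mul_le_mul_of_nonneg_left hVk hC₂0.le).trans_eq ?_)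
    rw [hC₃]
    ring
  have hβk : ∀ k, C₁ * C₂ * r ^ k * (B * b) + C₃ * b ≤ β * b := by
    intro k
    have h1 : C₁ * C₂ * r ^ k * (B * b) ≤ C₁ * C₂ * 1 * (B * b) := by
      gcongr
      exact pow_le_one₀ hr0 hr.le
    have h2 : 0 ≤ B * b := by positivity
    rw [hβ]
    linarith
  -- Two levels: within an epoch the state may reach βb, but at each epoch start it is back below
  -- Bb. The weaker bound on the past already makes the next model accurate.
  have hind : ∀ i, 2 ^ i * Tw ≤ T → (∀ t ≤ 2 ^ i * Tw, ‖xi t‖ + ‖xp t‖ ≤ β * b) ∧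
      ‖xi (2 ^ i * Tw)‖ + ‖xp (2 ^ i * Tw)‖ ≤ B * b := by
    intro i
    induction i with
    | zero =>
      intro _
      rw [pow_zero, one_mul]
      exact ⟨fun t ht => (hw t ht).trans hBβ, hw Tw le_rfl⟩
    | succ i ih =>
      intro hT
      have e1 : 2 ^ (i + 1) * Tw = 2 ^ i * Tw + 2 ^ i * Tw := by ring
      rw [e1] at hT ⊢
      obtain ⟨h1, h2⟩ := ih (by omega)
      have h3 := hepoch i (by omega) h1 h2
      refine ⟨fun t ht => ?_, ?_⟩
      · by_cases hti : t ≤ 2 ^ i * Tw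
        · exact h1 t hti
        · obtain ⟨k, rfl⟩ := Nat.exists_eq_add_of_le (le_of_not_ge hti)
          exact (h3 k (by omega) (by omega)).trans (hβk k)
      · refine (h3 _ le_rfl hT).trans ?_
        have h4 := hN (2 ^ i * Tw) (hNTw.trans (Nat.le_mul_of_pos_left _ (by positivity)))
        have h5 := mul_le_mul_of_nonneg_right h4 (by positivity : 0 ≤ B * b)
        have h6 : 2 * C₃ * b ≤ B * b := by
          refine mul_le_mul_of_nonneg_right ?_ hb0
          linarith
        linarith
  intro t ht
  by_cases htw : t ≤ Tw
  · exact (hw t htw).trans hBβ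
  · obtain ⟨h1, h2⟩ := epoch_spec hTw (le_of_not_ge htw)
    obtain ⟨h3, h4⟩ := hind _ (h1.trans ht)
    obtain ⟨k, hk⟩ := Nat.exists_eq_add_of_le h1
    have e1 : 2 ^ (epoch Tw t + 1) * Tw = 2 ^ epoch Tw t * Tw + 2 ^ epoch Tw t * Tw := by ring
    have := hepoch _ (h1.trans ht) h3 h4 k (by omega) (by omega)
    rw [← hk] at this
    exact this.trans (hβk k)

end Epochs

/-! ### Real Gaussian variables and linear functionals of Gaussian vectors. -/

section Gaussian

variable {Ω : Type*} [MeasurableSpace Ω] {μ : Measure Ω}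

/-- `X` is a centered real Gaussian variable with variance `v`. -/
structure HasGauss (μ : Measure Ω) (X : Ω → ℝ) (v : ℝ) : Prop where
  meas : Measurable X
  nonneg : 0 ≤ v
  law : μ.map X = gaussianReal 0 v.toNNReal

theorem HasGauss.add {X Y : Ω → ℝ} {v w : ℝ} (hX : HasGauss μ X v) (hY : HasGauss μ Y w)
    (h : IndepFun X Y μ) : HasGauss μ (fun ω => X ω + Y ω) (v + w) := by
  refine ⟨hX.meas.add hY.meas, add_nonneg hX.nonneg hY.nonneg, ?_⟩
  have := gaussianReal_add_gaussianReal_of_indepFun h hX.law hY.law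
  rw [add_zero, ← Real.toNNReal_add hX.nonneg hY.nonneg] at this
  exact this

theorem hasGauss_zero [IsProbabilityMeasure μ] : HasGauss μ (fun _ => 0) 0 := by
  refine ⟨measurable_const, le_rfl, ?_⟩
  simp

theorem HasGauss.sum [IsProbabilityMeasure μ] {E : Type*} [MeasurableSpace E] {X : ℕ → Ω → E}
    (hX : ∀ t, Measurable (X t)) (hind : iIndepFun X μ) {f : ℕ → E → ℝ}
    (hf : ∀ t, Measurable (f t)) {v : ℕ → ℝ} (h : ∀ t, HasGauss μ (fun ω => f t (X t ω)) (v t))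
    (T : ℕ) : HasGauss μ (fun ω => ∑ t ∈ Finset.range T, f t (X t ω))
      (∑ t ∈ Finset.range T, v t) := by
  induction T with
  | zero => simpa using hasGauss_zero
  | succ T ih =>
    simp only [Finset.sum_range_succ]
    refine ih.add (h T) ?_
    have h1 := hind.comp f hf
    have h2 := h1.indepFun_finsetSum_of_notMem (fun t => (hf t).comp (hX t))
      (s := Finset.range T) (i := T) (by simp)
    have e1 : (fun ω => ∑ t ∈ Finset.range T, f t (X t ω)) = ∑ j ∈ Finset.range T, f j ∘ X j := by
      ext ω
      simp
    rw [e1]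
    exact h2

theorem hasGauss_inner {k : ℕ} {X : Ω → Vec k} {S : Matrix (Fin k) (Fin k) ℝ} (hX : Measurable X)
    (hS : S.PosSemidef) (h : μ.map X = multivariateGaussian 0 S) (a : Vec k) :
    HasGauss μ (fun ω => inner ℝ a (X ω)) (inner ℝ a (Matrix.toEuclideanLin S a)) := by
  have hdot : ∀ a : Vec k, a.ofLp ⬝ᵥ S.mulVec a.ofLp = inner ℝ a (Matrix.toEuclideanLin S a) := by
    intro a
    rw [EuclideanSpace.inner_eq_star_dotProduct, dotProduct_comm]
    simp [Matrix.toLpLin_apply]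
  have hnn : 0 ≤ inner ℝ a (Matrix.toEuclideanLin S a) := inner_nonneg_of_posSemidef hS a
  refine ⟨by fun_prop, hnn, ?_⟩
  have hcomp : μ.map (fun ω => inner ℝ a (X ω))
      = (multivariateGaussian 0 S).map (fun x => inner ℝ a x) := by
    rw [← h, Measure.map_map (by fun_prop) hX]
    rfl
  rw [hcomp]
  have : IsProbabilityMeasure ((multivariateGaussian 0 S).map (fun x => inner ℝ a x)) :=
    Measure.isProbabilityMeasure_map (by fun_prop)
  refine Measure.ext_of_charFun ?_
  ext t
  have h1 : charFun ((multivariateGaussian 0 S).map (fun x => inner ℝ a x)) t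
      = charFun (multivariateGaussian 0 S) (t • a) := by
    rw [charFun_apply_real, charFun_apply, integral_map (by fun_prop) (by fun_prop)]
    simp only [real_inner_smul_right, real_inner_comm a]
    push_cast
    rfl
  have h2 : inner ℝ (t • a) (Matrix.toEuclideanLin S (t • a))
      = t ^ 2 * inner ℝ a (Matrix.toEuclideanLin S a) := by
    rw [map_smul, real_inner_smul_left, real_inner_smul_right]
    ring
  rw [h1, charFun_multivariateGaussian hS, charFun_gaussianReal, hdot, h2,
    Real.coe_toNNReal _ hnn]
  congr 1
  simp
  ring

end Gaussian

/-! ### Consequences of the filter Riccati equation. -/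

section FilterRiccati

variable {s : Setup m p} {Θ : LinSys n m p} {Sig : Matrix (Fin n) (Fin n) ℝ}

/-- Covariance of the innovations. -/
def innovCov (s : Setup m p) (Θ : LinSys n m p) (Sig : Matrix (Fin n) (Fin n) ℝ) :
    Matrix (Fin m) (Fin m) ℝ :=
  Θ.C * Sig * Θ.Cᵀ + s.σz ^ 2 • 1

theorem IsFilterRiccati.transpose_eq (h : IsFilterRiccati s Θ Sig) : Sigᵀ = Sig := by
  simpa using h.1.isHermitian.eq

theorem innovCov_posDef (hσ : 0 < s.σz) (h : IsFilterRiccati s Θ Sig) :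
    (innovCov s Θ Sig).PosDef := by
  have h1 : (Θ.C * Sig * Θ.Cᵀ).PosSemidef := by
    simpa using h.1.mul_mul_conjTranspose_same Θ.C
  refine Matrix.PosDef.posSemidef_add h1 ?_
  exact Matrix.PosDef.one.smul (by positivity)

theorem gain_mul_innovCov (hσ : 0 < s.σz) (h : IsFilterRiccati s Θ Sig) :
    Θ.A * kalmanGain s Θ Sig * innovCov s Θ Sig = Θ.A * Sig * Θ.Cᵀ := by
  have h1 : IsUnit (innovCov s Θ Sig).det := (innovCov_posDef hσ h).isUnit.map Matrix.detMonoidHom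
  rw [kalmanGain, ← innovCov, Matrix.mul_assoc, Matrix.mul_assoc (Sig * Θ.Cᵀ),
    Matrix.nonsing_inv_mul _ h1, Matrix.mul_one, Matrix.mul_assoc]

theorem innovCov_mul_gain (hσ : 0 < s.σz) (h : IsFilterRiccati s Θ Sig) :
    innovCov s Θ Sig * (Θ.A * kalmanGain s Θ Sig)ᵀ = Θ.C * Sig * Θ.Aᵀ := by
  have h1 := congrArg Matrix.transpose (gain_mul_innovCov hσ h)
  have h2 : (innovCov s Θ Sig)ᵀ = innovCov s Θ Sig := by
    simpa using (innovCov_posDef hσ h).isHermitian.eq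
  rw [Matrix.transpose_mul, h2] at h1
  rw [h1, Matrix.transpose_mul, Matrix.transpose_mul, Matrix.transpose_transpose, h.transpose_eq,
    Matrix.mul_assoc]

/-- Orthogonality in matrix form: the correlation of C times the error with Ā times the error equals
the one that measurement noise contributes through F, so innovation and next prediction error are
uncorrelated. -/
theorem output_mul_cov_mul_filterMat (hσ : 0 < s.σz) (h : IsFilterRiccati s Θ Sig) :
    Θ.C * Sig * (filterMat Θ (kalmanGain s Θ Sig))ᵀ
      = s.σz ^ 2 • (Θ.A * kalmanGain s Θ Sig)ᵀ := by
  have h1 := innovCov_mul_gain hσ h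
  rw [filterMat, Matrix.transpose_sub, Matrix.transpose_mul, Matrix.mul_sub, ← h1, innovCov,
    Matrix.add_mul, ← Matrix.mul_assoc, add_sub_cancel_left, Matrix.smul_mul, Matrix.one_mul]

/-- The Joseph form of the Riccati equation: the error covariance is stationary under the error
dynamics. -/
theorem filterMat_lyapunov (hσ : 0 < s.σz) (h : IsFilterRiccati s Θ Sig) :
    filterMat Θ (kalmanGain s Θ Sig) * Sig * (filterMat Θ (kalmanGain s Θ Sig))ᵀ
      = Sig - s.σw ^ 2 • 1 - s.σz ^ 2 • ((Θ.A * kalmanGain s Θ Sig)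
        * (Θ.A * kalmanGain s Θ Sig)ᵀ) := by
  have h1 := innovCov_mul_gain hσ h
  have h2 := gain_mul_innovCov hσ h
  have h3 := output_mul_cov_mul_filterMat hσ h
  set F := Θ.A * kalmanGain s Θ Sig with hF
  set Ab := filterMat Θ (kalmanGain s Θ Sig) with hAb
  have h4 : Ab = Θ.A - F * Θ.C := rfl
  have h5 : Θ.A * Sig * Abᵀ = Sig - s.σw ^ 2 • 1 := by
    have e1 : Θ.A * Sig * Abᵀ = Θ.A * Sig * Θ.Aᵀ - F * (Θ.C * Sig * Θ.Aᵀ) := by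
      rw [h4, Matrix.transpose_sub, Matrix.mul_sub, Matrix.transpose_mul, ← Matrix.mul_assoc, ← h2,
        Matrix.mul_assoc F, h1]
    have e2 : F * (Θ.C * Sig * Θ.Aᵀ) = Θ.A * Sig * Θ.Cᵀ
        * (Θ.C * Sig * Θ.Cᵀ + s.σz ^ 2 • 1)⁻¹ * Θ.C * Sig * Θ.Aᵀ := by
      rw [hF, kalmanGain]
      simp only [Matrix.mul_assoc]
    rw [e1, e2, eq_sub_iff_add_eq]
    exact h.2.symm
  nth_rw 1 [h4]
  rw [Matrix.sub_mul, Matrix.sub_mul, h5, Matrix.mul_assoc F, Matrix.mul_assoc F, h3,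
    Matrix.mul_smul]

/-- The quadratic form behind the one-step independence of innovation and prediction error. -/
theorem innovation_quadratic_identity (hσ : 0 < s.σz) (h : IsFilterRiccati s Θ Sig) (a : Vec m)
    (c : Vec n) :
    let d := Matrix.toEuclideanLin Θ.Cᵀ a
      + Matrix.toEuclideanLin (filterMat Θ (kalmanGain s Θ Sig))ᵀ c
    let z := a - Matrix.toEuclideanLin (Θ.A * kalmanGain s Θ Sig)ᵀ c
    inner ℝ d (Matrix.toEuclideanLin Sig d) + s.σw ^ 2 * ‖c‖ ^ 2 + s.σz ^ 2 * ‖z‖ ^ 2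
      = inner ℝ a (Matrix.toEuclideanLin (innovCov s Θ Sig) a)
        + inner ℝ c (Matrix.toEuclideanLin Sig c) := by
  intro d z
  have h1 := output_mul_cov_mul_filterMat hσ h
  have h2 := filterMat_lyapunov hσ h
  set F := Θ.A * kalmanGain s Θ Sig with hF
  set Ab := filterMat Θ (kalmanGain s Θ Sig) with hAb
  set x := Matrix.toEuclideanLin Θ.Cᵀ a with hx
  set y := Matrix.toEuclideanLin Abᵀ c with hy
  -- The cross terms of the form in d, each equal to this, cancel the mixed term of σz²‖a − Fᵀc‖².
  have e1 : inner ℝ x (Matrix.toEuclideanLin Sig y) = s.σz ^ 2 * inner ℝ a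
      (Matrix.toEuclideanLin Fᵀ c) := by
    rw [hx, inner_toEuclideanLin, Matrix.transpose_transpose, hy, ← toEuclideanLin_mul_apply,
      ← toEuclideanLin_mul_apply, h1, map_smul, LinearMap.smul_apply, real_inner_smul_right]
  have e2 : inner ℝ y (Matrix.toEuclideanLin Sig x) = inner ℝ x (Matrix.toEuclideanLin Sig y) := by
    rw [real_inner_comm, inner_toEuclideanLin, h.transpose_eq]
  have e3 : inner ℝ y (Matrix.toEuclideanLin Sig y) = inner ℝ c (Matrix.toEuclideanLin Sig c)
      - s.σw ^ 2 * ‖c‖ ^ 2 - s.σz ^ 2 * ‖Matrix.toEuclideanLin Fᵀ c‖ ^ 2 := by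
    nth_rw 1 [hy]
    rw [inner_toEuclideanLin, Matrix.transpose_transpose, hy, ← toEuclideanLin_mul_apply,
      ← toEuclideanLin_mul_apply, h2, norm_sq_toEuclideanLin, Matrix.transpose_transpose,
      ← real_inner_self_eq_norm_sq]
    simp only [map_sub, map_smul, LinearMap.sub_apply, LinearMap.smul_apply, inner_sub_right,
      real_inner_smul_right, toEuclideanLin_one_apply]
  have e4 : inner ℝ a (Matrix.toEuclideanLin (innovCov s Θ Sig) a)
      = inner ℝ x (Matrix.toEuclideanLin Sig x) + s.σz ^ 2 * ‖a‖ ^ 2 := by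
    nth_rw 1 [hx]
    rw [inner_toEuclideanLin, Matrix.transpose_transpose, innovCov, hx, ← toEuclideanLin_mul_apply,
      ← toEuclideanLin_mul_apply, ← real_inner_self_eq_norm_sq]
    simp only [map_add, map_smul, LinearMap.add_apply, LinearMap.smul_apply, inner_add_right,
      real_inner_smul_right, toEuclideanLin_one_apply]
  have e5 : ‖z‖ ^ 2 = ‖a‖ ^ 2 - 2 * inner ℝ a (Matrix.toEuclideanLin Fᵀ c)
      + ‖Matrix.toEuclideanLin Fᵀ c‖ ^ 2 := norm_sub_sq_real _ _
  have e6 : inner ℝ d (Matrix.toEuclideanLin Sig d) = inner ℝ x (Matrix.toEuclideanLin Sig x)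
      + inner ℝ x (Matrix.toEuclideanLin Sig y) + (inner ℝ y (Matrix.toEuclideanLin Sig x)
      + inner ℝ y (Matrix.toEuclideanLin Sig y)) := by
    rw [show d = x + y from rfl, map_add, inner_add_left, inner_add_right, inner_add_right]
  rw [e6, e2, e3, e4, e5, e1]
  ring

end FilterRiccati

/-! ### The innovations are independent and Gaussian. -/

section Innovations

/-- The prediction error of the steady-state Kalman filter. -/
def predErr (Θ : LinSys n m p) (L : Matrix (Fin n) (Fin m) ℝ) (x0 : Vec n) (w : ℕ → Vec n)
    (z : ℕ → Vec m) : ℕ → Vec n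
  | 0 => x0
  | t + 1 => Matrix.toEuclideanLin (filterMat Θ L) (predErr Θ L x0 w z t) + w t
      - Matrix.toEuclideanLin (Θ.A * L) (z t)

/-- The innovations. -/
def innov (Θ : LinSys n m p) (L : Matrix (Fin n) (Fin m) ℝ) (x0 : Vec n) (w : ℕ → Vec n)
    (z : ℕ → Vec m) (t : ℕ) : Vec m :=
  Matrix.toEuclideanLin Θ.C (predErr Θ L x0 w z t) + z t

variable {s : Setup m p} {Θ : LinSys n m p} {Sig : Matrix (Fin n) (Fin n) ℝ}
  {L : Matrix (Fin n) (Fin m) ℝ}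

/-- A linear functional of the innovations and the prediction error, as a functional of the
noise. -/
theorem exists_noise_functional (hσ : 0 < s.σz) (h : IsFilterRiccati s Θ Sig)
    (hL : L = kalmanGain s Θ Sig) (a : ℕ → Vec m) (T : ℕ) (c : Vec n) :
    ∃ (c₀ : Vec n) (α : ℕ → Vec n) (β : ℕ → Vec m),
      (∀ x0 w z, ∑ t ∈ Finset.range T, inner ℝ (a t) (innov Θ L x0 w z t)
          + inner ℝ c (predErr Θ L x0 w z T)
        = inner ℝ c₀ x0 + (∑ t ∈ Finset.range T, inner ℝ (α t) (w t)
          + ∑ t ∈ Finset.range T, inner ℝ (β t) (z t))) ∧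
      inner ℝ c₀ (Matrix.toEuclideanLin Sig c₀) + (∑ t ∈ Finset.range T, s.σw ^ 2 * ‖α t‖ ^ 2
          + ∑ t ∈ Finset.range T, s.σz ^ 2 * ‖β t‖ ^ 2)
        = ∑ t ∈ Finset.range T, inner ℝ (a t) (Matrix.toEuclideanLin (innovCov s Θ Sig) (a t))
          + inner ℝ c (Matrix.toEuclideanLin Sig c) := by
  induction T generalizing c with
  | zero => exact ⟨c, 0, 0, fun x0 w z => by simp [predErr], by simp⟩
  | succ T ih =>
    -- Peel off the last step: a functional of the innovation at T and the error at T + 1 is a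
    -- functional of the error at T, plus c applied to the process noise and a − Fᵀc applied to the
    -- measurement noise. The variances match by `innovation_quadratic_identity`.
    obtain ⟨c₀, α, β, h1, h2⟩ := ih (Matrix.toEuclideanLin Θ.Cᵀ (a T)
      + Matrix.toEuclideanLin (filterMat Θ L)ᵀ c)
    have hα : ∀ f : ℕ → Vec n → ℝ, ∑ t ∈ Finset.range (T + 1), f t (Function.update α T c t)
        = ∑ t ∈ Finset.range T, f t (α t) + f T c := by
      intro f
      rw [Finset.sum_range_succ, Function.update_self]
      congr 1
      refine Finset.sum_congr rfl fun t ht => ?_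
      rw [Function.update_of_ne (by simp at ht; omega)]
    set b := a T - Matrix.toEuclideanLin (Θ.A * L)ᵀ c with hb
    have hβ : ∀ f : ℕ → Vec m → ℝ, ∑ t ∈ Finset.range (T + 1), f t (Function.update β T b t)
        = ∑ t ∈ Finset.range T, f t (β t) + f T b := by
      intro f
      rw [Finset.sum_range_succ, Function.update_self]
      congr 1
      refine Finset.sum_congr rfl fun t ht => ?_
      rw [Function.update_of_ne (by simp at ht; omega)]
    refine ⟨c₀, Function.update α T c, Function.update β T b, fun x0 w z => ?_, ?_⟩
    · rw [hα fun t x => inner ℝ x (w t), hβ fun t x => inner ℝ x (z t), Finset.sum_range_succ]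
      have h3 := h1 x0 w z
      have h4 : inner ℝ (a T) (innov Θ L x0 w z T) + inner ℝ c (predErr Θ L x0 w z (T + 1))
          = inner ℝ (Matrix.toEuclideanLin Θ.Cᵀ (a T) + Matrix.toEuclideanLin (filterMat Θ L)ᵀ c)
            (predErr Θ L x0 w z T) + inner ℝ c (w T) + inner ℝ b (z T) := by
        rw [innov, predErr, hb, inner_add_left, inner_toEuclideanLin, inner_toEuclideanLin,
          Matrix.transpose_transpose, Matrix.transpose_transpose, inner_sub_left,
          inner_toEuclideanLin (Θ.A * L)ᵀ, Matrix.transpose_transpose, inner_add_right,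
          inner_sub_right, inner_add_right]
        ring
      linarith
    · rw [hα fun t x => s.σw ^ 2 * ‖x‖ ^ 2, hβ fun t x => s.σz ^ 2 * ‖x‖ ^ 2,
        Finset.sum_range_succ]
      have h3 := innovation_quadratic_identity hσ h (a T) c
      rw [← hL] at h3
      simp only at h3
      linarith

variable {Ω : Type*} [MeasurableSpace Ω] {μ : Measure Ω} [IsProbabilityMeasure μ]

theorem measurable_predErr {x0 : Ω → Vec n} {w : ℕ → Ω → Vec n} {z : ℕ → Ω → Vec m}
    (hx : Measurable x0) (hw : ∀ t, Measurable (w t)) (hz : ∀ t, Measurable (z t)) (t : ℕ) :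
    Measurable fun ω => predErr Θ L (x0 ω) (fun t => w t ω) (fun t => z t ω) t := by
  have hc : ∀ {q r : ℕ} (A : Matrix (Fin q) (Fin r) ℝ), Measurable (Matrix.toEuclideanLin A) :=
    fun A => (LinearMap.continuous_of_finiteDimensional _).measurable
  induction t with
  | zero => exact hx
  | succ t ih =>
    simp only [predErr]
    exact (((hc _).comp ih).add (hw t)).sub ((hc _).comp (hz t))

theorem measurable_innov {x0 : Ω → Vec n} {w : ℕ → Ω → Vec n} {z : ℕ → Ω → Vec m}
    (hx : Measurable x0) (hw : ∀ t, Measurable (w t)) (hz : ∀ t, Measurable (z t)) (t : ℕ) :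
    Measurable fun ω => innov Θ L (x0 ω) (fun t => w t ω) (fun t => z t ω) t :=
  (((LinearMap.continuous_of_finiteDimensional _).measurable).comp
    (measurable_predErr hx hw hz t)).add (hz t)

theorem posSemidef_smul_one (k : ℕ) (σ : ℝ) :
    (σ ^ 2 • (1 : Matrix (Fin k) (Fin k) ℝ)).PosSemidef :=
  Matrix.PosSemidef.one.smul (sq_nonneg σ)

theorem inner_smul_one {k : ℕ} (σ : ℝ) (a : Vec k) :
    inner ℝ a (Matrix.toEuclideanLin (σ ^ 2 • (1 : Matrix (Fin k) (Fin k) ℝ)) a)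
      = σ ^ 2 * ‖a‖ ^ 2 := by
  rw [map_smul, LinearMap.smul_apply, toEuclideanLin_one_apply, real_inner_smul_right,
    real_inner_self_eq_norm_sq]

/-- Linear functionals of innovations and excitation are Gaussian. -/
theorem hasGauss_innov_sum (hσ : 0 < s.σz) (h : IsFilterRiccati s Θ Sig)
    (hL : L = kalmanGain s Θ Sig) {x0 : Ω → Vec n} {w : ℕ → Ω → Vec n} {z : ℕ → Ω → Vec m}
    {exc : ℕ → Ω → Vec p} (hn : SystemNoise μ s Sig x0 w z) (hem : ∀ t, Measurable (exc t))
    (hel : ∀ t, μ.map (exc t) = multivariateGaussian 0 (s.σu ^ 2 • 1)) (hei : iIndepFun exc μ)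
    (hen : IndepFun (fun ω t => exc t ω) (fun ω => (x0 ω, (fun t => w t ω), (fun t => z t ω))) μ)
    (a : ℕ → Vec m) (b : ℕ → Vec p) (T : ℕ) :
    HasGauss μ (fun ω => ∑ t ∈ Finset.range T,
        (inner ℝ (a t) (innov Θ L (x0 ω) (fun t => w t ω) (fun t => z t ω) t)
          + inner ℝ (b t) (exc t ω)))
      (∑ t ∈ Finset.range T, (inner ℝ (a t) (Matrix.toEuclideanLin (innovCov s Θ Sig) (a t))
        + s.σu ^ 2 * ‖b t‖ ^ 2)) := by
  -- The terminal weight on the prediction error served the induction only; here it is zero.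
  obtain ⟨c₀, α, β, h1, h2⟩ := exists_noise_functional hσ h hL a T 0
  simp only [inner_zero_left, add_zero] at h1 h2
  simp only [Finset.sum_add_distrib, h1, ← h2]
  have gx := hasGauss_inner hn.meas_x0 h.1 hn.law_x0 c₀
  have gw : HasGauss μ (fun ω => ∑ t ∈ Finset.range T, inner ℝ (α t) (w t ω))
      (∑ t ∈ Finset.range T, s.σw ^ 2 * ‖α t‖ ^ 2) :=
    HasGauss.sum hn.meas_w hn.indep_w (f := fun t x => inner ℝ (α t) x) (fun t => by fun_prop)
      (fun t => by
        rw [← inner_smul_one]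
        exact hasGauss_inner (hn.meas_w t) (posSemidef_smul_one _ _) (hn.law_w t) _) T
  have gz : HasGauss μ (fun ω => ∑ t ∈ Finset.range T, inner ℝ (β t) (z t ω))
      (∑ t ∈ Finset.range T, s.σz ^ 2 * ‖β t‖ ^ 2) :=
    HasGauss.sum hn.meas_z hn.indep_z (f := fun t x => inner ℝ (β t) x) (fun t => by fun_prop)
      (fun t => by
        rw [← inner_smul_one]
        exact hasGauss_inner (hn.meas_z t) (posSemidef_smul_one _ _) (hn.law_z t) _) T
  have ge : HasGauss μ (fun ω => ∑ t ∈ Finset.range T, inner ℝ (b t) (exc t ω))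
      (∑ t ∈ Finset.range T, s.σu ^ 2 * ‖b t‖ ^ 2) :=
    HasGauss.sum hem hei (f := fun t x => inner ℝ (b t) x) (fun t => by fun_prop)
      (fun t => by
        rw [← inner_smul_one]
        exact hasGauss_inner (hem t) (posSemidef_smul_one _ _) (hel t) _) T
  have hfw : Measurable fun f : ℕ → Vec n => ∑ t ∈ Finset.range T, inner ℝ (α t) (f t) := by
    fun_prop
  have hfz : Measurable fun f : ℕ → Vec m => ∑ t ∈ Finset.range T, inner ℝ (β t) (f t) := by
    fun_prop
  have hfe : Measurable fun f : ℕ → Vec p => ∑ t ∈ Finset.range T, inner ℝ (b t) (f t) := by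
    fun_prop
  have hwz : IndepFun (fun ω => ∑ t ∈ Finset.range T, inner ℝ (α t) (w t ω))
      (fun ω => ∑ t ∈ Finset.range T, inner ℝ (β t) (z t ω)) μ := hn.indep_w_z.comp hfw hfz
  have hx : IndepFun (fun ω => inner ℝ c₀ (x0 ω))
      (fun ω => ∑ t ∈ Finset.range T, inner ℝ (α t) (w t ω)
        + ∑ t ∈ Finset.range T, inner ℝ (β t) (z t ω)) μ :=
    hn.indep_x0.comp (φ := fun x => inner ℝ c₀ x)
      (ψ := fun q : (ℕ → Vec n) × (ℕ → Vec m) => ∑ t ∈ Finset.range T, inner ℝ (α t) (q.1 t)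
        + ∑ t ∈ Finset.range T, inner ℝ (β t) (q.2 t)) (by fun_prop) (by fun_prop)
  have he : IndepFun (fun ω => inner ℝ c₀ (x0 ω)
      + (∑ t ∈ Finset.range T, inner ℝ (α t) (w t ω)
        + ∑ t ∈ Finset.range T, inner ℝ (β t) (z t ω)))
      (fun ω => ∑ t ∈ Finset.range T, inner ℝ (b t) (exc t ω)) μ :=
    (hen.comp (φ := fun f : ℕ → Vec p => ∑ t ∈ Finset.range T, inner ℝ (b t) (f t))
      (ψ := fun q : Vec n × (ℕ → Vec n) × (ℕ → Vec m) => inner ℝ c₀ q.1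
        + (∑ t ∈ Finset.range T, inner ℝ (α t) (q.2.1 t)
        + ∑ t ∈ Finset.range T, inner ℝ (β t) (q.2.2 t))) hfe (by fun_prop)).symm
  exact (gx.add (gw.add gz hwz) hx).add ge he

/-- A sequence whose finite linear functionals are Gaussian with additive variances is
independent. -/
theorem iIndepFun_of_hasGauss_sum {e : ℕ → Ω → Vec m} {x : ℕ → Ω → Vec p}
    (he : ∀ t, Measurable (e t)) (hx : ∀ t, Measurable (x t)) {v : Vec m → Vec p → ℝ}
    (h : ∀ (a : ℕ → Vec m) (b : ℕ → Vec p) (T : ℕ), HasGauss μ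
      (fun ω => ∑ t ∈ Finset.range T, (inner ℝ (a t) (e t ω) + inner ℝ (b t) (x t ω)))
      (∑ t ∈ Finset.range T, v (a t) (b t)))
    (h1 : ∀ (a : Vec m) (b : Vec p) (t : ℕ), HasGauss μ
      (fun ω => inner ℝ a (e t ω) + inner ℝ b (x t ω)) (v a b)) (hv0 : v 0 0 = 0) :
    iIndepFun (fun t ω => (e t ω, x t ω)) μ := by
  rw [iIndepFun_iff_finset]
  intro S
  classical
  have hmeas : ∀ t, Measurable fun ω => (e t ω, x t ω) := fun t => (he t).prodMk (hx t)
  -- Independence is read off characteristic functions: additive variances make exp(−½ Σ v) a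
  -- product. Weights are extended by zero to the times outside S.
  refine (iIndepFun_iff_charFunDual_pi (X := fun (i : S) ω => (e i ω, x i ω))
    fun i => (hmeas i).aemeasurable).2 ?_
  intro l
  let li : S → StrongDual ℝ (Vec m × Vec p) := fun i => l.comp (.single ℝ (fun _ : S => Vec m × Vec p) i)
  let a : ℕ → Vec m := fun t => if ht : t ∈ S then
    (InnerProductSpace.toDual ℝ (Vec m)).symm ((li ⟨t, ht⟩).comp (.inl ℝ _ _)) else 0
  let b : ℕ → Vec p := fun t => if ht : t ∈ S then
    (InnerProductSpace.toDual ℝ (Vec p)).symm ((li ⟨t, ht⟩).comp (.inr ℝ _ _)) else 0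
  have hli : ∀ (i : S) (y : Vec m × Vec p), li i y = inner ℝ (a i) y.1 + inner ℝ (b i) y.2 := by
    intro i y
    simp only [a, b, dif_pos i.2, InnerProductSpace.toDual_symm_apply]
    change li i y = li i (ContinuousLinearMap.inl ℝ (Vec m) (Vec p) y.1)
      + li i (ContinuousLinearMap.inr ℝ (Vec m) (Vec p) y.2)
    rw [← map_add]
    simp
  have hsum : ∀ y : S → Vec m × Vec p, l y = ∑ i, li i (y i) := by
    intro y
    simp only [li, ContinuousLinearMap.comp_apply, ← map_sum]
    congr 1
    ext1 i
    simp [Finset.sum_apply, Pi.single_apply]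
  obtain ⟨T, hT⟩ := S.exists_nat_subset_range
  have hout : ∀ t ∉ S, a t = 0 ∧ b t = 0 := fun t ht => ⟨dif_neg ht, dif_neg ht⟩
  have hL : (fun ω => l (fun i : S => (e i ω, x i ω)))
      = fun ω => ∑ t ∈ Finset.range T, (inner ℝ (a t) (e t ω) + inner ℝ (b t) (x t ω)) := by
    ext ω
    rw [hsum]
    simp only [hli]
    rw [Finset.sum_coe_sort S fun t => inner ℝ (a t) (e t ω) + inner ℝ (b t) (x t ω)]
    refine Finset.sum_subset hT fun t _ ht => ?_
    simp [hout t ht]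
  have hvs : ∑ t ∈ Finset.range T, v (a t) (b t) = ∑ i : S, v (a i) (b i) := by
    rw [Finset.sum_coe_sort S fun t => v (a t) (b t)]
    refine (Finset.sum_subset hT fun t _ ht => ?_).symm
    rw [(hout t ht).1, (hout t ht).2, hv0]
  have key : ∀ {w : ℝ} {Y : Ω → ℝ}, HasGauss μ Y w →
      charFun (μ.map Y) 1 = Complex.exp (-(w / 2)) := by
    intro w Y hY
    rw [hY.law, charFun_gaussianReal, Real.coe_toNNReal _ hY.nonneg]
    congr 1
    simp
  rw [charFunDual_eq_charFun_map_one, Measure.map_map (by fun_prop)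
    (measurable_pi_lambda (fun ω (i : S) => (e i ω, x i ω)) fun i => hmeas i)]
  have e1 : (l ∘ fun ω (i : S) => (e i ω, x i ω))
      = fun ω => ∑ t ∈ Finset.range T, (inner ℝ (a t) (e t ω) + inner ℝ (b t) (x t ω)) := hL
  rw [e1, key (h a b T), hvs]
  have e2 : ∀ i : S, charFunDual (μ.map fun ω => (e i ω, x i ω))
      (l.comp (.single ℝ (fun _ : S => Vec m × Vec p) i)) = Complex.exp (-(v (a i) (b i) / 2)) := by
    intro i
    rw [charFunDual_eq_charFun_map_one, Measure.map_map (by fun_prop) (hmeas i), ← key (h1 _ _ i)]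
    congr 2
    ext ω
    exact hli i _
  rw [Finset.prod_congr rfl fun i _ => e2 i, ← Complex.exp_sum]
  congr 1
  push_cast
  rw [Finset.sum_neg_distrib, Finset.sum_div]

end Innovations

/-! ### White noise and the σ-algebras it generates. -/

section WhiteNoise

variable {Ω : Type*} [MeasurableSpace Ω] {μ : Measure Ω}

/-- Independent centered Gaussian vectors with covariances between `v₀` and `v₁`. -/
structure WhiteNoise (μ : Measure Ω) (e : ℕ → Ω → Vec m) (exc : ℕ → Ω → Vec p) (v₀ v₁ : ℝ) :
    Prop where
  meas_out : ∀ t, Measurable (e t)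
  meas_in : ∀ t, Measurable (exc t)
  indep : iIndepFun (fun t ω => (e t ω, exc t ω)) μ
  gauss : ∀ (a : Vec m) (b : Vec p) (t : ℕ), ∃ v, v₀ * (‖a‖ ^ 2 + ‖b‖ ^ 2) ≤ v ∧
    v ≤ v₁ * (‖a‖ ^ 2 + ‖b‖ ^ 2) ∧
    HasGauss μ (fun ω => inner ℝ a (e t ω) + inner ℝ b (exc t ω)) v

/-- The σ-algebra generated by the noise at the times in `I`. -/
@[reducible]
def noiseAlg (e : ℕ → Ω → Vec m) (exc : ℕ → Ω → Vec p) (I : Set ℕ) : MeasurableSpace Ω :=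
  ⨆ t ∈ I, MeasurableSpace.comap (fun ω => (e t ω, exc t ω)) inferInstance

variable {e : ℕ → Ω → Vec m} {exc : ℕ → Ω → Vec p}

theorem noiseAlg_mono {I J : Set ℕ} (h : I ⊆ J) : noiseAlg e exc I ≤ noiseAlg e exc J :=
  biSup_mono fun _ ht => h ht

theorem noiseAlg_le (he : ∀ t, Measurable (e t)) (hx : ∀ t, Measurable (exc t)) (I : Set ℕ) :
    noiseAlg e exc I ≤ ‹MeasurableSpace Ω› :=
  iSup₂_le fun t _ => ((he t).prodMk (hx t)).comap_le

theorem measurable_noiseAlg {I : Set ℕ} {t : ℕ} (ht : t ∈ I) :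
    Measurable[noiseAlg e exc I] (fun ω => (e t ω, exc t ω)) :=
  measurable_iff_comap_le.2 (le_iSup₂_of_le t ht le_rfl)

theorem measurable_out_noiseAlg {I : Set ℕ} {t : ℕ} (ht : t ∈ I) :
    Measurable[noiseAlg e exc I] (e t) :=
  measurable_fst.comp (measurable_noiseAlg ht)

theorem measurable_in_noiseAlg {I : Set ℕ} {t : ℕ} (ht : t ∈ I) :
    Measurable[noiseAlg e exc I] (exc t) :=
  measurable_snd.comp (measurable_noiseAlg ht)

theorem WhiteNoise.indep_noiseAlg {v₀ v₁ : ℝ} (h : WhiteNoise μ e exc v₀ v₁) {I J : Set ℕ}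
    (hIJ : Disjoint I J) : Indep (noiseAlg e exc I) (noiseAlg e exc J) μ :=
  indep_iSup_of_disjoint (fun t => ((h.meas_out t).prodMk (h.meas_in t)).comap_le) h.indep hIJ

/-- The set I may contain times after t; the small-ball estimate conditions on all times but one. -/
theorem WhiteNoise.indepFun {v₀ v₁ : ℝ} (h : WhiteNoise μ e exc v₀ v₁) {I : Set ℕ} {t : ℕ}
    (ht : t ∉ I) (a : Vec m) (b : Vec p) {E : Type*} [MeasurableSpace E] {Z : Ω → E}
    (hZ : Measurable[noiseAlg e exc I] Z) :
    IndepFun Z (fun ω => inner ℝ a (e t ω) + inner ℝ b (exc t ω)) μ := by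
  refine indep_of_indep_of_le_left (indep_of_indep_of_le_right
    (h.indep_noiseAlg (J := {t}) (Set.disjoint_singleton_right.2 ht)) ?_)
    (measurable_iff_comap_le.1 hZ)
  rw [← measurable_iff_comap_le]
  have h1 := measurable_out_noiseAlg (e := e) (exc := exc) (Set.mem_singleton t)
  have h2 := measurable_in_noiseAlg (e := e) (exc := exc) (Set.mem_singleton t)
  exact (measurable_const.inner h1).add (measurable_const.inner h2)

end WhiteNoise

/-! ### Measurability tools. -/

section Measurability

theorem measurable_toEuclideanLin {q r : ℕ} (A : Matrix (Fin q) (Fin r) ℝ) :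
    Measurable (Matrix.toEuclideanLin A) :=
  (LinearMap.continuous_of_finiteDimensional _).measurable

theorem measurable_toEuclideanLin_apply {Ω : Type*} {mΩ : MeasurableSpace Ω} {q r : ℕ}
    {A : Ω → Matrix (Fin q) (Fin r) ℝ} {x : Ω → Vec r} (hA : ∀ i j, Measurable fun ω => A ω i j)
    (hx : Measurable x) : Measurable fun ω => Matrix.toEuclideanLin (A ω) (x ω) := by
  have h1 : Measurable fun ω => (fun i => ∑ j, A ω i j * x ω j) := by
    refine measurable_pi_lambda _ fun i => Finset.measurable_sum _ fun j _ => (hA i j).mul ?_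
    exact (EuclideanSpace.proj (𝕜 := ℝ) j).continuous.measurable.comp hx
  exact (WithLp.measurable_toLp 2 (Fin q → ℝ)).comp h1

theorem dataHistory_le {Ω : Type*} {𝓜 : MeasurableSpace Ω} {y : ℕ → Ω → Vec m} {u : ℕ → Ω → Vec p}
    {t : ℕ} (hy : ∀ r ≤ t, Measurable[𝓜] (y r)) (hu : ∀ r < t, Measurable[𝓜] (u r)) :
    dataHistory y u t ≤ 𝓜 := by
  refine sup_le (iSup₂_le fun r hr => ?_) (iSup₂_le fun r hr => ?_)
  · exact measurable_iff_comap_le.1 (hy r (by simp at hr; omega))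
  · exact measurable_iff_comap_le.1 (hu r (by simpa using hr))

end Measurability

/-! ### Innovations form and adaptedness of a run. -/

section Run

variable {Ω : Type*} [MeasurableSpace Ω] {μ : Measure Ω} {s : Setup m p} {c : RadiusConst}
  {S : Set (LinSys n m p)} {Θ : LinSys n m p} {Sig : Matrix (Fin n) (Fin n) ℝ}
  {L : Matrix (Fin n) (Fin m) ℝ} {T Tw d₁ d₂ : ℕ} {X : Processes n m p Ω}

/-- The innovations of a run. -/
def Processes.innov (X : Processes n m p Ω) (Θ : LinSys n m p) (L : Matrix (Fin n) (Fin m) ℝ)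
    (t : ℕ) (ω : Ω) : Vec m :=
  LQG.innov Θ L (X.x0 ω) (fun t => X.w t ω) (fun t => X.z t ω) t

/-- The optimal one-step predictions of the state in a run. -/
def Processes.optPred (X : Processes n m p Ω) (Θ : LinSys n m p) (L : Matrix (Fin n) (Fin m) ℝ)
    (t : ℕ) (ω : Ω) : Vec n :=
  X.x t ω - predErr Θ L (X.x0 ω) (fun t => X.w t ω) (fun t => X.z t ω) t

theorem IsLqgOptRun.optPred_zero (h : IsLqgOptRun μ s c S Θ Sig L T Tw d₁ d₂ X) (ω : Ω) :
    X.optPred Θ L 0 ω = 0 := by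
  rw [Processes.optPred, h.trajectory.init, predErr, sub_self]

theorem IsLqgOptRun.output_eq (h : IsLqgOptRun μ s c S Θ Sig L T Tw d₁ d₂ X) (t : ℕ) (ω : Ω) :
    X.y t ω = Matrix.toEuclideanLin Θ.C (X.optPred Θ L t ω) + X.innov Θ L t ω := by
  rw [h.trajectory.output, Processes.optPred, Processes.innov, LQG.innov, map_sub]
  abel

/-- Inputs act on the state but not on the prediction error, so the difference carries them in full.
-/
theorem IsLqgOptRun.optPred_succ (h : IsLqgOptRun μ s c S Θ Sig L T Tw d₁ d₂ X) (t : ℕ) (ω : Ω) :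
    X.optPred Θ L (t + 1) ω = Matrix.toEuclideanLin Θ.A (X.optPred Θ L t ω)
      + Matrix.toEuclideanLin Θ.B (X.u t ω) + Matrix.toEuclideanLin (Θ.A * L) (X.innov Θ L t ω) := by
  rw [Processes.optPred, h.trajectory.state, predErr, Processes.optPred, Processes.innov, LQG.innov,
    filterMat]
  simp only [map_sub, map_add, LinearMap.sub_apply, toEuclideanLin_mul_apply]
  abel

theorem IsLqgOptRun.closedLoop (h : IsLqgOptRun μ s c S Θ Sig L T Tw d₁ d₂ X) (ω : Ω) :
    ClosedLoop Θ (Θ.A * L) Tw (fun i => X.Θopt i ω) (fun i => X.Kopt i ω) (fun i => X.Lopt i ω)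
      (fun t => X.innov Θ L t ω) (fun t => X.optPred Θ L t ω) (fun t => X.xpred t ω)
      (fun t => X.xfilt t ω) (fun t => X.u t ω) where
  xi_zero := h.optPred_zero ω
  xi_succ t := h.optPred_succ t ω
  xp_zero := h.pred_init ω
  xp_succ t := h.pred t ω
  filt t := by rw [h.filt t ω, h.output_eq t ω]
  input t ht := by rw [h.input t ω, if_neg (by omega)]

theorem IsLqgOptRun.measurable_innov (h : IsLqgOptRun μ s c S Θ Sig L T Tw d₁ d₂ X) (t : ℕ) :
    Measurable (X.innov Θ L t) :=
  LQG.measurable_innov h.noise.meas_x0 h.noise.meas_w h.noise.meas_z t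

/-- Measurability of the earlier inputs is assumed here so that the lemma can be used inside the
strong induction that proves it. -/
theorem IsLqgOptRun.measurable_optPred_of (h : IsLqgOptRun μ s c S Θ Sig L T Tw d₁ d₂ X) {t : ℕ}
    (hu : ∀ r < t, Measurable[noiseAlg (X.innov Θ L) X.exc (Set.Iio t)] (X.u r)) :
    ∀ r ≤ t, Measurable[noiseAlg (X.innov Θ L) X.exc (Set.Iio t)] (X.optPred Θ L r) := by
  intro r
  induction r with
  | zero =>
    intro _
    have : X.optPred Θ L 0 = fun _ => 0 := funext h.optPred_zero
    rw [this]
    exact measurable_const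
  | succ r ih =>
    intro hr
    have : X.optPred Θ L (r + 1) = fun ω => Matrix.toEuclideanLin Θ.A (X.optPred Θ L r ω)
      + Matrix.toEuclideanLin Θ.B (X.u r ω) + Matrix.toEuclideanLin (Θ.A * L) (X.innov Θ L r ω) :=
      funext (h.optPred_succ r)
    rw [this]
    exact (((measurable_toEuclideanLin _).comp (ih (by omega))).add
      ((measurable_toEuclideanLin _).comp (hu r (by omega)))).add
      ((measurable_toEuclideanLin _).comp (measurable_out_noiseAlg (Set.mem_Iio.2 (by omega))))

theorem IsLqgOptRun.measurable_xpred_of (h : IsLqgOptRun μ s c S Θ Sig L T Tw d₁ d₂ X)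
    (hTw : 0 < Tw) {t : ℕ} (ht : Tw ≤ t) {I : Set ℕ}
    (hy : ∀ r ≤ t, Measurable[noiseAlg (X.innov Θ L) X.exc I] (X.y r))
    (hu : ∀ r < t, Measurable[noiseAlg (X.innov Θ L) X.exc I] (X.u r)) :
    ∀ r ≤ t, Measurable[noiseAlg (X.innov Θ L) X.exc I] (X.xpred r) ∧
      Measurable[noiseAlg (X.innov Θ L) X.exc I] (X.xfilt r) := by
  have hle : ∀ r ≤ t, dataHistory X.y X.u (2 ^ epoch Tw r * Tw) ≤ noiseAlg (X.innov Θ L) X.exc I := by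
    intro r hr
    have h1 : 2 ^ epoch Tw r * Tw ≤ t := by
      by_cases hrw : r < Tw
      · rw [epoch_of_lt hrw, pow_zero, one_mul]; exact ht
      · exact (epoch_spec hTw (not_lt.1 hrw)).1.trans hr
    exact dataHistory_le (fun q hq => hy q (by omega)) fun q hq => hu q (by omega)
  have hfilt : ∀ r ≤ t, Measurable[noiseAlg (X.innov Θ L) X.exc I] (X.xpred r) →
      Measurable[noiseAlg (X.innov Θ L) X.exc I] (X.xfilt r) := by
    intro r hr hxp
    have : X.xfilt r = fun ω => X.xpred r ω + Matrix.toEuclideanLin (X.Lopt (epoch Tw r) ω)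
        (X.y r ω - Matrix.toEuclideanLin (X.Θopt (epoch Tw r) ω).C (X.xpred r ω)) :=
      funext (h.filt r)
    rw [this]
    refine hxp.add (measurable_toEuclideanLin_apply
      (fun i j => (h.causal_L _ i j).mono (hle r hr) le_rfl) ((hy r hr).sub ?_))
    exact measurable_toEuclideanLin_apply
      (fun i j => (h.causal_C _ i j).mono (hle r hr) le_rfl) hxp
  have hpred : ∀ r ≤ t, Measurable[noiseAlg (X.innov Θ L) X.exc I] (X.xpred r) := by
    intro r
    induction r with
    | zero =>
      intro _
      have : X.xpred 0 = fun _ => 0 := funext h.pred_init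
      rw [this]
      exact measurable_const
    | succ r ih =>
      intro hr
      have : X.xpred (r + 1) = fun ω =>
          Matrix.toEuclideanLin (X.Θopt (epoch Tw r) ω).A (X.xfilt r ω)
          + Matrix.toEuclideanLin (X.Θopt (epoch Tw r) ω).B (X.u r ω) := funext (h.pred r)
      rw [this]
      exact (measurable_toEuclideanLin_apply
        (fun i j => (h.causal_A _ i j).mono (hle r (by omega)) le_rfl)
        (hfilt r (by omega) (ih (by omega)))).add (measurable_toEuclideanLin_apply
        (fun i j => (h.causal_B _ i j).mono (hle r (by omega)) le_rfl) (hu r (by omega)))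
  exact fun r hr => ⟨hpred r hr, hfilt r hr (hpred r hr)⟩

/-- Outputs and inputs are functions of the past noise. -/
theorem IsLqgOptRun.measurable_data (h : IsLqgOptRun μ s c S Θ Sig L T Tw d₁ d₂ X)
    (hTw : 0 < Tw) (t : ℕ) :
    Measurable[noiseAlg (X.innov Θ L) X.exc (Set.Iio (t + 1))] (X.y t) ∧
      Measurable[noiseAlg (X.innov Θ L) X.exc (Set.Iio (t + 1))] (X.u t) := by
  induction t using Nat.strong_induction_on with
  | _ t ih =>
    have hxi := h.measurable_optPred_of (t := t) (fun r hr => (ih r hr).2.mono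
      (noiseAlg_mono (Set.Iio_subset_Iio (by omega))) le_rfl) t le_rfl
    have hmono : noiseAlg (X.innov Θ L) X.exc (Set.Iio t)
        ≤ noiseAlg (X.innov Θ L) X.exc (Set.Iio (t + 1)) :=
      noiseAlg_mono (Set.Iio_subset_Iio (by omega))
    have hy : Measurable[noiseAlg (X.innov Θ L) X.exc (Set.Iio (t + 1))] (X.y t) := by
      have : X.y t = fun ω => Matrix.toEuclideanLin Θ.C (X.optPred Θ L t ω) + X.innov Θ L t ω :=
        funext (h.output_eq t)
      rw [this]
      exact ((measurable_toEuclideanLin _).comp (hxi.mono hmono le_rfl)).add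
        (measurable_out_noiseAlg (Set.mem_Iio.2 (by omega)))
    refine ⟨hy, ?_⟩
    have hpast : ∀ r < t, Measurable[noiseAlg (X.innov Θ L) X.exc (Set.Iio (t + 1))] (X.y r) ∧
        Measurable[noiseAlg (X.innov Θ L) X.exc (Set.Iio (t + 1))] (X.u r) := fun r hr =>
      ⟨(ih r hr).1.mono (noiseAlg_mono (Set.Iio_subset_Iio (by omega))) le_rfl,
        (ih r hr).2.mono (noiseAlg_mono (Set.Iio_subset_Iio (by omega))) le_rfl⟩
    have hyr : ∀ r ≤ t, Measurable[noiseAlg (X.innov Θ L) X.exc (Set.Iio (t + 1))] (X.y r) := by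
      intro r hr
      rcases hr.lt_or_eq with h1 | rfl
      · exact (hpast r h1).1
      · exact hy
    by_cases ht : t < Tw
    · have : X.u t = X.exc t := by
        ext1 ω
        rw [h.input, if_pos ht]
      rw [this]
      exact measurable_in_noiseAlg (Set.mem_Iio.2 (by omega))
    · have : X.u t = fun ω =>
          -Matrix.toEuclideanLin (X.Kopt (epoch Tw t) ω) (X.xfilt t ω) := by
        ext1 ω
        rw [h.input, if_neg ht]
      rw [this]
      have hxf := (h.measurable_xpred_of hTw (not_lt.1 ht) hyr (fun r hr => (hpast r hr).2) t
        le_rfl).2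
      refine (measurable_toEuclideanLin_apply (fun i j => (h.causal_K _ i j).mono ?_ le_rfl)
        hxf).neg
      have hes := (epoch_spec hTw (not_lt.1 ht)).1
      exact dataHistory_le (fun q hq => hyr q (by omega)) fun q hq => (hpast q (by omega)).2

theorem IsLqgOptRun.whiteNoise [IsProbabilityMeasure μ] (hs : s.Valid)
    (hSig : IsFilterRiccati s Θ Sig) (hL : L = kalmanGain s Θ Sig)
    (h : IsLqgOptRun μ s c S Θ Sig L T Tw d₁ d₂ X) :
    WhiteNoise μ (X.innov Θ L) X.exc (min (s.σz ^ 2) (s.σu ^ 2))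
      (max ‖innovCov s Θ Sig‖ (s.σu ^ 2)) := by
  let v : Vec m → Vec p → ℝ := fun a b =>
    inner ℝ a (Matrix.toEuclideanLin (innovCov s Θ Sig) a) + s.σu ^ 2 * ‖b‖ ^ 2
  have hsum : ∀ (a : ℕ → Vec m) (b : ℕ → Vec p) (T : ℕ), HasGauss μ
      (fun ω => ∑ t ∈ Finset.range T, (inner ℝ (a t) (X.innov Θ L t ω)
        + inner ℝ (b t) (X.exc t ω))) (∑ t ∈ Finset.range T, v (a t) (b t)) :=
    hasGauss_innov_sum hs.σz_pos hSig hL h.noise h.meas_exc h.law_exc h.indep_exc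
      h.indep_exc_noise
  have hone : ∀ (a : Vec m) (b : Vec p) (t : ℕ), HasGauss μ
      (fun ω => inner ℝ a (X.innov Θ L t ω) + inner ℝ b (X.exc t ω)) (v a b) := by
    intro a b t
    have h1 := hsum (Pi.single t a) (Pi.single t b) (t + 1)
    have h2 : ∀ (f : ℕ → Vec m → Vec p → ℝ), (∀ r, f r 0 0 = 0) →
        ∑ r ∈ Finset.range (t + 1), f r ((Pi.single t a : ℕ → Vec m) r)
          ((Pi.single t b : ℕ → Vec p) r) = f t a b := by
      intro f hf
      rw [Finset.sum_eq_single t]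
      · simp
      · intro r _ hr
        simp [hr, hf]
      · simp
    have e1 := h2 (fun r a b => v a b) (fun r => by simp [v])
    rw [e1] at h1
    convert h1 using 1
    ext ω
    exact (h2 (fun r a b => inner ℝ a (X.innov Θ L r ω) + inner ℝ b (X.exc r ω))
      (fun r => by simp)).symm
  refine ⟨h.measurable_innov, h.meas_exc,
    iIndepFun_of_hasGauss_sum h.measurable_innov h.meas_exc hsum hone (by simp [v]),
    fun a b t => ⟨v a b, ?_, ?_, hone a b t⟩⟩
  · have h1 : s.σz ^ 2 * ‖a‖ ^ 2 ≤ inner ℝ a (Matrix.toEuclideanLin (innovCov s Θ Sig) a) := by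
      have h2 : 0 ≤ inner ℝ a (Matrix.toEuclideanLin (Θ.C * Sig * Θ.Cᵀ) a) :=
        inner_nonneg_of_posSemidef (by simpa using hSig.1.mul_mul_conjTranspose_same Θ.C) a
      rw [innovCov, map_add, LinearMap.add_apply, inner_add_right, inner_smul_one]
      linarith
    have h3 : min (s.σz ^ 2) (s.σu ^ 2) * ‖a‖ ^ 2 ≤ s.σz ^ 2 * ‖a‖ ^ 2 := by
      gcongr; exact min_le_left _ _
    have h4 : min (s.σz ^ 2) (s.σu ^ 2) * ‖b‖ ^ 2 ≤ s.σu ^ 2 * ‖b‖ ^ 2 := by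
      gcongr; exact min_le_right _ _
    simp only [v]
    linarith
  · have h1 : inner ℝ a (Matrix.toEuclideanLin (innovCov s Θ Sig) a)
        ≤ ‖innovCov s Θ Sig‖ * ‖a‖ ^ 2 := by
      refine (real_inner_le_norm _ _).trans ?_
      have := norm_toEuclideanLin_le (innovCov s Θ Sig) a
      nlinarith [norm_nonneg a]
    have h3 : ‖innovCov s Θ Sig‖ * ‖a‖ ^ 2 ≤ max ‖innovCov s Θ Sig‖ (s.σu ^ 2) * ‖a‖ ^ 2 := by
      gcongr; exact le_max_left _ _
    have h4 : s.σu ^ 2 * ‖b‖ ^ 2 ≤ max ‖innovCov s Θ Sig‖ (s.σu ^ 2) * ‖b‖ ^ 2 := by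
      gcongr; exact le_max_right _ _
    simp only [v]
    linarith

end Run

/-! ### Exponential supermartingales and small-ball estimates. -/

section GaussianIntegrals

/-- Compensating with the upper bound v₁ rather than the variance gives a supermartingale whatever
the covariance of the innovations. -/
theorem lintegral_exp_gaussianReal_le {v v₁ : ℝ} (hv0 : 0 ≤ v) (hv : v ≤ v₁) (c : ℝ) :
    ∫⁻ x, ENNReal.ofReal (Real.exp (c * x - v₁ * c ^ 2 / 2)) ∂gaussianReal 0 v.toNNReal ≤ 1 := by
  have h1 : Integrable (fun x => Real.exp (c * x)) (gaussianReal 0 v.toNNReal) :=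
    integrable_exp_mul_gaussianReal c
  have h2 : ∫ x, Real.exp (c * x) ∂gaussianReal 0 v.toNNReal = Real.exp (v * c ^ 2 / 2) := by
    have := mgf_gaussianReal (p := gaussianReal 0 v.toNNReal) (X := id) (μ := 0)
      (v := v.toNNReal) (by simp) c
    simpa [mgf, Real.coe_toNNReal _ hv0] using this
  have h3 : ∀ x : ℝ, Real.exp (c * x - v₁ * c ^ 2 / 2)
      = Real.exp (c * x) * Real.exp (-(v₁ * c ^ 2 / 2)) := fun x => by
    rw [← Real.exp_add, sub_eq_add_neg]
  simp only [h3]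
  rw [← ofReal_integral_eq_lintegral_ofReal (h1.mul_const _)
    (ae_of_all _ fun x => by positivity), integral_mul_const, h2, ← Real.exp_add]
  refine ENNReal.ofReal_le_one.2 (Real.exp_le_one_iff.2 ?_)
  have := mul_le_mul_of_nonneg_right hv (sq_nonneg c)
  linarith

/-- Bound the density by its maximum and integrate the kernel against Lebesgue measure. Translation
invariance makes the bound uniform in the shift ζ, which will be the contribution of the other
noise. -/
theorem lintegral_exp_neg_sq_gaussianReal_le {v θ : ℝ} (hv : 0 < v) (hθ : 0 < θ) (ζ : ℝ) :
    ∫⁻ x, ENNReal.ofReal (Real.exp (-θ * (x + ζ) ^ 2)) ∂gaussianReal 0 v.toNNReal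
      ≤ ENNReal.ofReal (√(1 / (2 * θ * v))) := by
  have hv' : v.toNNReal ≠ 0 := by simpa using hv
  have hexp := integrable_exp_neg_mul_sq hθ
  have hpdf : ∀ x, gaussianPDF 0 v.toNNReal x ≤ ENNReal.ofReal (√(2 * Real.pi * v))⁻¹ := by
    intro x
    rw [gaussianPDF]
    refine ENNReal.ofReal_le_ofReal ?_
    rw [gaussianPDFReal, Real.coe_toNNReal _ hv.le]
    refine mul_le_of_le_one_right (by positivity) (Real.exp_le_one_iff.2 ?_)
    have : 0 ≤ (x - 0) ^ 2 / (2 * v) := by positivity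
    rw [neg_div]
    linarith
  rw [gaussianReal_of_var_ne_zero _ hv', lintegral_withDensity_eq_lintegral_mul _
    (measurable_gaussianPDF _ _) (by fun_prop)]
  calc ∫⁻ x, (gaussianPDF 0 v.toNNReal * fun x =>
        ENNReal.ofReal (Real.exp (-θ * (x + ζ) ^ 2))) x
      ≤ ∫⁻ x, ENNReal.ofReal (√(2 * Real.pi * v))⁻¹
          * ENNReal.ofReal (Real.exp (-θ * (x + ζ) ^ 2)) := by
        refine lintegral_mono fun x => ?_
        exact mul_le_mul_left (hpdf x) _
    _ = ENNReal.ofReal (√(2 * Real.pi * v))⁻¹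
          * ∫⁻ x, ENNReal.ofReal (Real.exp (-θ * x ^ 2)) := by
        rw [lintegral_const_mul _ (by fun_prop), lintegral_add_right_eq_self
          (fun x => ENNReal.ofReal (Real.exp (-θ * x ^ 2))) ζ]
    _ = _ := by
        rw [← ofReal_integral_eq_lintegral_ofReal hexp (ae_of_all _ fun x => by positivity),
          integral_gaussian, ← ENNReal.ofReal_mul (by positivity), ← Real.sqrt_inv,
          ← Real.sqrt_mul (by positivity)]
        congr 2
        field_simp

variable {Ω : Type*} [MeasurableSpace Ω] {μ : Measure Ω} [IsProbabilityMeasure μ]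

/-- Takes the place of conditional expectations: independence gives a product law, and Fubini
integrates out the fresh Gaussian first. -/
theorem HasGauss.lintegral_le {g : Ω → ℝ} {v : ℝ} (hg : HasGauss μ g v) {E : Type*}
    [MeasurableSpace E] {Z : Ω → E} (hZ : Measurable Z) (h : IndepFun Z g μ) {F : E → ℝ → ℝ≥0∞}
    (hF : Measurable (Function.uncurry F)) {Y : E → ℝ≥0∞} (hY : Measurable Y) {q : ℝ≥0∞}
    (hle : ∀ z, ∫⁻ x, F z x ∂gaussianReal 0 v.toNNReal ≤ q * Y z) :
    ∫⁻ ω, F (Z ω) (g ω) ∂μ ≤ q * ∫⁻ ω, Y (Z ω) ∂μ := by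
  have h1 := (indepFun_iff_map_prod_eq_prod_map_map hZ.aemeasurable hg.meas.aemeasurable).1 h
  have h2 : ∫⁻ ω, F (Z ω) (g ω) ∂μ
      = ∫⁻ x, Function.uncurry F x ∂(μ.map fun ω => (Z ω, g ω)) := by
    rw [lintegral_map hF (hZ.prodMk hg.meas)]
    rfl
  have : SFinite (μ.map Z) := by infer_instance
  rw [h2, h1, hg.law, lintegral_prod _ hF.aemeasurable]
  calc ∫⁻ z, ∫⁻ x, Function.uncurry F (z, x) ∂gaussianReal 0 v.toNNReal ∂μ.map Z
      ≤ ∫⁻ z, q * Y z ∂μ.map Z := lintegral_mono fun z => hle z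
    _ = q * ∫⁻ ω, Y (Z ω) ∂μ := by
        rw [lintegral_const_mul _ hY, lintegral_map hY hZ]

theorem measure_le_lintegral_exp {Y : Ω → ℝ} (hY : Measurable Y) (K : ℝ) :
    μ {ω | K ≤ Y ω} ≤ ENNReal.ofReal (Real.exp (-K)) * ∫⁻ ω, ENNReal.ofReal (Real.exp (Y ω)) ∂μ := by
  rw [← lintegral_const_mul' _ _ ENNReal.ofReal_ne_top]
  refine meas_le_lintegral₀ (by fun_prop) fun ω hω => ?_
  rw [← ENNReal.ofReal_mul (Real.exp_pos _).le, ← Real.exp_add, ENNReal.one_le_ofReal,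
    Real.one_le_exp_iff]
  have : K ≤ Y ω := hω
  linarith

/-- Chernoff bound with the optimal exponents ±a/v₁. -/
theorem HasGauss.measure_abs_ge_le {g : Ω → ℝ} {v v₁ : ℝ} (hg : HasGauss μ g v) (hv : v ≤ v₁)
    (hv₁ : 0 < v₁) {a : ℝ} (ha : 0 ≤ a) :
    μ {ω | a ≤ |g ω|} ≤ ENNReal.ofReal (2 * Real.exp (-(a ^ 2 / (2 * v₁)))) := by
  have key : ∀ c : ℝ, c ^ 2 = (a / v₁) ^ 2 →
      μ {ω | a ^ 2 / v₁ ≤ c * g ω} ≤ ENNReal.ofReal (Real.exp (-(a ^ 2 / (2 * v₁)))) := by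
    intro c hc
    have hm : Measurable fun ω => c * g ω - v₁ * c ^ 2 / 2 := (hg.meas.const_mul c).sub_const _
    have h1 := measure_le_lintegral_exp (μ := μ) hm (a ^ 2 / (2 * v₁))
    have h2 : ∫⁻ ω, ENNReal.ofReal (Real.exp (c * g ω - v₁ * c ^ 2 / 2)) ∂μ ≤ 1 := by
      have h3 := lintegral_exp_gaussianReal_le hg.nonneg hv c
      rwa [← hg.law, lintegral_map (by fun_prop) hg.meas] at h3
    have h4 : {ω | a ^ 2 / v₁ ≤ c * g ω}
        = {ω | a ^ 2 / (2 * v₁) ≤ c * g ω - v₁ * c ^ 2 / 2} := by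
      ext ω
      have : v₁ * c ^ 2 / 2 = a ^ 2 / v₁ - a ^ 2 / (2 * v₁) := by rw [hc]; field_simp; ring
      simp only [Set.mem_ofPred_eq]
      rw [this]
      constructor <;> intro h <;> linarith
    rw [h4]
    exact h1.trans ((mul_le_mul_right h2 _).trans_eq (mul_one _))
  have hsub : {ω | a ≤ |g ω|} ⊆ {ω | a ^ 2 / v₁ ≤ (a / v₁) * g ω}
      ∪ {ω | a ^ 2 / v₁ ≤ (-(a / v₁)) * g ω} := by
    intro ω hω
    have h0 : 0 ≤ a / v₁ := by positivity
    have hω' : a ≤ |g ω| := hω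
    have h1 := mul_le_mul_of_nonneg_left hω' h0
    have h2 : a / v₁ * a = a ^ 2 / v₁ := by ring
    rcases abs_cases (g ω) with ⟨h3, _⟩ | ⟨h3, _⟩
    · left
      rw [h3, h2] at h1
      exact h1
    · right
      rw [h3, h2] at h1
      simp only [Set.mem_ofPred_eq]
      linarith
  refine (measure_mono hsub).trans ((measure_union_le _ _).trans
    ((add_le_add (key _ rfl) (key _ (by ring))).trans_eq ?_))
  rw [← ENNReal.ofReal_add (Real.exp_pos _).le (Real.exp_pos _).le]
  congr 1
  ring

variable {e : ℕ → Ω → Vec m} {exc : ℕ → Ω → Vec p} {v₀ v₁ : ℝ}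

/-- The exponential supermartingale of a transform of white noise. -/
theorem WhiteNoise.lintegral_exp_sum_le (h : WhiteNoise μ e exc v₀ v₁) {a : Vec m} (ha : ‖a‖ = 1)
    {c : ℕ → Ω → ℝ} (H N : ℕ) (hN : H ≤ N)
    (hc : ∀ r, H ≤ r → Measurable[noiseAlg e exc (Set.Iio r)] (c r)) :
    ∫⁻ ω, ENNReal.ofReal (Real.exp (∑ r ∈ Finset.Ico H N,
      (c r ω * inner ℝ a (e r ω) - v₁ * c r ω ^ 2 / 2))) ∂μ ≤ 1 := by
  have hle : ∀ I, noiseAlg e exc I ≤ ‹MeasurableSpace Ω› := noiseAlg_le h.meas_out h.meas_in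
  have hsum : ∀ N, Measurable[noiseAlg e exc (Set.Iio N)] fun ω => ∑ r ∈ Finset.Ico H N,
      (c r ω * inner ℝ a (e r ω) - v₁ * c r ω ^ 2 / 2) := by
    intro N
    refine Finset.measurable_sum _ fun r hr => ?_
    have hrN : r < N := (Finset.mem_Ico.1 hr).2
    have h1 : Measurable[noiseAlg e exc (Set.Iio N)] (c r) :=
      (hc r (Finset.mem_Ico.1 hr).1).mono (noiseAlg_mono (Set.Iio_subset_Iio hrN.le)) le_rfl
    have h2 : Measurable[noiseAlg e exc (Set.Iio N)] (e r) :=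
      measurable_out_noiseAlg (Set.mem_Iio.2 hrN)
    exact (h1.mul (measurable_const.inner h2)).sub (((h1.pow_const 2).const_mul v₁).div_const 2)
  induction N, hN using Nat.le_induction with
  | base => simp
  | succ N hN ih =>
    obtain ⟨v, _, hv, hg⟩ := h.gauss a 0 N
    simp only [inner_zero_left, add_zero, norm_zero, ha] at hg hv
    have hv' : v ≤ v₁ := by linarith
    have hZ : Measurable[noiseAlg e exc (Set.Iio N)] fun ω => ((∑ r ∈ Finset.Ico H N,
      (c r ω * inner ℝ a (e r ω) - v₁ * c r ω ^ 2 / 2)), c N ω) := (hsum N).prodMk (hc N hN)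
    have hind := h.indepFun (t := N) (by simp) a 0 hZ
    simp only [inner_zero_left, add_zero] at hind
    have h1 := hg.lintegral_le (hZ.mono (hle _) le_rfl) hind
      (F := fun z x => ENNReal.ofReal (Real.exp (z.1 + (z.2 * x - v₁ * z.2 ^ 2 / 2))))
      (Y := fun z => ENNReal.ofReal (Real.exp z.1)) (q := 1) (by fun_prop) (by fun_prop)
      (fun z => by
        simp only [Real.exp_add z.1, ENNReal.ofReal_mul (Real.exp_pos _).le]
        rw [lintegral_const_mul _ (by fun_prop), one_mul]
        exact (mul_le_mul_right (lintegral_exp_gaussianReal_le hg.nonneg hv' z.2) _).trans_eq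
          (mul_one _))
    simp only [Finset.sum_Ico_succ_top hN]
    exact (h1.trans_eq (one_mul _)).trans ih

/-- Small-ball estimate for a sequence in which every term contains fresh noise. -/
theorem WhiteNoise.lintegral_exp_neg_sum_sq_le (h : WhiteNoise μ e exc v₀ v₁) {Y Z : ℕ → Ω → ℝ}
    {τ : ℕ → ℕ} {a : Vec m} {b : Vec p} (hv₀ : 0 < v₀) (hab : 0 < ‖a‖ ^ 2 + ‖b‖ ^ 2)
    {θ : ℝ} (hθ : 0 < θ) (N : ℕ)
    (hY : ∀ k < N, ∀ ω, Y k ω = inner ℝ a (e (τ k) ω) + inner ℝ b (exc (τ k) ω) + Z k ω)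
    (hZ : ∀ k < N, Measurable[noiseAlg e exc {τ k}ᶜ] (Z k))
    (hYk : ∀ k < N, ∀ i < k, Measurable[noiseAlg e exc {τ k}ᶜ] (Y i)) :
    ∫⁻ ω, ENNReal.ofReal (Real.exp (-θ * ∑ k ∈ Finset.range N, Y k ω ^ 2)) ∂μ
      ≤ ENNReal.ofReal (√(1 / (2 * θ * (v₀ * (‖a‖ ^ 2 + ‖b‖ ^ 2))))) ^ N := by
  have hle : ∀ I, noiseAlg e exc I ≤ ‹MeasurableSpace Ω› := noiseAlg_le h.meas_out h.meas_in
  induction N with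
  | zero => simp
  | succ N ih =>
    replace ih := ih (fun k hk => hY k (by omega)) (fun k hk => hZ k (by omega))
      fun k hk => hYk k (by omega)
    obtain ⟨v, hv, _, hg⟩ := h.gauss a b (τ N)
    have hv0 : 0 < v := (by positivity : 0 < v₀ * (‖a‖ ^ 2 + ‖b‖ ^ 2)).trans_le hv
    have hS : Measurable[noiseAlg e exc {τ N}ᶜ] fun ω => ∑ k ∈ Finset.range N, Y k ω ^ 2 :=
      Finset.measurable_sum _ fun k hk => (hYk N (by omega) k (Finset.mem_range.1 hk)).pow_const 2
    have hZ' : Measurable[noiseAlg e exc {τ N}ᶜ] fun ω =>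
        (∑ k ∈ Finset.range N, Y k ω ^ 2, Z N ω) := hS.prodMk (hZ N (by omega))
    have hind := h.indepFun (t := τ N) (by simp) a b hZ'
    have h1 := hg.lintegral_le (hZ'.mono (hle _) le_rfl) hind
      (F := fun z x => ENNReal.ofReal (Real.exp (-θ * z.1 + -θ * (x + z.2) ^ 2)))
      (Y := fun z => ENNReal.ofReal (Real.exp (-θ * z.1)))
      (q := ENNReal.ofReal (√(1 / (2 * θ * (v₀ * (‖a‖ ^ 2 + ‖b‖ ^ 2))))))
      (by fun_prop) (by fun_prop)
      (fun z => by
        simp only [Real.exp_add (-θ * z.1), ENNReal.ofReal_mul (Real.exp_pos _).le]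
        rw [lintegral_const_mul _ (by fun_prop), mul_comm]
        refine mul_le_mul_left ((lintegral_exp_neg_sq_gaussianReal_le hv0 hθ z.2).trans
          (ENNReal.ofReal_le_ofReal (Real.sqrt_le_sqrt ?_))) _
        gcongr)
    have h2 : ∀ ω, -θ * ∑ k ∈ Finset.range (N + 1), Y k ω ^ 2
        = -θ * ∑ k ∈ Finset.range N, Y k ω ^ 2
          + -θ * (inner ℝ a (e (τ N) ω) + inner ℝ b (exc (τ N) ω) + Z N ω) ^ 2 := fun ω => by
      rw [Finset.sum_range_succ, hY N (by omega)]
      ring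
    simp only [h2]
    rw [pow_succ']
    exact h1.trans (mul_le_mul_right ih _)

end GaussianIntegrals

/-! ### Regressor functionals as functionals of the noise. -/

section Costate

/-- The adjoint recursion driven by output weights `f`. -/
def costate (Θ : LinSys n m p) (f : ℕ → Vec m) : ℕ → Vec n
  | 0 => 0
  | j + 1 => Matrix.toEuclideanLin Θ.Aᵀ (costate Θ f j) + Matrix.toEuclideanLin Θ.Cᵀ (f j)

/-- Unrolling ξ backwards in time turns weights on outputs into weights on innovations and inputs
plus one term in ξ; the adjoint recursion collects what has been passed to earlier times. -/
theorem sum_weights_eq {Θ : LinSys n m p} {F : Matrix (Fin n) (Fin m) ℝ} {xi : ℕ → Vec n}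
    {e y : ℕ → Vec m} {u : ℕ → Vec p} (f : ℕ → Vec m) (g : ℕ → Vec p) (r : ℕ)
    (hxi : ∀ t, xi (t + 1) = Matrix.toEuclideanLin Θ.A (xi t) + Matrix.toEuclideanLin Θ.B (u t)
      + Matrix.toEuclideanLin F (e t))
    (hy : ∀ t, y t = Matrix.toEuclideanLin Θ.C (xi t) + e t) (J : ℕ) (hJ : J ≤ r) :
    ∑ j ∈ Finset.range J, (inner ℝ (f j) (y (r - 1 - j)) + inner ℝ (g j) (u (r - 1 - j)))
      = ∑ j ∈ Finset.range J,
          (inner ℝ (f j + Matrix.toEuclideanLin Fᵀ (costate Θ f j)) (e (r - 1 - j))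
          + inner ℝ (g j + Matrix.toEuclideanLin Θ.Bᵀ (costate Θ f j)) (u (r - 1 - j)))
        + inner ℝ (costate Θ f J) (xi (r - J)) := by
  induction J with
  | zero => simp [costate]
  | succ J ih =>
    rw [Finset.sum_range_succ, ih (by omega), Finset.sum_range_succ]
    obtain ⟨t, ht⟩ : ∃ t, t = r - (J + 1) := ⟨_, rfl⟩
    rw [show r - J = t + 1 by omega, show r - 1 - J = t by omega, ← ht, hxi, hy, costate]
    simp only [inner_add_left, inner_add_right]
    have h1 := inner_toEuclideanLin Θ.Aᵀ (costate Θ f J) (xi t)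
    have h2 := inner_toEuclideanLin Θ.Bᵀ (costate Θ f J) (u t)
    have h3 := inner_toEuclideanLin Fᵀ (costate Θ f J) (e t)
    have h4 := inner_toEuclideanLin Θ.Cᵀ (f J) (xi t)
    rw [Matrix.transpose_transpose] at h1 h2 h3 h4
    rw [h1, h2, h3, h4]
    ring

/-- Rewritten with the innovation weights as forcing, the recursion is driven by the contraction (A
− FC)ᵀ, so small innovation weights keep the costate small uniformly in the window length. -/
theorem norm_costate_le {Θ : LinSys n m p} {F : Matrix (Fin n) (Fin m) ℝ} {υ η : ℝ} (hυ₁ : υ < 1)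
    (hF : ‖Θ.A - F * Θ.C‖ ≤ υ) (hη : 0 ≤ η) {f : ℕ → Vec m} {J : ℕ}
    (h : ∀ j < J, ‖f j + Matrix.toEuclideanLin Fᵀ (costate Θ f j)‖ ≤ η) :
    ∀ j ≤ J, ‖costate Θ f j‖ ≤ ‖Θ.C‖ * η / (1 - υ) := by
  intro j
  have h1υ : 0 < 1 - υ := by linarith
  induction j with
  | zero => intro _; simp only [costate, norm_zero]; positivity
  | succ j ih =>
    intro hj
    have hrec : costate Θ f (j + 1) = Matrix.toEuclideanLin (Θ.A - F * Θ.C)ᵀ (costate Θ f j)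
        + Matrix.toEuclideanLin Θ.Cᵀ (f j + Matrix.toEuclideanLin Fᵀ (costate Θ f j)) := by
      rw [costate, Matrix.transpose_sub, Matrix.transpose_mul]
      simp only [map_sub, map_add, LinearMap.sub_apply, toEuclideanLin_mul_apply]
      abel
    have h1 := norm_toEuclideanLin_le (Θ.A - F * Θ.C)ᵀ (costate Θ f j)
    have h2 := norm_toEuclideanLin_le Θ.Cᵀ (f j + Matrix.toEuclideanLin Fᵀ (costate Θ f j))
    rw [norm_transpose] at h1 h2
    have h3 : ‖Θ.A - F * Θ.C‖ * ‖costate Θ f j‖ ≤ υ * (‖Θ.C‖ * η / (1 - υ)) := by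
      refine mul_le_mul hF (ih (by omega)) (norm_nonneg _) ((norm_nonneg _).trans hF)
    have h4 := mul_le_mul_of_nonneg_left (h j (by omega)) (norm_nonneg Θ.C)
    have h5 : υ * (‖Θ.C‖ * η / (1 - υ)) + ‖Θ.C‖ * η = ‖Θ.C‖ * η / (1 - υ) := by
      field_simp
      ring
    rw [hrec]
    refine (norm_add_le _ _).trans ?_
    linarith

/-- The output weights in a vector of regressor weights. -/
def outWeight {H : ℕ} (v : BlockIdx H m p → ℝ) (j : ℕ) : Vec m :=
  WithLp.toLp 2 fun i => if h : j < H then v (Sum.inl (⟨j, h⟩, i)) else 0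

/-- The input weights in a vector of regressor weights. -/
def inWeight {H : ℕ} (v : BlockIdx H m p → ℝ) (j : ℕ) : Vec p :=
  WithLp.toLp 2 fun i => if h : j < H then v (Sum.inr (⟨j, h⟩, i)) else 0

theorem dotProduct_regressor {H : ℕ} (v : BlockIdx H m p → ℝ) (y : ℕ → Vec m) (u : ℕ → Vec p)
    (r : ℕ) : v ⬝ᵥ regressor H y u r = ∑ j ∈ Finset.range H,
      (inner ℝ (outWeight v j) (y (r - 1 - j)) + inner ℝ (inWeight v j) (u (r - 1 - j))) := by
  rw [Finset.sum_range, dotProduct, Fintype.sum_sum_type, Finset.sum_add_distrib,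
    Fintype.sum_prod_type, Fintype.sum_prod_type]
  congr 1 <;> refine Finset.sum_congr rfl fun j _ => ?_
  · rw [EuclideanSpace.inner_eq_star_dotProduct, dotProduct]
    refine Finset.sum_congr rfl fun i _ => ?_
    simp [outWeight, regressor, mul_comm]
  · rw [EuclideanSpace.inner_eq_star_dotProduct, dotProduct]
    refine Finset.sum_congr rfl fun i _ => ?_
    simp [inWeight, regressor, mul_comm]

theorem dotProduct_self_eq {H : ℕ} (v : BlockIdx H m p → ℝ) :
    v ⬝ᵥ v = ∑ j ∈ Finset.range H, (‖outWeight v j‖ ^ 2 + ‖inWeight v j‖ ^ 2) := by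
  rw [Finset.sum_range, dotProduct, Fintype.sum_sum_type, Finset.sum_add_distrib,
    Fintype.sum_prod_type, Fintype.sum_prod_type]
  congr 1 <;> refine Finset.sum_congr rfl fun j _ => ?_
  · rw [EuclideanSpace.real_norm_sq_eq]
    refine Finset.sum_congr rfl fun i _ => ?_
    simp [outWeight, sq]
  · rw [EuclideanSpace.real_norm_sq_eq]
    refine Finset.sum_congr rfl fun i _ => ?_
    simp [inWeight, sq]

/-- A vector of weights of norm at least `1/2` puts weight on some noise variable. -/
theorem exists_noise_weight {Θ : LinSys n m p} {F : Matrix (Fin n) (Fin m) ℝ} {υ k : ℝ}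
    (hυ₁ : υ < 1) (hF : ‖Θ.A - F * Θ.C‖ ≤ υ)
    (hk : 1 + (‖F‖ + ‖Θ.B‖) * (‖Θ.C‖ / (1 - υ)) ≤ k) {H : ℕ} (hH : 0 < H)
    {v : BlockIdx H m p → ℝ} (hv : 1 / 4 ≤ v ⬝ᵥ v) :
    ∃ j < H, 1 / (16 * H * k ^ 2) ≤
      ‖outWeight v j + Matrix.toEuclideanLin Fᵀ (costate Θ (outWeight v) j)‖ ^ 2
      + ‖inWeight v j + Matrix.toEuclideanLin Θ.Bᵀ (costate Θ (outWeight v) j)‖ ^ 2 := by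
  -- If all noise weights were at most η, the costate and then all regressor weights would be O(η),
  -- at most kη; summing 2(kη)² over H lags gives v·v ≤ 1/8.
  by_contra! hcon
  have h1υ : 0 < 1 - υ := by linarith
  have hH' : (0 : ℝ) < H := by exact_mod_cast hH
  have hk1 : 1 ≤ k := le_trans (by
    have : 0 ≤ (‖F‖ + ‖Θ.B‖) * (‖Θ.C‖ / (1 - υ)) := by positivity
    linarith) hk
  obtain ⟨η, hη⟩ : ∃ η, η = √(1 / (16 * H * k ^ 2)) := ⟨_, rfl⟩
  have hη0 : 0 ≤ η := hη ▸ Real.sqrt_nonneg _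
  have hη2 : η ^ 2 = 1 / (16 * H * k ^ 2) := by rw [hη]; exact Real.sq_sqrt (by positivity)
  have ha : ∀ j < H, ‖outWeight v j + Matrix.toEuclideanLin Fᵀ (costate Θ (outWeight v) j)‖ ≤ η :=
    fun j hj => abs_le_of_sq_le_sq' (by
      rw [hη2]; have := hcon j hj; nlinarith [sq_nonneg ‖inWeight v j + Matrix.toEuclideanLin Θ.Bᵀ (costate Θ (outWeight v) j)‖]) hη0 |>.2
  have hb : ∀ j < H, ‖inWeight v j + Matrix.toEuclideanLin Θ.Bᵀ (costate Θ (outWeight v) j)‖ ≤ η :=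
    fun j hj => abs_le_of_sq_le_sq' (by
      rw [hη2]; have := hcon j hj; nlinarith [sq_nonneg ‖outWeight v j + Matrix.toEuclideanLin Fᵀ (costate Θ (outWeight v) j)‖]) hη0 |>.2
  have hp := norm_costate_le hυ₁ hF hη0 ha
  have hbound : ∀ (q : ℕ) (G : Matrix (Fin n) (Fin q) ℝ) (x : Vec q) (j : ℕ), j < H →
      ‖x + Matrix.toEuclideanLin Gᵀ (costate Θ (outWeight v) j)‖ ≤ η →
      ‖G‖ ≤ ‖F‖ + ‖Θ.B‖ → ‖x‖ ^ 2 ≤ (k * η) ^ 2 := by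
    intro q G x j hj hx hG
    have h1 := norm_toEuclideanLin_le Gᵀ (costate Θ (outWeight v) j)
    rw [norm_transpose] at h1
    have h2 : ‖G‖ * ‖costate Θ (outWeight v) j‖ ≤ (‖F‖ + ‖Θ.B‖) * (‖Θ.C‖ * η / (1 - υ)) :=
      mul_le_mul hG (hp j hj.le) (norm_nonneg _) (by positivity)
    have h3 : ‖x‖ ≤ k * η := by
      calc ‖x‖ = ‖(x + Matrix.toEuclideanLin Gᵀ (costate Θ (outWeight v) j))
            - Matrix.toEuclideanLin Gᵀ (costate Θ (outWeight v) j)‖ := by rw [add_sub_cancel_right]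
        _ ≤ η + (‖F‖ + ‖Θ.B‖) * (‖Θ.C‖ * η / (1 - υ)) :=
            (norm_sub_le _ _).trans (add_le_add hx (h1.trans h2))
        _ = (1 + (‖F‖ + ‖Θ.B‖) * (‖Θ.C‖ / (1 - υ))) * η := by ring
        _ ≤ k * η := mul_le_mul_of_nonneg_right hk hη0
    exact pow_le_pow_left₀ (norm_nonneg _) h3 2
  have hsum : v ⬝ᵥ v ≤ ∑ j ∈ Finset.range H, ((k * η) ^ 2 + (k * η) ^ 2) := by
    rw [dotProduct_self_eq]
    refine Finset.sum_le_sum fun j hj => add_le_add ?_ ?_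
    · exact hbound m F _ j (Finset.mem_range.1 hj) (ha j (Finset.mem_range.1 hj))
        (le_add_of_nonneg_right (norm_nonneg _))
    · exact hbound p Θ.B _ j (Finset.mem_range.1 hj) (hb j (Finset.mem_range.1 hj))
        (le_add_of_nonneg_left (norm_nonneg _))
  rw [Finset.sum_const, Finset.card_range, nsmul_eq_mul, mul_pow, hη2] at hsum
  have : (H : ℝ) * (k ^ 2 * (1 / (16 * H * k ^ 2)) + k ^ 2 * (1 / (16 * H * k ^ 2))) = 1 / 8 := by
    field_simp
    norm_num
  linarith

end Costate

/-! ### Probability of the single noise events. -/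

section Events

variable {Ω : Type*} [MeasurableSpace Ω] {μ : Measure Ω} [IsProbabilityMeasure μ] {s : Setup m p}
  {c : RadiusConst} {S : Set (LinSys n m p)} {Θ : LinSys n m p} {Sig : Matrix (Fin n) (Fin n) ℝ}
  {L : Matrix (Fin n) (Fin m) ℝ} {T Tw d₁ d₂ : ℕ} {X : Processes n m p Ω}

/-- The regressor of a run. -/
def Processes.reg (X : Processes n m p Ω) (H r : ℕ) (ω : Ω) : BlockIdx H m p → ℝ :=
  regressor H (fun t => X.y t ω) (fun t => X.u t ω) r

theorem IsLqgOptRun.measurable_reg (h : IsLqgOptRun μ s c S Θ Sig L T Tw d₁ d₂ X) (hTw : 0 < Tw)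
    {H r : ℕ} (hr : 0 < r) (v : BlockIdx H m p → ℝ) :
    Measurable[noiseAlg (X.innov Θ L) X.exc (Set.Iio r)] fun ω => v ⬝ᵥ X.reg H r ω := by
  have h1 : ∀ j, noiseAlg (X.innov Θ L) X.exc (Set.Iio (r - 1 - j + 1))
      ≤ noiseAlg (X.innov Θ L) X.exc (Set.Iio r) := fun j =>
    noiseAlg_mono (Set.Iio_subset_Iio (by omega))
  simp only [Processes.reg, dotProduct_regressor]
  exact Finset.measurable_sum _ fun j _ =>
    (measurable_const.inner ((h.measurable_data hTw (r - 1 - j)).1.mono (h1 j) le_rfl)).add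
    (measurable_const.inner ((h.measurable_data hTw (r - 1 - j)).2.mono (h1 j) le_rfl))

/-- During the warm-up every direction is excited. -/
theorem IsLqgOptRun.measure_unexcited_le (h : IsLqgOptRun μ s c S Θ Sig L T Tw d₁ d₂ X)
    (hTw : 0 < Tw) {v₀ v₁ υ k : ℝ} (hw : WhiteNoise μ (X.innov Θ L) X.exc v₀ v₁) (hv₀ : 0 < v₀)
    (hυ₁ : υ < 1) (hF : ‖Θ.A - Θ.A * L * Θ.C‖ ≤ υ)
    (hk : 1 + (‖Θ.A * L‖ + ‖Θ.B‖) * (‖Θ.C‖ / (1 - υ)) ≤ k) {H N : ℕ} (hH : 0 < H)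
    (hN : N * H ≤ Tw) {v : BlockIdx H m p → ℝ} (hv : 1 / 4 ≤ v ⬝ᵥ v) :
    μ {ω | 8 * H * k ^ 2 * Real.exp 4 / v₀ * ∑ i ∈ Finset.range N, (v ⬝ᵥ X.reg H ((i + 1) * H) ω) ^ 2
      ≤ N} ≤ ENNReal.ofReal (Real.exp (-N)) := by
  have h1υ : 0 < 1 - υ := by linarith
  have hH' : (0 : ℝ) < H := by exact_mod_cast hH
  have hk1 : 1 ≤ k := le_trans (by
    have : 0 ≤ (‖Θ.A * L‖ + ‖Θ.B‖) * (‖Θ.C‖ / (1 - υ)) := by positivity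
    linarith) hk
  -- The same lag j serves every block, since the weights depend on v only.
  obtain ⟨j, hj, hab⟩ := exists_noise_weight (v := v) hυ₁ hF hk hH hv
  obtain ⟨a, ha⟩ : ∃ a : ℕ → Vec m, a = fun j =>
    outWeight v j + Matrix.toEuclideanLin (Θ.A * L)ᵀ (costate Θ (outWeight v) j) := ⟨_, rfl⟩
  obtain ⟨b, hb⟩ : ∃ b : ℕ → Vec p, b = fun j =>
    inWeight v j + Matrix.toEuclideanLin Θ.Bᵀ (costate Θ (outWeight v) j) := ⟨_, rfl⟩
  have hab' : 1 / (16 * H * k ^ 2) ≤ ‖a j‖ ^ 2 + ‖b j‖ ^ 2 := by rw [ha, hb]; exact hab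
  have hpos : 0 < 1 / (16 * H * k ^ 2) := by positivity
  -- With this θ each block contributes a factor e⁻², and after the Chernoff factor e^N there
  -- remains e^{−N}.
  obtain ⟨θ, hθ⟩ : ∃ θ, θ = 8 * H * k ^ 2 * Real.exp 4 / v₀ := ⟨_, rfl⟩
  have hθ0 : 0 < θ := by rw [hθ]; positivity
  have hrep : ∀ i < N, ∀ ω, v ⬝ᵥ X.reg H ((i + 1) * H) ω = ∑ j ∈ Finset.range H,
      (inner ℝ (a j) (X.innov Θ L ((i + 1) * H - 1 - j) ω)
        + inner ℝ (b j) (X.exc ((i + 1) * H - 1 - j) ω))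
      + inner ℝ (costate Θ (outWeight v) H) (X.optPred Θ L (i * H) ω) := by
    intro i hi ω
    have h0 : (i + 1) * H ≤ N * H := Nat.mul_le_mul_right _ hi
    have h1 := sum_weights_eq (outWeight v) (inWeight v) ((i + 1) * H)
      (xi := fun t => X.optPred Θ L t ω) (e := fun t => X.innov Θ L t ω)
      (y := fun t => X.y t ω) (u := fun t => X.u t ω)
      (fun t => h.optPred_succ t ω) (fun t => h.output_eq t ω) H
      (Nat.le_mul_of_pos_left _ (by omega))
    have h2 : (i + 1) * H - H = i * H := by rw [Nat.add_mul, one_mul, Nat.add_sub_cancel]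
    rw [Processes.reg, dotProduct_regressor, h1, h2]
    congr 1
    refine Finset.sum_congr rfl fun j hj => ?_
    have h3 : (i + 1) * H - 1 - j < Tw := by
      have : 0 < (i + 1) * H := by positivity
      omega
    rw [ha, hb, h.input, if_pos h3]
  have hτ : ∀ i, i * H ≤ (i + 1) * H - 1 - j := fun i => by
    rw [Nat.add_mul, one_mul]
    omega
  -- Block i draws on the noise at time (i + 1)H − 1 − j ≥ iH. The other noise of the block, the
  -- prediction at iH and all earlier regressors avoid that time. The blocks lie in the warm-up,
  -- where inputs are the excitation.
  have hmain := hw.lintegral_exp_neg_sum_sq_le (a := a j) (b := b j)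
    (Y := fun i ω => v ⬝ᵥ X.reg H ((i + 1) * H) ω)
    (Z := fun i ω => ∑ j' ∈ (Finset.range H).erase j,
      (inner ℝ (a j') (X.innov Θ L ((i + 1) * H - 1 - j') ω)
        + inner ℝ (b j') (X.exc ((i + 1) * H - 1 - j') ω))
      + inner ℝ (costate Θ (outWeight v) H) (X.optPred Θ L (i * H) ω))
    (τ := fun i => (i + 1) * H - 1 - j) hv₀ (hpos.trans_le hab') hθ0 N
    (fun i hi ω => by
      rw [hrep i hi ω, ← Finset.add_sum_erase _ _ (Finset.mem_range.2 hj)]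
      ring)
    (fun i hi => by
      refine Measurable.add (Finset.measurable_sum _ fun j' hj' => ?_)
        (measurable_const.inner ?_)
      · have hne : (i + 1) * H - 1 - j' ∈ ({(i + 1) * H - 1 - j} : Set ℕ)ᶜ := by
          simp only [Finset.mem_erase, Finset.mem_range] at hj'
          simp only [Set.mem_compl_iff, Set.mem_singleton_iff, Nat.add_mul, one_mul]
          omega
        exact (measurable_const.inner (measurable_out_noiseAlg hne)).add
          (measurable_const.inner (measurable_in_noiseAlg hne))
      · have h1 := h.measurable_optPred_of (t := i * H) (fun r hr =>
          (h.measurable_data hTw r).2.mono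
          (noiseAlg_mono (Set.Iio_subset_Iio (by omega))) le_rfl) (i * H) le_rfl
        refine h1.mono (noiseAlg_mono fun t ht => ?_) le_rfl
        have := hτ i
        simp only [Set.mem_Iio] at ht
        simp only [Set.mem_compl_iff, Set.mem_singleton_iff]
        omega)
    (fun i hi i' hi' => by
      refine (h.measurable_reg hTw (r := (i' + 1) * H) (by positivity) v).mono
        (noiseAlg_mono fun t ht => ?_) le_rfl
      have h1 := hτ i
      have h2 : (i' + 1) * H ≤ i * H := Nat.mul_le_mul_right _ hi'
      simp only [Set.mem_Iio] at ht
      simp only [Set.mem_compl_iff, Set.mem_singleton_iff]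
      omega)
  have hq : √(1 / (2 * θ * (v₀ * (‖a j‖ ^ 2 + ‖b j‖ ^ 2)))) ≤ Real.exp (-2) := by
    rw [show Real.exp (-2) = √(Real.exp (-4)) by
      rw [show (-4 : ℝ) = -2 + -2 by norm_num, Real.exp_add, ← sq, Real.sqrt_sq (Real.exp_pos _).le]]
    refine Real.sqrt_le_sqrt ?_
    have h1 : Real.exp 4 ≤ 2 * θ * (v₀ * (‖a j‖ ^ 2 + ‖b j‖ ^ 2)) := by
      calc Real.exp 4 = 2 * θ * (v₀ * (1 / (16 * H * k ^ 2))) := by rw [hθ]; field_simp; norm_num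
        _ ≤ _ := by gcongr
    rw [Real.exp_neg, ← one_div]
    exact one_div_le_one_div_of_le (Real.exp_pos _) h1
  have hmeas : Measurable fun ω => -θ * ∑ i ∈ Finset.range N, (v ⬝ᵥ X.reg H ((i + 1) * H) ω) ^ 2 :=
    (Finset.measurable_sum _ fun i _ => (((h.measurable_reg hTw (r := (i + 1) * H)
      (by positivity) v).mono (noiseAlg_le hw.meas_out hw.meas_in _) le_rfl).pow_const 2)).const_mul _
  have hset : {ω | 8 * H * k ^ 2 * Real.exp 4 / v₀ *
      ∑ i ∈ Finset.range N, (v ⬝ᵥ X.reg H ((i + 1) * H) ω) ^ 2 ≤ N}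
      = {ω | -(N : ℝ) ≤ -θ * ∑ i ∈ Finset.range N, (v ⬝ᵥ X.reg H ((i + 1) * H) ω) ^ 2} := by
    ext ω
    simp only [Set.mem_ofPred_eq, ← hθ]
    constructor <;> intro h <;> linarith
  rw [hset]
  refine (measure_le_lintegral_exp hmeas _).trans ((mul_le_mul_right (hmain.trans
    (pow_le_pow_left₀ zero_le (ENNReal.ofReal_le_ofReal hq) N)) _).trans_eq ?_)
  rw [← ENNReal.ofReal_pow (Real.exp_pos _).le, ← ENNReal.ofReal_mul (Real.exp_pos _).le,
    ← Real.exp_nat_mul, ← Real.exp_add]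
  congr 2
  ring

/-- The exponential tail of the self-normalized noise. -/
theorem IsLqgOptRun.measure_martingale_ge_le (h : IsLqgOptRun μ s c S Θ Sig L T Tw d₁ d₂ X)
    (hTw : 0 < Tw) {v₀ v₁ : ℝ} (hw : WhiteNoise μ (X.innov Θ L) X.exc v₀ v₁) {H t : ℕ} (hH : 0 < H)
    (ht : H ≤ t) (v : BlockIdx H m p → ℝ) (j : Fin m) (ℓ : ℝ) :
    μ {ω | ℓ ≤ ∑ r ∈ Finset.Icc H t, ((v ⬝ᵥ X.reg H r ω) * X.innov Θ L r ω j
      - v₁ * (v ⬝ᵥ X.reg H r ω) ^ 2 / 2)} ≤ ENNReal.ofReal (Real.exp (-ℓ)) := by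
  have hm : ∀ r, H ≤ r → Measurable[noiseAlg (X.innov Θ L) X.exc (Set.Iio r)]
      fun ω => v ⬝ᵥ X.reg H r ω := fun r hr => h.measurable_reg hTw (by omega) v
  have h1 := hw.lintegral_exp_sum_le (a := EuclideanSpace.single j (1 : ℝ)) (by simp) H (t + 1)
    (by omega) hm
  have hIcc : Finset.Icc H t = Finset.Ico H (t + 1) := rfl
  have hin : ∀ x : Vec m, inner ℝ (EuclideanSpace.single j (1 : ℝ)) x = x j := fun x => by
    simp [EuclideanSpace.inner_single_left]
  simp only [hin] at h1
  have hle := noiseAlg_le hw.meas_out hw.meas_in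
  have hmeas : Measurable fun ω => ∑ r ∈ Finset.Icc H t, ((v ⬝ᵥ X.reg H r ω) * X.innov Θ L r ω j
      - v₁ * (v ⬝ᵥ X.reg H r ω) ^ 2 / 2) := by
    refine Finset.measurable_sum _ fun r hr => ?_
    have h2 := (hm r (Finset.mem_Icc.1 hr).1).mono (hle _) le_rfl
    have h3 : Measurable fun ω => X.innov Θ L r ω j :=
      (EuclideanSpace.proj (𝕜 := ℝ) j).continuous.measurable.comp (hw.meas_out r)
    exact (h2.mul h3).sub (((h2.pow_const 2).const_mul v₁).div_const 2)
  refine (measure_le_lintegral_exp hmeas ℓ).trans ?_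
  rw [hIcc]
  exact (mul_le_mul_right h1 _).trans_eq (mul_one _)

theorem norm_le_of_forall_abs_le {q : ℕ} {x : Vec q} {a : ℝ} (h : ∀ i, |x i| ≤ a) :
    ‖x‖ ≤ q * a := by
  have h1 : x = ∑ i, x i • EuclideanSpace.single i (1 : ℝ) := by
    ext j
    simp [Finset.sum_apply, Pi.single_apply]
  calc ‖x‖ = ‖∑ i, x i • EuclideanSpace.single i (1 : ℝ)‖ := by rw [← h1]
    _ ≤ ∑ i, ‖x i • EuclideanSpace.single i (1 : ℝ)‖ := norm_sum_le _ _
    _ ≤ ∑ _i : Fin q, a := Finset.sum_le_sum fun i _ => by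
        rw [norm_smul]; simpa using h i
    _ = q * a := by simp

theorem measure_exists_le {ι : Type*} (s : Finset ι) (P : ι → Ω → Prop) {q : ℝ}
    (h : ∀ i ∈ s, μ {ω | P i ω} ≤ ENNReal.ofReal q) :
    μ {ω | ∃ i ∈ s, P i ω} ≤ ENNReal.ofReal (s.card * q) := by
  have h1 : {ω | ∃ i ∈ s, P i ω} = ⋃ i ∈ s, {ω | P i ω} := by ext ω; simp
  rw [h1]
  refine (measure_biUnion_finset_le _ _).trans ((Finset.sum_le_sum h).trans_eq ?_)
  rw [Finset.sum_const, nsmul_eq_mul, ENNReal.ofReal_mul (by positivity), ENNReal.ofReal_natCast]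

theorem WhiteNoise.measure_norm_gt_le {e : ℕ → Ω → Vec m} {exc : ℕ → Ω → Vec p} {v₀ v₁ : ℝ}
    (h : WhiteNoise μ e exc v₀ v₁) (hv₁ : 0 < v₁) {a : ℝ} (ha : 0 ≤ a) (t : ℕ) :
    μ {ω | ¬ (‖e t ω‖ ≤ (m + p) * a ∧ ‖exc t ω‖ ≤ (m + p) * a)}
      ≤ ENNReal.ofReal ((m + p) * (2 * Real.exp (-(a ^ 2 / (2 * v₁))))) := by
  have hsub : {ω | ¬ (‖e t ω‖ ≤ (m + p) * a ∧ ‖exc t ω‖ ≤ (m + p) * a)}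
      ⊆ {ω | ∃ i ∈ (Finset.univ : Finset (Fin m ⊕ Fin p)),
        a ≤ |Sum.elim (fun i => e t ω i) (fun i => exc t ω i) i|} := by
    intro ω hω
    by_contra hcon
    simp only [Set.mem_ofPred_eq, not_exists, not_and, not_le] at hcon
    refine hω ⟨?_, ?_⟩
    · refine (norm_le_of_forall_abs_le fun i => (hcon (Sum.inl i) (Finset.mem_univ _)).le).trans ?_
      exact mul_le_mul_of_nonneg_right (by simp) ha
    · refine (norm_le_of_forall_abs_le fun i => (hcon (Sum.inr i) (Finset.mem_univ _)).le).trans ?_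
      exact mul_le_mul_of_nonneg_right (by simp) ha
  refine (measure_mono hsub).trans ((measure_exists_le _ _
    (q := 2 * Real.exp (-(a ^ 2 / (2 * v₁)))) fun i _ => ?_).trans_eq (by simp))
  rcases i with i | i
  · obtain ⟨v, _, hv, hg⟩ := h.gauss (EuclideanSpace.single i (1 : ℝ)) 0 t
    simp only [inner_zero_left, add_zero, PiLp.norm_single, norm_one, norm_zero] at hg hv
    simpa [EuclideanSpace.inner_single_left] using hg.measure_abs_ge_le (by linarith) hv₁ ha
  · obtain ⟨v, _, hv, hg⟩ := h.gauss 0 (EuclideanSpace.single i (1 : ℝ)) t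
    simp only [inner_zero_left, zero_add, PiLp.norm_single, norm_one, norm_zero] at hg hv
    simpa [EuclideanSpace.inner_single_left] using hg.measure_abs_ge_le (by linarith) hv₁ ha

end Events

/-! ### The good event. -/

section GoodNoise

/-- Integer labels of a grid of weight vectors. -/
def grid (H m p T : ℕ) : Finset (BlockIdx H m p → ℤ) :=
  Fintype.piFinset fun _ => Finset.Icc (-(T : ℤ) ^ 5) ((T : ℤ) ^ 5)

/-- The weight vector with a given label. -/
def gridVec {H : ℕ} (T : ℕ) (κ : BlockIdx H m p → ℤ) : BlockIdx H m p → ℝ :=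
  fun i => κ i / (T : ℝ) ^ 2

/-- Entries up to T² with spacing T⁻² have labels up to T⁴ plus rounding, hence below T⁵; 2T⁵ + 1 ≤
T⁷ produces the 7. -/
theorem card_grid_le {H T : ℕ} (hT : 2 ≤ T) {ℓ : ℝ} (hℓ : (T : ℝ) ≤ Real.exp ℓ) :
    ((grid H m p T).card : ℝ) ≤ Real.exp (7 * (H * (m + p)) * ℓ) := by
  have hcard : (grid H m p T).card = (2 * T ^ 5 + 1) ^ (H * (m + p)) := by
    rw [grid, Fintype.card_piFinset, Finset.prod_const, Int.card_Icc]
    congr 1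
    · have : (T : ℤ) ^ 5 + 1 - -(T : ℤ) ^ 5 = ((2 * T ^ 5 + 1 : ℕ) : ℤ) := by push_cast; ring
      rw [this, Int.toNat_natCast]
    · simp [BlockIdx]; ring
  have h1 : (2 * T ^ 5 + 1 : ℕ) ≤ T ^ 7 := by
    have h2 : 1 ≤ T ^ 5 := Nat.one_le_pow _ _ (by omega)
    have h3 : T ^ 7 = T ^ 5 * (T * T) := by ring
    have h4 : 2 * 2 ≤ T * T := Nat.mul_le_mul hT hT
    have h5 := Nat.mul_le_mul_left (T ^ 5) h4
    omega
  rw [hcard]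
  have h2 : (((2 * T ^ 5 + 1) ^ (H * (m + p)) : ℕ) : ℝ) ≤ ((T : ℝ) ^ 7) ^ (H * (m + p)) := by
    exact_mod_cast Nat.pow_le_pow_left h1 _
  refine h2.trans ((pow_le_pow_left₀ (by positivity) (pow_le_pow_left₀ (by positivity) hℓ 7) _).trans_eq
    ?_)
  rw [← Real.exp_nat_mul, ← Real.exp_nat_mul]
  congr 1
  push_cast
  ring

variable {Ω : Type*}

/-- The noise is bounded, the warm-up data are exciting and the noise is self-normalized along
the grid. -/
structure GoodNoise (X : Processes n m p Ω) (Θ : LinSys n m p) (L : Matrix (Fin n) (Fin m) ℝ)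
    (H T N : ℕ) (θ v₁ b ℓ : ℝ) (ω : Ω) : Prop where
  noise_le : ∀ t ≤ T, ‖X.innov Θ L t ω‖ ≤ b ∧ ‖X.exc t ω‖ ≤ b
  excited : ∀ κ ∈ grid H m p T, 1 / 4 ≤ gridVec T κ ⬝ᵥ gridVec T κ →
    N < θ * ∑ i ∈ Finset.range N, (gridVec T κ ⬝ᵥ X.reg H ((i + 1) * H) ω) ^ 2
  martingale : ∀ t ≤ T, H ≤ t → ∀ j, ∀ κ ∈ grid H m p T,
    ∑ r ∈ Finset.Icc H t, ((gridVec T κ ⬝ᵥ X.reg H r ω) * X.innov Θ L r ω j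
      - v₁ * (gridVec T κ ⬝ᵥ X.reg H r ω) ^ 2 / 2) < ℓ

variable [MeasurableSpace Ω] {μ : Measure Ω} [IsProbabilityMeasure μ] {s : Setup m p}
  {c : RadiusConst} {S : Set (LinSys n m p)} {Θ : LinSys n m p} {Sig : Matrix (Fin n) (Fin n) ℝ}
  {L : Matrix (Fin n) (Fin m) ℝ} {T Tw d₁ d₂ : ℕ} {X : Processes n m p Ω}

theorem natCast_le_exp_mul {ℓ : ℝ} (hℓ : 2 ≤ Real.exp ℓ) (k : ℕ) : (k : ℝ) ≤ Real.exp (k * ℓ) := by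
  rw [Real.exp_nat_mul]
  calc (k : ℝ) ≤ 2 ^ k := by exact_mod_cast Nat.lt_two_pow_self.le
    _ ≤ _ := pow_le_pow_left₀ (by norm_num) hℓ k

/-- Three union bounds, each of total at most e^{−ℓ} = δ/T ≤ δ. -/
theorem IsLqgOptRun.measure_not_goodNoise_le (h : IsLqgOptRun μ s c S Θ Sig L T Tw d₁ d₂ X)
    (hm : 0 < m) (hTw : 0 < Tw) {v₀ v₁ υ k : ℝ} (hw : WhiteNoise μ (X.innov Θ L) X.exc v₀ v₁)
    (hv₀ : 0 < v₀) (hv₁ : 0 < v₁) (hυ₁ : υ < 1) (hF : ‖Θ.A - Θ.A * L * Θ.C‖ ≤ υ)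
    (hk : 1 + (‖Θ.A * L‖ + ‖Θ.B‖) * (‖Θ.C‖ / (1 - υ)) ≤ k) {H N : ℕ} (hH : 0 < H)
    (hN : N * H ≤ Tw) (hT : 2 ≤ T) {δ : ℝ} (hδ : 0 < δ) (hδ₁ : δ < 1)
    (hN' : 8 * (H * (m + p)) * Real.log (T / δ) ≤ N) :
    μ {ω | ¬ GoodNoise X Θ L H T N (8 * H * k ^ 2 * Real.exp 4 / v₀) v₁
      ((m + p) * √(2 * v₁ * (m + p + 4) * Real.log (T / δ)))
      (11 * (H * (m + p)) * Real.log (T / δ)) ω} ≤ ENNReal.ofReal (3 * δ) := by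
  obtain ⟨ℓ, hℓ⟩ : ∃ ℓ, ℓ = Real.log (T / δ) := ⟨_, rfl⟩
  rw [← hℓ] at hN' ⊢
  have hT' : (2 : ℝ) ≤ T := by exact_mod_cast hT
  have hx : Real.exp ℓ = T / δ := by rw [hℓ]; exact Real.exp_log (by positivity)
  have hTx : (T : ℝ) ≤ Real.exp ℓ := by
    rw [hx, le_div_iff₀ hδ]; nlinarith
  have hx2 : 2 ≤ Real.exp ℓ := hT'.trans hTx
  have hℓ0 : 0 ≤ ℓ := by
    rw [hℓ]; refine Real.log_nonneg ?_; rw [← hx]; linarith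
  have hδx : Real.exp (-ℓ) ≤ δ := by
    rw [Real.exp_neg, hx, inv_div, div_le_iff₀ (by positivity)]; nlinarith
  have hHM : (1 : ℝ) ≤ H * (m + p) := by
    have : 1 ≤ H * (m + p) := Nat.mul_pos hH (by omega)
    exact_mod_cast this
  have hmHM : (m : ℝ) ≤ H * (m + p) := by
    have : m ≤ H * (m + p) := le_trans (by omega) (Nat.le_mul_of_pos_left (m + p) hH)
    exact_mod_cast this
  have hT1 : ((T + 1 : ℕ) : ℝ) ≤ Real.exp (2 * ℓ) := by
    rw [two_mul, Real.exp_add]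
    push_cast
    nlinarith
  have hcard := card_grid_le (H := H) (m := m) (p := p) hT hTx
  have hE1 : μ {ω | ∃ t ∈ Finset.range (T + 1), ¬ (‖X.innov Θ L t ω‖
        ≤ (m + p) * √(2 * v₁ * (m + p + 4) * ℓ)
      ∧ ‖X.exc t ω‖ ≤ (m + p) * √(2 * v₁ * (m + p + 4) * ℓ))} ≤ ENNReal.ofReal δ := by
    refine (measure_exists_le _ _ fun t _ => hw.measure_norm_gt_le hv₁ (Real.sqrt_nonneg _) t).trans
      (ENNReal.ofReal_le_ofReal (le_trans ?_ hδx))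
    rw [Real.sq_sqrt (by positivity), Finset.card_range]
    have h1 : ((m : ℝ) + p) ≤ Real.exp ((m + p) * ℓ) := by
      have := natCast_le_exp_mul hx2 (m + p)
      push_cast at this
      exact this
    have h2 : -(2 * v₁ * (m + p + 4) * ℓ / (2 * v₁)) = -((m + p + 4) * ℓ) := by field_simp
    rw [h2]
    -- The exponent m + p + 4 pays 2 for the T + 1 times, m + p for the coordinates and 1 for the
    -- two tails, leaving 1.
    calc ((T + 1 : ℕ) : ℝ) * ((m + p) * (2 * Real.exp (-((m + p + 4) * ℓ))))
        ≤ Real.exp (2 * ℓ) * (Real.exp ((m + p) * ℓ)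
          * (Real.exp ℓ * Real.exp (-((m + p + 4) * ℓ)))) := by gcongr
      _ = Real.exp (-ℓ) := by simp only [← Real.exp_add]; congr 1; ring
  have hE2 : μ {ω | ∃ κ ∈ grid H m p T, 1 / 4 ≤ gridVec T κ ⬝ᵥ gridVec T κ ∧
      8 * H * k ^ 2 * Real.exp 4 / v₀ * ∑ i ∈ Finset.range N,
        (gridVec T κ ⬝ᵥ X.reg H ((i + 1) * H) ω) ^ 2 ≤ N} ≤ ENNReal.ofReal δ := by
    refine (measure_exists_le _ _ (q := Real.exp (-N)) fun κ _ => ?_).trans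
      (ENNReal.ofReal_le_ofReal (le_trans ?_ hδx))
    · by_cases hκ : 1 / 4 ≤ gridVec T κ ⬝ᵥ gridVec T κ
      · refine (measure_mono fun ω hω => ?_).trans
          (h.measure_unexcited_le hTw hw hv₀ hυ₁ hF hk hH hN hκ)
        exact hω.2
      · simp only [hκ, false_and]
        simp
    -- The number of blocks exceeds the entropy of the grid: 8 against 7 in units of H(m + p)ℓ.
    · calc ((grid H m p T).card : ℝ) * Real.exp (-N)
          ≤ Real.exp (7 * (H * (m + p)) * ℓ) * Real.exp (-(8 * (H * (m + p)) * ℓ)) := by gcongr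
        _ = Real.exp (-(H * (m + p) * ℓ)) := by rw [← Real.exp_add]; congr 1; ring
        _ ≤ Real.exp (-ℓ) := Real.exp_le_exp.2 (by nlinarith)
  have hE3 : μ {ω | ∃ τ ∈ Finset.range (T + 1) ×ˢ (Finset.univ : Finset (Fin m)) ×ˢ grid H m p T,
      H ≤ τ.1 ∧ 11 * (H * (m + p)) * ℓ ≤ ∑ r ∈ Finset.Icc H τ.1,
        ((gridVec T τ.2.2 ⬝ᵥ X.reg H r ω) * X.innov Θ L r ω τ.2.1
        - v₁ * (gridVec T τ.2.2 ⬝ᵥ X.reg H r ω) ^ 2 / 2)} ≤ ENNReal.ofReal δ := by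
    refine (measure_exists_le _ _ (q := Real.exp (-(11 * (H * (m + p)) * ℓ))) fun τ _ => ?_).trans
      (ENNReal.ofReal_le_ofReal (le_trans ?_ hδx))
    · by_cases hτ : H ≤ τ.1
      · refine (measure_mono fun ω hω => ?_).trans
          (h.measure_martingale_ge_le hTw hw hH hτ (gridVec T τ.2.2) τ.2.1 _)
        exact hω.2
      · simp [hτ]
    · rw [Finset.card_product, Finset.card_product, Finset.card_range, Finset.card_univ,
        Fintype.card_fin, Nat.cast_mul, Nat.cast_mul]
      -- Of 11, the grid takes 7; the remaining 4H(m + p) cover 2 for the times, m for the rows and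
      -- the final 1.
      calc ((T + 1 : ℕ) : ℝ) * (m * (grid H m p T).card) * Real.exp (-(11 * (H * (m + p)) * ℓ))
          ≤ Real.exp (2 * ℓ) * (Real.exp (m * ℓ) * Real.exp (7 * (H * (m + p)) * ℓ))
            * Real.exp (-(11 * (H * (m + p)) * ℓ)) := by
              gcongr
              exact natCast_le_exp_mul hx2 m
        _ = Real.exp (2 * ℓ + m * ℓ - 4 * (H * (m + p)) * ℓ) := by
              simp only [← Real.exp_add]; congr 1; ring
        _ ≤ Real.exp (-ℓ) := Real.exp_le_exp.2 (by nlinarith)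
  have hsub : {ω | ¬ GoodNoise X Θ L H T N (8 * H * k ^ 2 * Real.exp 4 / v₀) v₁
      ((m + p) * √(2 * v₁ * (m + p + 4) * ℓ)) (11 * (H * (m + p)) * ℓ) ω}
      ⊆ ({ω | ∃ t ∈ Finset.range (T + 1), ¬ (‖X.innov Θ L t ω‖
        ≤ (m + p) * √(2 * v₁ * (m + p + 4) * ℓ)
      ∧ ‖X.exc t ω‖ ≤ (m + p) * √(2 * v₁ * (m + p + 4) * ℓ))} ∪
      {ω | ∃ κ ∈ grid H m p T, 1 / 4 ≤ gridVec T κ ⬝ᵥ gridVec T κ ∧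
      8 * H * k ^ 2 * Real.exp 4 / v₀ * ∑ i ∈ Finset.range N,
        (gridVec T κ ⬝ᵥ X.reg H ((i + 1) * H) ω) ^ 2 ≤ N}) ∪
      {ω | ∃ τ ∈ Finset.range (T + 1) ×ˢ (Finset.univ : Finset (Fin m)) ×ˢ grid H m p T,
      H ≤ τ.1 ∧ 11 * (H * (m + p)) * ℓ ≤ ∑ r ∈ Finset.Icc H τ.1,
        ((gridVec T τ.2.2 ⬝ᵥ X.reg H r ω) * X.innov Θ L r ω τ.2.1
        - v₁ * (gridVec T τ.2.2 ⬝ᵥ X.reg H r ω) ^ 2 / 2)} := by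
    intro ω hω
    by_contra hcon
    simp only [Set.mem_union, not_or] at hcon
    obtain ⟨⟨h1, h2⟩, h3⟩ := hcon
    refine hω ⟨fun t ht => ?_, fun κ hκ hv => ?_, fun t ht hHt j κ hκ => ?_⟩
    · by_contra h4
      exact h1 ⟨t, Finset.mem_range.2 (by omega), h4⟩
    · by_contra h4
      exact h2 ⟨κ, hκ, hv, not_lt.1 h4⟩
    · by_contra h4
      refine h3 ⟨(t, j, κ), ?_, hHt, not_lt.1 h4⟩
      simp only [Finset.mem_product, Finset.mem_range, Finset.mem_univ, true_and]
      exact ⟨by omega, hκ⟩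
  refine (measure_mono hsub).trans ((measure_union_le _ _).trans ((add_le_add
    ((measure_union_le _ _).trans (add_le_add hE1 hE2)) hE3).trans_eq ?_))
  rw [← ENNReal.ofReal_add hδ.le hδ.le, ← ENNReal.ofReal_add (by linarith) hδ.le]
  congr 1
  ring

end GoodNoise

/-! ### Deterministic analysis of regularized least squares. -/

section LeastSquares

variable {ι : Type*} [Fintype ι]

theorem exists_round {T : ℕ} (hT : 2 ≤ T) {x : ι → ℝ} (hx : ∀ i, |x i| ≤ (T : ℝ) ^ 2) :
    ∃ κ : ι → ℤ, (∀ i, |κ i| ≤ (T : ℤ) ^ 5) ∧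
      ∀ i, |(κ i : ℝ) / (T : ℝ) ^ 2 - x i| ≤ 1 / (T : ℝ) ^ 2 := by
  have hT' : (2 : ℝ) ≤ T := by exact_mod_cast hT
  have hT2 : 0 < (T : ℝ) ^ 2 := by positivity
  refine ⟨fun i => ⌊x i * (T : ℝ) ^ 2⌋, fun i => ?_, fun i => ?_⟩
  · have h1 := Int.floor_le (x i * (T : ℝ) ^ 2)
    have h2 := Int.lt_floor_add_one (x i * (T : ℝ) ^ 2)
    have h3 : |x i * (T : ℝ) ^ 2| ≤ (T : ℝ) ^ 4 := by
      rw [abs_mul, abs_of_pos hT2]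
      calc |x i| * (T : ℝ) ^ 2 ≤ (T : ℝ) ^ 2 * (T : ℝ) ^ 2 := by gcongr; exact hx i
        _ = (T : ℝ) ^ 4 := by ring
    have h4 : (T : ℝ) ^ 4 + 1 ≤ (T : ℝ) ^ 5 := by
      have : 1 ≤ (T : ℝ) ^ 4 := one_le_pow₀ (by linarith)
      have h5 : (T : ℝ) ^ 5 = (T : ℝ) ^ 4 * T := by ring
      nlinarith
    have h5 := abs_le.1 h3
    have h6 : |((⌊x i * (T : ℝ) ^ 2⌋ : ℤ) : ℝ)| ≤ (T : ℝ) ^ 5 :=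
      abs_le.2 ⟨by linarith, by linarith⟩
    exact_mod_cast h6
  · have h1 := Int.floor_le (x i * (T : ℝ) ^ 2)
    have h2 := Int.lt_floor_add_one (x i * (T : ℝ) ^ 2)
    have h3 : ((⌊x i * (T : ℝ) ^ 2⌋ : ℤ) : ℝ) / (T : ℝ) ^ 2 - x i
        = ((⌊x i * (T : ℝ) ^ 2⌋ : ℤ) - x i * (T : ℝ) ^ 2) / (T : ℝ) ^ 2 := by
      field_simp
    rw [h3, abs_div, abs_of_pos hT2]
    gcongr
    exact abs_le.2 ⟨by linarith, by linarith⟩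

theorem abs_dotProduct_le {x φ : ι → ℝ} {ε Φ : ℝ} (hε : 0 ≤ ε) (hx : ∀ i, |x i| ≤ ε)
    (hφ : ∑ i, |φ i| ≤ Φ) : |x ⬝ᵥ φ| ≤ ε * Φ := by
  refine (Finset.abs_sum_le_sum_abs _ _).trans ?_
  calc ∑ i, |x i * φ i| ≤ ∑ i, ε * |φ i| := Finset.sum_le_sum fun i _ => by
        rw [abs_mul]; exact mul_le_mul_of_nonneg_right (hx i) (abs_nonneg _)
    _ = ε * ∑ i, |φ i| := by rw [Finset.mul_sum]
    _ ≤ ε * Φ := mul_le_mul_of_nonneg_left hφ hε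

theorem abs_le_sqrt_dotProduct_self (x : ι → ℝ) (i : ι) : |x i| ≤ √(x ⬝ᵥ x) := by
  refine Real.abs_le_sqrt ?_
  rw [sq]
  exact Finset.single_le_sum (f := fun i => x i * x i) (fun i _ => mul_self_nonneg _)
    (Finset.mem_univ i)

theorem dotProduct_le_half (x y : ι → ℝ) : -(x ⬝ᵥ y) ≤ (y ⬝ᵥ y + x ⬝ᵥ x) / 2 := by
  simp only [dotProduct]
  rw [← Finset.sum_neg_distrib, ← Finset.sum_add_distrib, Finset.sum_div]
  exact Finset.sum_le_sum fun i _ => by nlinarith [sq_nonneg (x i + y i)]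

/-- A weak bound for the error of a regularized least-squares estimate. -/
theorem leastSquares_apriori {I : Finset ℕ} {φ : ℕ → ι → ℝ} {h M : ι → ℝ} {e d : ℕ → ℝ} {lam : ℝ}
    (hlam : 0 < lam) (hnormal : lam * (h ⬝ᵥ h) + ∑ r ∈ I, (h ⬝ᵥ φ r) ^ 2
      = ∑ r ∈ I, (h ⬝ᵥ φ r) * (e r + d r) - lam * (M ⬝ᵥ h)) :
    lam * (h ⬝ᵥ h) ≤ ∑ r ∈ I, (e r + d r) ^ 2 + lam * (M ⬝ᵥ M) := by
  have h1 : ∑ r ∈ I, (h ⬝ᵥ φ r) * (e r + d r)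
      ≤ ∑ r ∈ I, (h ⬝ᵥ φ r) ^ 2 + (∑ r ∈ I, (e r + d r) ^ 2) / 2 := by
    rw [Finset.sum_div, ← Finset.sum_add_distrib]
    exact Finset.sum_le_sum fun r _ => by
      nlinarith [sq_nonneg (h ⬝ᵥ φ r - (e r + d r) / 2), sq_nonneg (e r + d r)]
  have h2 := mul_le_mul_of_nonneg_left (dotProduct_le_half M h) hlam.le
  linarith

/-- The energy of the error of a least-squares estimate, along an approximation `a` of
`h / (2 v₁)` for which the noise is self-normalized. -/
theorem leastSquares_energy {I : Finset ℕ} {φ : ℕ → ι → ℝ} {h M a : ι → ℝ} {e d : ℕ → ℝ}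
    {lam v₁ ε b ℓ : ℝ} (hlam : 0 < lam) (hv₁ : 0 < v₁)
    (hnormal : lam * (h ⬝ᵥ h) + ∑ r ∈ I, (h ⬝ᵥ φ r) ^ 2
      = ∑ r ∈ I, (h ⬝ᵥ φ r) * (e r + d r) - lam * (M ⬝ᵥ h))
    (ha : ∀ r ∈ I, |a ⬝ᵥ φ r - (h ⬝ᵥ φ r) / (2 * v₁)| ≤ ε) (he : ∀ r ∈ I, |e r| ≤ b)
    (hmart : ∑ r ∈ I, ((a ⬝ᵥ φ r) * e r - v₁ * (a ⬝ᵥ φ r) ^ 2 / 2) ≤ ℓ) :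
    ∑ r ∈ I, (h ⬝ᵥ φ r) ^ 2 ≤ 4 * (2 * v₁ * (ℓ + I.card * (ε * b + v₁ * ε ^ 2))
      + ∑ r ∈ I, d r ^ 2 + lam * (M ⬝ᵥ M) / 2) := by
  -- For a near h/(2v₁) the compensator is at most half of the energy (h·φ)² plus rounding terms.
  -- The truncation residual takes another quarter, so a quarter remains and yields the factor 4.
  have h1 : ∑ r ∈ I, (h ⬝ᵥ φ r) * e r ≤ 2 * v₁ * ∑ r ∈ I, ((a ⬝ᵥ φ r) * e r - v₁ * (a ⬝ᵥ φ r) ^ 2 / 2)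
      + (∑ r ∈ I, (h ⬝ᵥ φ r) ^ 2) / 2 + ∑ _r ∈ I, 2 * v₁ * (ε * b + v₁ * ε ^ 2) := by
    rw [Finset.mul_sum, Finset.sum_div, ← Finset.sum_add_distrib, ← Finset.sum_add_distrib]
    refine Finset.sum_le_sum fun r hr => ?_
    obtain ⟨z, hz⟩ : ∃ z, z = a ⬝ᵥ φ r - (h ⬝ᵥ φ r) / (2 * v₁) := ⟨_, rfl⟩
    have hzε : |z| ≤ ε := hz ▸ ha r hr
    have hε0 : 0 ≤ ε := (abs_nonneg _).trans hzε
    have hax : a ⬝ᵥ φ r = z + (h ⬝ᵥ φ r) / (2 * v₁) := by rw [hz]; ring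
    have h2 : -(ε * b) ≤ z * e r := by
      have := mul_le_mul hzε (he r hr) (abs_nonneg _) hε0
      rw [← abs_mul] at this
      linarith [neg_abs_le (z * e r)]
    have h3 : z ^ 2 ≤ ε ^ 2 := sq_le_sq' (abs_le.1 hzε).1 (abs_le.1 hzε).2
    have h4 : (a ⬝ᵥ φ r) ^ 2 ≤ 2 * z ^ 2 + 2 * ((h ⬝ᵥ φ r) / (2 * v₁)) ^ 2 := by
      rw [hax]; nlinarith [sq_nonneg (z - (h ⬝ᵥ φ r) / (2 * v₁))]
    have h5 : v₁ ^ 2 * (2 * ((h ⬝ᵥ φ r) / (2 * v₁)) ^ 2) = (h ⬝ᵥ φ r) ^ 2 / 2 := by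
      field_simp
    have h6 : 2 * v₁ * ((a ⬝ᵥ φ r) * e r) = 2 * v₁ * (z * e r) + (h ⬝ᵥ φ r) * e r := by
      rw [hax]; field_simp
    have h7 := mul_le_mul_of_nonneg_left h2 hv₁.le
    have h8 := mul_le_mul_of_nonneg_left h3 (sq_nonneg v₁)
    have h9 := mul_le_mul_of_nonneg_left h4 (sq_nonneg v₁)
    nlinarith only [h5, h6, h7, h8, h9]
  have h2 : ∑ r ∈ I, (h ⬝ᵥ φ r) * d r ≤ (∑ r ∈ I, (h ⬝ᵥ φ r) ^ 2) / 4 + ∑ r ∈ I, d r ^ 2 := by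
    rw [Finset.sum_div, ← Finset.sum_add_distrib]
    exact Finset.sum_le_sum fun r _ => by nlinarith [sq_nonneg ((h ⬝ᵥ φ r) / 2 - d r)]
  have h3 := mul_le_mul_of_nonneg_left (dotProduct_le_half M h) hlam.le
  have h4 : 0 ≤ lam * (h ⬝ᵥ h) :=
    mul_nonneg hlam.le (Finset.sum_nonneg fun i _ => mul_self_nonneg (h i))
  have h5 := mul_le_mul_of_nonneg_left hmart (by positivity : 0 ≤ 2 * v₁)
  simp only [mul_add, Finset.sum_add_distrib] at hnormal
  rw [Finset.sum_const, nsmul_eq_mul] at h1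
  linarith

theorem sum_block_le {f : ℕ → ℝ} (hf : ∀ r, 0 ≤ f r) {H N t : ℕ} (hH : 0 < H) (hN : N * H ≤ t) :
    ∑ i ∈ Finset.range N, f ((i + 1) * H) ≤ ∑ r ∈ Finset.Icc H t, f r := by
  have hinj : Set.InjOn (fun i => (i + 1) * H) (Finset.range N) := fun i _ j _ hij => by
    have := Nat.eq_of_mul_eq_mul_right hH hij
    omega
  rw [← Finset.sum_image (f := f) hinj]
  refine Finset.sum_le_sum_of_subset_of_nonneg (fun r hr => ?_) fun r _ _ => hf r
  obtain ⟨i, hi, rfl⟩ := Finset.mem_image.1 hr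
  have h1 : (i + 1) * H ≤ N * H := Nat.mul_le_mul_right _ (Finset.mem_range.1 hi)
  exact Finset.mem_Icc.2 ⟨Nat.le_mul_of_pos_left _ (by omega), by omega⟩

/-- Quantitative consistency of one row of a regularized least-squares estimate. -/
theorem leastSquares_error_le {H t T N : ℕ} {φ : ℕ → ι → ℝ} {h M : ι → ℝ} {e d : ℕ → ℝ}
    {lam v₁ θ ℓ b β Φ μ₀ : ℝ} (hH : 0 < H) (hN : 0 < N) (hNt : N * H ≤ t) (htT : t ≤ T)
    (hT : 2 ≤ T) (hlam : 0 < lam) (hv₁ : 0 < v₁) (hθ : 0 < θ)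
    (hnormal : lam * (h ⬝ᵥ h) + ∑ r ∈ Finset.Icc H t, (h ⬝ᵥ φ r) ^ 2
      = ∑ r ∈ Finset.Icc H t, (h ⬝ᵥ φ r) * (e r + d r) - lam * (M ⬝ᵥ h))
    (hΦ : ∀ r ∈ Finset.Icc H t, ∑ i, |φ r i| ≤ Φ) (he : ∀ r ∈ Finset.Icc H t, |e r| ≤ b)
    (hd : ∀ r ∈ Finset.Icc H t, |d r| ≤ β) (hM : M ⬝ᵥ M ≤ μ₀)
    (hexc : ∀ κ : ι → ℤ, (∀ i, |κ i| ≤ (T : ℤ) ^ 5) →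
      1 / 4 ≤ (fun i => (κ i : ℝ) / (T : ℝ) ^ 2) ⬝ᵥ (fun i => (κ i : ℝ) / (T : ℝ) ^ 2) →
      N < θ * ∑ i ∈ Finset.range N, ((fun i => (κ i : ℝ) / (T : ℝ) ^ 2) ⬝ᵥ φ ((i + 1) * H)) ^ 2)
    (hmart : ∀ κ : ι → ℤ, (∀ i, |κ i| ≤ (T : ℤ) ^ 5) →
      ∑ r ∈ Finset.Icc H t, (((fun i => (κ i : ℝ) / (T : ℝ) ^ 2) ⬝ᵥ φ r) * e r
        - v₁ * ((fun i => (κ i : ℝ) / (T : ℝ) ^ 2) ⬝ᵥ φ r) ^ 2 / 2) < ℓ)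
    (hcard : 4 * (Fintype.card ι : ℝ) ≤ (T : ℝ) ^ 4) (hθΦ : 4 * θ * Φ ^ 2 ≤ (T : ℝ) ^ 4)
    (hrange : (T + 1) * (b + β) ^ 2 + lam * μ₀ ≤ lam * (2 * v₁ * (T : ℝ) ^ 2) ^ 2) :
    h ⬝ᵥ h ≤ 16 * θ / N * (2 * v₁ * (ℓ + (T + 1) * (1 / (T : ℝ) ^ 2 * Φ * b
      + v₁ * (1 / (T : ℝ) ^ 2 * Φ) ^ 2)) + (T + 1) * β ^ 2 + lam * μ₀ / 2) := by
  have hT' : (2 : ℝ) ≤ T := by exact_mod_cast hT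
  have hT2 : 0 < (T : ℝ) ^ 2 := by positivity
  have hN' : (0 : ℝ) < N := by exact_mod_cast hN
  have hHt : H ∈ Finset.Icc H t :=
    Finset.mem_Icc.2 ⟨le_rfl, (Nat.le_mul_of_pos_left H hN).trans hNt⟩
  have hb : 0 ≤ b := (abs_nonneg _).trans (he H hHt)
  have hβ : 0 ≤ β := (abs_nonneg _).trans (hd H hHt)
  have hΦ0 : 0 ≤ Φ := (Finset.sum_nonneg fun i _ => abs_nonneg _).trans (hΦ H hHt)
  have hIcard : ((Finset.Icc H t).card : ℝ) ≤ T + 1 := by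
    rw [Nat.card_Icc]
    have : t + 1 - H ≤ T + 1 := by omega
    exact_mod_cast this
  have hsumle : ∀ (f : ℕ → ℝ) (q : ℝ), 0 ≤ q → (∀ r ∈ Finset.Icc H t, |f r| ≤ q) →
      ∑ r ∈ Finset.Icc H t, f r ^ 2 ≤ (T + 1) * q ^ 2 := by
    intro f q hq hf
    calc ∑ r ∈ Finset.Icc H t, f r ^ 2 ≤ ∑ _r ∈ Finset.Icc H t, q ^ 2 :=
          Finset.sum_le_sum fun r hr => sq_le_sq' (abs_le.1 (hf r hr)).1 (abs_le.1 (hf r hr)).2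
      _ = (Finset.Icc H t).card * q ^ 2 := by rw [Finset.sum_const, nsmul_eq_mul]
      _ ≤ _ := by gcongr
  obtain ⟨ε, hε⟩ : ∃ ε, ε = 1 / (T : ℝ) ^ 2 * Φ := ⟨_, rfl⟩
  have hε0 : 0 ≤ ε := by rw [hε]; positivity
  obtain ⟨B, hB⟩ : ∃ B, B = 2 * v₁ * (ℓ + (T + 1) * (ε * b + v₁ * ε ^ 2)) + (T + 1) * β ^ 2
    + lam * μ₀ / 2 := ⟨_, rfl⟩
  have hround : ∀ (x y : ι → ℝ), (∀ i, |x i - y i| ≤ 1 / (T : ℝ) ^ 2) → ∀ r ∈ Finset.Icc H t,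
      |x ⬝ᵥ φ r - y ⬝ᵥ φ r| ≤ ε := by
    intro x y hxy r hr
    rw [← sub_dotProduct, hε]
    exact abs_dotProduct_le (by positivity) hxy (hΦ r hr)
  have henergy : ∑ r ∈ Finset.Icc H t, (h ⬝ᵥ φ r) ^ 2 ≤ 4 * B := by
    -- The weak a priori bound serves only to place the random direction h/(2v₁) within reach of the
    -- grid.
    have hhi : ∀ i, |((1 / (2 * v₁)) • h) i| ≤ (T : ℝ) ^ 2 := by
      intro i
      have h1 : lam * (h ⬝ᵥ h) ≤ lam * (2 * v₁ * (T : ℝ) ^ 2) ^ 2 :=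
        (leastSquares_apriori hlam hnormal).trans (le_trans (add_le_add
          (hsumle (fun r => e r + d r) (b + β) (by positivity) fun r hr =>
            (abs_add_le _ _).trans (add_le_add (he r hr) (hd r hr)))
          (mul_le_mul_of_nonneg_left hM hlam.le)) hrange)
      have h2 : √(h ⬝ᵥ h) ≤ 2 * v₁ * (T : ℝ) ^ 2 :=
        Real.sqrt_le_iff.2 ⟨by positivity, le_of_mul_le_mul_left h1 hlam⟩
      have h3 := (abs_le_sqrt_dotProduct_self h i).trans h2
      rw [Pi.smul_apply, smul_eq_mul, abs_mul, abs_of_pos (by positivity)]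
      rw [one_div, inv_mul_le_iff₀ (by positivity)]
      exact h3
    obtain ⟨κ, hκ, hκh⟩ := exists_round hT hhi
    have h1 := leastSquares_energy hlam hv₁ hnormal (ε := ε)
      (a := fun i => (κ i : ℝ) / (T : ℝ) ^ 2) (fun r hr => by
        have := hround _ _ hκh r hr
        rwa [smul_dotProduct, smul_eq_mul, one_div_mul_eq_div] at this) he (hmart κ hκ).le
    refine h1.trans ?_
    rw [hB]
    have h2 := hsumle d β hβ hd
    have h3 := mul_le_mul_of_nonneg_left hM hlam.le
    have h4 : ((Finset.Icc H t).card : ℝ) * (ε * b + v₁ * ε ^ 2)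
        ≤ (T + 1) * (ε * b + v₁ * ε ^ 2) := mul_le_mul_of_nonneg_right hIcard (by positivity)
    have h5 := mul_le_mul_of_nonneg_left h4 (by positivity : 0 ≤ 2 * v₁)
    linarith
  have hhh : 0 ≤ h ⬝ᵥ h := Finset.sum_nonneg fun i _ => mul_self_nonneg (h i)
  have hfin : h ⬝ᵥ h * N ≤ 16 * θ * B := by
    have hB0 : 0 ≤ B := by
      have : 0 ≤ 4 * B := (Finset.sum_nonneg fun r _ => sq_nonneg _).trans henergy
      linarith
    rcases hhh.eq_or_lt with h0 | h0
    · rw [← h0, zero_mul]; positivity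
    obtain ⟨σ, hσ⟩ : ∃ σ, σ = √(h ⬝ᵥ h) := ⟨_, rfl⟩
    have hσ0 : 0 < σ := by rw [hσ]; exact Real.sqrt_pos.2 h0
    have hσ2 : σ ^ 2 = h ⬝ᵥ h := by rw [hσ]; exact Real.sq_sqrt h0.le
    have hunit : (σ⁻¹ • h) ⬝ᵥ (σ⁻¹ • h) = 1 := by
      rw [smul_dotProduct, dotProduct_smul, smul_eq_mul, smul_eq_mul, ← hσ2]
      field_simp
    have hhi : ∀ i, |(σ⁻¹ • h) i| ≤ (T : ℝ) ^ 2 := fun i => by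
      refine (abs_le_sqrt_dotProduct_self _ i).trans ?_
      rw [hunit, Real.sqrt_one]
      exact one_le_pow₀ (by linarith)
    -- Second rounding, now of h normalized: the rounded vector keeps squared norm at least 1/4, and
    -- rounding costs at most half of the excitation N.
    obtain ⟨κ, hκ, hκh⟩ := exists_round hT hhi
    obtain ⟨v, hv⟩ : ∃ v : ι → ℝ, v = fun i => (κ i : ℝ) / (T : ℝ) ^ 2 := ⟨_, rfl⟩
    have hκh' : ∀ i, |v i - (σ⁻¹ • h) i| ≤ 1 / (T : ℝ) ^ 2 := by rw [hv]; exact hκh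
    have hvv : 1 / 4 ≤ v ⬝ᵥ v := by
      have h1 : (σ⁻¹ • h) ⬝ᵥ (σ⁻¹ • h) ≤ ∑ i, (2 * (v i * v i) + 2 * (1 / (T : ℝ) ^ 2) ^ 2) := by
        refine Finset.sum_le_sum fun i _ => ?_
        have h2 := sq_le_sq' (abs_le.1 (hκh' i)).1 (abs_le.1 (hκh' i)).2
        nlinarith only [h2, sq_nonneg (v i + (v i - (σ⁻¹ • h) i))]
      rw [hunit, Finset.sum_add_distrib, ← Finset.mul_sum, Finset.sum_const, Finset.card_univ,
        nsmul_eq_mul] at h1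
      have h2 : (Fintype.card ι : ℝ) * (2 * (1 / (T : ℝ) ^ 2) ^ 2) ≤ 1 / 2 := by
        have h3 : (Fintype.card ι : ℝ) * (2 * (1 / (T : ℝ) ^ 2) ^ 2)
            = (4 * (Fintype.card ι : ℝ)) / (T : ℝ) ^ 4 / 2 := by field_simp; norm_num
        rw [h3]
        have : (4 * (Fintype.card ι : ℝ)) / (T : ℝ) ^ 4 ≤ 1 := by
          rw [div_le_one (by positivity)]; exact hcard
        linarith
      have h4 : ∑ i, v i * v i = v ⬝ᵥ v := rfl
      rw [h4] at h1
      linarith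
    have h1 := hexc κ hκ (by rw [← hv]; exact hvv)
    rw [← hv] at h1
    have h2 : ∑ i ∈ Finset.range N, (v ⬝ᵥ φ ((i + 1) * H)) ^ 2
        ≤ ∑ i ∈ Finset.range N, (2 * (σ ^ 2)⁻¹ * (h ⬝ᵥ φ ((i + 1) * H)) ^ 2 + 2 * ε ^ 2) := by
      refine Finset.sum_le_sum fun i hi => ?_
      have h0 : (i + 1) * H ≤ N * H := Nat.mul_le_mul_right _ (Finset.mem_range.1 hi)
      have h3 := hround _ _ hκh' ((i + 1) * H)
        (Finset.mem_Icc.2 ⟨Nat.le_mul_of_pos_left _ (by omega), by omega⟩)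
      rw [smul_dotProduct, smul_eq_mul] at h3
      have h4 := sq_le_sq' (abs_le.1 h3).1 (abs_le.1 h3).2
      rw [← inv_pow]
      nlinarith only [h4, sq_nonneg (v ⬝ᵥ φ ((i + 1) * H) - 2 * (σ⁻¹ * (h ⬝ᵥ φ ((i + 1) * H))))]
    rw [Finset.sum_add_distrib, ← Finset.mul_sum, Finset.sum_const, Finset.card_range,
      nsmul_eq_mul] at h2
    have h3 := sum_block_le (f := fun r => (h ⬝ᵥ φ r) ^ 2) (fun r => sq_nonneg _) hH hNt
    have h4 : θ * (N * (2 * ε ^ 2)) ≤ N / 2 := by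
      have : 4 * θ * ε ^ 2 ≤ 1 := by
        rw [hε, mul_pow, div_pow, one_pow, ← pow_mul]
        calc 4 * θ * (1 / (T : ℝ) ^ (2 * 2) * Φ ^ 2) = 4 * θ * Φ ^ 2 / (T : ℝ) ^ 4 := by ring
          _ ≤ 1 := by rw [div_le_one (by positivity)]; exact hθΦ
      nlinarith only [this, hN']
    have h5 : (N : ℝ) / 2 ≤ θ * (2 * (σ ^ 2)⁻¹ * (4 * B)) := by
      have h6 : θ * ∑ i ∈ Finset.range N, (v ⬝ᵥ φ ((i + 1) * H)) ^ 2
          ≤ θ * (2 * (σ ^ 2)⁻¹ * (4 * B)) + θ * (N * (2 * ε ^ 2)) := by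
        rw [← mul_add]
        refine mul_le_mul_of_nonneg_left (h2.trans ?_) hθ.le
        gcongr
        exact h3.trans henergy
      linarith
    have h6 := mul_le_mul_of_nonneg_left h5 (sq_nonneg σ)
    have h7 : σ ^ 2 * (θ * (2 * (σ ^ 2)⁻¹ * (4 * B))) = 8 * θ * B := by field_simp; ring
    rw [← hσ2]
    linarith
  rw [← hε, ← hB]
  rw [div_mul_eq_mul_div, le_div_iff₀ hN']
  exact hfin

end LeastSquares

/-! ### The ARX representation and its normal equation. -/

section ArxModel

theorem norm_sq_le_sum_rows {κ : Type*} [Fintype κ] [DecidableEq κ] (M : Matrix (Fin m) κ ℝ) :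
    ‖M‖ ^ 2 ≤ ∑ j, M j ⬝ᵥ M j := by
  have h0 : 0 ≤ ∑ j, M j ⬝ᵥ M j :=
    Finset.sum_nonneg fun j _ => Finset.sum_nonneg fun i _ => mul_self_nonneg (M j i)
  have h1 : ‖M‖ ≤ √(∑ j, M j ⬝ᵥ M j) := by
    refine opNorm_le_of_forall M (Real.sqrt_nonneg _) fun x => ?_
    rw [← Real.sqrt_sq (norm_nonneg x), ← Real.sqrt_mul h0]
    refine Real.le_sqrt_of_sq_le ?_
    rw [EuclideanSpace.real_norm_sq_eq, EuclideanSpace.real_norm_sq_eq, Finset.sum_mul]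
    refine Finset.sum_le_sum fun j _ => ?_
    have h2 := Finset.sum_mul_sq_le_sq_mul_sq Finset.univ (M j) (fun i => x i)
    have h3 : ∑ i, M j i ^ 2 = M j ⬝ᵥ M j := Finset.sum_congr rfl fun i _ => sq _
    rw [h3] at h2
    exact h2
  calc ‖M‖ ^ 2 ≤ √(∑ j, M j ⬝ᵥ M j) ^ 2 := pow_le_pow_left₀ (norm_nonneg _) h1 2
    _ = _ := Real.sq_sqrt h0

/-- Substituting e = y − Cξ replaces A by Ā, so J unrolled steps leave a remainder with the small
factor Ā^J. -/
theorem predictor_expansion {Θ : LinSys n m p} {L : Matrix (Fin n) (Fin m) ℝ} {xi : ℕ → Vec n}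
    {e y : ℕ → Vec m} {u : ℕ → Vec p}
    (hxi : ∀ t, xi (t + 1) = Matrix.toEuclideanLin Θ.A (xi t) + Matrix.toEuclideanLin Θ.B (u t)
      + Matrix.toEuclideanLin (Θ.A * L) (e t))
    (hy : ∀ t, y t = Matrix.toEuclideanLin Θ.C (xi t) + e t) (r : ℕ) (J : ℕ) (hJ : J ≤ r) :
    xi r = ∑ j ∈ Finset.range J,
        (Matrix.toEuclideanLin (filterMat Θ L ^ j * (Θ.A * L)) (y (r - 1 - j))
        + Matrix.toEuclideanLin (filterMat Θ L ^ j * Θ.B) (u (r - 1 - j)))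
      + Matrix.toEuclideanLin (filterMat Θ L ^ J) (xi (r - J)) := by
  have hrec : ∀ t, xi (t + 1) = Matrix.toEuclideanLin (filterMat Θ L) (xi t)
      + Matrix.toEuclideanLin Θ.B (u t) + Matrix.toEuclideanLin (Θ.A * L) (y t) := by
    intro t
    rw [hxi, hy, filterMat]
    simp only [map_sub, map_add, LinearMap.sub_apply, toEuclideanLin_mul_apply]
    abel
  induction J with
  | zero => simp
  | succ J ih =>
    rw [ih (by omega), Finset.sum_range_succ]
    obtain ⟨t, ht⟩ : ∃ t, t = r - (J + 1) := ⟨_, rfl⟩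
    rw [show r - J = t + 1 by omega, show r - 1 - J = t by omega, ← ht, hrec, pow_succ]
    simp only [map_add, toEuclideanLin_mul_apply]
    abel

theorem arxMatrix_dotProduct_regressor {Θ : LinSys n m p} {L : Matrix (Fin n) (Fin m) ℝ} {H : ℕ}
    (y : ℕ → Vec m) (u : ℕ → Vec p) (r : ℕ) (a : Fin m) :
    arxMatrix H Θ L a ⬝ᵥ regressor H y u r = Matrix.toEuclideanLin Θ.C (∑ j ∈ Finset.range H,
        (Matrix.toEuclideanLin (filterMat Θ L ^ j * (Θ.A * L)) (y (r - 1 - j))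
        + Matrix.toEuclideanLin (filterMat Θ L ^ j * Θ.B) (u (r - 1 - j)))) a := by
  rw [Finset.sum_range, map_sum, dotProduct, Fintype.sum_sum_type, Fintype.sum_prod_type,
    Fintype.sum_prod_type, WithLp.ofLp_sum, Finset.sum_apply, ← Finset.sum_add_distrib]
  refine Finset.sum_congr rfl fun j _ => ?_
  rw [map_add, ← toEuclideanLin_mul_apply, ← toEuclideanLin_mul_apply,
    ← Matrix.mul_assoc Θ.C (filterMat Θ L ^ (j : ℕ)) (Θ.A * L),
    ← Matrix.mul_assoc Θ.C (filterMat Θ L ^ (j : ℕ)) Θ.B]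
  rfl

theorem arxMatrix_row_le {Θ : LinSys n m p} {L : Matrix (Fin n) (Fin m) ℝ} {υ : ℝ} (hυ₁ : υ < 1)
    (hF : ‖filterMat Θ L‖ ≤ υ) (H : ℕ) (a : Fin m) :
    arxMatrix H Θ L a ⬝ᵥ arxMatrix H Θ L a
      ≤ (‖Θ.C‖ * ‖Θ.A * L‖) ^ 2 / (1 - υ) + (‖Θ.C‖ * ‖Θ.B‖) ^ 2 / (1 - υ) := by
  have hυ0 : 0 ≤ υ := (norm_nonneg _).trans hF
  have hrow : ∀ (q : ℕ) (G : Matrix (Fin n) (Fin q) ℝ) (j : ℕ),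
      ∑ b, (Θ.C * filterMat Θ L ^ j * G) a b ^ 2 ≤ (‖Θ.C‖ * ‖G‖ * υ ^ j) ^ 2 := by
    intro q G j
    have h1 := norm_toEuclideanLin_le (Θ.C * filterMat Θ L ^ j * G)ᵀ (EuclideanSpace.single a (1 : ℝ))
    rw [norm_transpose, PiLp.norm_single, norm_one, mul_one] at h1
    have h2 := norm_mul_le_mul _ G (norm_mul_le_mul Θ.C _ le_rfl (norm_pow_le_pow hF j)) le_rfl
    have h4 : ∀ N : Matrix (Fin m) (Fin q) ℝ, ∀ b,
        Matrix.toEuclideanLin Nᵀ (EuclideanSpace.single a (1 : ℝ)) b = N a b := fun N b => by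
      simp [Matrix.toLpLin_apply]
    have h3 : ‖Matrix.toEuclideanLin (Θ.C * filterMat Θ L ^ j * G)ᵀ
        (EuclideanSpace.single a (1 : ℝ))‖ ^ 2 = ∑ b, (Θ.C * filterMat Θ L ^ j * G) a b ^ 2 := by
      rw [EuclideanSpace.real_norm_sq_eq]
      exact Finset.sum_congr rfl fun b _ => by rw [h4]
    rw [← h3]
    refine pow_le_pow_left₀ (norm_nonneg _) (h1.trans (h2.trans_eq (by ring))) 2
  have h1 : arxMatrix H Θ L a ⬝ᵥ arxMatrix H Θ L a
      = ∑ j ∈ Finset.range H, ∑ b, (Θ.C * filterMat Θ L ^ j * (Θ.A * L)) a b ^ 2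
        + ∑ j ∈ Finset.range H, ∑ b, (Θ.C * filterMat Θ L ^ j * Θ.B) a b ^ 2 := by
    rw [Finset.sum_range, Finset.sum_range, dotProduct, Fintype.sum_sum_type, Fintype.sum_prod_type,
      Fintype.sum_prod_type]
    congr 1 <;> refine Finset.sum_congr rfl fun j _ => Finset.sum_congr rfl fun b _ => ?_
    · rw [sq]; rfl
    · rw [sq]; rfl
  rw [h1]
  exact add_le_add (sum_geometric_sq_le hυ0 hυ₁ (fun i => hrow m _ i) H)
    (sum_geometric_sq_le hυ0 hυ₁ (fun i => hrow p _ i) H)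

theorem isUnit_det_gramMatrix {H : ℕ} {lam : ℝ} (hlam : 0 < lam) (y : ℕ → Vec m) (u : ℕ → Vec p)
    (t : ℕ) : IsUnit (gramMatrix H lam y u t).det := by
  have h1 : (lam • (1 : Matrix (BlockIdx H m p) (BlockIdx H m p) ℝ)).PosDef :=
    Matrix.PosDef.one.smul hlam
  have h2 : (∑ r ∈ Finset.Icc H t,
      Matrix.vecMulVec (regressor H y u r) (regressor H y u r)).PosSemidef :=
    Matrix.posSemidef_sum _ fun r _ => by
      simpa using Matrix.posSemidef_vecMulVec_self_star (regressor H y u r)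
  exact (Matrix.isUnit_iff_isUnit_det _).1 (h1.add_posSemidef h2).isUnit

/-- The normal equation for the error of the least-squares estimate. -/
theorem arxEstimate_normal {H : ℕ} {lam : ℝ} (hlam : 0 < lam) (y : ℕ → Vec m) (u : ℕ → Vec p)
    (t : ℕ) (j : Fin m) (M : BlockIdx H m p → ℝ) (d : ℕ → ℝ)
    (hy : ∀ r ∈ Finset.Icc H t, y r j = M ⬝ᵥ regressor H y u r + d r) (x : BlockIdx H m p → ℝ) :
    lam * ((arxEstimate H lam y u t j - M) ⬝ᵥ x) + ∑ r ∈ Finset.Icc H t,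
        ((arxEstimate H lam y u t j - M) ⬝ᵥ regressor H y u r) * (x ⬝ᵥ regressor H y u r)
      = ∑ r ∈ Finset.Icc H t, (x ⬝ᵥ regressor H y u r) * d r - lam * (M ⬝ᵥ x) := by
  have h1 : arxEstimate H lam y u t * gramMatrix H lam y u t
      = ∑ r ∈ Finset.Icc H t, Matrix.vecMulVec (fun a => y r a) (regressor H y u r) := by
    rw [arxEstimate, Matrix.mul_assoc, Matrix.nonsing_inv_mul _ (isUnit_det_gramMatrix hlam y u t),
      Matrix.mul_one]
  have hV : gramMatrix H lam y u t *ᵥ x = lam • x + ∑ r ∈ Finset.Icc H t,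
      (x ⬝ᵥ regressor H y u r) • regressor H y u r := by
    rw [gramMatrix, Matrix.add_mulVec, Matrix.smul_mulVec, Matrix.one_mulVec, Matrix.sum_mulVec]
    congr 1
    refine Finset.sum_congr rfl fun r _ => ?_
    rw [Matrix.vecMulVec_mulVec, dotProduct_comm]
    simp
  have h2 : ((arxEstimate H lam y u t * gramMatrix H lam y u t) *ᵥ x) j
      = ∑ r ∈ Finset.Icc H t, y r j * (x ⬝ᵥ regressor H y u r) := by
    rw [h1, Matrix.sum_mulVec, Finset.sum_apply]
    refine Finset.sum_congr rfl fun r _ => ?_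
    rw [Matrix.vecMulVec_mulVec, dotProduct_comm]
    simp [mul_comm]
  rw [← Matrix.mulVec_mulVec, hV] at h2
  have h3 : ∀ M' : BlockIdx H m p → ℝ, M' ⬝ᵥ (lam • x + ∑ r ∈ Finset.Icc H t,
      (x ⬝ᵥ regressor H y u r) • regressor H y u r) = lam * (M' ⬝ᵥ x)
      + ∑ r ∈ Finset.Icc H t, (M' ⬝ᵥ regressor H y u r) * (x ⬝ᵥ regressor H y u r) := by
    intro M'
    rw [dotProduct_add, dotProduct_smul, smul_eq_mul, dotProduct_sum]
    congr 1
    refine Finset.sum_congr rfl fun r _ => ?_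
    rw [dotProduct_smul, smul_eq_mul, mul_comm]
  have h4 : arxEstimate H lam y u t j ⬝ᵥ (lam • x + ∑ r ∈ Finset.Icc H t,
      (x ⬝ᵥ regressor H y u r) • regressor H y u r)
      = ∑ r ∈ Finset.Icc H t, y r j * (x ⬝ᵥ regressor H y u r) := h2
  rw [← h3, sub_dotProduct, h4, h3]
  have h5 : ∑ r ∈ Finset.Icc H t, y r j * (x ⬝ᵥ regressor H y u r)
      = ∑ r ∈ Finset.Icc H t, (M ⬝ᵥ regressor H y u r) * (x ⬝ᵥ regressor H y u r)
        + ∑ r ∈ Finset.Icc H t, (x ⬝ᵥ regressor H y u r) * d r := by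
    rw [← Finset.sum_add_distrib]
    refine Finset.sum_congr rfl fun r hr => ?_
    rw [hy r hr]
    ring
  rw [h5]
  ring

end ArxModel

/-! ### Length of the warm-up. -/

section Estimation

/-- The warm-up length that makes the least-squares estimate accurate up to `ε`. -/
def warmupConst (D M θ₀ v₁ b₀ Y₀ C₀ lam μ₀ cυ ε : ℝ) : ℝ :=
  32 * D + 2 + 32 * θ₀ * D ^ 2 * Y₀ ^ 2 + (b₀ + C₀ * Y₀) ^ 2 / (lam * v₁ ^ 2) + μ₀ / (2 * v₁ ^ 2)
    + 2 * D * Y₀ * b₀ + 8 * v₁ * D ^ 2 * Y₀ ^ 2 + 2 * C₀ ^ 2 * Y₀ ^ 2 * cυ ^ 2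
    + 256 * M * θ₀ * (2 * v₁ * (11 * D + 2) + 1 + lam * μ₀ / 2) / ε ^ 2

-- The summands of `warmupConst` pay for the individual requirements, all with powers at most 4 of g
-- = Hℓ ≥ 1. The last one needs the fourth power: the squared error is of order H²g/N with N ≥
-- W/(2H), and H ≤ 2g.
set_option maxHeartbeats 1000000 in
theorem estimation_arith {D M θ₀ v₁ b₀ Y₀ C₀ lam μ₀ cυ ε H T N W ℓ σ q : ℝ} (hD : 1 ≤ D)
    (hM : 0 ≤ M) (hθ₀ : 0 < θ₀) (hv₁ : 0 < v₁) (hb₀ : 0 ≤ b₀) (hY₀ : 0 ≤ Y₀) (hC₀ : 0 ≤ C₀)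
    (hlam : 0 < lam) (hμ₀ : 0 ≤ μ₀) (hε : 0 < ε) (hH : 2 ≤ H) (hℓ : 1 / 2 ≤ ℓ) (hσ0 : 0 ≤ σ)
    (hσ : σ ^ 2 = ℓ) (hT : 2 ≤ T) (hWT : W ≤ T) (hN : 0 < N) (hNW : W ≤ 2 * H * N)
    (hq0 : 0 ≤ q) (hq1 : q ≤ 1) (hq : q * T ^ 2 ≤ cυ)
    (hK : warmupConst D M θ₀ v₁ b₀ Y₀ C₀ lam μ₀ cυ ε * (H * ℓ) ^ 4 ≤ W) :
    8 * (H * D) * ℓ ≤ N ∧ 4 * (H * D) ≤ T ^ 4 ∧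
    4 * (θ₀ * H) * (H * D * (Y₀ * σ)) ^ 2 ≤ T ^ 4 ∧
    (T + 1) * (b₀ * σ + C₀ * q * (Y₀ * σ)) ^ 2 + lam * μ₀ ≤ lam * (2 * v₁ * T ^ 2) ^ 2 ∧
    H * M * (16 * (θ₀ * H) / N * (2 * v₁ * (11 * (H * D) * ℓ + (T + 1)
      * (1 / T ^ 2 * (H * D * (Y₀ * σ)) * (b₀ * σ) + v₁ * (1 / T ^ 2 * (H * D * (Y₀ * σ))) ^ 2))
      + (T + 1) * (C₀ * q * (Y₀ * σ)) ^ 2 + lam * μ₀ / 2)) ≤ ε ^ 2 := by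
  obtain ⟨g, hg⟩ : ∃ g, g = H * ℓ := ⟨_, rfl⟩
  rw [← hg] at hK
  have hg1 : 1 ≤ g := by rw [hg]; nlinarith
  have hH2 : H ≤ 2 * g := by rw [hg]; nlinarith
  have hℓg : ℓ ≤ g := by rw [hg]; nlinarith
  have hcυ : 0 ≤ cυ := le_trans (by positivity) hq
  have key : ∀ c, 0 ≤ c → c ≤ warmupConst D M θ₀ v₁ b₀ Y₀ C₀ lam μ₀ cυ ε → ∀ j ≤ 4,
      c * g ^ j ≤ W := by
    intro c hc hcK j hj
    have h1 : g ^ j ≤ g ^ 4 := pow_le_pow_right₀ hg1 hj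
    calc c * g ^ j ≤ c * g ^ 4 := mul_le_mul_of_nonneg_left h1 hc
      _ ≤ _ := (mul_le_mul_of_nonneg_right hcK (by positivity)).trans hK
  obtain ⟨B₀, hB₀⟩ : ∃ B₀, B₀ = 2 * v₁ * (11 * D + 2) + 1 + lam * μ₀ / 2 := ⟨_, rfl⟩
  have hB₀0 : 0 ≤ B₀ := by rw [hB₀]; positivity
  have p1 : 0 ≤ 32 * θ₀ * D ^ 2 * Y₀ ^ 2 := by positivity
  have p2 : 0 ≤ (b₀ + C₀ * Y₀) ^ 2 / (lam * v₁ ^ 2) := by positivity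
  have p3 : 0 ≤ μ₀ / (2 * v₁ ^ 2) := by positivity
  have p4 : 0 ≤ 2 * D * Y₀ * b₀ := by positivity
  have p5 : 0 ≤ 8 * v₁ * D ^ 2 * Y₀ ^ 2 := by positivity
  have p6 : 0 ≤ 2 * C₀ ^ 2 * Y₀ ^ 2 * cυ ^ 2 := by positivity
  have p7 : 0 ≤ 256 * M * θ₀ * B₀ / ε ^ 2 := by positivity
  have hKdef : warmupConst D M θ₀ v₁ b₀ Y₀ C₀ lam μ₀ cυ ε = 32 * D + 2
    + 32 * θ₀ * D ^ 2 * Y₀ ^ 2 + (b₀ + C₀ * Y₀) ^ 2 / (lam * v₁ ^ 2) + μ₀ / (2 * v₁ ^ 2)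
    + 2 * D * Y₀ * b₀ + 8 * v₁ * D ^ 2 * Y₀ ^ 2 + 2 * C₀ ^ 2 * Y₀ ^ 2 * cυ ^ 2
    + 256 * M * θ₀ * B₀ / ε ^ 2 := by rw [hB₀, warmupConst]
  have k0 := key (32 * D) (by positivity) (by rw [hKdef]; linarith)
  have k1 := key _ p1 (by rw [hKdef]; linarith)
  have k2 := key _ p2 (by rw [hKdef]; linarith) 1 (by norm_num)
  have k3 := key _ p3 (by rw [hKdef]; linarith) 0 (by norm_num)
  have k4 := key _ p4 (by rw [hKdef]; linarith) 1 (by norm_num)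
  have k5 := key _ p5 (by rw [hKdef]; linarith) 3 (by norm_num)
  have k6 := key _ p6 (by rw [hKdef]; linarith) 1 (by norm_num)
  have k7 := key _ p7 (by rw [hKdef]; linarith) 4 (by norm_num)
  clear key hKdef hK
  have hTpow : ∀ j : ℕ, 1 ≤ j → T ≤ T ^ j := fun j hj => by
    calc T = T ^ 1 := (pow_one T).symm
      _ ≤ T ^ j := pow_le_pow_right₀ (by linarith) hj
  have hΦ2 : (H * D * (Y₀ * σ)) ^ 2 ≤ 4 * D ^ 2 * Y₀ ^ 2 * g ^ 3 := by
    calc (H * D * (Y₀ * σ)) ^ 2 = H * (H * ℓ) * (D ^ 2 * Y₀ ^ 2) := by rw [← hσ]; ring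
      _ ≤ (2 * g) * g * (D ^ 2 * Y₀ ^ 2) := by rw [← hg]; gcongr
      _ ≤ (2 * g) * g * (D ^ 2 * Y₀ ^ 2) * (2 * g) :=
          le_mul_of_one_le_right (by positivity) (by linarith)
      _ = _ := by ring
  have hT1 : T + 1 ≤ 2 * T := by linarith
  have hT0 : 0 < T := by linarith
  refine ⟨?_, ?_, ?_, ?_, ?_⟩
  · have h1 : 32 * D * g ^ 2 ≤ 2 * H * N := (k0 2 (by norm_num)).trans hNW
    have h2 : 2 * H * (8 * (H * D) * ℓ) ≤ 2 * H * N := by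
      refine le_trans ?_ h1
      calc 2 * H * (8 * (H * D) * ℓ) = 16 * D * H * (H * ℓ) := by ring
        _ ≤ 16 * D * (2 * g) * g := by rw [← hg]; gcongr
        _ = 32 * D * g ^ 2 := by ring
    exact le_of_mul_le_mul_left h2 (by positivity)
  · have h1 := k0 1 (by norm_num)
    have h2 : 4 * (H * D) ≤ 32 * D * g ^ 1 := by nlinarith
    linarith [hTpow 4 (by norm_num)]
  · calc 4 * (θ₀ * H) * (H * D * (Y₀ * σ)) ^ 2
        ≤ 4 * (θ₀ * (2 * g)) * (4 * D ^ 2 * Y₀ ^ 2 * g ^ 3) := by gcongr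
      _ = 32 * θ₀ * D ^ 2 * Y₀ ^ 2 * g ^ 4 := by ring
      _ ≤ T ^ 4 := (k1 4 le_rfl).trans (hWT.trans (hTpow 4 (by norm_num)))
  · have h1 : (b₀ * σ + C₀ * q * (Y₀ * σ)) ^ 2 ≤ (b₀ + C₀ * Y₀) ^ 2 * g := by
      calc (b₀ * σ + C₀ * q * (Y₀ * σ)) ^ 2 ≤ (b₀ * σ + C₀ * 1 * (Y₀ * σ)) ^ 2 := by gcongr
        _ = (b₀ + C₀ * Y₀) ^ 2 * ℓ := by rw [← hσ]; ring
        _ ≤ _ := by gcongr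
    have h2 : (b₀ + C₀ * Y₀) ^ 2 * g ≤ lam * v₁ ^ 2 * T := by
      have h3 := k2.trans hWT
      rw [pow_one, div_mul_eq_mul_div, div_le_iff₀ (by positivity)] at h3
      linarith
    have h4 : μ₀ ≤ 2 * v₁ ^ 2 * T := by
      have h3 := k3.trans hWT
      rw [pow_zero, mul_one, div_le_iff₀ (by positivity)] at h3
      linarith
    have h5 : (T + 1) * (b₀ * σ + C₀ * q * (Y₀ * σ)) ^ 2 ≤ 2 * T * (lam * v₁ ^ 2 * T) := by
      gcongr
      exact h1.trans h2
    have h6 : T ^ 2 ≤ T ^ 4 := pow_le_pow_right₀ (by linarith) (by norm_num)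
    have h7 := hTpow 4 (by norm_num)
    have h8 : lam * μ₀ ≤ lam * (2 * v₁ ^ 2 * T ^ 4) := by gcongr; exact h4.trans (by gcongr)
    have h9 : 2 * T * (lam * v₁ ^ 2 * T) ≤ 2 * (lam * v₁ ^ 2) * T ^ 4 := by
      calc 2 * T * (lam * v₁ ^ 2 * T) = 2 * (lam * v₁ ^ 2) * T ^ 2 := by ring
        _ ≤ _ := by gcongr
    calc _ ≤ 2 * (lam * v₁ ^ 2) * T ^ 4 + lam * (2 * v₁ ^ 2 * T ^ 4) := add_le_add (h5.trans h9) h8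
      _ = _ := by ring
  · have e1 : (T + 1) * (1 / T ^ 2 * (H * D * (Y₀ * σ)) * (b₀ * σ)) ≤ 1 := by
      calc (T + 1) * (1 / T ^ 2 * (H * D * (Y₀ * σ)) * (b₀ * σ))
          ≤ 2 * T * (1 / T ^ 2 * (H * D * (Y₀ * σ)) * (b₀ * σ)) := by gcongr
        _ = (2 * D * Y₀ * b₀ * (H * σ ^ 2)) / T := by field_simp
        _ ≤ 1 := by
            rw [hσ, ← hg, div_le_one hT0]
            rw [pow_one] at k4
            exact k4.trans hWT
    have e2 : (T + 1) * (v₁ * (1 / T ^ 2 * (H * D * (Y₀ * σ))) ^ 2) ≤ 1 := by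
      calc (T + 1) * (v₁ * (1 / T ^ 2 * (H * D * (Y₀ * σ))) ^ 2)
          ≤ 2 * T * (v₁ * (1 / T ^ 2 * (H * D * (Y₀ * σ))) ^ 2) := by gcongr
        _ = 2 * v₁ * (H * D * (Y₀ * σ)) ^ 2 / T ^ 3 := by field_simp
        _ ≤ 1 := by
            rw [div_le_one (by positivity)]
            refine le_trans ?_ (k5.trans (hWT.trans (hTpow 3 (by norm_num))))
            calc 2 * v₁ * (H * D * (Y₀ * σ)) ^ 2 ≤ 2 * v₁ * (4 * D ^ 2 * Y₀ ^ 2 * g ^ 3) := by gcongr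
              _ = _ := by ring
    have e3 : (T + 1) * (C₀ * q * (Y₀ * σ)) ^ 2 ≤ 1 := by
      have hq' : q ≤ cυ / T ^ 2 := by rw [le_div_iff₀ (by positivity)]; exact hq
      calc (T + 1) * (C₀ * q * (Y₀ * σ)) ^ 2
          ≤ 2 * T * (C₀ * (cυ / T ^ 2) * (Y₀ * σ)) ^ 2 := by gcongr
        _ = 2 * C₀ ^ 2 * Y₀ ^ 2 * cυ ^ 2 * σ ^ 2 / T ^ 3 := by field_simp
        _ ≤ 1 := by
            rw [div_le_one (by positivity), hσ]
            refine le_trans ?_ (k6.trans (hWT.trans (hTpow 3 (by norm_num))))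
            rw [pow_one]
            gcongr
    have e4 : 2 * v₁ * (11 * (H * D) * ℓ + (T + 1)
      * (1 / T ^ 2 * (H * D * (Y₀ * σ)) * (b₀ * σ) + v₁ * (1 / T ^ 2 * (H * D * (Y₀ * σ))) ^ 2))
      + (T + 1) * (C₀ * q * (Y₀ * σ)) ^ 2 + lam * μ₀ / 2 ≤ B₀ * g := by
      rw [mul_add (T + 1)]
      have h1 : 11 * (H * D) * ℓ = 11 * D * g := by rw [hg]; ring
      rw [h1]
      have h2 : 2 * v₁ * (11 * D * g + ((T + 1) * (1 / T ^ 2 * (H * D * (Y₀ * σ)) * (b₀ * σ))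
          + (T + 1) * (v₁ * (1 / T ^ 2 * (H * D * (Y₀ * σ))) ^ 2)))
          ≤ 2 * v₁ * (11 * D * g + 2 * g) := by
        gcongr
        linarith
      have h3 : lam * μ₀ / 2 ≤ lam * μ₀ / 2 * g := le_mul_of_one_le_right (by positivity) hg1
      rw [hB₀]
      linarith
    calc _ ≤ H * M * (16 * (θ₀ * H) / N * (B₀ * g)) := by gcongr
      _ = 16 * M * θ₀ * B₀ * g * H ^ 2 / N := by ring
      _ ≤ ε ^ 2 := by
          rw [div_le_iff₀ hN]
          have h1 : 256 * M * θ₀ * B₀ * g ^ 4 ≤ ε ^ 2 * (2 * H * N) := by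
            have h2 := k7.trans hNW
            rw [div_mul_eq_mul_div, div_le_iff₀ (by positivity)] at h2
            linarith
          have h3 : 2 * H * (16 * M * θ₀ * B₀ * g * H ^ 2) ≤ 2 * H * (ε ^ 2 * N) := by
            calc 2 * H * (16 * M * θ₀ * B₀ * g * H ^ 2) = 32 * M * θ₀ * B₀ * g * H ^ 3 := by ring
              _ ≤ 32 * M * θ₀ * B₀ * g * (2 * g) ^ 3 := by gcongr
              _ = 256 * M * θ₀ * B₀ * g ^ 4 := by ring
              _ ≤ _ := h1.trans_eq (by ring)
          exact le_of_mul_le_mul_left h3 (by positivity)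

theorem sum_abs_le_of_norm_le {q : ℕ} {x : Vec q} {a : ℝ} (h : ‖x‖ ≤ a) : ∑ i, |x i| ≤ q * a := by
  calc ∑ i, |x i| ≤ ∑ _i : Fin q, a := Finset.sum_le_sum fun i _ => by
        have := PiLp.norm_apply_le x i
        rw [Real.norm_eq_abs] at this
        exact this.trans h
    _ = q * a := by simp

theorem sum_abs_regressor_le {H : ℕ} {y : ℕ → Vec m} {u : ℕ → Vec p} {r : ℕ} (hr : 0 < r) {Y : ℝ}
    (h : ∀ i < r, ‖y i‖ ≤ Y ∧ ‖u i‖ ≤ Y) :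
    ∑ i, |regressor H y u r i| ≤ H * (m + p) * Y := by
  rw [Fintype.sum_sum_type, Fintype.sum_prod_type, Fintype.sum_prod_type]
  have h1 : ∑ j : Fin H, ∑ a, |regressor H y u r (Sum.inl (j, a))| ≤ ∑ _j : Fin H, m * Y :=
    Finset.sum_le_sum fun j _ => sum_abs_le_of_norm_le (h (r - 1 - j) (by omega)).1
  have h2 : ∑ j : Fin H, ∑ a, |regressor H y u r (Sum.inr (j, a))| ≤ ∑ _j : Fin H, p * Y :=
    Finset.sum_le_sum fun j _ => sum_abs_le_of_norm_le (h (r - 1 - j) (by omega)).2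
  refine (add_le_add h1 h2).trans_eq ?_
  simp
  ring

end Estimation

/-! ### Accuracy of the estimate in a run. -/

section RunEstimation

variable {Ω : Type*} [MeasurableSpace Ω] {μ : Measure Ω} {s : Setup m p}
  {c : RadiusConst} {S : Set (LinSys n m p)} {Θ : LinSys n m p} {Sig : Matrix (Fin n) (Fin n) ℝ}
  {L : Matrix (Fin n) (Fin m) ℝ} {T Tw d₁ d₂ : ℕ} {X : Processes n m p Ω}

/-- An upper bound for the squared norm of every row of the ARX matrix. -/
def rowConst (Θ : LinSys n m p) (L : Matrix (Fin n) (Fin m) ℝ) (υ : ℝ) : ℝ :=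
  (‖Θ.C‖ * ‖Θ.A * L‖) ^ 2 / (1 - υ) + (‖Θ.C‖ * ‖Θ.B‖) ^ 2 / (1 - υ)

/-- On the good event bounded data give an accurate estimate. -/
theorem IsLqgOptRun.estimation_le (h : IsLqgOptRun μ s c S Θ Sig L T Tw d₁ d₂ X) (hm : 0 < m)
    (hlam : 0 < s.lam) {υ θ₀ v₁ b₀ Y₀ cυ ε ℓ W : ℝ} (hυ₁ : υ < 1) (hF : ‖filterMat Θ L‖ ≤ υ)
    (hθ₀ : 0 < θ₀) (hv₁ : 0 < v₁) (hb₀ : 0 ≤ b₀) (hY₀ : 0 ≤ Y₀) (hε : 0 < ε) {H N t : ℕ}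
    (hH : 2 ≤ H) (hT : 2 ≤ T) (hℓ : 1 / 2 ≤ ℓ) (hN : 0 < N) (hNt : N * H ≤ t) (htT : t ≤ T)
    (hWT : W ≤ T) (hNW : W ≤ 2 * H * N) (hq : υ ^ H * (T : ℝ) ^ 2 ≤ cυ)
    (hK : warmupConst (m + p) m θ₀ v₁ b₀ Y₀ ‖Θ.C‖ s.lam (rowConst Θ L υ) cυ ε * (H * ℓ) ^ 4 ≤ W)
    {ω : Ω} (hgood : GoodNoise X Θ L H T N (θ₀ * H) v₁ (b₀ * √ℓ) (11 * (H * (m + p)) * ℓ) ω)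
    (hbd : ∀ r < t, ‖X.y r ω‖ ≤ Y₀ * √ℓ ∧ ‖X.u r ω‖ ≤ Y₀ * √ℓ ∧ ‖X.optPred Θ L r ω‖ ≤ Y₀ * √ℓ) :
    √(H : ℝ) * ‖X.Mhat s H t ω - arxMatrix H Θ L‖ ≤ ε := by
  have hυ0 : 0 ≤ υ := (norm_nonneg _).trans hF
  have h1υ : 0 < 1 - υ := by linarith
  have hH' : (2 : ℝ) ≤ H := by exact_mod_cast hH
  have hT' : (2 : ℝ) ≤ T := by exact_mod_cast hT
  have hN' : (0 : ℝ) < N := by exact_mod_cast hN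
  have hD : (1 : ℝ) ≤ (m : ℝ) + p := by
    have : 1 ≤ m + p := by omega
    exact_mod_cast this
  have hμ₀ : 0 ≤ rowConst Θ L υ := by unfold rowConst; positivity
  have hℓ0 : 0 ≤ ℓ := by linarith
  obtain ⟨-, hA1, hA2, hA3, hA4⟩ := estimation_arith (M := (m : ℝ)) (C₀ := ‖Θ.C‖) hD
    (by positivity) hθ₀ hv₁ hb₀ hY₀ (norm_nonneg _) hlam hμ₀ hε hH' hℓ (Real.sqrt_nonneg ℓ)
    (Real.sq_sqrt hℓ0) hT' hWT hN' hNW (by positivity) (pow_le_one₀ hυ0 hυ₁.le) hq hK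
  obtain ⟨E, hE⟩ : ∃ E : ℝ, E = 16 * (θ₀ * H) / N * (2 * v₁ * (11 * (H * ((m : ℝ) + p)) * ℓ + (T + 1)
      * (1 / (T : ℝ) ^ 2 * (H * ((m : ℝ) + p) * (Y₀ * √ℓ)) * (b₀ * √ℓ)
        + v₁ * (1 / (T : ℝ) ^ 2 * (H * ((m : ℝ) + p) * (Y₀ * √ℓ))) ^ 2))
      + (T + 1) * (‖Θ.C‖ * υ ^ H * (Y₀ * √ℓ)) ^ 2 + s.lam * rowConst Θ L υ / 2) := ⟨_, rfl⟩
  rw [← hE] at hA4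
  have hrow : ∀ j, (X.Mhat s H t ω - arxMatrix H Θ L) j ⬝ᵥ (X.Mhat s H t ω - arxMatrix H Θ L) j
      ≤ E := by
    intro j
    -- The truncation residual of the ARX model, of size υ^H; the regression noise is the innovation
    -- plus d.
    obtain ⟨d, hd⟩ : ∃ d : ℕ → ℝ, d = fun r =>
      Matrix.toEuclideanLin (Θ.C * filterMat Θ L ^ H) (X.optPred Θ L (r - H) ω) j := ⟨_, rfl⟩
    have hyr : ∀ r ∈ Finset.Icc H t, X.y r ω j = arxMatrix H Θ L j ⬝ᵥ X.reg H r ω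
        + (X.innov Θ L r ω j + d r) := by
      intro r hr
      have h1 := predictor_expansion (xi := fun t => X.optPred Θ L t ω)
        (e := fun t => X.innov Θ L t ω) (y := fun t => X.y t ω) (u := fun t => X.u t ω)
        (fun t => h.optPred_succ t ω) (fun t => h.output_eq t ω) r H (Finset.mem_Icc.1 hr).1
      have h2 : d r = Matrix.toEuclideanLin Θ.C
          (Matrix.toEuclideanLin (filterMat Θ L ^ H) (X.optPred Θ L (r - H) ω)) j := by
        rw [hd, ← toEuclideanLin_mul_apply]
      rw [Processes.reg, arxMatrix_dotProduct_regressor, h.output_eq, h1, h2, map_add]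
      simp only [PiLp.add_apply]
      ring
    have hnormal := arxEstimate_normal hlam (fun t => X.y t ω) (fun t => X.u t ω) t j
      (arxMatrix H Θ L j) (fun r => X.innov Θ L r ω j + d r) hyr
      ((X.Mhat s H t ω - arxMatrix H Θ L) j)
    have hdle : ∀ r ∈ Finset.Icc H t, |d r| ≤ ‖Θ.C‖ * υ ^ H * (Y₀ * √ℓ) := by
      intro r hr
      have hr' := Finset.mem_Icc.1 hr
      have h1 := PiLp.norm_apply_le
        (Matrix.toEuclideanLin (Θ.C * filterMat Θ L ^ H) (X.optPred Θ L (r - H) ω)) j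
      rw [Real.norm_eq_abs] at h1
      rw [hd]
      refine h1.trans ((norm_toEuclideanLin_le _ _).trans (mul_le_mul
        (norm_mul_le_mul _ _ le_rfl (norm_pow_le_pow hF H)) (hbd (r - H) (by omega)).2.2
        (norm_nonneg _) (by positivity)))
    have hgrid : ∀ κ : BlockIdx H m p → ℤ, (∀ i, |κ i| ≤ (T : ℤ) ^ 5) → κ ∈ grid H m p T := by
      intro κ hκ
      refine Fintype.mem_piFinset.2 fun i => Finset.mem_Icc.2 (abs_le.1 (hκ i))
    rw [hE]
    refine leastSquares_error_le (H := H) (t := t) (T := T) (N := N) (φ := fun r => X.reg H r ω)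
      (M := arxMatrix H Θ L j) (e := fun r => X.innov Θ L r ω j) (d := d) (by omega) hN hNt htT hT
      hlam hv₁ (by positivity) ?_ ?_ ?_ hdle (arxMatrix_row_le hυ₁ hF H j) ?_ ?_ ?_ hA2 hA3
    · simp only [sq]
      exact hnormal
    · intro r hr
      have hr' := Finset.mem_Icc.1 hr
      exact sum_abs_regressor_le (by omega) fun i hi =>
        ⟨(hbd i (by omega)).1, (hbd i (by omega)).2.1⟩
    · intro r hr
      have h1 := PiLp.norm_apply_le (X.innov Θ L r ω) j
      rw [Real.norm_eq_abs] at h1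
      exact h1.trans (hgood.noise_le r ((Finset.mem_Icc.1 hr).2.trans htT)).1
    · exact fun κ hκ hv => hgood.excited κ (hgrid κ hκ) hv
    · exact fun κ hκ => hgood.martingale t htT
        ((Nat.le_mul_of_pos_left H hN).trans hNt) j κ (hgrid κ hκ)
    · have : (Fintype.card (BlockIdx H m p) : ℝ) = H * (m + p) := by
        simp [BlockIdx]
        ring
      rw [this]
      exact hA1
  have h1 : (H : ℝ) * ‖X.Mhat s H t ω - arxMatrix H Θ L‖ ^ 2 ≤ ε ^ 2 := by
    refine le_trans ?_ hA4
    rw [mul_assoc]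
    refine mul_le_mul_of_nonneg_left ((norm_sq_le_sum_rows _).trans
      ((Finset.sum_le_sum fun j _ => hrow j).trans_eq ?_)) (by positivity)
    simp
  refine abs_le_of_sq_le_sq' ?_ hε.le |>.2
  rw [mul_pow, Real.sq_sqrt (by positivity)]
  exact h1

end RunEstimation

/-! ### Confidence sets of the true system. -/

section Confidence

variable {Θ : LinSys n m p} {L : Matrix (Fin n) (Fin m) ℝ}

theorem FactorBounds.norm_mul_le {ι κ : Type*} [Fintype ι] [Fintype κ] [DecidableEq ι]
    [DecidableEq κ] {x₀ x₁ y₀ y₁ : ℝ} {O : Matrix ι (Fin n) ℝ} {W : Matrix (Fin n) κ ℝ}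
    (h : FactorBounds x₀ x₁ y₀ y₁ O W) (hx₁ : 0 ≤ x₁) (hy₁ : 0 ≤ y₁) : ‖O * W‖ ≤ x₁ * y₁ := by
  refine norm_mul_le_mul _ _ (opNorm_le_of_forall _ hx₁ h.left_le) ?_
  rw [← norm_transpose]
  exact opNorm_le_of_forall _ hy₁ h.right_le

/-- What is known about the confidence sets of a stable observable and controllable system. -/
structure ConfidenceData (Θ : LinSys n m p) (L : Matrix (Fin n) (Fin m) ℝ) (c₀ ε₀ x X γ : ℝ)
    (d₁ d₂ : ℕ) : Prop where
  sigma_ge : x ≤ sigma n (hankel d₁ d₂ (arxMatrix (d₁ + d₂ + 1) Θ L))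
  norm_le : ‖hankel d₁ d₂ (arxMatrix (d₁ + d₂ + 1) Θ L)‖ ≤ X
  balancing : ∃ G, IsBalancing (obsBlock d₁ Θ L) (ctrBlock d₂ Θ L) G ∧ ‖G‖ ≤ γ ∧ ‖G⁻¹‖ ≤ γ
  exact_output : ∀ (Θbar : LinSys n m p) (Lbar : Matrix (Fin n) (Fin m) ℝ),
    IsSysIdOutput d₁ d₂ (arxMatrix (d₁ + d₂ + 1) Θ L) Θbar Lbar →
    ∃ G, IsBalancing (obsBlock d₁ Θ L) (ctrBlock d₂ Θ L) G ∧ Θbar = Θ.conj G ∧ Lbar = G⁻¹ * L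
  inBalls : ∀ (Mh : Matrix (Fin m) (BlockIdx (d₁ + d₂ + 1) m p) ℝ) (Θh : LinSys n m p)
    (Lh : Matrix (Fin n) (Fin m) ℝ), IsSysIdOutput d₁ d₂ Mh Θh Lh →
    √(d₁ + d₂ + 1 : ℕ) * ‖Mh - arxMatrix (d₁ + d₂ + 1) Θ L‖ ≤ ε₀ →
    ∀ G, IsBalancing (obsBlock d₁ Θ L) (ctrBlock d₂ Θ L) G →
    ∃ T ∈ Matrix.orthogonalGroup (Fin n) ℝ, ∀ c : RadiusConst, c₀ ≤ c.c₁ → c₀ ≤ c.c₂ → c₀ ≤ c.c₃ →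
      InBalls c d₁ d₂ (arxMatrix (d₁ + d₂ + 1) Θ L) Mh Θh Lh T (Θ.conj G) (G⁻¹ * L)

/-- Collects the identification results with constants independent of the window; it only has to be
long enough for the last block column of the Hankel matrix to be small. -/
theorem exists_confidenceData (hn : 0 < n) {υ : ℝ} (hυ₁ : υ < 1) (hF : ‖filterMat Θ L‖ ≤ υ)
    (ho : Observable Θ.A Θ.C) (hc : Controllable Θ.A Θ.B) (hA : IsUnit Θ.A.det) :
    ∃ (c₀ ε₀ x X γ : ℝ) (q : ℕ), 0 < c₀ ∧ 0 < ε₀ ∧ 0 < x ∧ 0 < γ ∧ ∀ d₁ d₂ : ℕ, n ≤ d₁ →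
      n ≤ d₂ → d₁ ≤ d₂ + 1 → q ≤ d₂ → ConfidenceData Θ L c₀ ε₀ x X γ d₁ d₂ := by
  have hυ0 : 0 ≤ υ := (norm_nonneg _).trans hF
  obtain ⟨x₀, x₁, y₀, y₁, hx, hx₁, hy, hy₁, hfb⟩ := exists_factorBounds hF hυ₁ ho hc
  obtain ⟨c₀, ε₀, hc₀, hε₀, hrad⟩ := exists_sysId_radius hn hx hy hx₁ hy₁ hA (hF.trans hυ₁.le)
  obtain ⟨κ, hκ⟩ : ∃ κ, κ = (√(x₁ * y₁) / y₀) ^ 2 * (‖Θ.A * L‖ ^ 2 + ‖Θ.B‖ ^ 2) := ⟨_, rfl⟩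
  have hκ0 : 0 ≤ κ := by rw [hκ]; positivity
  obtain ⟨q, hq⟩ := exists_pow_lt_of_lt_one (show 0 < 3 * (x₀ * y₀) / (κ + 1) by positivity) hυ₁
  refine ⟨c₀, ε₀, x₀ * y₀, x₁ * y₁, √(x₁ * y₁) / x₀ + √(x₁ * y₁) / y₀ + 1, q, hc₀, hε₀,
    by positivity, by positivity, fun d₁ d₂ hd₁ hd₂ hd hqd => ?_⟩
  have hfb₁ := hfb d₁ (d₂ + 1) hd₁ (by omega)
  have hfb₂ := hfb d₁ d₂ hd₁ hd₂
  have hσ : x₀ * y₀ ≤ sigma n (hankel d₁ d₂ (arxMatrix (d₁ + d₂ + 1) Θ L)) := by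
    rw [hankel_arxMatrix]
    exact hfb₁.le_sigma hx hy hn
  have htail : (√(x₁ * y₁) / y₀ * ‖filterMat Θ L ^ d₂ * (Θ.A * L)‖) ^ 2
        + (√(x₁ * y₁) / y₀ * ‖filterMat Θ L ^ d₂ * Θ.B‖) ^ 2 ≤ 3 * (x₀ * y₀) := by
    have h1 := norm_mul_le_mul _ (Θ.A * L) (norm_pow_le_pow hF d₂) le_rfl
    have h2 := norm_mul_le_mul _ Θ.B (norm_pow_le_pow hF d₂) le_rfl
    have h3 : υ ^ d₂ ≤ υ ^ q := pow_le_pow_of_le_one hυ0 hυ₁.le hqd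
    have h4 : υ ^ d₂ ≤ 1 := pow_le_one₀ hυ0 hυ₁.le
    have h5 : 0 ≤ υ ^ d₂ := by positivity
    calc _ ≤ (√(x₁ * y₁) / y₀ * (υ ^ d₂ * ‖Θ.A * L‖)) ^ 2
          + (√(x₁ * y₁) / y₀ * (υ ^ d₂ * ‖Θ.B‖)) ^ 2 := by gcongr
      _ = κ * (υ ^ d₂ * υ ^ d₂) := by rw [hκ]; ring
      _ ≤ (κ + 1) * (υ ^ q * 1) := by gcongr; linarith
      _ ≤ 3 * (x₀ * y₀) := by
          rw [lt_div_iff₀ (by positivity)] at hq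
          linarith
  refine ⟨hσ, ?_, ?_, fun Θbar Lbar => exists_isBalancing_of_isSysIdOutput hx hy hfb₂ (by omega)
    (by omega) hA, fun Mh Θh Lh hout hMh => hrad d₁ d₂ (by omega) (by omega) (by omega) hfb₂ htail
      Mh Θh Lh hout hMh ((by positivity : 0 < x₀ * y₀).trans_le hσ)⟩
  · rw [hankel_arxMatrix]
    exact hfb₁.norm_mul_le hx₁ hy₁
  · obtain ⟨G, hG⟩ := exists_isBalancing (hfb₂.isUnit_left hx) (hfb₂.isUnit_right hy)
    obtain ⟨-, -, h1, h2, -⟩ := hG.bounds hfb₂ hx hy hn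
    have h3 : 0 ≤ √(x₁ * y₁) / x₀ := by positivity
    have h4 : 0 ≤ √(x₁ * y₁) / y₀ := by positivity
    exact ⟨G, hG, by linarith, by linarith⟩

theorem ConfidenceData.mem_confSet {c₀ ε₀ x X γ : ℝ} {d₁ d₂ : ℕ}
    (h : ConfidenceData Θ L c₀ ε₀ x X γ d₁ d₂) {c : RadiusConst} (h₁ : c₀ ≤ c.c₁) (h₂ : c₀ ≤ c.c₂)
    (h₃ : c₀ ≤ c.c₃) {Mh : Matrix (Fin m) (BlockIdx (d₁ + d₂ + 1) m p) ℝ} {Θh : LinSys n m p}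
    {Lh : Matrix (Fin n) (Fin m) ℝ} (hout : IsSysIdOutput d₁ d₂ Mh Θh Lh)
    (hMh : √(d₁ + d₂ + 1 : ℕ) * ‖Mh - arxMatrix (d₁ + d₂ + 1) Θ L‖ ≤ ε₀) :
    (Θ, L) ∈ confSet c d₁ d₂ (arxMatrix (d₁ + d₂ + 1) Θ L) Mh Θh Lh := by
  obtain ⟨G, hG, -, -⟩ := h.balancing
  obtain ⟨T, hT, hballs⟩ := h.inBalls Mh Θh Lh hout hMh G hG
  exact ⟨Θ.conj G, G⁻¹ * L, similar_conj hG.unit, T, hT, hballs c h₁ h₂ h₃⟩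

/-- Small estimation errors force the members of the confidence set to be close to the truth. -/
theorem ConfidenceData.exists_closeModel (hn : 0 < n) {c₀ ε₀ x X γ : ℝ} (hc₀ : 0 < c₀)
    (hε₀ : 0 < ε₀) (hx : 0 < x) (hγ : 0 < γ) (ho : Observable Θ.A Θ.C) (hc : Controllable Θ.A Θ.B)
    (b : ℝ) {c : RadiusConst} (h₁ : c₀ ≤ c.c₁) (h₂ : c₀ ≤ c.c₂) (h₃ : c₀ ≤ c.c₃) :
    ∃ g : ℝ, ∀ ε : ℝ, 0 < ε → ∃ η : ℝ, 0 < η ∧ η ≤ ε₀ ∧ ∀ d₁ d₂ : ℕ,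
      ConfidenceData Θ L c₀ ε₀ x X γ d₁ d₂ →
      ∀ (Mh : Matrix (Fin m) (BlockIdx (d₁ + d₂ + 1) m p) ℝ) (Θh Θt : LinSys n m p)
      (Lh Lt : Matrix (Fin n) (Fin m) ℝ), IsSysIdOutput d₁ d₂ Mh Θh Lh →
      √(d₁ + d₂ + 1 : ℕ) * ‖Mh - arxMatrix (d₁ + d₂ + 1) Θ L‖ ≤ η →
      ‖Θt.A‖ ≤ b → ‖Θt.B‖ ≤ b → ‖Θt.C‖ ≤ b →
      (Θt, Lt) ∈ confSet c d₁ d₂ (arxMatrix (d₁ + d₂ + 1) Θ L) Mh Θh Lh →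
      ∃ S S', CloseModel g ε Θ Θt S S' := by
  obtain ⟨g, hg⟩ := LQG.exists_closeModel ho hc hγ b
  refine ⟨g, fun ε hε => ?_⟩
  obtain ⟨η, hη, hclose⟩ := hg ε hε
  have hc₁0 : 0 ≤ c.c₁ := hc₀.le.trans h₁
  -- A common Lipschitz constant of the radii for A, B and C with respect to √H‖M̂ − M‖.
  obtain ⟨k, hk⟩ : ∃ k, k = c.c₁ * (√n * (|X| + |X|) / x ^ 2) + √(20 * n / x) + 1 := ⟨_, rfl⟩
  have hk0 : 0 < k := by rw [hk]; positivity
  refine ⟨min ε₀ (η / k), by positivity, min_le_left _ _, ?_⟩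
  intro d₁ d₂ hd Mh Θh Θt Lh Lt hout hMh hAb hBb hCb hmem
  obtain ⟨G, hG, hGn, hGi⟩ := hd.balancing
  obtain ⟨T, hT, hballs⟩ := hd.inBalls Mh Θh Lh hout (hMh.trans (min_le_left _ _)) G hG
  obtain ⟨Θ', L', ⟨G', hG', hA', hB', hC', -⟩, T', hT', hballs'⟩ := hmem
  obtain ⟨hb₁, hb₂, hb₃, -⟩ := hballs c h₁ h₂ h₃
  obtain ⟨hb₁', hb₂', hb₃', -⟩ := hballs'
  have he0 : 0 ≤ √(d₁ + d₂ + 1 : ℕ) * ‖Mh - arxMatrix (d₁ + d₂ + 1) Θ L‖ := by positivity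
  have hekη : k * (√(d₁ + d₂ + 1 : ℕ) * ‖Mh - arxMatrix (d₁ + d₂ + 1) Θ L‖) ≤ η := by
    have := hMh.trans (min_le_right _ _)
    rw [le_div_iff₀ hk0] at this
    linarith
  have hX := hd.norm_le.trans (le_abs_self X)
  have hβA : betaA c n (d₁ + d₂ + 1) (hankel d₁ d₂ (arxMatrix (d₁ + d₂ + 1) Θ L))
      ‖Mh - arxMatrix (d₁ + d₂ + 1) Θ L‖ ≤ η := by
    refine (betaA_le hc₁0 (norm_nonneg _) hx hd.sigma_ge hX ((sigma_le_norm _ hn).trans hX)).trans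
      (le_trans (mul_le_mul_of_nonneg_right ?_ he0) hekη)
    rw [hk]
    have : 0 ≤ √(20 * n / x) := Real.sqrt_nonneg _
    linarith
  have hβB : betaB n (d₁ + d₂ + 1) (hankel d₁ d₂ (arxMatrix (d₁ + d₂ + 1) Θ L))
      ‖Mh - arxMatrix (d₁ + d₂ + 1) Θ L‖ ≤ η := by
    refine (betaB_le (norm_nonneg _) hx hd.sigma_ge).trans
      (le_trans (mul_le_mul_of_nonneg_right ?_ he0) hekη)
    rw [hk]
    have : 0 ≤ c.c₁ * (√n * (|X| + |X|) / x ^ 2) := by positivity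
    linarith
  rw [hA'] at hb₁'
  rw [hB'] at hb₂'
  rw [hC'] at hb₃'
  exact hclose Θt Θh G T G' T' hG.unit hG' hGn hGi hT hT' hAb hBb hCb (hb₁.trans hβA)
    (hb₂.trans hβB) (hb₃.trans hβB) (hb₁'.trans hβA) (hb₂'.trans hβB) (hb₃'.trans hβB)

end Confidence

/-! ### Length of the window. -/

section Horizon

/-- The window is long enough for the truncation error to be negligible. -/
theorem window_long {υ lam : ℝ} (hυ₀ : 0 < υ) (hυ₁ : υ < 1) (hlam : 0 < lam) (hm : 0 < m) (q : ℕ)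
    {T H : ℕ} (hT : 2 ≤ T) (h : Real.log ((1 / υ) ^ q * √lam * (T : ℝ) ^ 2 * √m / √lam)
      / Real.log (1 / υ) ≤ (H : ℝ)) : q ≤ H ∧ υ ^ H * (T : ℝ) ^ 2 ≤ 1 := by
  have hT' : (2 : ℝ) ≤ T := by exact_mod_cast hT
  have h1 : 1 < 1 / υ := by rw [lt_div_iff₀ hυ₀]; linarith
  have hm' : 1 ≤ √(m : ℝ) := by
    rw [Real.one_le_sqrt]
    exact_mod_cast hm
  have hlog : 0 < Real.log (1 / υ) := Real.log_pos h1
  have hs : 0 < √lam := Real.sqrt_pos.2 hlam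
  rw [div_le_iff₀ hlog, ← Real.log_pow, Real.log_le_log_iff (by positivity) (by positivity)] at h
  have h2 : (1 / υ) ^ q * √lam * (T : ℝ) ^ 2 * √m / √lam = (1 / υ) ^ q * (T : ℝ) ^ 2 * √m := by
    field_simp
  rw [h2] at h
  have h3 : (1 / υ) ^ q * (T : ℝ) ^ 2 ≤ (1 / υ) ^ H :=
    (le_mul_of_one_le_right (by positivity) hm').trans h
  constructor
  · refine (pow_le_pow_iff_right₀ h1).1 (le_trans ?_ h3)
    exact le_mul_of_one_le_right (by positivity) (one_le_pow₀ (by linarith))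
  · have h4 : (T : ℝ) ^ 2 ≤ (1 / υ) ^ H :=
      (le_mul_of_one_le_left (by positivity) (one_le_pow₀ h1.le)).trans h3
    calc υ ^ H * (T : ℝ) ^ 2 ≤ υ ^ H * (1 / υ) ^ H := by gcongr
      _ = 1 := by rw [← mul_pow, mul_one_div_cancel hυ₀.ne', one_pow]

end Horizon

/-! ### Bounds for outputs, inputs and filtered states. -/

section DataBounds

variable {Θ : LinSys n m p} {F : Matrix (Fin n) (Fin m) ℝ} {Tw : ℕ}
    {Θt : ℕ → LinSys n m p} {K : ℕ → Matrix (Fin p) (Fin n) ℝ} {Lt : ℕ → Matrix (Fin n) (Fin m) ℝ}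
    {e : ℕ → Vec m} {xi xp xf : ℕ → Vec n} {u : ℕ → Vec p}

theorem ClosedLoop.data_le (h : ClosedLoop Θ F Tw Θt K Lt e xi xp xf u) {g ρ υ β b : ℝ}
    (hg : 1 ≤ g) (hC : ‖Θ.C‖ ≤ g) (hM : ∀ i, ModelBounds g ρ υ (Θt i) (K i) (Lt i)) {t : ℕ}
    (he : ‖e t‖ ≤ b) (hx : ‖xi t‖ + ‖xp t‖ ≤ β * b) (hu : t < Tw → ‖u t‖ ≤ b) :
    ‖Matrix.toEuclideanLin Θ.C (xi t) + e t‖ ≤ (g * β + 1) * b ∧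
      ‖xf t‖ ≤ (β + g * (2 * (g * β) + 1)) * b ∧
      ‖u t‖ ≤ (g * (β + g * (2 * (g * β) + 1)) + 1) * b := by
  have hb : 0 ≤ b := (norm_nonneg _).trans he
  have hβb : 0 ≤ β * b := (by positivity : 0 ≤ ‖xi t‖ + ‖xp t‖).trans hx
  have hxi : ‖xi t‖ ≤ β * b := by linarith [norm_nonneg (xp t)]
  have hxp : ‖xp t‖ ≤ β * b := by linarith [norm_nonneg (xi t)]
  have h1 : ‖Matrix.toEuclideanLin Θ.C (xi t) + e t‖ ≤ (g * β + 1) * b := by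
    refine (norm_add_le _ _).trans ?_
    have h2 : ‖Matrix.toEuclideanLin Θ.C (xi t)‖ ≤ g * (β * b) :=
      (norm_toEuclideanLin_le _ _).trans (mul_le_mul hC hxi (norm_nonneg _) (by linarith))
    linarith
  have h2 : ‖xf t‖ ≤ (β + g * (2 * (g * β) + 1)) * b := by
    rw [h.filt t]
    refine (norm_add_le _ _).trans ?_
    have h3 : ‖Matrix.toEuclideanLin (Θt (epoch Tw t)).C (xp t)‖ ≤ g * (β * b) :=
      (norm_toEuclideanLin_le _ _).trans
        (mul_le_mul (hM _).output hxp (norm_nonneg _) (by linarith))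
    have h4 : ‖Matrix.toEuclideanLin (Lt (epoch Tw t)) (Matrix.toEuclideanLin Θ.C (xi t) + e t
        - Matrix.toEuclideanLin (Θt (epoch Tw t)).C (xp t))‖ ≤ g * ((g * β + 1) * b + g * (β * b)) :=
      (norm_toEuclideanLin_le _ _).trans (mul_le_mul (hM _).filter
        ((norm_sub_le _ _).trans (add_le_add h1 h3)) (norm_nonneg _) (by linarith))
    linarith
  refine ⟨h1, h2, ?_⟩
  have h5 : 0 ≤ g * ((β + g * (2 * (g * β) + 1)) * b) :=
    mul_nonneg (by linarith) ((norm_nonneg _).trans h2)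
  by_cases ht : t < Tw
  · linarith [hu ht]
  · rw [h.input t (not_lt.1 ht), norm_neg]
    have h6 : ‖Matrix.toEuclideanLin (K (epoch Tw t)) (xf t)‖
        ≤ g * ((β + g * (2 * (g * β) + 1)) * b) :=
      (norm_toEuclideanLin_le _ _).trans
        (mul_le_mul (hM _).control h2 (norm_nonneg _) (by linarith))
    linarith

end DataBounds

/-! ### Number of blocks in the warm-up. -/

section WarmUp

theorem two_le_warmupConst {D M θ₀ v₁ b₀ Y₀ C₀ lam μ₀ cυ ε : ℝ} (hD : 1 ≤ D)
    (hM : 0 ≤ M) (hθ₀ : 0 < θ₀) (hv₁ : 0 < v₁) (hb₀ : 0 ≤ b₀) (hY₀ : 0 ≤ Y₀) (hlam : 0 < lam)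
    (hμ₀ : 0 ≤ μ₀) : 2 ≤ warmupConst D M θ₀ v₁ b₀ Y₀ C₀ lam μ₀ cυ ε := by
  have p1 : 0 ≤ 32 * θ₀ * D ^ 2 * Y₀ ^ 2 := by positivity
  have p2 : 0 ≤ (b₀ + C₀ * Y₀) ^ 2 / (lam * v₁ ^ 2) := by positivity
  have p3 : 0 ≤ μ₀ / (2 * v₁ ^ 2) := by positivity
  have p4 : 0 ≤ 2 * D * Y₀ * b₀ := by positivity
  have p5 : 0 ≤ 8 * v₁ * D ^ 2 * Y₀ ^ 2 := by positivity
  have p6 : 0 ≤ 2 * C₀ ^ 2 * Y₀ ^ 2 * cυ ^ 2 := by positivity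
  have p7 : 0 ≤ 256 * M * θ₀ * (2 * v₁ * (11 * D + 2) + 1 + lam * μ₀ / 2) / ε ^ 2 := by positivity
  rw [warmupConst]
  linarith

theorem warmup_blocks {H Tw : ℕ} {ℓ Wc : ℝ} (hWc : 2 ≤ Wc) (hH : 2 ≤ H) (hℓ : 1 / 2 ≤ ℓ)
    (hK : Wc * (H * ℓ) ^ 4 ≤ Tw) :
    1 ≤ ((H : ℝ) * ℓ) ^ 4 ∧ 0 < Tw / H ∧ (Tw : ℝ) ≤ 2 * H * (Tw / H : ℕ) := by
  have hH' : (2 : ℝ) ≤ H := by exact_mod_cast hH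
  have hg : 1 ≤ (H : ℝ) * ℓ := by nlinarith
  have hg4 : (H : ℝ) * ℓ ≤ ((H : ℝ) * ℓ) ^ 4 := le_self_pow₀ hg (by norm_num)
  have hHTw : H ≤ Tw := by
    have h1 : (H : ℝ) ≤ Tw := by
      refine le_trans ?_ hK
      calc (H : ℝ) ≤ 2 * (H * ℓ) := by nlinarith
        _ ≤ Wc * (H * ℓ) ^ 4 := mul_le_mul hWc hg4 (by positivity) (by linarith)
    exact_mod_cast h1
  have hN : 0 < Tw / H := Nat.div_pos hHTw (by omega)
  refine ⟨one_le_pow₀ hg, hN, ?_⟩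
  have h1 : Tw < H * (Tw / H + 1) := Nat.lt_mul_div_succ Tw (by omega)
  have h2 : H * (Tw / H + 1) ≤ 2 * H * (Tw / H) := by nlinarith
  exact_mod_cast h1.le.trans h2

end WarmUp

end LQG

end

/-! ### The boundedness lemma. -/

open LQG

set_option maxHeartbeats 1000000 in
theorem mainTheorem3 {n m p : ℕ} (hn : 0 < n) (hm : 0 < m) (hp : 0 < p)
    (s : LQG.Setup m p) (hs : s.Valid)
    (κ : LQG.SetBounds) (hρ : κ.ρ < 1) (hυ₀ : 0 < κ.υ) (hυ₁ : κ.υ < 1)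
    (Θ : LQG.LinSys n m p) (hΘ : LQG.StableFinitePhi Θ)
    (Sig : Matrix (Fin n) (Fin n) ℝ) (hSig : LQG.IsFilterRiccati s Θ Sig)
    (L : Matrix (Fin n) (Fin m) ℝ) (hL : L = LQG.kalmanGain s Θ Sig) :
    ∃ c₀ : ℝ, 0 < c₀ ∧ ∀ c : LQG.RadiusConst, c₀ ≤ c.c₁ → c₀ ≤ c.c₂ → c₀ ≤ c.c₃ →
    ∃ (cH K cX cY : ℝ) (k : ℕ), 0 < cH ∧ 0 < K ∧ 0 < cX ∧ 0 < cY ∧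
    ∀ S : Set (LQG.LinSys n m p), LQG.AdmissibleSet s κ S → Θ ∈ S →
    ∀ (T Tw d₁ d₂ : ℕ) (δ : ℝ), 2 ≤ T → 0 < δ → δ < 1 →
      n ≤ d₁ → n ≤ d₂ → d₁ ≤ d₂ + 1 → d₂ ≤ d₁ + 1 →
      Real.log (cH * (T : ℝ) ^ 2 * √m / √s.lam) / Real.log (1 / κ.υ) ≤ ((d₁ + d₂ + 1 : ℕ) : ℝ) →
      K * (((d₁ + d₂ + 1 : ℕ) : ℝ) * Real.log (T / δ)) ^ k ≤ (Tw : ℝ) → Tw ≤ T →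
    ∀ (Ω : Type*) [MeasurableSpace Ω] (μ : MeasureTheory.Measure Ω)
      [MeasureTheory.IsProbabilityMeasure μ] (X : LQG.Processes n m p Ω),
      LQG.IsLqgOptRun μ s c S Θ Sig L T Tw d₁ d₂ X →
      μ {ω | ¬ ∀ t : ℕ, Tw ≤ t → t ≤ T →
        ((Θ, L) ∈ X.conf s c d₁ d₂ Θ L t ω ∧
          ∀ (Θbar : LQG.LinSys n m p) (Lbar : Matrix (Fin n) (Fin m) ℝ),
            LQG.IsSysIdOutput d₁ d₂ (LQG.arxMatrix (d₁ + d₂ + 1) Θ L) Θbar Lbar →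
            LQG.Similar Θ L Θbar Lbar ∧ ∃ O ∈ Matrix.orthogonalGroup (Fin n) ℝ,
              LQG.InBalls c d₁ d₂ (LQG.arxMatrix (d₁ + d₂ + 1) Θ L)
                (X.Mhat s (d₁ + d₂ + 1) t ω) (X.Θhat t ω) (X.Lhat t ω) O Θbar Lbar) ∧
        ‖X.xfilt t ω‖ ≤ cX * √(Real.log (T / δ)) ∧
        ‖X.y t ω‖ ≤ cY * √(Real.log (T / δ))} ≤ ENNReal.ofReal (3 * δ) := by
  -- The constants precede S. If no admissible set contains Θ the claim is vacuous; otherwise one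
  -- such set reveals the properties of Θ itself, and the constants are built from these and κ.
  by_cases hex : ∃ S, AdmissibleSet s κ S ∧ Θ ∈ S
  swap
  · exact ⟨1, one_pos, fun c _ _ _ => ⟨1, 1, 1, 1, 0, one_pos, one_pos, one_pos, one_pos,
      fun S hS hΘS => absurd ⟨S, hS, hΘS⟩ hex⟩⟩
  obtain ⟨S₀, hS₀, hΘ₀⟩ := hex
  have hkal : IsKalmanGain s Θ L := ⟨Sig, hSig, hL⟩
  have hF : ‖filterMat Θ L‖ ≤ κ.υ := hS₀.contract_filter Θ hΘ₀ L hkal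
  have ho := hS₀.obsv Θ hΘ₀
  have hc := hS₀.ctrb Θ hΘ₀
  obtain ⟨c₀, ε₀, x, X₀, γ, q, hc₀, hε₀, hx, hγ, hconf⟩ := exists_confidenceData hn hυ₁ hF ho hc
    (hS₀.ctrb_filter Θ hΘ₀ L hkal).isUnit_det
  refine ⟨c₀, hc₀, fun c h₁ h₂ h₃ => ?_⟩
  obtain ⟨g₁, hg₁⟩ := ConfidenceData.exists_closeModel (L := L) (X := X₀) hn hc₀ hε₀ hx hγ ho hc κ.b
    h₁ h₂ h₃
  obtain ⟨g, hg, hgg, hgb, hgΓ, hgζ, hgF, hgB, hgC⟩ : ∃ g : ℝ, 1 ≤ g ∧ g₁ ≤ g ∧ κ.b ≤ g ∧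
      κ.Γ ≤ g ∧ κ.ζ ≤ g ∧ ‖Θ.A * L‖ ≤ g ∧ ‖Θ.B‖ ≤ g ∧ ‖Θ.C‖ ≤ g := by
    refine ⟨1 + |g₁| + |κ.b| + |κ.Γ| + |κ.ζ| + ‖Θ.A * L‖ + ‖Θ.B‖ + ‖Θ.C‖, ?_⟩
    have a1 := abs_nonneg g₁
    have a2 := abs_nonneg κ.b
    have a3 := abs_nonneg κ.Γ
    have a4 := abs_nonneg κ.ζ
    have a5 := norm_nonneg (Θ.A * L)
    have a6 := norm_nonneg Θ.B
    have a7 := norm_nonneg Θ.C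
    have b1 := le_abs_self g₁
    have b2 := le_abs_self κ.b
    have b3 := le_abs_self κ.Γ
    have b4 := le_abs_self κ.ζ
    refine ⟨?_, ?_, ?_, ?_, ?_, ?_, ?_, ?_⟩ <;> linarith
  -- Order of choice: the coordinate bound g, then the model accuracy ε₁ required by the loop, then
  -- the estimation accuracy η that guarantees it. The maximum with 0 provides a nonnegative
  -- contraction rate.
  obtain ⟨ε₁, β, N₀, hε₁, hβ, hloop⟩ := exists_closedLoop_bound hΘ hg hgF hgB hgC
    (le_max_right κ.ρ 0) (max_lt hρ one_pos) hυ₀.le hυ₁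
  obtain ⟨η, hη, hηε, hclose⟩ := hg₁ ε₁ hε₁
  obtain ⟨v₀, hv₀def⟩ : ∃ v, v = min (s.σz ^ 2) (s.σu ^ 2) := ⟨_, rfl⟩
  obtain ⟨v₁, hv₁def⟩ : ∃ v, v = max ‖innovCov s Θ Sig‖ (s.σu ^ 2) := ⟨_, rfl⟩
  have hv₀ : 0 < v₀ := by
    rw [hv₀def]; exact lt_min (pow_pos hs.σz_pos 2) (pow_pos hs.σu_pos 2)
  have hv₁ : 0 < v₁ := by rw [hv₁def]; exact lt_max_of_lt_right (pow_pos hs.σu_pos 2)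
  have h1υ : 0 < 1 - κ.υ := by linarith
  obtain ⟨r, hr⟩ : ∃ r, r = 1 + (‖Θ.A * L‖ + ‖Θ.B‖) * (‖Θ.C‖ / (1 - κ.υ)) := ⟨_, rfl⟩
  have hr0 : 0 < r := by rw [hr]; positivity
  obtain ⟨θ₀, hθ₀def⟩ : ∃ θ₀, θ₀ = 8 * r ^ 2 * Real.exp 4 / v₀ := ⟨_, rfl⟩
  have hθ₀ : 0 < θ₀ := by rw [hθ₀def]; positivity
  have hD : (1 : ℝ) ≤ (m : ℝ) + p := by
    have : 1 ≤ m + p := by omega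
    exact_mod_cast this
  obtain ⟨b₀, hb₀def⟩ : ∃ b₀ : ℝ, b₀ = (m + p) * √(2 * v₁ * (m + p + 4)) := ⟨_, rfl⟩
  have hb₀ : 0 < b₀ := by rw [hb₀def]; positivity
  obtain ⟨f₀, hf₀⟩ : ∃ f₀, f₀ = β + g * (2 * (g * β) + 1) := ⟨_, rfl⟩
  have hf₀0 : 0 < f₀ := by rw [hf₀]; positivity
  -- The summands bound outputs, inputs and predictions, in units of √log(T/δ).
  obtain ⟨Y₀, hY₀def⟩ : ∃ Y₀, Y₀ = ((g * β + 1) + (g * f₀ + 1) + β) * b₀ := ⟨_, rfl⟩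
  have hY₀ : 0 ≤ Y₀ := by rw [hY₀def]; positivity
  have hμ₀ : 0 ≤ rowConst Θ L κ.υ := by unfold rowConst; positivity
  obtain ⟨Wc, hWc⟩ : ∃ Wc, Wc = warmupConst (m + p) m θ₀ v₁ b₀ Y₀ ‖Θ.C‖ s.lam
    (rowConst Θ L κ.υ) 1 η := ⟨_, rfl⟩
  have hWc2 : 2 ≤ Wc := hWc ▸ two_le_warmupConst hD (by positivity) hθ₀ hv₁ hb₀.le hY₀
    hs.lam_pos hμ₀
  -- The first constant yields H ≥ 2q + 2, hence d₂ ≥ q because d₁ ≤ d₂ + 1; its √λ cancels the one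
  -- in the condition on H. Adding N₀ makes each epoch long enough for the contraction.
  refine ⟨(1 / κ.υ) ^ (2 * q + 2) * √s.lam, Wc + N₀, f₀ * b₀, (g * β + 1) * b₀, 4,
    mul_pos (by positivity) (Real.sqrt_pos.2 hs.lam_pos), by positivity, by positivity,
    by positivity, ?_⟩
  intro S hS hΘS T Tw d₁ d₂ δ hT hδ hδ₁ hd₁ hd₂ hd₁₂ hd₂₁ hH hK hTwT Ω _ μ _ X hrun
  obtain ⟨hqH, hυH⟩ := window_long hυ₀ hυ₁ hs.lam_pos hm (2 * q + 2) hT hH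
  have hd := hconf d₁ d₂ hd₁ hd₂ hd₁₂ (by omega)
  have hT' : (2 : ℝ) ≤ T := by exact_mod_cast hT
  have hH2 : 2 ≤ d₁ + d₂ + 1 := by omega
  have hH2' : (2 : ℝ) ≤ (d₁ + d₂ + 1 : ℕ) := by exact_mod_cast hH2
  have hℓ : 1 / 2 ≤ Real.log (T / δ) := by
    have h1 : (2 : ℝ) ≤ T / δ := by rw [le_div_iff₀ hδ]; nlinarith
    have h2 := Real.log_le_log (by norm_num) h1
    linarith [Real.log_two_gt_d9]
  have hN₀ : (0 : ℝ) ≤ N₀ := Nat.cast_nonneg _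
  have hpow0 : 0 ≤ (((d₁ + d₂ + 1 : ℕ) : ℝ) * Real.log (T / δ)) ^ 4 := by positivity
  have hKW : Wc * (((d₁ + d₂ + 1 : ℕ) : ℝ) * Real.log (T / δ)) ^ 4 ≤ Tw := by
    rw [add_mul] at hK
    linarith [mul_nonneg hN₀ hpow0]
  obtain ⟨hg4, hN, hNW⟩ := warmup_blocks hWc2 hH2 hℓ hKW
  have hN₀Tw : N₀ ≤ Tw := by
    have h1 : (N₀ : ℝ) ≤ Tw := by
      refine le_trans ?_ hK
      rw [add_mul]
      have h2 := mul_le_mul_of_nonneg_left hg4 hN₀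
      have h3 := mul_nonneg (by linarith : 0 ≤ Wc) hpow0
      linarith
    exact_mod_cast h1
  have hNTw : Tw / (d₁ + d₂ + 1) * (d₁ + d₂ + 1) ≤ Tw := Nat.div_mul_le_self _ _
  have hTw : 0 < Tw := (Nat.mul_pos hN (by omega)).trans_le hNTw
  have hWT : (Tw : ℝ) ≤ T := by exact_mod_cast hTwT
  rw [hWc] at hKW
  have hw := hrun.whiteNoise hs hSig hL
  rw [← hv₀def, ← hv₁def] at hw
  have hN8 := (estimation_arith (M := (m : ℝ)) (C₀ := ‖Θ.C‖) hD (by positivity) hθ₀ hv₁ hb₀.le hY₀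
    (norm_nonneg _) hs.lam_pos hμ₀ hη hH2' hℓ (Real.sqrt_nonneg _) (Real.sq_sqrt (by linarith)) hT'
    hWT (by exact_mod_cast hN) hNW (by positivity) (pow_le_one₀ hυ₀.le hυ₁.le) hυH hKW).1
  have hmeas := hrun.measure_not_goodNoise_le hm hTw hw hv₀ hv₁ hυ₁ hF hr.ge
    (by omega : 0 < d₁ + d₂ + 1) hNTw hT hδ hδ₁ hN8
  have hθeq : 8 * ((d₁ + d₂ + 1 : ℕ) : ℝ) * r ^ 2 * Real.exp 4 / v₀ = θ₀ * (d₁ + d₂ + 1 : ℕ) := by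
    rw [hθ₀def]; ring
  have hbeq : ((m : ℝ) + p) * √(2 * v₁ * (m + p + 4) * Real.log (T / δ))
      = b₀ * √(Real.log (T / δ)) := by
    rw [hb₀def, Real.sqrt_mul (by positivity), ← mul_assoc]
  rw [hθeq, hbeq] at hmeas
  refine le_trans (measure_mono fun ω hω => ?_) hmeas
  by_contra hcon
  refine hω ?_
  have hgood := not_not.1 hcon
  clear hω hcon
  have hcl := hrun.closedLoop ω
  have hMB : ∀ i, ModelBounds g (max κ.ρ 0) κ.υ (X.Θopt i ω) (X.Kopt i ω) (X.Lopt i ω) := fun i =>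
    have hmem := hrun.opt_mem i ω
    ⟨(hS.bounded _ hmem).1.trans hgb, (hS.bounded _ hmem).2.1.trans hgb,
      (hS.bounded _ hmem).2.2.trans hgb, (hS.control_le _ hmem _ (hrun.opt_gain i ω)).trans hgΓ,
      (hS.filter_le _ hmem _ (hrun.opt_kalman i ω)).trans hgζ,
      (hS.contract_control _ hmem _ (hrun.opt_gain i ω)).trans (le_max_left _ _),
      hS.contract_filter _ hmem _ (hrun.opt_kalman i ω)⟩
  have hwarm : ∀ t < Tw, ‖X.u t ω‖ ≤ b₀ * √(Real.log (T / δ)) := fun t ht => by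
    rw [hrun.input, if_pos ht]
    exact (hgood.noise_le t (by omega)).2
  have hdata : ∀ t ≤ T, ‖X.optPred Θ L t ω‖ + ‖X.xpred t ω‖ ≤ β * (b₀ * √(Real.log (T / δ))) →
      ‖X.y t ω‖ ≤ (g * β + 1) * (b₀ * √(Real.log (T / δ))) ∧
      ‖X.xfilt t ω‖ ≤ f₀ * (b₀ * √(Real.log (T / δ))) ∧
      ‖X.u t ω‖ ≤ (g * f₀ + 1) * (b₀ * √(Real.log (T / δ))) := by
    intro t ht hbd
    have h := hcl.data_le hg hgC hMB (hgood.noise_le t ht).1 hbd (hwarm t)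
    rw [hrun.output_eq, hf₀]
    exact h
  have hest : ∀ t, Tw ≤ t → t ≤ T → (∀ r ≤ t, ‖X.optPred Θ L r ω‖ + ‖X.xpred r ω‖
      ≤ β * (b₀ * √(Real.log (T / δ)))) → √((d₁ + d₂ + 1 : ℕ) : ℝ) *
        ‖X.Mhat s (d₁ + d₂ + 1) t ω - arxMatrix (d₁ + d₂ + 1) Θ L‖ ≤ η := by
    intro t htw htT hbd
    refine hrun.estimation_le hm hs.lam_pos hυ₁ hF hθ₀ hv₁ hb₀.le hY₀ hη hH2 hT hℓ hN
      (hNTw.trans htw) htT hWT hNW hυH hKW hgood fun r hr => ?_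
    obtain ⟨hy, -, hu⟩ := hdata r (by omega) (hbd r hr.le)
    have h1 := hbd r hr.le
    have hσ0 : 0 ≤ b₀ * √(Real.log (T / δ)) := by positivity
    have q1 : 0 ≤ (g * β + 1) * (b₀ * √(Real.log (T / δ))) := by positivity
    have q2 : 0 ≤ (g * f₀ + 1) * (b₀ * √(Real.log (T / δ))) := by positivity
    have q3 : 0 ≤ β * (b₀ * √(Real.log (T / δ))) := by positivity
    have hYe : Y₀ * √(Real.log (T / δ)) = (g * β + 1) * (b₀ * √(Real.log (T / δ)))
        + (g * f₀ + 1) * (b₀ * √(Real.log (T / δ))) + β * (b₀ * √(Real.log (T / δ))) := by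
      rw [hY₀def]; ring
    rw [hYe]
    refine ⟨by linarith only [hy, q2, q3], by linarith only [hu, q1, q3], ?_⟩
    linarith only [h1, norm_nonneg (X.xpred r ω), q1, q2]
  have hmemconf : ∀ t, Tw ≤ t → √((d₁ + d₂ + 1 : ℕ) : ℝ) *
      ‖X.Mhat s (d₁ + d₂ + 1) t ω - arxMatrix (d₁ + d₂ + 1) Θ L‖ ≤ η →
      (Θ, L) ∈ X.conf s c d₁ d₂ Θ L t ω := fun t ht he =>
    hd.mem_confSet h₁ h₂ h₃ (hrun.sysId t ω ht) (he.trans hηε)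
  -- The circle closes here: bounded data before the epoch give an accurate estimate, so (Θ, L) is a
  -- candidate; the selected model then lies in the confidence set too, and is close to Θ.
  have hbound := hloop Tw T _ _ _ _ _ _ _ _ (b₀ * √(Real.log (T / δ))) hN₀Tw hTw hTwT hcl hMB
    (fun t ht => (hgood.noise_le t ht).1) hwarm (fun i hi hprev => by
      have htw : Tw ≤ 2 ^ i * Tw := Nat.le_mul_of_pos_left _ (by positivity)
      have he := hest (2 ^ i * Tw) htw hi hprev
      have hcand := (hrun.optimism i ω ⟨(Θ, L), hmemconf _ htw he, hΘS, hkal⟩).1.1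
      have hmem := hS.bounded _ (hrun.opt_mem i ω)
      obtain ⟨U, U', hU⟩ := hclose d₁ d₂ hd _ _ (X.Θopt i ω) _ (X.Lopt i ω)
        (hrun.sysId _ ω htw) he hmem.1 hmem.2.1 hmem.2.2 hcand
      exact ⟨U, U', hU.mul_inv, hU.inv_mul, hU.norm_le.trans hgg, hU.norm_inv_le.trans hgg,
        hU.state, hU.input, hU.output⟩)
  intro t htw htT
  have he := hest t htw htT fun r hr => hbound r (hr.trans htT)
  obtain ⟨hy, hxf, -⟩ := hdata t htT (hbound t htT)
  refine ⟨⟨hmemconf t htw he, fun Θbar Lbar hout => ?_⟩, by rw [mul_assoc]; exact hxf,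
    by rw [mul_assoc]; exact hy⟩
  obtain ⟨G, hG, rfl, rfl⟩ := hd.exact_output Θbar Lbar hout
  obtain ⟨O, hO, hballs⟩ := hd.inBalls _ _ _ (hrun.sysId t ω htw) (he.trans hηε) G hG
  exact ⟨similar_conj hG.unit, O, hO, hballs c h₁ h₂ h₃⟩
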